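/- **Setting.** Let $f:[0,1]\to\mathbb{R}^2$ be a smooth simple curve: differentiable with $\|f'(u)\|=\varphi>0$ constant (parametrised by arclength, normalised to $[0,1]$) and injective on $(0,1)$. It is *closed* if $f(0)=f(1)$ and *open* otherwise. Let $\Gamma_f=f([0,1])$. Its thickness $\Delta(f)$ is the infimum of the radii of the circles through three distinct points of $\Gamma_f$ ($\infty$ for collinear points). Let $0<\sigma<\Delta(f)$ and, if $f$ is open, $2\sigma<\|f(1)-f(0)\|$. Write $B(x,r)$ for closed balls, $A\oplus r=\bigcup_{x\in A}B(x,r)$, $d_H$ for Hausdorff distance, and $S=\Gamma_f\oplus\sigma$. Let $\hat S\supseteq S$ be compact with boundary $\widehat{\partial S}$. Let $\hat\Lambda(y)=d(y,\widehat{\partial S})$, $\hat\sigma=\max_{\hat S}\hat\Lambda$, let $\hat y\in\hat S$ be any point with $\hat\Lambda(\hat y)=\hat\sigma$, and for $\epsilon>0$ let $\hat\Gamma=\{y\in\hat S:\hat\Lambda(y)\ge\hat\sigma-2\epsilon\}$ be the EDT estimator. **Extraction.** *Open-curve algorithm* on a set $K$ with constraint sets $E_0,E_1$ (default $\mathbb{R}^2$):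 choose $(x_0,x_1)\in(K\cap E_0)\times(K\cap E_1)$ that maximises, among the pairs joined by a path of finite length in $K$, the infimum of the lengths of such paths; return any path in $K$ from $x_0$ to $x_1$. For an open-curve extraction, $K=\hat\Gamma$. *Closed-curve algorithm*, with $\eta>0$: let $\mathcal{A}_8$ be the union of all segments of length at most $8\epsilon$ that contain $\hat y$ and have both end points on $\partial\hat\Gamma$, and let $\mathcal{A}=(\mathcal{A}_8\cap\hat\Gamma)\oplus\eta$. Run the open-curve algorithm on $\overline{\hat\Gamma\setminus\mathcal{A}}$ with $E_0=E_1=\partial\mathcal{A}$, join the two end points by any path in $\mathcal{A}$, and return the union of the two paths. *General-curve algorithm*: if $\hat\Gamma\setminus\mathcal{A}$ has exactly one connected component, run the closed-curve algorithm. If it has exactly two, $U$ and $V$, run the open-curve algorithm on $\overline U$ with $(E_0,E_1)=(\mathbb{R}^2,\partial\mathcal{A})$ and on $\overline V$ with $(E_0,E_1)=(\partial\mathcal{A},\mathbb{R}^2)$, join the two end points on $\partial\mathcal{A}$ by any path in $\mathcal{A}$, and return the union of the three paths. **Theorem.** There is an absolute constant $c>0$ such that the following holds in this setting whenever $0<\epsilon\le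 c\,\sigma$, $0<\eta\le c\,\epsilon$, $d_H(S,\hat S)\le\epsilon$ and $d_H(\partial S,\widehat{\partial S})\le\epsilon$. 1. If $f$ is closed, then the closed-curve algorithm has an output, and every output $C$ of the closed-curve or of the general-curve algorithm satisfies $d_H(C,\Gamma_f)\le4\epsilon$. 2. If $f$ is open, then the open-curve algorithm has an output, and every output $C$ of the open-curve or of the general-curve algorithm satisfies $d_H(C,\Gamma_f)\le16\epsilon$. -/

import Mathlib

open Set Metric
open scoped ENNReal

namespace Filament

noncomputable section

/-- The Euclidean plane. -/
abbrev Plane : Type := EuclideanSpace ℝ (Fin 2)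

/-- The `δ`-enlargement of `A`: the union of the closed balls of radius `δ` centred in `A`. -/
def enlargement (A : Set Plane) (δ : ℝ) : Set Plane := ⋃ x ∈ A, closedBall x δ

/-- A smooth simple curve `[0,1] → ℝ²`, parametrised by arclength normalised to `[0,1]`.
Only the values of `f` on `[0,1]` matter. -/
structure IsFilament (f : ℝ → Plane) : Prop where
  differentiable : DifferentiableOn ℝ f (Icc 0 1)
  constant_speed : ∃ φ : ℝ, 0 < φ ∧ ∀ u ∈ Icc (0 : ℝ) 1, ‖derivWithin f (Icc 0 1) u‖ = φ
  simple : InjOn f (Ioo 0 1)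

/-- The trace of the curve `f`. -/
def trace (f : ℝ → Plane) : Set Plane := f '' Icc 0 1

/-- The radius of the circle through three distinct points of the plane. There is exactly one
such circle if the points are not collinear; if they are, there is none and the value is `∞`. -/
def circleRadius (x y z : Plane) : ℝ≥0∞ :=
  ⨅ (c : Plane) (_ : dist x c = dist y c ∧ dist y c = dist z c), ENNReal.ofReal (dist x c)

/-- The thickness (minimum global radius of curvature): the infimum of the radii of the circles
through triples of distinct points of `G`. -/
def thickness (G : Set Plane) : ℝ≥0∞ :=
  ⨅ (x ∈ G) (y ∈ G) (z ∈ G) (_ : x ≠ y ∧ y ≠ z ∧ x ≠ z), circleRadius x y z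

/-- The support `S = ⋃ᵤ B(f(u), σ)` of the data. -/
def support (f : ℝ → Plane) (σ : ℝ) : Set Plane := enlargement (trace f) σ

/-- The empirical Euclidean distance transform: the distance to the boundary of the support
estimate. -/
def edt (Shat : Set Plane) (y : Plane) : ℝ := infDist y (frontier Shat)

/-- The estimated noise level, the maximum of the empirical EDT over the support estimate. -/
def sigmaHat (Shat : Set Plane) : ℝ := sSup (edt Shat '' Shat)

/-- The EDT estimator, with tolerance `δ = 2ε`. -/
def edtEstimator (Shat : Set Plane) (ε : ℝ) : Set Plane :=
  {y ∈ Shat | sigmaHat Shat - 2 * ε ≤ edt Shat y}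

/-- The minimal (infimal) length of the paths from `u` to `v` that stay in `K`; it is `∞` if no
path of finite length in `K` joins the two points. -/
def pathDist (K : Set Plane) (u v : Plane) : ℝ≥0∞ :=
  ⨅ (γ : Path u v) (_ : range γ ⊆ K), eVariationOn γ univ

/-- `(x₀, x₁)` maximises the minimal path length in `K` among the pairs `(u, v)` with
`u ∈ K ∩ E₀` and `v ∈ K ∩ E₁` that are joined by a path of finite length in `K`. -/
structure IsEndpointPair (K E₀ E₁ : Set Plane) (x₀ x₁ : Plane) : Prop where
  left_mem : x₀ ∈ K ∩ E₀
  right_mem : x₁ ∈ K ∩ E₁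
  joined : pathDist K x₀ x₁ ≠ ∞
  maximal : ∀ u ∈ K ∩ E₀, ∀ v ∈ K ∩ E₁, pathDist K u v ≠ ∞ → pathDist K u v ≤ pathDist K x₀ x₁

/-- `γ` is a possible result of the open-curve algorithm on `K` with constraint sets `E₀`, `E₁`:
any path in `K` that joins a maximising pair of end points. (Relaxing such a path inside `K`,
with its end points fixed, gives a path of the same kind.) -/
def IsOpenPath (K E₀ E₁ : Set Plane) {x₀ x₁ : Plane} (γ : Path x₀ x₁) : Prop :=
  IsEndpointPair K E₀ E₁ x₀ x₁ ∧ range γ ⊆ K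

/-- `C` is a possible output of the open-curve algorithm on `G` with the default constraint sets. -/
def OpenOutput (G C : Set Plane) : Prop :=
  ∃ (x₀ x₁ : Plane) (γ : Path x₀ x₁), IsOpenPath G univ univ γ ∧ C = range γ

/-- The union of all line segments through `y` with end points on the boundary of `G` and with
length at most `8ε`. -/
def shortChords (G : Set Plane) (y : Plane) (ε : ℝ) : Set Plane :=
  {x | ∃ p ∈ frontier G, ∃ q ∈ frontier G,
    y ∈ segment ℝ p q ∧ dist p q ≤ 8 * ε ∧ x ∈ segment ℝ p q}

/-- The cut set: the `η`-enlargement of the part in `G` of the short chords through `y`. -/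
def cutSet (G : Set Plane) (y : Plane) (ε η : ℝ) : Set Plane :=
  enlargement (shortChords G y ε ∩ G) η

/-- `C` is a possible output of the closed-curve algorithm on `G`. As the cut set `A` is closed,
the open-curve algorithm is run on the closure of `G \ A`, so that its end points can lie on the
boundary of `A`; the end points are then joined through `A`. -/
def ClosedOutput (G : Set Plane) (y : Plane) (ε η : ℝ) (C : Set Plane) : Prop :=
  ∃ (x₀ x₁ : Plane) (γ : Path x₀ x₁) (γ' : Path x₁ x₀),
    IsOpenPath (closure (G \ cutSet G y ε η))
      (frontier (cutSet G y ε η)) (frontier (cutSet G y ε η)) γ ∧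
    range γ' ⊆ cutSet G y ε η ∧ C = range γ ∪ range γ'

/-- The set of connected components of the set `F`. -/
def components (F : Set Plane) : Set (Set Plane) := connectedComponentIn F '' F

/-- `C` is a possible output of the general-curve algorithm on `G`, with cut set `A`: if `G \ A`
has one connected component, an output of the closed-curve algorithm; if it has two, the
open-curve algorithm is run on (the closure of) each, with one end point constrained to the
boundary of `A`, and the two constrained end points are joined through `A`. -/
def GeneralOutput (G : Set Plane) (y : Plane) (ε η : ℝ) (C : Set Plane) : Prop :=
  ((∃ U, components (G \ cutSet G y ε η) = {U}) ∧ ClosedOutput G y ε η C) ∨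
  (∃ U V : Set Plane, U ≠ V ∧ components (G \ cutSet G y ε η) = {U, V} ∧
    ∃ (x₀ x₁ y₀ y₁ : Plane) (γ : Path x₀ x₁) (β : Path x₁ y₀) (γ' : Path y₀ y₁),
      IsOpenPath (closure U) univ (frontier (cutSet G y ε η)) γ ∧
      range β ⊆ cutSet G y ε η ∧
      IsOpenPath (closure V) (frontier (cutSet G y ε η)) univ γ' ∧
      C = range γ ∪ range β ∪ range γ')

end

end Filament

namespace Filament

/-! ### Intrinsic path distance -/

/-! Thickness above σ means that the two discs of radius σ tangent to the curve at any of its points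
have no point of the curve inside (`Strand.tan`). Consequently the distance from a fixed point of
the curve has no critical points along the curve at distances strictly between 0 and 2σ. This gives
everything needed about the curve: it does not come back after leaving a 2σ-neighbourhood, arcs are
bounded by chords (`arc_le`), and the deviation from the tangent is quadratic (`flat`). Moreover
every point of the plane lies on a normal whose tangent disc is empty (`HasNormals`), so inside S
the distance to ∂S is at most σ − d(·, Γ).

With the Hausdorff hypotheses this yields σ ≤ σ̂ ≤ σ + ε. So H = Γ̂ contains the ε-balls around Γ
and the ball B(ŷ, 2ε), and lies within 3ε of Γ (`core_edtEstimator`). The complement of H is a union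
of open balls of radius r = σ̂ − 2ε, which is huge compared with ε. On scales up to 5000 ε such
balls look like half-planes, and H is star-shaped with room to spare about each point of Γ and about
ŷ (`Core.hull`). Every output lies in H or in the cut set, hence within 4ε of Γ; the work is to show
that it leaves no part of Γ uncovered.

Two principles do this. A connected subset of H cannot skip a stretch of the curve between the
positions of two of its points (`OpenCurve.cover`, `ClosedLoc.exists_near_of_far`). And maximality
locates the end points: if a competitor a of x₀ is no farther from x₁ than x₀, and every path from a
to x₁ passes a landmark close to x₀, then the common remainder cancels and a is close to that
landmark (`exists_crossing_le`). With the true end of an open curve as competitor this shows that x₀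
is near that end.

The cut is studied in coordinates X, Y along and across the tangent, with origin ŷ and unit ε. There
H lies in a strip of height 6.04, so every chord through ŷ with 4|X| ≤ 3|Y| is short, and the short
chords separate right from left (`Loc.le_abs_X`). Flatter chords may be short as well. Since H is
star-shaped about ŷ, no point of H lies behind the end of a chord, so such a chord can only close
off a pocket (`Loc.sector`), in which path distances are at most 2000 ε
(`Loc.pathDist_le_of_sector`). From the remaining main part, `MainRight`, straight segments lead to
a curve point farther right with growing clearance from the chords (`Loc.clearance_segment`); this
makes path distances there finite and continuous.

For a closed curve, connected pairs on one side of the cut are at most 2000 ε apart and pairs on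
opposite sides at least 10⁶ ε. So the maximal pair lies on opposite sides, its path runs round the
curve, and the connecting path in the cut set passes all intermediate values of X. If a pocket is a
second component, the main component alone gives a covering path whose ends are close to ŷ. For an
open curve right and left are never connected, so there are two components, and each is treated by
the landmark argument; the constant 16 comes from a relay point just beyond the cut set. -/

lemma pathDist_le {K : Set Plane} {u v : Plane} (γ : Path u v) (h : range γ ⊆ K) :
    pathDist K u v ≤ eVariationOn γ univ :=
  iInf₂_le γ h

lemma exists_path_of_pathDist_lt {K : Set Plane} {u v : Plane} {r : ℝ≥0∞}
    (h : pathDist K u v < r) :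
    ∃ γ : Path u v, range γ ⊆ K ∧ eVariationOn γ univ < r := by
  unfold pathDist at h
  simp only [iInf_lt_iff] at h
  obtain ⟨γ, h1, h2⟩ := h
  exact ⟨γ, h1, h2⟩

lemma edist_le_pathDist (K : Set Plane) (u v : Plane) : edist u v ≤ pathDist K u v := by
  refine le_iInf₂ fun γ _ => ?_
  have := eVariationOn.edist_le (γ : unitInterval → Plane) (mem_univ 0) (mem_univ 1)
  simpa using this

lemma pathDist_comm (K : Set Plane) (u v : Plane) : pathDist K u v = pathDist K v u := by
  have key : ∀ u v, pathDist K v u ≤ pathDist K u v := by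
    intro u v
    refine le_iInf₂ fun γ hγ => ?_
    refine (pathDist_le γ.symm (by rwa [Path.symm_range])).trans ?_
    exact eVariationOn.comp_le_of_antitoneOn (γ : unitInterval → Plane) (t := univ) (s := univ)
      unitInterval.symm (fun a _ b _ h => unitInterval.symm_le_symm.2 h) (mapsTo_univ _ _)
  exact le_antisymm (key _ _) (key _ _)

lemma eVariationOn_trans_le {u v w : Plane} (γ : Path u v) (γ' : Path v w) :
    eVariationOn (γ.trans γ') univ ≤ eVariationOn γ univ + eVariationOn γ' univ := by
  set h : unitInterval := ⟨1 / 2, by norm_num, by norm_num⟩ with hh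
  have hun : (univ : Set unitInterval) = Iic h ∪ Ici h := by
    ext x; simp
  have h1 : eVariationOn (γ.trans γ') (Iic h) ≤ eVariationOn γ univ := by
    have : EqOn (γ.trans γ') (γ ∘ fun t : unitInterval => projIcc (0 : ℝ) 1 zero_le_one (2 * t))
        (Iic h) := by
      intro t ht
      have ht' : (t : ℝ) ≤ 1 / 2 := ht
      have hm : (2 * t : ℝ) ∈ Icc (0 : ℝ) 1 := ⟨by linarith [t.2.1], by linarith⟩
      simp only [Path.trans_apply, ht', dif_pos, Function.comp]
      rw [projIcc_of_mem zero_le_one hm]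
    rw [eVariationOn.eq_of_eqOn this]
    exact eVariationOn.comp_le_of_monotoneOn _ _
      (fun a _ b _ hab => monotone_projIcc _ (by
        have : (a : ℝ) ≤ b := hab
        linarith)) (mapsTo_univ _ _)
  have h2 : eVariationOn (γ.trans γ') (Ici h) ≤ eVariationOn γ' univ := by
    have : EqOn (γ.trans γ') (γ' ∘ fun t : unitInterval =>
        projIcc (0 : ℝ) 1 zero_le_one (2 * t - 1)) (Ici h) := by
      intro t ht
      have ht' : 1 / 2 ≤ (t : ℝ) := ht
      have hm : (2 * t - 1 : ℝ) ∈ Icc (0 : ℝ) 1 := ⟨by linarith, by linarith [t.2.2]⟩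
      simp only [Path.trans_apply, Function.comp]
      rw [projIcc_of_mem zero_le_one hm]
      split_ifs with h3
      · have h4 : (t : ℝ) = 1 / 2 := le_antisymm h3 ht'
        have e1 : (⟨2 * t, by rw [h4]; norm_num, by rw [h4]; norm_num⟩ : unitInterval) = 1 := by
          ext; simp [h4]
        have e2 : (⟨2 * t - 1, hm⟩ : unitInterval) = 0 := by
          ext; simp [h4]
        rw [e2]
        have := congrArg γ e1
        simp only [Path.target] at this
        simpa using this
      · rfl
    rw [eVariationOn.eq_of_eqOn this]
    exact eVariationOn.comp_le_of_monotoneOn _ _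
      (fun a _ b _ hab => monotone_projIcc _ (by
        have : (a : ℝ) ≤ b := hab
        linarith)) (mapsTo_univ _ _)
  calc eVariationOn (γ.trans γ') univ = eVariationOn (γ.trans γ') (Iic h ∪ Ici h) := by rw [← hun]
    _ = _ := eVariationOn.union (γ.trans γ') (x := h) isGreatest_Iic isLeast_Ici
    _ ≤ _ := add_le_add h1 h2

lemma pathDist_triangle (K : Set Plane) (u v w : Plane) :
    pathDist K u w ≤ pathDist K u v + pathDist K v w := by
  by_contra hlt
  push Not at hlt
  have hfin : pathDist K u v + pathDist K v w ≠ ∞ := hlt.ne_top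
  obtain ⟨h1, h2⟩ := ENNReal.add_ne_top.1 hfin
  obtain ⟨δ, hδ, hδ'⟩ : ∃ δ : ℝ≥0∞, 0 < δ ∧
      pathDist K u v + δ + (pathDist K v w + δ) ≤ pathDist K u w := by
    obtain ⟨x, hx1, hx2⟩ := ENNReal.lt_iff_exists_add_pos_lt.1 hlt
    refine ⟨(x : ℝ≥0∞) / 2, by simpa using hx1.ne', ?_⟩
    calc _ = pathDist K u v + pathDist K v w + ((x : ℝ≥0∞) / 2 + (x : ℝ≥0∞) / 2) := by ring
      _ ≤ _ := by rw [ENNReal.add_halves]; exact hx2.le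
  obtain ⟨γ, hγ, hl⟩ := exists_path_of_pathDist_lt (ENNReal.lt_add_right h1 hδ.ne')
  obtain ⟨γ', hγ', hl'⟩ := exists_path_of_pathDist_lt (ENNReal.lt_add_right h2 hδ.ne')
  have h3 : pathDist K u w ≤ eVariationOn (γ.trans γ') univ :=
    pathDist_le _ (by rw [Path.trans_range]; exact union_subset hγ hγ')
  have h4 := h3.trans (eVariationOn_trans_le γ γ')
  exact absurd (h4.trans_lt (ENNReal.add_lt_add hl hl')) (not_lt.2 hδ')

lemma pathDist_le_of_lipschitzOn {K : Set Plane} {c : ℝ → Plane} {a b : ℝ} (hab : a ≤ b)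
    {C : NNReal} (hc : LipschitzOnWith C c (Icc a b)) (hK : MapsTo c (Icc a b) K) :
    pathDist K (c a) (c b) ≤ C * ENNReal.ofReal (b - a) := by
  have hm : ∀ t : unitInterval, a + (b - a) * t ∈ Icc a b := fun t =>
    ⟨by nlinarith [t.2.1], by nlinarith [t.2.2]⟩
  let γ : Path (c a) (c b) :=
    { toFun := fun t => c (a + (b - a) * t)
      continuous_toFun := hc.continuousOn.comp_continuous (by fun_prop) hm
      source' := by simp
      target' := by simp }
  refine (pathDist_le γ (range_subset_iff.2 fun t => hK (hm t))).trans ?_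
  have h1 : eVariationOn (c ∘ fun t : unitInterval => a + (b - a) * (t : ℝ)) univ ≤
      C * eVariationOn (fun t : unitInterval => a + (b - a) * (t : ℝ)) univ :=
    hc.comp_eVariationOn_le fun t _ => hm t
  have hmono : MonotoneOn (fun t : unitInterval => a + (b - a) * (t : ℝ)) univ := by
    intro s _ t _ hst
    have : (s : ℝ) ≤ t := hst
    simp only
    nlinarith
  have h2 := (hmono.eVariationOn_eq (mem_univ 0) (mem_univ 1)).le
  have h3 : (univ : Set unitInterval) ∩ Icc 0 1 = univ := by
    ext t; simp [unitInterval.le_one']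
  rw [h3] at h2
  refine h1.trans (mul_le_mul_right (h2.trans (ENNReal.ofReal_le_ofReal ?_)) _)
  simp

lemma pathDist_le_of_segment {K : Set Plane} {u v : Plane} (h : segment ℝ u v ⊆ K) :
    pathDist K u v ≤ ENNReal.ofReal (dist u v) := by
  have hL : LipschitzOnWith (nndist u v) (AffineMap.lineMap u v : ℝ → Plane) (Icc 0 1) :=
    (LipschitzWith.of_dist_le_mul fun s t => by
      rw [dist_lineMap_lineMap, mul_comm]; rfl).lipschitzOnWith
  have h1 := pathDist_le_of_lipschitzOn (K := K) zero_le_one hL (fun t ht => h (by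
    rw [segment_eq_image_lineMap]; exact ⟨t, ht, rfl⟩))
  simp only [AffineMap.lineMap_apply_zero, AffineMap.lineMap_apply_one, sub_zero,
    ENNReal.ofReal_one, mul_one] at h1
  refine h1.trans (le_of_eq ?_)
  rw [← edist_dist, edist_nndist]

/-- The two pieces into which `w` cuts the path are competitors for the two infima. This is how a
landmark that every path has to pass enters estimates of path distances. -/
lemma pathDist_add_le_of_mem_range {K : Set Plane} {u v w : Plane} (γ : Path u v)
    (hγ : range γ ⊆ K) (hw : w ∈ range γ) :
    pathDist K u w + pathDist K w v ≤ eVariationOn γ univ := by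
  obtain ⟨t, rfl⟩ := hw
  have hun : (univ : Set unitInterval) = Iic t ∪ Ici t := by
    ext x; simp
  rw [hun, eVariationOn.union γ (x := t) isGreatest_Iic isLeast_Ici]
  refine add_le_add ?_ ?_
  · let γ₁ : Path u (γ t) :=
      { toFun := fun s => γ (s * t)
        continuous_toFun := by fun_prop
        source' := by simp
        target' := by simp }
    refine (pathDist_le γ₁ (range_subset_iff.2 fun s => hγ ⟨_, rfl⟩)).trans ?_
    exact eVariationOn.comp_le_of_monotoneOn (γ : unitInterval → Plane) (t := univ)
      (fun s => s * t) (fun a _ b _ hab => mul_le_mul_left hab t)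
      (fun s _ => unitInterval.mul_le_right)
  · let γ₂ : Path (γ t) v :=
      { toFun := fun s => γ (unitInterval.symm (unitInterval.symm s * unitInterval.symm t))
        continuous_toFun := by fun_prop
        source' := by simp
        target' := by simp }
    refine (pathDist_le γ₂ (range_subset_iff.2 fun s => hγ ⟨_, rfl⟩)).trans ?_
    refine eVariationOn.comp_le_of_monotoneOn (γ : unitInterval → Plane) (t := univ)
      (fun s => unitInterval.symm (unitInterval.symm s * unitInterval.symm t)) ?_ ?_
    · intro a _ b _ hab
      exact unitInterval.symm_le_symm.2 (mul_le_mul_left (unitInterval.symm_le_symm.2 hab) _)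
    · intro s _
      have : unitInterval.symm s * unitInterval.symm t ≤ unitInterval.symm t :=
        unitInterval.mul_le_right
      have := unitInterval.symm_le_symm.2 this
      simpa using this

/-- If all paths from `a` to `x₁` meet `W`, and `a` is not farther from `x₁` than `x₀`, then some
point of `W` is almost as close to `a` as to `x₀`. -/
lemma exists_crossing_le {K W : Set Plane} {a x₀ x₁ : Plane} (hfin : pathDist K a x₁ ≠ ∞)
    (hle : pathDist K a x₁ ≤ pathDist K x₀ x₁)
    (hc : ∀ γ : Path a x₁, range γ ⊆ K → ∃ w ∈ range γ, w ∈ W) {δ : ℝ} (hδ : 0 < δ) :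
    ∃ w ∈ W ∩ K, pathDist K a w ≤ pathDist K x₀ w + ENNReal.ofReal δ := by
  obtain ⟨γ, hγ, hl⟩ := exists_path_of_pathDist_lt
    (ENNReal.lt_add_right hfin (ENNReal.ofReal_pos.2 hδ).ne')
  obtain ⟨w, hw, hW⟩ := hc γ hγ
  have h1 := pathDist_add_le_of_mem_range γ hγ hw
  refine ⟨w, ⟨hW, hγ hw⟩, ?_⟩
  have h2 : pathDist K a w + pathDist K w x₁ ≤
      pathDist K x₀ w + ENNReal.ofReal δ + pathDist K w x₁ := by
    calc _ ≤ pathDist K a x₁ + ENNReal.ofReal δ := h1.trans hl.le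
      _ ≤ pathDist K x₀ x₁ + ENNReal.ofReal δ := by gcongr
      _ ≤ pathDist K x₀ w + pathDist K w x₁ + ENNReal.ofReal δ := by
        gcongr; exact pathDist_triangle _ _ _ _
      _ = _ := by ring
  -- Finiteness allows the common remainder to be cancelled in the extended reals.
  have hne : pathDist K w x₁ ≠ ∞ := by
    intro h
    rw [h] at h1
    have := h1.trans_lt hl
    simp at this
  exact (ENNReal.add_le_add_iff_right hne).1 h2

lemma exists_path_of_pathDist_ne_top {K : Set Plane} {u v : Plane} (h : pathDist K u v ≠ ∞) :
    ∃ γ : Path u v, range γ ⊆ K := by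
  obtain ⟨γ, hγ, -⟩ := exists_path_of_pathDist_lt (lt_top_iff_ne_top.2 h)
  exact ⟨γ, hγ⟩

lemma isPreconnected_range_path {u v : Plane} (γ : Path u v) : IsPreconnected (range γ) :=
  isPreconnected_range γ.continuous

lemma IsEndpointPair.symm {K E₀ E₁ : Set Plane} {x₀ x₁ : Plane}
    (h : IsEndpointPair K E₀ E₁ x₀ x₁) : IsEndpointPair K E₁ E₀ x₁ x₀ where
  left_mem := h.right_mem
  right_mem := h.left_mem
  joined := by rw [pathDist_comm]; exact h.joined
  maximal u hu v hv huv := by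
    rw [pathDist_comm K x₁, pathDist_comm K u]
    exact h.maximal v hv u hu (by rwa [pathDist_comm])

end Filament

open Filter Topology

namespace Filament

/-! ### Plane vector algebra -/

/-- The planar cross product. -/
def cross (p q : Plane) : ℝ := p 0 * q 1 - p 1 * q 0

/-- Rotation by a right angle. -/
noncomputable def rot (p : Plane) : Plane := !₂[-p 1, p 0]

lemma norm_sq_coord (p : Plane) : ‖p‖ ^ 2 = p 0 ^ 2 + p 1 ^ 2 := by
  simp [EuclideanSpace.norm_sq_eq]

lemma inner_coord (p q : Plane) : inner ℝ p q = p 0 * q 0 + p 1 * q 1 := by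
  simp [PiLp.inner_apply, mul_comm]

@[simp] lemma rot_zero_apply (p : Plane) : rot p 0 = -p 1 := by simp [rot]
@[simp] lemma rot_one_apply (p : Plane) : rot p 1 = p 0 := by simp [rot]

lemma inner_rot (p q : Plane) : inner ℝ (rot p) q = cross p q := by
  rw [inner_coord, cross]; simp; ring

lemma norm_rot (p : Plane) : ‖rot p‖ = ‖p‖ := by
  have : ‖rot p‖ ^ 2 = ‖p‖ ^ 2 := by rw [norm_sq_coord, norm_sq_coord]; simp; ring
  exact (pow_left_inj₀ (norm_nonneg _) (norm_nonneg _) two_ne_zero).1 this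

lemma cross_sq_add_inner_sq (p q : Plane) :
    cross p q ^ 2 + inner ℝ p q ^ 2 = ‖p‖ ^ 2 * ‖q‖ ^ 2 := by
  rw [norm_sq_coord, norm_sq_coord, inner_coord, cross]; ring

lemma abs_cross_le (p q : Plane) : |cross p q| ≤ ‖p‖ * ‖q‖ := by
  apply abs_le_of_sq_le_sq _ (by positivity)
  have := cross_sq_add_inner_sq p q
  nlinarith [sq_nonneg (inner ℝ p q)]

lemma cross_self (p : Plane) : cross p p = 0 := by rw [cross]; ring
lemma cross_neg_left (p q : Plane) : cross (-p) q = -cross p q := by simp [cross]; ring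
lemma cross_neg_right (p q : Plane) : cross p (-q) = -cross p q := by simp [cross]; ring
lemma cross_smul_left (a : ℝ) (p q : Plane) : cross (a • p) q = a * cross p q := by
  simp [cross]; ring
lemma cross_smul_right (a : ℝ) (p q : Plane) : cross p (a • q) = a * cross p q := by
  simp [cross]; ring

lemma continuous_cross : Continuous fun pq : Plane × Plane => cross pq.1 pq.2 := by
  unfold cross; fun_prop

/-- A unit vector and its rotation form a basis. -/
lemma eq_inner_smul_add_cross_smul {t : Plane} (ht : ‖t‖ = 1) (v : Plane) :
    v = (inner ℝ t v : ℝ) • t + cross t v • rot t := by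
  have h : t 0 ^ 2 + t 1 ^ 2 = 1 := by rw [← norm_sq_coord, ht]; norm_num
  ext i
  fin_cases i <;> simp [inner_coord, cross]
  · linear_combination -(v 0) * h
  · linear_combination -(v 1) * h

lemma norm_le_abs_inner_add_abs_cross {t : Plane} (ht : ‖t‖ = 1) (v : Plane) :
    ‖v‖ ≤ |inner ℝ t v| + |cross t v| := by
  have h := cross_sq_add_inner_sq t v
  rw [ht, one_pow, one_mul] at h
  apply le_of_sq_le_sq _ (by positivity)
  rw [← h, ← sq_abs (cross t v), ← sq_abs (inner ℝ t v)]
  nlinarith [abs_nonneg (cross t v), abs_nonneg (inner ℝ t v : ℝ)]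

/-! ### The three point condition -/

/-- A triangle with sides a, b, c and circumradius R satisfies 4R · area = abc, and |cross| is twice
the area. In this form the condition includes degenerate triples and passes to limits. -/
lemma two_mul_mul_abs_cross_le_of_le_thickness {G : Set Plane} {σ : ℝ}
    (h : ENNReal.ofReal σ ≤ thickness G) {x y z : Plane} (hx : x ∈ G) (hy : y ∈ G) (hz : z ∈ G) :
    2 * σ * |cross (y - x) (z - x)| ≤ ‖y - x‖ * ‖z - x‖ * ‖y - z‖ := by
  by_cases hc : cross (y - x) (z - x) = 0
  · rw [hc]; simp; positivity
  have hxy : x ≠ y := by rintro rfl; simp [cross] at hc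
  have hxz : x ≠ z := by rintro rfl; simp [cross] at hc
  have hyz : y ≠ z := by rintro rfl; exact hc (cross_self _)
  set p := y - x with hp
  set q := z - x with hq
  set cr := cross p q with hcr
  -- The circumcentre, the solution of the two perpendicular bisector equations relative to `x`.
  let c : Plane := !₂[x 0 + ((q 0 ^ 2 + q 1 ^ 2) * (-p 1) + (p 0 ^ 2 + p 1 ^ 2) * q 1) / (2 * cr),
    x 1 + ((q 0 ^ 2 + q 1 ^ 2) * p 0 - (p 0 ^ 2 + p 1 ^ 2) * q 0) / (2 * cr)]
  have hy' : ∀ i, y i = x i + p i := by intro i; simp [hp]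
  have hz' : ∀ i, z i = x i + q i := by intro i; simp [hq]
  have hcr' : cr = p 0 * q 1 - p 1 * q 0 := rfl
  have hxc : dist x c ^ 2 = ((q 0 ^ 2 + q 1 ^ 2) * (p 0 ^ 2 + p 1 ^ 2) *
      ((p 0 - q 0) ^ 2 + (p 1 - q 1) ^ 2)) / (4 * cr ^ 2) := by
    rw [dist_eq_norm, norm_sq_coord]
    simp only [c, PiLp.sub_apply]
    simp
    field_simp
    ring
  have hyc : dist y c ^ 2 = dist x c ^ 2 := by
    rw [hxc, dist_eq_norm, norm_sq_coord]
    simp only [c, PiLp.sub_apply, hy']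
    simp
    field_simp
    rw [hcr']
    ring
  have hzc : dist z c ^ 2 = dist x c ^ 2 := by
    rw [hxc, dist_eq_norm, norm_sq_coord]
    simp only [c, PiLp.sub_apply, hz']
    simp
    field_simp
    rw [hcr']
    ring
  have e1 : dist y c = dist x c := (pow_left_inj₀ dist_nonneg dist_nonneg two_ne_zero).1 hyc
  have e2 : dist z c = dist x c := (pow_left_inj₀ dist_nonneg dist_nonneg two_ne_zero).1 hzc
  have h1 : ENNReal.ofReal σ ≤ ENNReal.ofReal (dist x c) := by
    refine h.trans ?_
    unfold thickness
    refine (iInf₂_le x hx).trans ((iInf₂_le y hy).trans ((iInf₂_le z hz).trans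
      ((iInf_le _ ⟨hxy, hyz, hxz⟩).trans ?_)))
    exact iInf₂_le c ⟨e1.symm, by rw [e1, e2]⟩
  have h2 : σ ≤ dist x c := (ENNReal.ofReal_le_ofReal_iff dist_nonneg).1 h1
  have h3 : 2 * dist x c * |cr| = ‖p‖ * ‖q‖ * ‖y - z‖ := by
    have hyz' : y - z = p - q := by rw [hp, hq]; abel
    apply (pow_left_inj₀ (by positivity) (by positivity) two_ne_zero).1
    rw [mul_pow, mul_pow, mul_pow, mul_pow, hxc, sq_abs, norm_sq_coord, norm_sq_coord, hyz',
      norm_sq_coord]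
    simp only [PiLp.sub_apply]
    field_simp
    ring
  calc 2 * σ * |cr| ≤ 2 * dist x c * |cr| := by gcongr
    _ = _ := h3

/-! ### Strands: unit speed curves with the tangent circle condition -/

/-- A curve with unit speed on `[a, b]` for which all circles tangent to the curve at one point and
through another one have radius at least `σ`. -/
structure Strand (g T : ℝ → Plane) (a b σ : ℝ) : Prop where
  deriv : ∀ s ∈ Icc a b, HasDerivWithinAt g (T s) (Icc a b) s
  unit : ∀ s ∈ Icc a b, ‖T s‖ = 1
  tan : ∀ s ∈ Icc a b, ∀ t ∈ Icc a b, 2 * σ * |cross (T s) (g t - g s)| ≤ ‖g t - g s‖ ^ 2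

namespace Strand

variable {g T : ℝ → Plane} {a b σ : ℝ}

lemma mono (h : Strand g T a b σ) {a' b' : ℝ} (ha : a ≤ a') (hb : b' ≤ b) :
    Strand g T a' b' σ where
  deriv s hs := (h.deriv s (Icc_subset_Icc ha hb hs)).mono (Icc_subset_Icc ha hb)
  unit s hs := h.unit s (Icc_subset_Icc ha hb hs)
  tan s hs t ht := h.tan s (Icc_subset_Icc ha hb hs) t (Icc_subset_Icc ha hb ht)

lemma reverse (h : Strand g T a b σ) :
    Strand (fun s => g (-s)) (fun s => -T (-s)) (-b) (-a) σ where
  deriv s hs := by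
    have hs' : -s ∈ Icc a b := ⟨by linarith [hs.2], by linarith [hs.1]⟩
    have h1 := (h.deriv _ hs').scomp s (hasDerivAt_neg s).hasDerivWithinAt
      (s := Icc (-b) (-a)) (t' := Icc a b) (fun t ht => ⟨by linarith [ht.2], by linarith [ht.1]⟩)
    simpa [Function.comp_def] using h1
  unit s hs := by
    rw [norm_neg]
    exact h.unit _ ⟨by linarith [hs.2], by linarith [hs.1]⟩
  tan s hs t ht := by
    rw [cross_neg_left, abs_neg]
    exact h.tan _ ⟨by linarith [hs.2], by linarith [hs.1]⟩ _
      ⟨by linarith [ht.2], by linarith [ht.1]⟩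

lemma continuousOn (h : Strand g T a b σ) : ContinuousOn g (Icc a b) :=
  fun s hs => (h.deriv s hs).continuousWithinAt

lemma norm_sub_le (h : Strand g T a b σ) {s t : ℝ} (hs : s ∈ Icc a b) (ht : t ∈ Icc a b) :
    ‖g t - g s‖ ≤ |t - s| := by
  have := (convex_Icc a b).norm_image_sub_le_of_norm_hasDerivWithin_le (C := 1)
    (fun x hx => h.deriv x hx) (fun x hx => (h.unit x hx).le) hs ht
  simpa using this

/-- If the tangent were orthogonal to the chord, |cross| would equal the chord length d, and the
tangent circle condition would read 2σd ≤ d². -/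
lemma inner_ne_zero (h : Strand g T a b σ) {s t : ℝ} (hs : s ∈ Icc a b) (ht : t ∈ Icc a b)
    (hne : g s ≠ g t) (hlt : ‖g s - g t‖ < 2 * σ) : inner ℝ (T s) (g s - g t) ≠ 0 := by
  intro h0
  have h1 := h.tan s hs t ht
  have h2 := cross_sq_add_inner_sq (T s) (g s - g t)
  rw [h0, h.unit s hs] at h2
  have h3 : |cross (T s) (g s - g t)| = ‖g s - g t‖ := by
    rw [← abs_of_nonneg (norm_nonneg (g s - g t))]
    apply (sq_eq_sq_iff_abs_eq_abs _ _).1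
    linarith
  have h4 : cross (T s) (g t - g s) = -cross (T s) (g s - g t) := by
    rw [← cross_neg_right, neg_sub]
  rw [h4, abs_neg, h3, norm_sub_rev (g t)] at h1
  have h5 : 0 < ‖g s - g t‖ := norm_pos_iff.2 (sub_ne_zero.2 hne)
  nlinarith

lemma hasDerivWithinAt_normSq (h : Strand g T a b σ) {s : ℝ} (hs : s ∈ Icc a b) (p : Plane) :
    HasDerivWithinAt (fun w => ‖g w - p‖ ^ 2) (2 * inner ℝ (T s) (g s - p)) (Icc a b) s := by
  have h1 := ((h.deriv s hs).sub_const p).norm_sq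
  simpa [real_inner_comm] using h1

/-- As long as a strand stays within distance `2σ` of its initial point, it moves away from it. -/
lemma inner_pos (h : Strand g T a b σ) (hinj : ∀ w ∈ Ioc a b, g w ≠ g a)
    (hlt : ∀ w ∈ Icc a b, ‖g w - g a‖ < 2 * σ) :
    ∀ w ∈ Ioc a b, 0 < inner ℝ (T w) (g w - g a) := by
  rcases le_or_gt b a with hba | hab
  · intro w hw; exact absurd (hw.1.trans_le hw.2) (not_lt.2 hba)
  have ha : a ∈ Icc a b := ⟨le_rfl, hab.le⟩
  have hd : ∀ w ∈ Ioc a b, HasDerivWithinAt (fun w => ‖g w - g a‖ ^ 2)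
      (2 * inner ℝ (T w) (g w - g a)) (Ioc a b) w := fun w hw =>
    (h.hasDerivWithinAt_normSq (Ioc_subset_Icc_self hw) _).mono Ioc_subset_Icc_self
  -- `T` is not assumed continuous; by Darboux a derivative without zeros still has constant sign.
  -- The negative sign is impossible because the squared distance starts at 0.
  rcases hasDerivWithinAt_forall_lt_or_forall_gt_of_forall_ne (convex_Ioc a b) hd (m := 0)
    (fun w hw => mul_ne_zero two_ne_zero (h.inner_ne_zero (Ioc_subset_Icc_self hw) ha
      (hinj w hw) (hlt w (Ioc_subset_Icc_self hw)))) with hneg | hpos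
  · exfalso
    have hcont : ContinuousOn (fun w => ‖g w - g a‖ ^ 2) (Icc a b) := fun w hw =>
      (h.hasDerivWithinAt_normSq hw _).continuousWithinAt
    have := strictAntiOn_of_hasDerivWithinAt_neg (convex_Icc a b) hcont
      (fun w hw => by
        rw [interior_Icc] at hw ⊢
        exact (h.hasDerivWithinAt_normSq (Ioo_subset_Icc_self hw) _).mono Ioo_subset_Icc_self)
      (fun w hw => by rw [interior_Icc] at hw; exact hneg w ⟨hw.1, hw.2.le⟩)
    have := this ha ⟨hab.le, le_rfl⟩ hab
    simp only [sub_self, norm_zero] at this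
    nlinarith [sq_nonneg ‖g b - g a‖]
  · intro w hw
    have := hpos w hw
    linarith

lemma norm_mono (h : Strand g T a b σ) (hinj : ∀ w ∈ Ioc a b, g w ≠ g a)
    (hlt : ∀ w ∈ Icc a b, ‖g w - g a‖ < 2 * σ) {s t : ℝ} (hs : s ∈ Icc a b) (ht : t ∈ Icc a b)
    (hst : s ≤ t) : ‖g s - g a‖ ≤ ‖g t - g a‖ := by
  have hcont : ContinuousOn (fun w => ‖g w - g a‖ ^ 2) (Icc a b) := fun w hw =>
    (h.hasDerivWithinAt_normSq hw _).continuousWithinAt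
  have := monotoneOn_of_hasDerivWithinAt_nonneg (convex_Icc a b) hcont
      (fun w hw => by
        rw [interior_Icc] at hw ⊢
        exact (h.hasDerivWithinAt_normSq (Ioo_subset_Icc_self hw) _).mono Ioo_subset_Icc_self)
      (fun w hw => by
        rw [interior_Icc] at hw
        have := h.inner_pos hinj hlt w ⟨hw.1, hw.2.le⟩
        positivity) hs ht hst
  exact le_of_sq_le_sq this (norm_nonneg _)

/-- Lower bound for the chord in terms of the arc. -/
lemma mul_le_norm (h : Strand g T a b σ) (hσ : 0 < σ) (hinj : ∀ w ∈ Ioc a b, g w ≠ g a)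
    {ρ : ℝ} (hρ : ρ < 2 * σ) (hlt : ∀ w ∈ Icc a b, ‖g w - g a‖ ≤ ρ) (hab : a ≤ b) :
    (1 - (ρ / (2 * σ)) ^ 2) * (b - a) ≤ ‖g b - g a‖ := by
  have ha : a ∈ Icc a b := ⟨le_rfl, hab⟩
  have hlt' : ∀ w ∈ Icc a b, ‖g w - g a‖ < 2 * σ := fun w hw => (hlt w hw).trans_lt hρ
  have hcont : ContinuousOn (fun w => ‖g w - g a‖) (Icc a b) :=
    (h.continuousOn.sub continuousOn_const).norm
  have hd : ∀ w ∈ Ioo a b, HasDerivAt (fun w => ‖g w - g a‖)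
      (inner ℝ (T w) (g w - g a) / ‖g w - g a‖) w := by
    intro w hw
    have h1 := (h.hasDerivWithinAt_normSq (Ioo_subset_Icc_self hw) (g a)).hasDerivAt
      (Icc_mem_nhds hw.1 hw.2)
    have hpos : 0 < ‖g w - g a‖ := norm_pos_iff.2 (sub_ne_zero.2 (hinj w ⟨hw.1, hw.2.le⟩))
    have h2 := h1.sqrt (by positivity)
    simp only [Real.sqrt_sq (norm_nonneg _)] at h2
    convert h2 using 1
    field_simp
  -- The chord grows at a rate equal to the cosine of the angle between chord and tangent. The sine
  -- is at most κ = ρ/(2σ), and cos ≥ cos² ≥ 1 − κ² avoids a square root.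
  have key := (convex_Icc a b).mul_sub_le_image_sub_of_le_deriv hcont
    (fun w hw => by
      rw [interior_Icc] at hw ⊢
      exact (hd w hw).differentiableAt.differentiableWithinAt)
    (C := 1 - (ρ / (2 * σ)) ^ 2) (fun w hw => by
      rw [interior_Icc] at hw
      rw [(hd w hw).deriv]
      have hw' := Ioo_subset_Icc_self hw
      have hpos : 0 < ‖g w - g a‖ := norm_pos_iff.2 (sub_ne_zero.2 (hinj w ⟨hw.1, hw.2.le⟩))
      have hip := h.inner_pos hinj hlt' w ⟨hw.1, hw.2.le⟩
      rw [le_div_iff₀ hpos]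
      have h1 := h.tan w hw' a ha
      have h4 : cross (T w) (g a - g w) = -cross (T w) (g w - g a) := by
        rw [← cross_neg_right, neg_sub]
      rw [h4, abs_neg, norm_sub_rev (g a)] at h1
      have h2 := cross_sq_add_inner_sq (T w) (g w - g a)
      rw [h.unit w hw', one_pow, one_mul, ← sq_abs (cross _ _)] at h2
      have h3 := hlt w hw'
      set d := ‖g w - g a‖
      set k := |cross (T w) (g w - g a)|
      set i : ℝ := inner ℝ (T w) (g w - g a)
      have hk0 : 0 ≤ k := abs_nonneg _
      have hk : k ≤ (ρ / (2 * σ)) * d := by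
        rw [div_mul_eq_mul_div, le_div_iff₀ (by positivity)]
        nlinarith
      set κ := ρ / (2 * σ)
      have hκ1 : κ < 1 := by rw [div_lt_one (by positivity)]; exact hρ
      have hκ0 : 0 ≤ κ := by
        by_contra hcon; push Not at hcon; nlinarith
      have : k ^ 2 ≤ κ ^ 2 * d ^ 2 := by rw [← mul_pow]; gcongr
      apply le_of_sq_le_sq _ hip.le
      have h5 : i ^ 2 ≥ (1 - κ ^ 2) * d ^ 2 := by nlinarith
      have h7 : κ ^ 2 ≤ 1 := by nlinarith
      have h6 : (1 - κ ^ 2) ^ 2 ≤ 1 - κ ^ 2 := by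
        nlinarith [mul_nonneg (sq_nonneg κ) (sub_nonneg.2 h7)]
      calc ((1 - κ ^ 2) * d) ^ 2 = (1 - κ ^ 2) ^ 2 * d ^ 2 := by ring
        _ ≤ (1 - κ ^ 2) * d ^ 2 := by gcongr
        _ ≤ _ := h5)
    a ha b ⟨hab, le_rfl⟩ hab
  simpa using key

/-- Write l = b − a, let d be the chord length and k the component of the chord across the tangent.
Then k ≤ l²/(2σ), the component along the tangent is positive and at least d − k, and d ≥ l −
l²/(4σ). The errors add up to at most 5l²/(4σ). -/
lemma flat_right (h : Strand g T a b σ) (hσ : 0 < σ) (hinj : ∀ w ∈ Ioc a b, g w ≠ g a)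
    (hinj' : ∀ w ∈ Ico a b, g w ≠ g b) (hab : a ≤ b) (hl : b - a ≤ σ) :
    ‖g b - g a - (b - a) • T a‖ ≤ 2 * (b - a) ^ 2 / σ := by
  rcases hab.eq_or_lt with rfl | hlt
  · simp
  have ha : a ∈ Icc a b := ⟨le_rfl, hab⟩
  have hb : b ∈ Icc a b := ⟨hab, le_rfl⟩
  have hdist : ∀ w ∈ Icc a b, ‖g w - g a‖ ≤ b - a := fun w hw =>
    (h.norm_sub_le ha hw).trans (by rw [abs_of_nonneg (by linarith [hw.1])]; linarith [hw.2])
  have hlow := h.mul_le_norm hσ hinj (ρ := b - a) (by linarith) hdist hab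
  have hr := hdist b hb
  have hpos : 0 < inner ℝ (T a) (g b - g a) := by
    have := (h.reverse).inner_pos (fun w hw => by
        simp only [neg_neg]
        exact hinj' _ ⟨by linarith [hw.2], by linarith [hw.1]⟩)
      (fun w hw => by
        simp only [neg_neg]
        have := h.norm_sub_le hb (t := -w) ⟨by linarith [hw.2], by linarith [hw.1]⟩
        refine this.trans_lt ?_
        rw [abs_lt]; constructor <;> linarith [hw.1, hw.2]) (-a) ⟨by linarith, by linarith⟩
    simp only [neg_neg, inner_neg_left] at this
    rw [← neg_sub (g a), inner_neg_right]
    linarith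
  have h1 := h.tan a ha b hb
  have h2 := cross_sq_add_inner_sq (T a) (g b - g a)
  rw [h.unit a ha, one_pow, one_mul, ← sq_abs (cross _ _)] at h2
  have h3 := norm_le_abs_inner_add_abs_cross (h.unit a ha) (g b - g a - (b - a) • T a)
  have h4 : inner ℝ (T a) (g b - g a - (b - a) • T a) = inner ℝ (T a) (g b - g a) - (b - a) := by
    rw [inner_sub_right, inner_smul_right, real_inner_self_eq_norm_sq, h.unit a ha]; ring
  have h5 : cross (T a) (g b - g a - (b - a) • T a) = cross (T a) (g b - g a) := by
    simp [cross]; ring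
  rw [h4, h5] at h3
  refine h3.trans ?_
  set d := ‖g b - g a‖
  set k := |cross (T a) (g b - g a)|
  set i : ℝ := inner ℝ (T a) (g b - g a)
  set l := b - a with hl'
  have hl0 : 0 < l := by linarith
  have hk0 : 0 ≤ k := abs_nonneg _
  have hd0 : 0 ≤ d := norm_nonneg _
  have hk : k ≤ l ^ 2 / (2 * σ) := by
    rw [le_div_iff₀ (by positivity)]; nlinarith
  have hid : i ≤ d := by nlinarith
  have hkd : k ≤ d := by nlinarith
  have hi : d - k ≤ i := by
    apply le_of_sq_le_sq _ hpos.le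
    nlinarith
  have hd : l - l ^ 2 / (4 * σ) ≤ d := by
    have e : (l / (2 * σ)) ^ 2 * l ≤ l ^ 2 / (4 * σ) := by
      rw [div_pow, div_mul_eq_mul_div, div_le_div_iff₀ (by positivity) (by positivity)]
      have : l ^ 2 * l * (4 * σ) ≤ l ^ 2 * σ * (4 * σ) := by gcongr
      nlinarith
    nlinarith
  rw [abs_of_nonpos (by linarith)]
  have e1 : l ^ 2 / (2 * σ) = l ^ 2 / σ / 2 := by field_simp
  have e2 : l ^ 2 / (4 * σ) = l ^ 2 / σ / 4 := by field_simp
  have e3 : 2 * l ^ 2 / σ = 2 * (l ^ 2 / σ) := by ring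
  have : 0 ≤ l ^ 2 / σ := by positivity
  rw [e1] at hk
  rw [e2] at hd
  rw [e3]
  linarith

lemma flat_left (h : Strand g T a b σ) (hσ : 0 < σ) (hinj : ∀ w ∈ Ioc a b, g w ≠ g a)
    (hinj' : ∀ w ∈ Ico a b, g w ≠ g b) (hab : a ≤ b) (hl : b - a ≤ σ) :
    ‖g a - g b - (a - b) • T b‖ ≤ 2 * (b - a) ^ 2 / σ := by
  have := h.reverse.flat_right hσ
    (fun w hw => by
      simp only [neg_neg]; exact hinj' _ ⟨by linarith [hw.2], by linarith [hw.1]⟩)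
    (fun w hw => by
      simp only [neg_neg]; exact hinj _ ⟨by linarith [hw.2], by linarith [hw.1]⟩)
    (by linarith) (by linarith)
  simp only [neg_neg] at this
  convert this using 3
  · rw [smul_neg, ← neg_smul]; congr 2; ring
  · ring

/-- A strand that has come back to within `2σ` of its initial point either never left the
`2σ`-neighbourhood, or stays in it until its end. -/
lemma no_return (h : Strand g T a b σ) (hinj : ∀ w ∈ Ioo a b, g w ≠ g a) {v : ℝ}
    (hlt : ‖g v - g a‖ < 2 * σ) :
    (∀ w ∈ Icc a v, ‖g w - g a‖ < 2 * σ) ∨ (∀ w ∈ Icc v b, ‖g w - g a‖ < 2 * σ) := by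
  by_contra hcon
  push Not at hcon
  obtain ⟨⟨w₁, hw₁, h₁⟩, w₂, hw₂, h₂⟩ := hcon
  have hsub : Icc w₁ w₂ ⊆ Icc a b := Icc_subset_Icc hw₁.1 hw₂.2
  have hcont : ContinuousOn (fun w => ‖g w - g a‖ ^ 2) (Icc w₁ w₂) := fun w hw =>
    ((h.hasDerivWithinAt_normSq (hsub hw) _).continuousWithinAt).mono hsub
  -- The distance is at least 2σ at `w₁` and `w₂` but smaller at `v`, so a minimiser is an interior
  -- critical point at a distance where none exists.
  obtain ⟨w, hw, hmin⟩ := isCompact_Icc.exists_isMinOn ⟨v, hw₁.2, hw₂.1⟩ hcont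
  have hwv : ‖g w - g a‖ ^ 2 ≤ ‖g v - g a‖ ^ 2 := hmin ⟨hw₁.2, hw₂.1⟩
  have hwlt : ‖g w - g a‖ < 2 * σ := (le_of_sq_le_sq hwv (norm_nonneg _)).trans_lt hlt
  have hw1 : w₁ < w := lt_of_le_of_ne hw.1 (by rintro rfl; exact absurd hwlt (not_lt.2 h₁))
  have hw2 : w < w₂ := lt_of_le_of_ne hw.2 (by rintro rfl; exact absurd hwlt (not_lt.2 h₂))
  have hnhds : Icc w₁ w₂ ∈ 𝓝 w := Icc_mem_nhds hw1 hw2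
  have hd := ((h.hasDerivWithinAt_normSq (hsub hw) (g a)).mono hsub).hasDerivAt hnhds
  have h0 := (hmin.isLocalMin hnhds).hasDerivAt_eq_zero hd
  exact h.inner_ne_zero (hsub hw) ⟨le_rfl, (hsub hw).1.trans (hsub hw).2⟩
    (hinj w ⟨hw₁.1.trans_lt hw1, hw2.trans_le hw₂.2⟩) hwlt (by linarith)

end Strand


/-! ### Self-contact of strands, and nearest points -/

namespace Strand

variable {g T : ℝ → Plane} {a b σ : ℝ}

lemma comp_affine (h : Strand g T a b σ) {p ω a' b' : ℝ} (hω : ω ^ 2 = 1)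
    (hm : ∀ t ∈ Icc a' b', p + ω * t ∈ Icc a b) :
    Strand (fun t => g (p + ω * t)) (fun t => ω • T (p + ω * t)) a' b' σ where
  deriv s hs := (h.deriv _ (hm s hs)).scomp s
    (((hasDerivAt_id s).const_mul ω).const_add p |>.hasDerivWithinAt.congr_deriv (by simp)) hm
  unit s hs := by
    rw [norm_smul, h.unit _ (hm s hs), mul_one, Real.norm_eq_abs]
    exact (pow_eq_one_iff_of_nonneg (abs_nonneg ω) two_ne_zero).1 (by rw [sq_abs, hω])
  tan s hs t ht := by
    have : |ω| = 1 := (pow_eq_one_iff_of_nonneg (abs_nonneg ω) two_ne_zero).1 (by rw [sq_abs, hω])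
    rw [cross_smul_left, abs_mul, this, one_mul]
    exact h.tan _ (hm s hs) _ (hm t ht)

lemma exists_half_le_inner (h : Strand g T 0 b σ) (hb : 0 < b) :
    ∃ δ ∈ Ioc 0 b, ∀ t ∈ Icc 0 δ, t / 2 ≤ inner ℝ (T 0) (g t - g 0) := by
  have h0 : (0 : ℝ) ∈ Icc 0 b := ⟨le_rfl, hb.le⟩
  have hd : HasDerivWithinAt (fun t => (inner ℝ (T 0) (g t - g 0) : ℝ)) 1 (Ioc 0 b) 0 := by
    have h1 := ((hasDerivWithinAt_const (0 : ℝ) (Icc 0 b) (T 0)).inner ℝ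
      ((h.deriv 0 h0).sub_const (g 0))).mono Ioc_subset_Icc_self
    refine h1.congr_deriv ?_
    simp [h.unit 0 h0]
  rw [hasDerivWithinAt_iff_tendsto_slope' (by simp)] at hd
  have hev := hd.eventually (lt_mem_nhds (show (1 / 2 : ℝ) < 1 by norm_num))
  rw [eventually_nhdsWithin_iff, Metric.eventually_nhds_iff] at hev
  obtain ⟨r, hr, hev⟩ := hev
  refine ⟨min (r / 2) b, ⟨by positivity, min_le_right _ _⟩, fun t ht => ?_⟩
  rcases ht.1.eq_or_lt with rfl | ht0
  · simp
  have h2 := hev (y := t) (by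
    rw [Real.dist_eq, sub_zero, abs_of_pos ht0]
    linarith [ht.2.trans (min_le_left _ _)]) ⟨ht0, ht.2.trans (min_le_right _ _)⟩
  rw [slope_def_field] at h2
  simp only [sub_self, inner_zero_right, sub_zero] at h2
  rw [lt_div_iff₀ ht0] at h2
  linarith

/-- The contradiction behind `exists_meet` in numbers. The mixed condition `hc1` makes the component
`i` of the later tangent along the initial direction tiny, because the gap β₂ − β₁ is small; `hc2`
makes the component `k` across it small. But k² + i² = 1. -/
lemma meet_arith {σ s t ξ β₁ β₂ i k : ℝ} (hσ : 0 < σ) (hs : 0 < s) (hsσ : s ≤ σ / 200)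
    (ht : 0 ≤ t) (hts : t ≤ 2 * s) (hξ : s / 2 ≤ ξ) (hb1 : 2 * σ * |β₁| ≤ s ^ 2)
    (hb2 : 2 * σ * |β₂| ≤ t ^ 2) (hκ : β₂ - β₁ ≠ 0)
    (hc1 : 2 * σ * (|β₂ - β₁| * |i|) ≤ |β₂ - β₁| ^ 2) (hc2 : 2 * σ * |ξ * k + β₁ * i| ≤ s ^ 2)
    (hsum : k ^ 2 + i ^ 2 = 1) : False := by
  have hκp : 0 < |β₂ - β₁| := abs_pos.2 hκ
  have h1 : 2 * σ * |i| ≤ |β₂ - β₁| := by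
    by_contra hcon
    push Not at hcon
    have := mul_lt_mul_of_pos_left hcon hκp
    linarith
  have h2 : |β₂ - β₁| ≤ |β₂| + |β₁| := abs_sub _ _
  have ht2 : t ^ 2 ≤ (2 * s) ^ 2 := by gcongr
  have hss : s ^ 2 ≤ s * (σ / 200) := by rw [pow_two]; gcongr
  have h3 : |β₂ - β₁| ≤ s / 80 := by
    have h4 : 2 * σ * |β₂ - β₁| ≤ 2 * σ * (s / 80) := by
      have := mul_le_mul_of_nonneg_left h2 (by positivity : (0 : ℝ) ≤ 2 * σ)
      linarith
    exact le_of_mul_le_mul_left h4 (by positivity)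
  have hi : |i| ≤ 1 / 16000 := by
    have h4 : 2 * σ * |i| ≤ 2 * σ * (1 / 16000) := by linarith
    exact le_of_mul_le_mul_left h4 (by positivity)
  have hk0 : ξ * |k| ≤ |ξ * k + β₁ * i| + |β₁| * |i| := by
    have e : ξ * |k| = |ξ * k| := by rw [abs_mul, abs_of_nonneg (by linarith : 0 ≤ ξ)]
    rw [e, ← abs_mul]
    simpa using abs_sub (ξ * k + β₁ * i) (β₁ * i)
  have hbi : 2 * σ * (|β₁| * |i|) ≤ s ^ 2 := by
    have : |β₁| * |i| ≤ |β₁| * 1 := by gcongr; linarith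
    have := mul_le_mul_of_nonneg_left this (by positivity : (0 : ℝ) ≤ 2 * σ)
    linarith
  have hk1 : s / 2 * |k| ≤ ξ * |k| := by gcongr
  have hk : |k| ≤ 1 / 100 := by
    have h4 : σ * s * |k| ≤ σ * s * (1 / 100) := by
      have := mul_le_mul_of_nonneg_left (hk1.trans hk0) (by positivity : (0 : ℝ) ≤ 2 * σ)
      linarith
    exact le_of_mul_le_mul_left h4 (by positivity)
  have h5 : k ^ 2 ≤ (1 / 100) ^ 2 := by rw [← sq_abs]; gcongr
  have h6 : i ^ 2 ≤ (1 / 16000) ^ 2 := by rw [← sq_abs]; gcongr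
  norm_num at h5 h6
  linarith

/-- Two strands that leave the same point in the same direction meet again. -/
lemma exists_meet {g₁ T₁ g₂ T₂ : ℝ → Plane} {δ : ℝ} (h₁ : Strand g₁ T₁ 0 δ σ)
    (h₂ : Strand g₂ T₂ 0 δ σ) (hσ : 0 < σ) (hδ : 0 < δ)
    (hc : ∀ s ∈ Icc 0 δ, ∀ t ∈ Icc 0 δ,
      2 * σ * |cross (T₁ s) (g₂ t - g₁ s)| ≤ ‖g₂ t - g₁ s‖ ^ 2)
    (hg : g₁ 0 = g₂ 0) (hT : T₁ 0 = T₂ 0) :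
    ∃ s ∈ Ioc 0 δ, ∃ t ∈ Ioc 0 δ, g₁ s = g₂ t := by
  obtain ⟨δ₁, hδ₁, hx₁⟩ := h₁.exists_half_le_inner hδ
  obtain ⟨δ₂, hδ₂, hx₂⟩ := h₂.exists_half_le_inner hδ
  set r := min (min δ₁ δ₂) (σ / 100) with hr
  have hr0 : 0 < r := by simp [hr, hδ₁.1, hδ₂.1, hσ]
  have hr1 : r ≤ δ₁ := (min_le_left _ _).trans (min_le_left _ _)
  have hr2 : r ≤ δ₂ := (min_le_left _ _).trans (min_le_right _ _)
  have hrσ : r ≤ σ / 100 := min_le_right _ _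
  set τ := T₁ 0 with hτ
  have h0 : (0 : ℝ) ∈ Icc 0 δ := ⟨le_rfl, hδ.le⟩
  have hτ1 : ‖τ‖ = 1 := h₁.unit 0 h0
  set s := r / 2 with hs
  have hs0 : 0 < s := by positivity
  have hsδ : s ∈ Icc 0 δ := ⟨hs0.le, by linarith [hδ₁.2]⟩
  set ξ : ℝ := inner ℝ τ (g₁ s - g₁ 0) with hξ
  have hξ1 : s / 2 ≤ ξ := hx₁ s ⟨hs0.le, by linarith⟩
  have hn1 : ‖g₁ s - g₁ 0‖ ≤ s := by
    simpa [abs_of_pos hs0] using h₁.norm_sub_le h0 hsδ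
  have hξ2 : ξ ≤ s := by
    have := real_inner_le_norm τ (g₁ s - g₁ 0)
    rw [hτ1, one_mul] at this
    linarith
  have hcont : ContinuousOn (fun t => (inner ℝ τ (g₂ t - g₂ 0) : ℝ)) (Icc 0 r) :=
    continuousOn_const.inner ((h₂.continuousOn.mono (Icc_subset_Icc le_rfl
      (hr2.trans hδ₂.2))).sub continuousOn_const)
  have hr' := hx₂ r ⟨hr0.le, hr2⟩
  rw [← hT] at hr'
  -- Both points are given the same coordinate ξ along the common initial direction τ, so that their
  -- difference is normal to τ.
  obtain ⟨t, ht, hxt⟩ := intermediate_value_Icc hr0.le hcont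
    (show ξ ∈ Icc _ _ from ⟨by simp only [sub_self, inner_zero_right]; linarith, by linarith⟩)
  simp only at hxt
  have ht2 := hx₂ t ⟨ht.1, ht.2.trans hr2⟩
  rw [← hT, hxt] at ht2
  have ht0 : 0 < t := by
    refine lt_of_le_of_ne ht.1 ?_
    rintro rfl
    simp only [sub_self, inner_zero_right] at hxt
    linarith
  have htδ : t ∈ Icc 0 δ := ⟨ht0.le, by linarith [ht.2, hδ₂.2]⟩
  refine ⟨s, ⟨hs0, hsδ.2⟩, t, ⟨ht0, htδ.2⟩, ?_⟩
  by_contra hne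
  have hn2 : ‖g₂ t - g₂ 0‖ ≤ t := by
    simpa [abs_of_pos ht0] using h₂.norm_sub_le h0 htδ
  have hp1 := h₁.tan 0 h0 s hsδ
  have hp2 := h₂.tan 0 h0 t htδ
  rw [← hT] at hp2
  rw [← hτ] at hp1
  set β₁ := cross τ (g₁ s - g₁ 0) with hβ₁
  set β₂ := cross τ (g₂ t - g₂ 0) with hβ₂
  have e1 := eq_inner_smul_add_cross_smul hτ1 (g₁ s - g₁ 0)
  have e2 := eq_inner_smul_add_cross_smul hτ1 (g₂ t - g₂ 0)
  rw [← hξ, ← hβ₁] at e1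
  rw [hxt, ← hβ₂] at e2
  have e3 : g₂ t - g₁ s = (β₂ - β₁) • rot τ := by
    have : g₂ t - g₁ s = (g₂ t - g₂ 0) - (g₁ s - g₁ 0) := by rw [hg]; abel
    rw [this, e1, e2, sub_smul]; abel
  set κ := β₂ - β₁ with hκ
  have hκ0 : κ ≠ 0 := by
    intro h; rw [h, zero_smul, sub_eq_zero] at e3; exact hne e3.symm
  have hc1 := hc s hsδ t htδ
  rw [e3, cross_smul_right, abs_mul, norm_smul, norm_rot, hτ1, mul_one, Real.norm_eq_abs] at hc1
  have hcr : cross (T₁ s) (rot τ) = inner ℝ (T₁ s) τ := by simp [cross, inner_coord]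
  rw [hcr] at hc1
  set i : ℝ := inner ℝ (T₁ s) τ with hi
  have hc2 := h₁.tan s hsδ 0 h0
  have e4 : g₁ 0 - g₁ s = -(ξ • τ + β₁ • rot τ) := by rw [← e1]; abel
  have e5 : cross (T₁ s) (g₁ 0 - g₁ s) = -(ξ * cross (T₁ s) τ + β₁ * i) := by
    rw [e4, cross_neg_right, ← hcr]; simp [cross]; ring
  rw [e5, abs_neg, norm_sub_rev] at hc2
  have hsum := cross_sq_add_inner_sq (T₁ s) τ
  rw [h₁.unit s hsδ, hτ1, ← hi, one_pow, one_mul] at hsum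
  have hn1' : ‖g₁ s - g₁ 0‖ ^ 2 ≤ s ^ 2 := by gcongr
  have hn2' : ‖g₂ t - g₂ 0‖ ^ 2 ≤ t ^ 2 := by gcongr
  exact meet_arith hσ hs0 (by linarith) ht0.le (by linarith) hξ1 (hp1.trans hn1') (hp2.trans hn2')
    hκ0 hc1 (hc2.trans hn1') hsum

lemma neBot_nhdsWithin_Icc_sdiff {a b q : ℝ} (hab : a < b) (hq : q ∈ Icc a b) :
    (𝓝[Icc a b \ {q}] q).NeBot := by
  rw [← mem_closure_iff_nhdsWithin_neBot]
  rcases hq.1.eq_or_lt with rfl | hlt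
  · have hsub : Ioo a b ⊆ Icc a b \ {a} := fun x hx => ⟨Ioo_subset_Icc_self hx, hx.1.ne'⟩
    exact closure_mono hsub (by rw [closure_Ioo hab.ne]; exact hq)
  · have hsub : Ioo a q ⊆ Icc a b \ {q} :=
      fun x hx => ⟨⟨hx.1.le, hx.2.le.trans hq.2⟩, hx.2.ne⟩
    exact closure_mono hsub (by rw [closure_Ioo hlt.ne]; exact ⟨hlt.le, le_rfl⟩)

/-- Apply the tangent circle condition at `p` to points `g t` with t → q and divide by |t − q|: the
right-hand side tends to 0. -/
lemma cross_eq_zero_of_eq (h : Strand g T a b σ) (hσ : 0 < σ) (hab : a < b) {p q : ℝ}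
    (hp : p ∈ Icc a b) (hq : q ∈ Icc a b) (hpq : g p = g q) : cross (T p) (T q) = 0 := by
  have hd := (hasDerivWithinAt_iff_tendsto_slope.1 (h.deriv q hq))
  have hne := neBot_nhdsWithin_Icc_sdiff hab hq
  have h1 : Tendsto (fun t => 2 * σ * |cross (T p) (slope g q t)|) (𝓝[Icc a b \ {q}] q)
      (𝓝 (2 * σ * |cross (T p) (T q)|)) := by
    have := (continuous_cross.tendsto (T p, T q)).comp (tendsto_const_nhds.prodMk_nhds hd)
    exact (this.abs).const_mul _
  have h2 : Tendsto (fun t => ‖g t - g q‖ * ‖slope g q t‖) (𝓝[Icc a b \ {q}] q)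
      (𝓝 (‖g q - g q‖ * ‖T q‖)) := by
    refine Tendsto.mul ?_ hd.norm
    exact (((h.continuousOn q hq).mono sdiff_subset).sub continuousWithinAt_const).norm
  have h3 := le_of_tendsto_of_tendsto h1 h2 (by
    filter_upwards [self_mem_nhdsWithin] with t ht
    have h4 := h.tan p hp t ht.1
    have ht' : 0 < |t - q| := abs_pos.2 (sub_ne_zero.2 ht.2)
    rw [slope_def_module, cross_smul_right, abs_mul, norm_smul, abs_inv, norm_inv,
      Real.norm_eq_abs]
    rw [hpq] at h4
    have : 2 * σ * (|t - q|⁻¹ * |cross (T p) (g t - g q)|) =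
      |t - q|⁻¹ * (2 * σ * |cross (T p) (g t - g q)|) := by ring
    rw [this]
    calc _ ≤ |t - q|⁻¹ * ‖g t - g q‖ ^ 2 := by gcongr
      _ = _ := by ring)
  rw [sub_self, norm_zero, zero_mul] at h3
  have := abs_nonneg (cross (T p) (T q))
  exact abs_eq_zero.1 (by nlinarith)

lemma eq_or_eq_neg_of_eq (h : Strand g T a b σ) (hσ : 0 < σ) (hab : a < b) {p q : ℝ}
    (hp : p ∈ Icc a b) (hq : q ∈ Icc a b) (hpq : g p = g q) :
    ∃ ω : ℝ, (ω = 1 ∨ ω = -1) ∧ ω • T q = T p := by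
  have h0 := h.cross_eq_zero_of_eq hσ hab hp hq hpq
  have h1 := eq_inner_smul_add_cross_smul (h.unit p hp) (T q)
  rw [h0, zero_smul, add_zero] at h1
  have h2 := cross_sq_add_inner_sq (T p) (T q)
  rw [h0, h.unit p hp, h.unit q hq] at h2
  have h3 : (inner ℝ (T p) (T q) : ℝ) ^ 2 = 1 := by linarith
  refine ⟨inner ℝ (T p) (T q), sq_eq_one_iff.1 h3, ?_⟩
  rw [h1, inner_smul_right, real_inner_self_eq_norm_sq, h.unit p hp, smul_smul]
  simp [← pow_two, h3]

/-- Injectivity on the open interval does not by itself prevent the end from touching the interior.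
At such a contact the tangents are parallel, so one of the two branches through the contact point
leaves it in the direction `T 0`; by `exists_meet` it meets the initial branch again, at two
distinct interior parameters. -/
lemma ne_left_of_injOn (h : Strand g T 0 b σ) (hσ : 0 < σ) (hinj : InjOn g (Ioo 0 b)) {p : ℝ}
    (hp : p ∈ Ioo 0 b) : g p ≠ g 0 := by
  intro heq
  have hb : 0 < b := hp.1.trans hp.2
  obtain ⟨ω, hω, hT⟩ := h.eq_or_eq_neg_of_eq hσ hb ⟨le_rfl, hb.le⟩ (Ioo_subset_Icc_self hp) heq.symm
  have hω2 : ω ^ 2 = 1 := by rcases hω with rfl | rfl <;> norm_num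
  set δ := min p (b - p) / 3 with hδ
  have hδ0 : 0 < δ := by
    have : 0 < min p (b - p) := lt_min hp.1 (by linarith [hp.2])
    positivity
  have hδp : δ ≤ p / 3 := by have := min_le_left p (b - p); linarith
  have hδb : δ ≤ (b - p) / 3 := by have := min_le_right p (b - p); linarith
  have hm : ∀ t ∈ Icc 0 δ, p + ω * t ∈ Icc 0 b ∧ δ < p + ω * t ∧ p + ω * t < b := by
    intro t ht
    rcases hω with rfl | rfl <;> refine ⟨⟨?_, ?_⟩, ?_, ?_⟩ <;> linarith [ht.1, ht.2, hp.1, hp.2]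
  obtain ⟨s, hs, t, ht, hst⟩ := exists_meet (h.mono le_rfl (show δ ≤ b by linarith [hp.1, hp.2]))
    (h.comp_affine hω2 fun t ht => (hm t ht).1) hσ hδ0
    (fun s hs t ht => h.tan _ ⟨hs.1, by linarith [hs.2, hp.1, hp.2]⟩ _ (hm t ht).1)
    (by simp [heq]) (by simp [hT])
  have ht' := hm t ⟨ht.1.le, ht.2⟩
  have := hinj ⟨hs.1, by linarith [hs.2, hp.1, hp.2]⟩ ⟨hδ0.trans ht'.2.1, ht'.2.2⟩ hst
  linarith [hs.2]

lemma ne_right_of_injOn (h : Strand g T 0 b σ) (hσ : 0 < σ) (hinj : InjOn g (Ioo 0 b)) {p : ℝ}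
    (hp : p ∈ Ioo 0 b) : g p ≠ g b := by
  have h1 := (h.comp_affine (p := b) (ω := -1) (a' := 0) (b' := b) (by norm_num)
    (fun t ht => ⟨by linarith [ht.2], by linarith [ht.1]⟩)).ne_left_of_injOn hσ (p := b - p)
    (fun s hs t ht hst => by
      have := hinj ⟨by linarith [hs.2], by linarith [hs.1]⟩ ⟨by linarith [ht.2], by linarith [ht.1]⟩
        hst
      linarith) ⟨by linarith [hp.2], by linarith [hp.1]⟩
  simpa using h1

/-- The alternative `T b = -T 0` is a cusp: both ends leave the common point in the same direction
and meet again. Equality makes the periodic extension differentiable. -/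
lemma tangent_eq_of_closed (h : Strand g T 0 b σ) (hσ : 0 < σ) (hb : 0 < b)
    (hinj : InjOn g (Ioo 0 b)) (hcl : g 0 = g b) : T b = T 0 := by
  obtain ⟨ω, hω, hT⟩ := h.eq_or_eq_neg_of_eq hσ hb ⟨le_rfl, hb.le⟩ ⟨hb.le, le_rfl⟩ hcl
  rcases hω with rfl | rfl
  · simpa using hT
  exfalso
  have hm : ∀ t ∈ Icc 0 (b / 3), b + -1 * t ∈ Icc 0 b := fun t ht =>
    ⟨by linarith [ht.1, ht.2], by linarith [ht.1, ht.2]⟩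
  obtain ⟨s, hs, t, ht, hst⟩ := exists_meet (h.mono le_rfl (show b / 3 ≤ b by linarith))
    (h.comp_affine (ω := -1) (by norm_num) hm) hσ (by positivity)
    (fun s hs t ht => h.tan _ ⟨hs.1, by linarith [hs.2]⟩ _ (hm t ht))
    (by simp [hcl]) (by simpa using hT.symm)
  have := hinj ⟨hs.1, by linarith [hs.2]⟩ ⟨by linarith [ht.1, ht.2], by linarith [ht.1, ht.2]⟩ hst
  linarith [hs.1, hs.2, ht.1, ht.2]

/-- First order condition at a nearest point, to the right. -/
lemma inner_nonneg_of_isMin (h : Strand g T a b σ) {u : ℝ} (hu : u ∈ Ico a b) {y : Plane}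
    (hmin : ∀ w ∈ Icc a b, ‖g u - y‖ ≤ ‖g w - y‖) : 0 ≤ inner ℝ (T u) (g u - y) := by
  have hd := (h.hasDerivWithinAt_normSq (Ico_subset_Icc_self hu) y).mono
    (show Ioc u b ⊆ Icc a b from fun x hx => ⟨hu.1.trans hx.1.le, hx.2⟩)
  rw [hasDerivWithinAt_iff_tendsto_slope' (by simp)] at hd
  have := left_nhdsWithin_Ioc_neBot hu.2
  have h1 := ge_of_tendsto hd (b := 0) (by
    filter_upwards [self_mem_nhdsWithin] with t ht
    rw [slope_def_field]
    have h2 := hmin t ⟨hu.1.trans ht.1.le, ht.2⟩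
    have h3 : 0 < t - u := by linarith [ht.1]
    apply div_nonneg _ h3.le
    have : ‖g u - y‖ ^ 2 ≤ ‖g t - y‖ ^ 2 := by gcongr
    linarith)
  linarith

lemma inner_nonpos_of_isMin (h : Strand g T a b σ) {u : ℝ} (hu : u ∈ Ioc a b) {y : Plane}
    (hmin : ∀ w ∈ Icc a b, ‖g u - y‖ ≤ ‖g w - y‖) : inner ℝ (T u) (g u - y) ≤ 0 := by
  have := h.reverse.inner_nonneg_of_isMin (u := -u) ⟨by linarith [hu.2], by linarith [hu.1]⟩
    (y := y) (fun w hw => by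
      simp only [neg_neg]; exact hmin _ ⟨by linarith [hw.2], by linarith [hw.1]⟩)
  simp only [neg_neg, inner_neg_left] at this
  linarith

end Strand


/-! ### Open and closed curves parametrised by arclength -/

/-- In the application this `σ` is slightly larger than the radius of the support. The strict
inequalities of the theorem leave room for that, and the room is needed to find boundary points of
the support. -/
structure OpenCurve (Γ : Set Plane) (g T : ℝ → Plane) (L σ : ℝ) : Prop where
  pos : 0 < L
  σ_pos : 0 < σ
  image : Γ = g '' Icc 0 L
  strand : Strand g T 0 L σ
  inj : InjOn g (Icc 0 L)
  ends : 2 * σ ≤ ‖g 0 - g L‖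

structure ClosedCurve (Γ : Set Plane) (g T : ℝ → Plane) (L σ : ℝ) : Prop where
  pos : 0 < L
  σ_pos : 0 < σ
  image : Γ = g '' Icc 0 L
  strand : ∀ a b, Strand g T a b σ
  periodic : ∀ s, g (s + L) = g s
  inj : ∀ u, ∀ w ∈ Ioo u (u + L), g w ≠ g u

/-- The tangent circle condition is the limit of the three point condition when two of the three
points merge. -/
lemma IsFilament.exists_strand {f : ℝ → Plane} (hf : IsFilament f) {σ : ℝ}
    (h : ENNReal.ofReal σ ≤ thickness (trace f)) :
    ∃ (g T : ℝ → Plane) (L : ℝ), 0 < L ∧ trace f = g '' Icc 0 L ∧ Strand g T 0 L σ ∧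
      InjOn g (Ioo 0 L) ∧ g 0 = f 0 ∧ g L = f 1 := by
  obtain ⟨φ, hφ, hs⟩ := hf.constant_speed
  have hmaps : MapsTo (fun s : ℝ => φ⁻¹ * s) (Icc 0 φ) (Icc 0 1) := fun s hs =>
    ⟨mul_nonneg (by positivity) hs.1, by
      rw [inv_mul_le_iff₀ hφ, mul_one]; exact hs.2⟩
  have himg : trace f = (fun s => f (φ⁻¹ * s)) '' Icc 0 φ := by
    apply Subset.antisymm
    · rintro _ ⟨u, hu, rfl⟩
      refine ⟨φ * u, ⟨by have := hu.1; positivity, by nlinarith [hu.2]⟩, ?_⟩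
      simp [hφ.ne']
    · rintro _ ⟨s, hs, rfl⟩
      exact ⟨_, hmaps hs, rfl⟩
  have hderiv : ∀ s ∈ Icc 0 φ, HasDerivWithinAt (fun s => f (φ⁻¹ * s))
      (φ⁻¹ • derivWithin f (Icc 0 1) (φ⁻¹ * s)) (Icc 0 φ) s := by
    intro s hs
    have h1 := (hf.differentiable _ (hmaps hs)).hasDerivWithinAt
    exact h1.scomp s (((hasDerivAt_id s).const_mul φ⁻¹).hasDerivWithinAt.congr_deriv (by simp))
      hmaps
  have hunit : ∀ s ∈ Icc 0 φ, ‖φ⁻¹ • derivWithin f (Icc 0 1) (φ⁻¹ * s)‖ = 1 := by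
    intro s hs'
    rw [norm_smul, hs _ (hmaps hs'), norm_inv, Real.norm_eq_abs, abs_of_pos hφ]
    field_simp
  refine ⟨fun s => f (φ⁻¹ * s), fun s => φ⁻¹ • derivWithin f (Icc 0 1) (φ⁻¹ * s), φ, hφ, himg,
    ⟨hderiv, hunit, fun s hs' t ht => ?_⟩, ?_, by simp, by simp [hφ.ne']⟩
  · set g := fun s => f (φ⁻¹ * s) with hg
    have hmem : ∀ w ∈ Icc 0 φ, g w ∈ trace f := fun w hw => ⟨_, hmaps hw, rfl⟩
    have hd := hasDerivWithinAt_iff_tendsto_slope.1 (hderiv s hs')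
    have hne := Strand.neBot_nhdsWithin_Icc_sdiff hφ hs'
    set τ := φ⁻¹ • derivWithin f (Icc 0 1) (φ⁻¹ * s)
    have h1 : Tendsto (fun w => 2 * σ * |cross (slope g s w) (g t - g s)|)
        (𝓝[Icc 0 φ \ {s}] s) (𝓝 (2 * σ * |cross τ (g t - g s)|)) := by
      have := (continuous_cross.tendsto (τ, g t - g s)).comp (hd.prodMk_nhds tendsto_const_nhds)
      exact (this.abs).const_mul _
    have h2 : Tendsto (fun w => ‖slope g s w‖ * ‖g t - g s‖ * ‖g w - g t‖)
        (𝓝[Icc 0 φ \ {s}] s) (𝓝 (‖τ‖ * ‖g t - g s‖ * ‖g s - g t‖)) := by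
      refine (hd.norm.mul_const _).mul ?_
      exact ((((hderiv s hs').continuousWithinAt).mono sdiff_subset).sub
        continuousWithinAt_const).norm
    have h3 := le_of_tendsto_of_tendsto h1 h2 (by
      filter_upwards [self_mem_nhdsWithin] with w hw
      have h4 := two_mul_mul_abs_cross_le_of_le_thickness h (hmem s hs') (hmem w hw.1) (hmem t ht)
      rw [slope_def_module, cross_smul_left, abs_mul, norm_smul, abs_inv, norm_inv,
        Real.norm_eq_abs]
      have : 2 * σ * (|w - s|⁻¹ * |cross (g w - g s) (g t - g s)|) =
        |w - s|⁻¹ * (2 * σ * |cross (g w - g s) (g t - g s)|) := by ring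
      rw [this]
      calc _ ≤ |w - s|⁻¹ * (‖g w - g s‖ * ‖g t - g s‖ * ‖g w - g t‖) := by gcongr
        _ = _ := by ring)
    rw [hunit s hs', one_mul, norm_sub_rev (g s), ← pow_two] at h3
    exact h3
  · intro s hs' t ht hst
    have hm : ∀ w ∈ Ioo 0 φ, φ⁻¹ * w ∈ Ioo (0 : ℝ) 1 := fun w hw =>
      ⟨mul_pos (by positivity) hw.1, by rw [inv_mul_lt_iff₀ hφ, mul_one]; exact hw.2⟩
    have := hf.simple (hm s hs') (hm t ht) hst
    exact mul_left_cancel₀ (inv_ne_zero hφ.ne') this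

lemma exists_gt_of_ofReal_lt {σ : ℝ} {x : ℝ≥0∞} (h : ENNReal.ofReal σ < x) :
    ∃ σ' > σ, ENNReal.ofReal σ' ≤ x := by
  obtain ⟨r, h1, h2⟩ := ENNReal.lt_iff_exists_nnreal_btwn.1 h
  refine ⟨r, ?_, by rw [ENNReal.ofReal_coe_nnreal]; exact h2.le⟩
  rw [← ENNReal.ofReal_coe_nnreal] at h1
  exact (ENNReal.ofReal_lt_ofReal_iff').1 h1 |>.1

lemma IsFilament.exists_openCurve {f : ℝ → Plane} (hf : IsFilament f) {σ : ℝ} (hσ : 0 < σ)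
    (h : ENNReal.ofReal σ < thickness (trace f)) (hopen : 2 * σ < dist (f 0) (f 1)) :
    ∃ (g T : ℝ → Plane) (L σ' : ℝ), σ < σ' ∧ OpenCurve (trace f) g T L σ' := by
  obtain ⟨σ₁, hσ₁, h₁⟩ := exists_gt_of_ofReal_lt h
  set σ' := min σ₁ (dist (f 0) (f 1) / 2) with hσ'
  have hlt : σ < σ' := lt_min hσ₁ (by linarith)
  have hpos : 0 < σ' := hσ.trans hlt
  obtain ⟨g, T, L, hL, himg, hst, hinj, h0, hL1⟩ := hf.exists_strand
    ((ENNReal.ofReal_le_ofReal (min_le_left _ _)).trans h₁ : ENNReal.ofReal σ' ≤ _)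
  have hends : 2 * σ' ≤ ‖g 0 - g L‖ := by
    rw [h0, hL1, ← dist_eq_norm]
    have := min_le_right σ₁ (dist (f 0) (f 1) / 2)
    linarith
  refine ⟨g, T, L, σ', hlt, hL, hpos, himg, hst, ?_, hends⟩
  have h0L : g 0 ≠ g L := fun he => by rw [he, sub_self, norm_zero] at hends; linarith
  have key : ∀ s ∈ Icc 0 L, ∀ t ∈ Icc 0 L, s < t → g s ≠ g t := by
    intro s hs t ht hst' heq
    rcases hs.1.eq_or_lt with rfl | hs0
    · rcases ht.2.eq_or_lt with rfl | ht1
      · exact h0L heq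
      · exact hst.ne_left_of_injOn hpos hinj ⟨hst', ht1⟩ heq.symm
    · rcases ht.2.eq_or_lt with rfl | ht1
      · exact hst.ne_right_of_injOn hpos hinj ⟨hs0, hst'⟩ heq
      · exact hst'.ne (hinj ⟨hs0, hst'.trans ht1⟩ ⟨hs0.trans hst', ht1⟩ heq)
  intro s hs t ht heq
  rcases lt_trichotomy s t with hlt | rfl | hlt
  · exact absurd heq (key s hs t ht hlt)
  · rfl
  · exact absurd heq.symm (key t ht s hs hlt)

/-- The closed strand extended periodically. -/
lemma Strand.exists_closedCurve {g T : ℝ → Plane} {L σ : ℝ} (hL : 0 < L) (hσ : 0 < σ)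
    (h : Strand g T 0 L σ) (hinj : InjOn g (Ioo 0 L)) (hcl : g 0 = g L) :
    ∃ (g' T' : ℝ → Plane), ClosedCurve (g '' Icc 0 L) g' T' L σ := by
  have hT := h.tangent_eq_of_closed hσ hL hinj hcl
  set φ : ℝ → ℝ := fun s => L * Int.fract (s / L) with hφ
  have hφm : ∀ s, φ s ∈ Ico 0 L := fun s =>
    ⟨mul_nonneg hL.le (Int.fract_nonneg _), by
      have := Int.fract_lt_one (s / L); simp only [hφ]; nlinarith⟩
  have hφk : ∀ (k : ℤ) (s : ℝ), s ∈ Ico (k * L) ((k + 1) * L) → φ s = s - k * L := by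
    intro k s hs
    have : ⌊s / L⌋ = k := by
      rw [Int.floor_eq_iff, le_div_iff₀ hL, div_lt_iff₀ hL]; exact hs
    simp only [hφ, Int.fract, this]
    field_simp
  have hper : ∀ s, φ (s + L) = φ s := by
    intro s
    simp only [hφ]
    rw [add_div, div_self hL.ne', Int.fract_add_one]
  have hpiece : ∀ (F : ℝ → Plane), F 0 = F L → ∀ (k : ℤ), ∀ s ∈ Icc (k * L) ((k + 1) * L),
      F (φ s) = F (s - k * L) := by
    intro F hF k s hs
    rcases hs.2.eq_or_lt with rfl | hlt
    · have := hφk (k + 1) ((k + 1) * L) ⟨by push_cast; rfl, by push_cast; nlinarith⟩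
      rw [this]
      push_cast
      rw [sub_self, hF]; congr 1; ring
    · rw [hφk k s ⟨hs.1, hlt⟩]
  have hdw : ∀ (k : ℤ), ∀ s ∈ Icc (k * L) ((k + 1) * L),
      HasDerivWithinAt (fun s => g (φ s)) (T (φ s)) (Icc (k * L) ((k + 1) * L)) s := by
    intro k s hs
    have h1 := h.comp_affine (p := -(k * L)) (ω := 1) (a' := k * L) (b' := (k + 1) * L)
      (by norm_num) (fun t ht => ⟨by linarith [ht.1], by linarith [ht.2]⟩)
    have h2 := h1.deriv s hs
    simp only [one_mul, one_smul] at h2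
    have e : ∀ w, -(k * L) + w = w - k * L := fun w => by ring
    simp only [e] at h2
    rw [hpiece T hT.symm k s hs]
    exact h2.congr (fun w hw => hpiece g hcl k w hw) (hpiece g hcl k s hs)
  have hda : ∀ s, HasDerivAt (fun s => g (φ s)) (T (φ s)) s := by
    intro s
    set k := ⌊s / L⌋ with hk
    have h1 : (k : ℝ) * L ≤ s := by rw [← le_div_iff₀ hL]; exact Int.floor_le _
    have h2 : s < (k + 1) * L := by rw [← div_lt_iff₀ hL]; exact Int.lt_floor_add_one _
    -- At a multiple of `L` two one-sided derivatives are glued together; they agree because the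
    -- tangents at the closing point do.
    rcases h1.eq_or_lt with heq | hlt
    · have d1 := hdw k s ⟨h1, h2.le⟩
      have d2 := hdw (k - 1) s ⟨by push_cast; nlinarith, by push_cast; linarith⟩
      have d3 := d1.union d2
      refine d3.hasDerivAt ?_
      refine mem_of_superset (Icc_mem_nhds (a := (k - 1) * L) (b := (k + 1) * L)
        (by nlinarith) h2) ?_
      intro w hw
      rcases le_total w (k * L) with hwk | hwk
      · right; exact ⟨by push_cast; exact hw.1, by push_cast; linarith⟩
      · left; exact ⟨hwk, hw.2⟩
    · exact (hdw k s ⟨h1, h2.le⟩).hasDerivAt (Icc_mem_nhds hlt h2)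
  refine ⟨fun s => g (φ s), fun s => T (φ s), hL, hσ, ?_, fun a b => ⟨fun s _ =>
    (hda s).hasDerivWithinAt, fun s _ => h.unit _ (Ico_subset_Icc_self (hφm s)), fun s _ t _ =>
    h.tan _ (Ico_subset_Icc_self (hφm s)) _ (Ico_subset_Icc_self (hφm t))⟩, fun s => by
      simp only [hper], ?_⟩
  · apply Subset.antisymm
    · rintro _ ⟨s, hs, rfl⟩
      refine ⟨s, hs, ?_⟩
      have := hpiece g hcl 0 s (by simpa using hs)
      simpa using this
    · rintro _ ⟨s, hs, rfl⟩
      exact ⟨_, Ico_subset_Icc_self (hφm s), rfl⟩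
  · intro u w hw heq
    have hne : ∀ p ∈ Ioo 0 L, g p ≠ g 0 := fun p hp => h.ne_left_of_injOn hσ hinj hp
    have hinj' : InjOn g (Ico 0 L) := by
      intro s hs t ht hst
      rcases hs.1.eq_or_lt with rfl | hs0
      · rcases ht.1.eq_or_lt with rfl | ht0
        · rfl
        · exact absurd hst.symm (hne t ⟨ht0, ht.2⟩)
      · rcases ht.1.eq_or_lt with rfl | ht0
        · exact absurd hst (hne s ⟨hs0, hs.2⟩)
        · exact hinj ⟨hs0, hs.2⟩ ⟨ht0, ht.2⟩ hst
    have h1 := mul_left_cancel₀ hL.ne' (hinj' (hφm w) (hφm u) heq)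
    obtain ⟨z, hz⟩ := Int.fract_eq_fract.1 h1
    have h2 : w - u = z * L := by field_simp at hz; linarith
    have h3 : (0 : ℝ) < z := by
      by_contra hcon; push Not at hcon; nlinarith [hw.1]
    have h4 : (z : ℝ) < 1 := by
      by_contra hcon; push Not at hcon; nlinarith [hw.2]
    have h5 : (0 : ℤ) < z := by exact_mod_cast h3
    have h6 : z < (1 : ℤ) := by exact_mod_cast h4
    omega

lemma IsFilament.exists_closedCurve {f : ℝ → Plane} (hf : IsFilament f) {σ : ℝ} (hσ : 0 < σ)
    (h : ENNReal.ofReal σ < thickness (trace f)) (hcl : f 0 = f 1) :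
    ∃ (g T : ℝ → Plane) (L σ' : ℝ), σ < σ' ∧ ClosedCurve (trace f) g T L σ' := by
  obtain ⟨σ₁, hσ₁, h₁⟩ := exists_gt_of_ofReal_lt h
  obtain ⟨g, T, L, hL, himg, hst, hinj, h0, hL1⟩ := hf.exists_strand h₁
  obtain ⟨g', T', hc⟩ := hst.exists_closedCurve hL (hσ.trans hσ₁) hinj (by rw [h0, hL1, hcl])
  exact ⟨g', T', L, σ₁, hσ₁, himg ▸ hc⟩

namespace OpenCurve

variable {Γ : Set Plane} {g T : ℝ → Plane} {L σ : ℝ}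

lemma reverse (h : OpenCurve Γ g T L σ) :
    OpenCurve Γ (fun s => g (L + -1 * s)) (fun s => (-1 : ℝ) • T (L + -1 * s)) L σ where
  pos := h.pos
  σ_pos := h.σ_pos
  image := by
    rw [h.image]
    apply Subset.antisymm
    · rintro _ ⟨s, hs, rfl⟩
      exact ⟨L - s, ⟨by linarith [hs.2], by linarith [hs.1]⟩, by simp⟩
    · rintro _ ⟨s, hs, rfl⟩
      exact ⟨L + -1 * s, ⟨by linarith [hs.2], by linarith [hs.1]⟩, rfl⟩
  strand := h.strand.comp_affine (by norm_num) fun t ht => ⟨by linarith [ht.2], by linarith [ht.1]⟩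
  inj s hs t ht hst := by
    have := h.inj ⟨by linarith [hs.2], by linarith [hs.1]⟩ ⟨by linarith [ht.2], by linarith [ht.1]⟩
      hst
    linarith
  ends := by simpa [norm_sub_rev] using h.ends

lemma ne (h : OpenCurve Γ g T L σ) {s t : ℝ} (hs : s ∈ Icc 0 L) (ht : t ∈ Icc 0 L) (hst : s ≠ t) :
    g s ≠ g t := fun he => hst (h.inj hs ht he)

/-- The curve cannot leave the `2σ`-neighbourhood of a point and come back. -/
lemma stay (h : OpenCurve Γ g T L σ) {u v : ℝ} (hu : 0 ≤ u) (hv : v ≤ L)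
    (hlt : ‖g v - g u‖ < 2 * σ) (huv : u ≤ v) : ∀ w ∈ Icc u v, ‖g w - g u‖ < 2 * σ := by
  have hs := h.strand.mono hu le_rfl
  have huL : u ≤ L := huv.trans hv
  rcases hs.no_return (fun w hw => h.ne ⟨hu.trans hw.1.le, hw.2.le⟩ ⟨hu, huL⟩ hw.1.ne') hlt
    with h1 | h2
  · exact h1
  by_contra hcon
  push Not at hcon
  obtain ⟨w₁, hw₁, hw₁'⟩ := hcon
  have hLu : ‖g L - g u‖ < 2 * σ := h2 L ⟨hv, le_rfl⟩
  -- all of `[u, L]` is close to the end point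
  have hend : ∀ w ∈ Icc u L, ‖g w - g L‖ < 2 * σ := by
    have hr := h.reverse
    have hsr := hr.strand
    have := hsr.no_return (v := L - u) (fun w hw => hr.ne ⟨hw.1.le, hw.2.le⟩ ⟨le_rfl, h.pos.le⟩
      hw.1.ne') (by simpa [norm_sub_rev] using hLu)
    rcases this with h3 | h3
    · intro w hw
      have := h3 (L - w) ⟨by linarith [hw.2], by linarith [hw.1]⟩
      simpa using this
    · exfalso
      have := h3 L ⟨by linarith, le_rfl⟩
      simp only [mul_zero, add_zero, neg_mul, one_mul, add_neg_cancel] at this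
      linarith [h.ends]
  -- the last point from which the rest of the curve is not close
  set P : Set (ℝ × ℝ) := (Icc u L ×ˢ Icc u L) ∩ {p | p.1 ≤ p.2 ∧ 2 * σ ≤ ‖g p.1 - g p.2‖} with hP
  have hsub : Icc u L ⊆ Icc 0 L := Icc_subset_Icc hu le_rfl
  have hcontg : ContinuousOn g (Icc u L) := h.strand.continuousOn.mono hsub
  have hPc : IsCompact P := by
    have hK : IsCompact (Icc u L ×ˢ Icc u L) := isCompact_Icc.prod isCompact_Icc
    have hf : ContinuousOn (fun p : ℝ × ℝ => ‖g p.1 - g p.2‖) (Icc u L ×ˢ Icc u L) :=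
      ((hcontg.comp continuousOn_fst fun p hp => hp.1).sub
        (hcontg.comp continuousOn_snd fun p hp => hp.2)).norm
    have hcl := hf.preimage_isClosed_of_isClosed hK.isClosed (isClosed_Ici (a := 2 * σ))
    have hcl2 : IsClosed {p : ℝ × ℝ | p.1 ≤ p.2} := isClosed_le continuous_fst continuous_snd
    have : P = (Icc u L ×ˢ Icc u L) ∩ (((Icc u L ×ˢ Icc u L) ∩
        (fun p : ℝ × ℝ => ‖g p.1 - g p.2‖) ⁻¹' Ici (2 * σ)) ∩ {p | p.1 ≤ p.2}) := by
      ext p; simp only [hP, mem_inter_iff, mem_ofPred_eq, mem_preimage, mem_Ici]; tauto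
    rw [this]
    exact hK.inter_right (hcl.inter hcl2)
  have hPne : P.Nonempty := ⟨(u, w₁), ⟨⟨le_rfl, huL⟩, ⟨hw₁.1, hw₁.2.trans hv⟩⟩, hw₁.1, by
    rw [norm_sub_rev]; exact hw₁'⟩
  obtain ⟨⟨w₀, v₀⟩, hmem, hmax⟩ := hPc.exists_isMaxOn hPne continuous_fst.continuousOn
  obtain ⟨⟨hw₀, hv₀⟩, hle, hge⟩ := hmem
  simp only at hw₀ hv₀ hle hge
  have hlt0 : w₀ < v₀ := by
    refine lt_of_le_of_ne hle ?_
    rintro rfl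
    rw [sub_self, norm_zero] at hge
    linarith [h.σ_pos]
  -- By maximality of `w₀` no point after `w` has distance 2σ from `g w`, so the distance from `g w`
  -- increases up to the end of the curve. In the limit w → w₀ this bounds ‖g v₀ − g w₀‖ ≥ 2σ by ‖g
  -- L − g w₀‖ < 2σ.
  have hmono : ∀ w ∈ Ioc w₀ v₀, ‖g v₀ - g w‖ ≤ ‖g L - g w‖ := by
    intro w hw
    have hw0 : u ≤ w := hw₀.1.trans hw.1.le
    have hwL : w ≤ L := hw.2.trans hv₀.2
    refine (h.strand.mono (hu.trans hw0) le_rfl).norm_mono (fun t ht => h.ne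
      ⟨(hu.trans hw0).trans ht.1.le, ht.2⟩ ⟨hu.trans hw0, hwL⟩ ht.1.ne') (fun t ht => ?_)
      ⟨hw.2, hv₀.2⟩ ⟨hwL, le_rfl⟩ hv₀.2
    by_contra hcon
    push Not at hcon
    have : (w, t) ∈ P := ⟨⟨⟨hw0, hwL⟩, ⟨hw0.trans ht.1, ht.2⟩⟩, ht.1, by
      rw [norm_sub_rev]; exact hcon⟩
    have := hmax this
    simp only [mem_ofPred_eq] at this
    linarith [hw.1]
  have hne := left_nhdsWithin_Ioc_neBot hlt0
  have htend : Tendsto g (𝓝[Ioc w₀ v₀] w₀) (𝓝 (g w₀)) :=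
    (hcontg w₀ hw₀).mono (fun x hx => ⟨hw₀.1.trans hx.1.le, hx.2.trans hv₀.2⟩)
  have := le_of_tendsto_of_tendsto ((tendsto_const_nhds (x := g v₀)).sub htend).norm
    ((tendsto_const_nhds (x := g L)).sub htend).norm (by
      filter_upwards [self_mem_nhdsWithin] with w hw using hmono w hw)
  have h5 := hend w₀ hw₀
  rw [norm_sub_rev] at hge h5
  linarith

lemma inner_pos (h : OpenCurve Γ g T L σ) {u v : ℝ} (hu : 0 ≤ u) (hv : v ≤ L)
    (hlt : ‖g v - g u‖ < 2 * σ) (huv : u < v) : 0 < inner ℝ (T v) (g v - g u) :=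
  (h.strand.mono hu hv).inner_pos (fun _ hw => h.ne ⟨hu.trans hw.1.le, hw.2.trans hv⟩
    ⟨hu, huv.le.trans hv⟩ hw.1.ne') (h.stay hu hv hlt huv.le) v ⟨huv, le_rfl⟩

lemma inner_pos' (h : OpenCurve Γ g T L σ) {u v : ℝ} (hu : 0 ≤ u) (hv : v ≤ L)
    (hlt : ‖g v - g u‖ < 2 * σ) (huv : u < v) : 0 < inner ℝ (T u) (g v - g u) := by
  have := h.reverse.inner_pos (u := L - v) (v := L - u) (by linarith) (by linarith)
    (by simpa [norm_sub_rev] using hlt) (by linarith)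
  simp only [neg_mul, one_mul, neg_sub, add_sub_cancel, inner_smul_left] at this
  rw [← neg_sub, inner_neg_right]
  simpa using this

/-- The chord bound with ρ equal to the chord, which is at most σ, has a factor of at least 3/4. -/
lemma arc_le (h : OpenCurve Γ g T L σ) {u v : ℝ} (hu : 0 ≤ u) (hv : v ≤ L) (huv : u ≤ v)
    (hle : ‖g v - g u‖ ≤ σ) : v - u ≤ 2 * ‖g v - g u‖ := by
  have hσ := h.σ_pos
  have hst := h.stay hu hv (by linarith) huv
  have hinj : ∀ w ∈ Ioc u v, g w ≠ g u := fun w hw =>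
    h.ne ⟨hu.trans hw.1.le, hw.2.trans hv⟩ ⟨hu, huv.trans hv⟩ hw.1.ne'
  have hs := h.strand.mono hu hv
  have h1 := hs.mul_le_norm hσ hinj (ρ := ‖g v - g u‖) (by linarith)
    (fun w hw => hs.norm_mono hinj hst hw ⟨huv, le_rfl⟩ hw.2) huv
  set d := ‖g v - g u‖
  have h2 : (d / (2 * σ)) ^ 2 ≤ (1 / 2) ^ 2 := by
    have : d / (2 * σ) ≤ 1 / 2 := by rw [div_le_iff₀ (by positivity)]; linarith
    have h0 : 0 ≤ d := norm_nonneg _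
    gcongr
  nlinarith

lemma flat (h : OpenCurve Γ g T L σ) {u v : ℝ} (hu : u ∈ Icc 0 L) (hv : v ∈ Icc 0 L)
    (hl : |v - u| ≤ σ) : ‖g v - g u - (v - u) • T u‖ ≤ 2 * (v - u) ^ 2 / σ := by
  rcases le_total u v with huv | huv
  · exact (h.strand.mono hu.1 hv.2).flat_right h.σ_pos
      (fun w hw => h.ne ⟨hu.1.trans hw.1.le, hw.2.trans hv.2⟩ hu hw.1.ne')
      (fun w hw => h.ne ⟨hu.1.trans hw.1, hw.2.le.trans hv.2⟩ hv hw.2.ne) huv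
      ((le_abs_self _).trans hl)
  · have := (h.strand.mono hv.1 hu.2).flat_left h.σ_pos
      (fun w hw => h.ne ⟨hv.1.trans hw.1.le, hw.2.trans hu.2⟩ hv hw.1.ne')
      (fun w hw => h.ne ⟨hv.1.trans hw.1, hw.2.le.trans hu.2⟩ hu hw.2.ne) huv
      (by rw [abs_of_nonpos (by linarith)] at hl; linarith)
    convert this using 2
    ring

end OpenCurve

namespace ClosedCurve

variable {Γ : Set Plane} {g T : ℝ → Plane} {L σ : ℝ}

/-- If L < 4σ, going one way round or the other, every point is within 2σ of `g 0`. The distance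
from `g 0` would then not decrease before the parameter reaches `L`, although the curve returns to
`g 0`. -/
lemma four_mul_le (h : ClosedCurve Γ g T L σ) : 4 * σ ≤ L := by
  by_contra hcon
  push Not at hcon
  have hL := h.pos
  have hs := h.strand 0 L
  have h0 : g L = g 0 := by simpa using h.periodic 0
  have hbd : ∀ w ∈ Icc 0 L, ‖g w - g 0‖ < 2 * σ := by
    intro w hw
    have h1 := hs.norm_sub_le ⟨le_rfl, hL.le⟩ hw
    have h2 := hs.norm_sub_le ⟨hL.le, le_rfl⟩ hw
    rw [h0] at h2
    rw [sub_zero, abs_of_nonneg hw.1] at h1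
    rw [abs_of_nonpos (by linarith [hw.2])] at h2
    linarith
  have hr : 0 < ‖g (L / 2) - g 0‖ := norm_pos_iff.2 (sub_ne_zero.2
    (h.inj 0 _ ⟨by linarith, by linarith⟩))
  set r := ‖g (L / 2) - g 0‖ with hr'
  have hr2 : r ≤ L / 2 := by
    have h1 := hs.norm_sub_le (s := 0) (t := L / 2) ⟨le_rfl, hL.le⟩ ⟨by linarith, by linarith⟩
    rwa [sub_zero, abs_of_nonneg (by linarith)] at h1
  have hsub : ∀ w ∈ Icc 0 (L - r / 2), w ∈ Icc 0 L := fun w hw => ⟨hw.1, by linarith [hw.2]⟩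
  have h1 := (h.strand 0 (L - r / 2)).norm_mono
    (fun w hw => h.inj 0 w ⟨hw.1, by linarith [hw.2]⟩) (fun w hw => hbd w (hsub w hw))
    (s := L / 2) (t := L - r / 2) ⟨by linarith, by linarith⟩ ⟨by linarith, le_rfl⟩ (by linarith)
  have h2 := hs.norm_sub_le (s := L) (t := L - r / 2) ⟨hL.le, le_rfl⟩ ⟨by linarith, by linarith⟩
  rw [h0, abs_of_nonpos (by linarith)] at h2
  linarith

lemma ne (h : ClosedCurve Γ g T L σ) {u v : ℝ} (huv : u ≠ v) (hl : |u - v| < L) : g u ≠ g v := by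
  rw [abs_lt] at hl
  rcases lt_or_gt_of_ne huv with hlt | hlt
  · exact (h.inj u v ⟨hlt, by linarith⟩).symm
  · exact h.inj v u ⟨hlt, by linarith⟩

lemma flat (h : ClosedCurve Γ g T L σ) {u v : ℝ} (hl : |v - u| ≤ σ) :
    ‖g v - g u - (v - u) • T u‖ ≤ 2 * (v - u) ^ 2 / σ := by
  have hL := h.four_mul_le
  have hσ := h.σ_pos
  rw [abs_le] at hl
  have hne : ∀ a b : ℝ, b - a ≤ σ → (∀ w ∈ Ioc a b, g w ≠ g a) ∧ (∀ w ∈ Ico a b, g w ≠ g b) :=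
    fun a b hab => ⟨fun w hw => h.ne hw.1.ne' (by rw [abs_lt]; constructor <;> linarith [hw.1, hw.2]),
      fun w hw => h.ne hw.2.ne (by rw [abs_lt]; constructor <;> linarith [hw.1, hw.2])⟩
  rcases le_total u v with huv | huv
  · obtain ⟨h1, h2⟩ := hne u v (by linarith)
    exact (h.strand u v).flat_right hσ h1 h2 huv (by linarith)
  · obtain ⟨h1, h2⟩ := hne v u (by linarith)
    have := (h.strand v u).flat_left hσ h1 h2 huv (by linarith)
    convert this using 2
    ring

lemma norm_sub_le (h : ClosedCurve Γ g T L σ) (s t : ℝ) : ‖g t - g s‖ ≤ |t - s| :=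
  (h.strand (min s t) (max s t)).norm_sub_le ⟨min_le_left _ _, le_max_left _ _⟩
    ⟨min_le_right _ _, le_max_right _ _⟩

/-- By `no_return` one of the two arcs between the points stays within 2σ of `g u`, and the chord
bound applies to that arc. -/
lemma arc_le (h : ClosedCurve Γ g T L σ) {u v : ℝ} (huv : u ≤ v) (hvL : v ≤ u + L)
    (hle : ‖g v - g u‖ ≤ σ) :
    v - u ≤ 2 * ‖g v - g u‖ ∨ u + L - v ≤ 2 * ‖g v - g u‖ := by
  have hσ := h.σ_pos
  have hL := h.four_mul_le
  set d := ‖g v - g u‖ with hd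
  have h2 : (d / (2 * σ)) ^ 2 ≤ (1 / 2) ^ 2 := by
    have : d / (2 * σ) ≤ 1 / 2 := by rw [div_le_iff₀ (by positivity)]; linarith
    have h0 : 0 ≤ d := norm_nonneg _
    gcongr
  rcases huv.eq_or_lt with rfl | huv'
  · left; simp [hd]
  rcases hvL.eq_or_lt with rfl | hvL'
  · right; simp [hd]
  rcases (h.strand u (u + L)).no_return (h.inj u) (v := v) (by linarith) with h1 | h1
  · left
    have hinj : ∀ w ∈ Ioc u v, g w ≠ g u := fun w hw => h.inj u w ⟨hw.1, hw.2.trans_lt hvL'⟩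
    have h3 := (h.strand u v).mul_le_norm hσ hinj (ρ := d) (by linarith)
      (fun w hw => (h.strand u v).norm_mono hinj h1 hw ⟨huv, le_rfl⟩ hw.2) huv
    rw [← hd] at h3
    nlinarith
  · right
    have hs := (h.strand v (u + L)).reverse
    have hinj : ∀ w ∈ Ioc (-(u + L)) (-v), g (-w) ≠ g (- -(u + L)) := fun w hw => by
      rw [neg_neg, h.periodic]
      exact h.inj u _ ⟨by linarith [hw.2], by linarith [hw.1]⟩
    have h1' : ∀ w ∈ Icc (-(u + L)) (-v), ‖g (-w) - g (- -(u + L))‖ < 2 * σ := fun w hw => by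
      rw [neg_neg, h.periodic]
      exact h1 _ ⟨by linarith [hw.2], by linarith [hw.1]⟩
    have h3 := hs.mul_le_norm hσ hinj (ρ := d) (by linarith) (fun w hw => by
      have := hs.norm_mono hinj h1' hw ⟨by linarith, le_rfl⟩ hw.2
      refine this.trans ?_
      simp only [neg_neg]
      rw [h.periodic]) (by linarith)
    simp only [neg_neg] at h3
    rw [h.periodic, ← hd] at h3
    nlinarith

end ClosedCurve


/-! ### Normals and the distance to the boundary of the support -/

/-- Every point of the plane lies on a ray from a nearest point of `Γ` whose direction is a normal
for which the tangent ball of radius `σ` does not meet `Γ`. -/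
def HasNormals (Γ : Set Plane) (σ : ℝ) : Prop :=
  ∀ y, ∃ e ∈ Γ, ∃ ν : Plane, ‖ν‖ = 1 ∧ y = e + infDist y Γ • ν ∧
    ∀ b ∈ Γ, 2 * σ * inner ℝ ν (b - e) ≤ ‖b - e‖ ^ 2

lemma inner_eq_of_norm_eq_one {t : Plane} (ht : ‖t‖ = 1) (ν v : Plane) :
    (inner ℝ ν v : ℝ) = inner ℝ t ν * inner ℝ t v + cross t ν * cross t v := by
  have h : t 0 ^ 2 + t 1 ^ 2 = 1 := by rw [← norm_sq_coord, ht]; norm_num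
  simp only [inner_coord, cross]
  linear_combination -(ν 0 * v 0 + ν 1 * v 1) * h

/-- If y = e, the rotated tangent serves as ν; otherwise ν points from `e` to `y`. For `b` within 2σ
of `e`, `hside` removes the tangential contribution and the tangent circle condition bounds the
rest; for other `b` Cauchy–Schwarz suffices. Orthogonality of ν to the tangent is not required,
since it fails at the ends of an open curve. -/
lemma exists_normal_aux {Γ : Set Plane} {y e t : Plane} {σ : ℝ} (hσ : 0 < σ) (ht : ‖t‖ = 1)
    (hd : infDist y Γ = dist y e)
    (htan : ∀ b ∈ Γ, 2 * σ * |cross t (b - e)| ≤ ‖b - e‖ ^ 2)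
    (hside : ∀ b ∈ Γ, ‖b - e‖ < 2 * σ → inner ℝ t (y - e) * inner ℝ t (b - e) ≤ 0) :
    ∃ ν : Plane, ‖ν‖ = 1 ∧ y = e + infDist y Γ • ν ∧
      ∀ b ∈ Γ, 2 * σ * inner ℝ ν (b - e) ≤ ‖b - e‖ ^ 2 := by
  rcases eq_or_ne y e with rfl | hne
  · refine ⟨rot t, by rw [norm_rot, ht], by rw [hd, dist_self]; simp, fun b hb => ?_⟩
    rw [inner_rot]
    refine le_trans ?_ (htan b hb)
    gcongr
    exact le_abs_self _
  · have hpos : 0 < dist y e := dist_pos.2 hne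
    refine ⟨(dist y e)⁻¹ • (y - e), ?_, ?_, fun b hb => ?_⟩
    · rw [norm_smul, norm_inv, ← dist_eq_norm, Real.norm_eq_abs, abs_of_pos hpos]
      field_simp
    · rw [hd, smul_smul, mul_inv_cancel₀ hpos.ne', one_smul]; abel
    · set ν := (dist y e)⁻¹ • (y - e) with hν
      have hν1 : ‖ν‖ = 1 := by
        rw [hν, norm_smul, norm_inv, ← dist_eq_norm, Real.norm_eq_abs, abs_of_pos hpos]
        field_simp
      rcases lt_or_ge ‖b - e‖ (2 * σ) with hlt | hge
      · have h1 := hside b hb hlt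
        have h2 : inner ℝ t ν * inner ℝ t (b - e) ≤ 0 := by
          rw [hν, inner_smul_right, mul_assoc]
          exact mul_nonpos_of_nonneg_of_nonpos (by positivity) h1
        rw [inner_eq_of_norm_eq_one ht ν]
        have h3 : cross t ν * cross t (b - e) ≤ |cross t (b - e)| := by
          have h4 := abs_cross_le t ν
          rw [ht, hν1, one_mul] at h4
          calc cross t ν * cross t (b - e) ≤ |cross t ν * cross t (b - e)| := le_abs_self _
            _ = |cross t ν| * |cross t (b - e)| := abs_mul _ _
            _ ≤ 1 * |cross t (b - e)| := by gcongr
            _ = _ := one_mul _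
        have := htan b hb
        nlinarith
      · have h1 := real_inner_le_norm ν (b - e)
        rw [hν1, one_mul] at h1
        nlinarith [norm_nonneg (b - e)]

lemma OpenCurve.isCompact {Γ : Set Plane} {g T : ℝ → Plane} {L σ : ℝ}
    (h : OpenCurve Γ g T L σ) : IsCompact Γ := by
  rw [h.image]; exact isCompact_Icc.image_of_continuousOn h.strand.continuousOn

lemma OpenCurve.nonempty {Γ : Set Plane} {g T : ℝ → Plane} {L σ : ℝ}
    (h : OpenCurve Γ g T L σ) : Γ.Nonempty := by
  rw [h.image]; exact ⟨_, 0, ⟨le_rfl, h.pos.le⟩, rfl⟩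

lemma ClosedCurve.isCompact {Γ : Set Plane} {g T : ℝ → Plane} {L σ : ℝ}
    (h : ClosedCurve Γ g T L σ) : IsCompact Γ := by
  rw [h.image]; exact isCompact_Icc.image_of_continuousOn (h.strand 0 L).continuousOn

lemma ClosedCurve.nonempty {Γ : Set Plane} {g T : ℝ → Plane} {L σ : ℝ}
    (h : ClosedCurve Γ g T L σ) : Γ.Nonempty := by
  rw [h.image]; exact ⟨_, 0, ⟨le_rfl, h.pos.le⟩, rfl⟩

lemma OpenCurve.hasNormals {Γ : Set Plane} {g T : ℝ → Plane} {L σ : ℝ}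
    (h : OpenCurve Γ g T L σ) : HasNormals Γ σ := by
  intro y
  obtain ⟨e, he, hd⟩ := h.isCompact.exists_infDist_eq_dist h.nonempty y
  refine ⟨e, he, ?_⟩
  have hmin : ∀ b ∈ Γ, ‖e - y‖ ≤ ‖b - y‖ := by
    intro b hb
    rw [← dist_eq_norm, ← dist_eq_norm, dist_comm, ← hd, dist_comm]
    exact infDist_le_dist_of_mem hb
  have himg := h.image
  obtain ⟨u, hu, rfl⟩ : e ∈ g '' Icc 0 L := himg ▸ he
  have hmin' : ∀ w ∈ Icc 0 L, ‖g u - y‖ ≤ ‖g w - y‖ := fun w hw =>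
    hmin _ (himg ▸ mem_image_of_mem g hw)
  refine exists_normal_aux h.σ_pos (h.strand.unit u hu) hd (fun b hb => ?_) (fun b hb hlt => ?_)
  · obtain ⟨t, ht, rfl⟩ : b ∈ g '' Icc 0 L := himg ▸ hb
    exact h.strand.tan u hu t ht
  · obtain ⟨w, hw, rfl⟩ : b ∈ g '' Icc 0 L := himg ▸ hb
    have e1 : (inner ℝ (T u) (y - g u) : ℝ) = -inner ℝ (T u) (g u - y) := by
      rw [← inner_neg_right, neg_sub]
    rw [e1]
    rcases lt_trichotomy u w with huw | rfl | huw
    · have h1 := h.inner_pos' hu.1 hw.2 hlt huw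
      have h2 := h.strand.inner_nonneg_of_isMin ⟨hu.1, huw.trans_le hw.2⟩ hmin'
      nlinarith
    · simp
    · have h1 := h.inner_pos hw.1 hu.2 (by rwa [norm_sub_rev]) huw
      have h2 := h.strand.inner_nonpos_of_isMin ⟨hw.1.trans_lt huw, hu.2⟩ hmin'
      have e2 : (inner ℝ (T u) (g w - g u) : ℝ) = -inner ℝ (T u) (g u - g w) := by
        rw [← inner_neg_right, neg_sub]
      rw [e2]
      nlinarith

lemma ClosedCurve.mem {Γ : Set Plane} {g T : ℝ → Plane} {L σ : ℝ}
    (h : ClosedCurve Γ g T L σ) (s : ℝ) : g s ∈ Γ := by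
  have hp : Function.Periodic g L := h.periodic
  obtain ⟨t, ht, hst⟩ := hp.exists_mem_Ico₀ h.pos s
  rw [hst, h.image]
  exact ⟨t, Ico_subset_Icc_self ht, rfl⟩

lemma ClosedCurve.exists_eq {Γ : Set Plane} {g T : ℝ → Plane} {L σ : ℝ}
    (h : ClosedCurve Γ g T L σ) {e : Plane} (he : e ∈ Γ) (a : ℝ) :
    ∃ s ∈ Ico a (a + L), g s = e := by
  have hp : Function.Periodic g L := h.periodic
  rw [h.image] at he
  obtain ⟨s, -, rfl⟩ := he
  obtain ⟨t, ht, hst⟩ := hp.exists_mem_Ico h.pos s a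
  exact ⟨t, ht, hst.symm⟩

lemma ClosedCurve.hasNormals {Γ : Set Plane} {g T : ℝ → Plane} {L σ : ℝ}
    (h : ClosedCurve Γ g T L σ) : HasNormals Γ σ := by
  intro y
  obtain ⟨e, he, hd⟩ := h.isCompact.exists_infDist_eq_dist h.nonempty y
  refine ⟨e, he, ?_⟩
  have hmin : ∀ b ∈ Γ, ‖e - y‖ ≤ ‖b - y‖ := by
    intro b hb
    rw [← dist_eq_norm, ← dist_eq_norm, dist_comm, ← hd, dist_comm]
    exact infDist_le_dist_of_mem hb
  obtain ⟨u, hu, rfl⟩ := h.exists_eq he 0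
  have hs := h.strand (u - 1) (u + 1)
  have hmin' : ∀ w ∈ Icc (u - 1) (u + 1), ‖g u - y‖ ≤ ‖g w - y‖ := fun w _ => hmin _ (h.mem w)
  have hu' : u ∈ Icc (u - 1) (u + 1) := ⟨by linarith, by linarith⟩
  refine exists_normal_aux h.σ_pos (hs.unit u hu') hd (fun b hb => ?_) (fun b hb hlt => ?_)
  · obtain ⟨t, ht, rfl⟩ := h.exists_eq hb u
    exact (h.strand u (u + L)).tan u ⟨le_rfl, by linarith [h.pos]⟩ t (Ico_subset_Icc_self ht)
  · have h1 := hs.inner_nonneg_of_isMin ⟨by linarith, by linarith⟩ hmin'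
    have h2 := hs.inner_nonpos_of_isMin ⟨by linarith, by linarith⟩ hmin'
    have e1 : (inner ℝ (T u) (y - g u) : ℝ) = -inner ℝ (T u) (g u - y) := by
      rw [← inner_neg_right, neg_sub]
    rw [e1, le_antisymm h2 h1]
    simp

lemma mem_enlargement {A : Set Plane} {δ : ℝ} {y : Plane} :
    y ∈ enlargement A δ ↔ ∃ x ∈ A, dist y x ≤ δ := by
  simp [enlargement]

/-- The tangent disc of radius σ contains the tangent disc of radius s ≤ σ on the same side. -/
lemma le_norm_add_smul_sub {e ν b : Plane} {σ s : ℝ} (hν : ‖ν‖ = 1) (hs : 0 ≤ s) (hsσ : s ≤ σ)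
    (h : 2 * σ * inner ℝ ν (b - e) ≤ ‖b - e‖ ^ 2) : s ≤ ‖e + s • ν - b‖ := by
  apply le_of_sq_le_sq _ (norm_nonneg _)
  have e1 : e + s • ν - b = s • ν - (b - e) := by abel
  rw [e1, norm_sub_sq_real, norm_smul, hν, inner_smul_left, Real.norm_eq_abs, mul_one, sq_abs]
  simp only [conj_trivial]
  rcases le_total (inner ℝ ν (b - e) : ℝ) 0 with hi | hi
  · nlinarith [sq_nonneg ‖b - e‖]
  · nlinarith

/-- The point `e + σ₀ • ν` is on the boundary because points slightly farther along ν have distance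
more than σ₀ from Γ. This is where σ₀ < σ is needed. -/
lemma exists_mem_frontier_enlargement {Γ : Set Plane} {σ₀ σ t : ℝ} {e ν : Plane} (h0 : 0 ≤ σ₀)
    (hlt : σ₀ < σ) (he : e ∈ Γ) (hν : ‖ν‖ = 1) (ht : t ≤ σ₀)
    (h : ∀ b ∈ Γ, 2 * σ * inner ℝ ν (b - e) ≤ ‖b - e‖ ^ 2) :
    ∃ z ∈ frontier (enlargement Γ σ₀), dist (e + t • ν) z ≤ σ₀ - t := by
  refine ⟨e + σ₀ • ν, ?_, ?_⟩
  · rw [frontier_eq_closure_inter_closure]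
    refine ⟨subset_closure (mem_enlargement.2 ⟨e, he, ?_⟩), ?_⟩
    · rw [dist_eq_norm, add_sub_cancel_left, norm_smul, hν, mul_one, Real.norm_eq_abs,
        abs_of_nonneg h0]
    · rw [Metric.mem_closure_iff]
      intro δ hδ
      set s := min σ (σ₀ + δ / 2)
      have hs : σ₀ < s := lt_min hlt (by linarith)
      refine ⟨e + s • ν, fun hmem => ?_, ?_⟩
      · obtain ⟨b, hb, hd⟩ := mem_enlargement.1 hmem
        have := le_norm_add_smul_sub hν (h0.trans hs.le) (min_le_left _ _) (h b hb)
        rw [dist_eq_norm] at hd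
        linarith
      · rw [dist_eq_norm, add_sub_add_left_eq_sub, ← sub_smul, norm_smul, hν, mul_one,
          Real.norm_eq_abs, abs_of_neg (by linarith)]
        have : s ≤ σ₀ + δ / 2 := min_le_right _ _
        linarith
  · rw [dist_eq_norm, add_sub_add_left_eq_sub, ← sub_smul, norm_smul, hν, mul_one,
      Real.norm_eq_abs, abs_of_nonpos (by linarith)]
    linarith

lemma exists_frontier_mem_segment {A : Set Plane} {y z : Plane} (hy : y ∈ A) (hz : z ∉ A) :
    ∃ w ∈ segment ℝ y z, w ∈ frontier A := by
  by_contra! hcon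
  obtain ⟨w, -, hw1, hw2⟩ := (convex_segment (𝕜 := ℝ) y z).isPreconnected (interior A) (closure A)ᶜ
    isOpen_interior isClosed_closure.isOpen_compl
    (fun w hw => by
      by_contra hn
      rw [mem_union, not_or, notMem_compl_iff] at hn
      exact hcon w hw ⟨hn.2, hn.1⟩)
    ⟨y, left_mem_segment ℝ y z, by
      by_contra hn
      exact hcon y (left_mem_segment ℝ y z) ⟨subset_closure hy, hn⟩⟩
    ⟨z, right_mem_segment ℝ y z, fun hn =>
      hcon z (right_mem_segment ℝ y z) ⟨hn, fun hi => hz (interior_subset hi)⟩⟩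
  exact hw2 (interior_subset_closure hw1)

lemma dist_le_of_mem_segment {x y w : Plane} (h : w ∈ segment ℝ x y) : dist x w ≤ dist x y := by
  have := (mem_segment_iff_wbtw.1 h).dist_add_dist
  linarith [dist_nonneg (x := w) (y := y)]

/-! ### The estimator -/

/-- The properties of the EDT estimator `H` that the analysis uses: `H` is the set of points at
distance at least `r` from the set `Z` of points outside the support estimate. -/
structure Core (Γ H Z : Set Plane) (yh : Plane) (r ε : ℝ) : Prop where
  ε_pos : 0 < ε
  r_big : 10 ^ 9 * ε ≤ r
  mem_iff : ∀ y, y ∈ H ↔ ∀ z ∈ Z, r ≤ dist y z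
  curve : ∀ e ∈ Γ, ∀ z ∈ Z, r + ε ≤ dist e z
  center : ∀ z ∈ Z, r + 2 * ε ≤ dist yh z
  near : ∀ y ∈ H, ∃ e ∈ Γ, dist y e ≤ 3 * ε
  near_center : ∃ e ∈ Γ, dist yh e ≤ ε
  isCompact : IsCompact H

/-- Points of Γ are at distance at least σ from the complement of Ŝ, so σ ≤ σ̂. On S the normals and
the hypothesis on the boundaries give Λ̂ ≤ σ − d(·, Γ) + ε; outside S, Λ̂ is at most 3ε. Hence σ̂ ≤
σ + ε, and with r = σ̂ − 2ε the margins ε, 2ε, 3ε and ε in `Core` follow. -/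
lemma core_edtEstimator {Γ Shat : Set Plane} {yh : Plane} {σ σ' ε : ℝ} (hΓc : IsCompact Γ)
    (hΓn : Γ.Nonempty) (hN : HasNormals Γ σ') (hσσ' : σ < σ') (hε : 0 < ε)
    (hεσ : 10 ^ 10 * ε ≤ σ) (hc : IsCompact Shat) (hsub : enlargement Γ σ ⊆ Shat)
    (hd : hausdorffDist (enlargement Γ σ) Shat ≤ ε)
    (hd' : hausdorffDist (frontier (enlargement Γ σ)) (frontier Shat) ≤ ε)
    (hy : yh ∈ Shat) (hmax : IsMaxOn (edt Shat) Shat yh) :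
    Core Γ (edtEstimator Shat ε) Shatᶜ yh (sigmaHat Shat - 2 * ε) ε := by
  have hσ : 0 < σ := by linarith
  set S := enlargement Γ σ with hS
  have hsig : sigmaHat Shat = edt Shat yh := by
    refine IsGreatest.csSup_eq ⟨mem_image_of_mem _ hy, ?_⟩
    rintro _ ⟨y, hy', rfl⟩
    exact hmax hy'
  have hmaxle : ∀ y ∈ Shat, edt Shat y ≤ sigmaHat Shat := fun y hy' => hsig ▸ hmax hy'
  have hΓS : Γ ⊆ S := fun e he => mem_enlargement.2 ⟨e, he, by simpa using hσ.le⟩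
  have hSn : S.Nonempty := hΓn.mono hΓS
  have hSb : Bornology.IsBounded S := hc.isBounded.subset hsub
  have hne : ∃ z, z ∉ Shat := by
    by_contra hcon
    push Not at hcon
    exact NormedSpace.unbounded_univ ℝ Plane (hc.isBounded.subset fun x _ => hcon x)
  obtain ⟨z₀, hz₀⟩ := hne
  have hFn : (frontier Shat).Nonempty := by
    obtain ⟨w, -, hw⟩ := exists_frontier_mem_segment hy hz₀
    exact ⟨w, hw⟩
  have hFSn : (frontier S).Nonempty := by
    obtain ⟨s, hs⟩ := hSn
    obtain ⟨w, -, hw⟩ := exists_frontier_mem_segment hs (fun h => hz₀ (hsub h))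
    exact ⟨w, hw⟩
  have hfin : hausdorffEDist (frontier S) (frontier Shat) ≠ ⊤ :=
    hausdorffEDist_ne_top_of_nonempty_of_bounded hFSn hFn
      (hSb.closure.subset frontier_subset_closure)
      (hc.isBounded.closure.subset frontier_subset_closure)
  have hfin2 : hausdorffEDist Shat S ≠ ⊤ :=
    hausdorffEDist_ne_top_of_nonempty_of_bounded ⟨yh, hy⟩ hSn hc.isBounded hSb
  have hedt_le : ∀ y ∈ Shat, ∀ z ∉ Shat, edt Shat y ≤ dist y z := by
    intro y hy' z hz
    obtain ⟨w, hw, hwf⟩ := exists_frontier_mem_segment hy' hz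
    exact (infDist_le_dist_of_mem hwf).trans (dist_le_of_mem_segment hw)
  have hle_edt : ∀ y ρ, (∀ z ∈ Shatᶜ, ρ ≤ dist y z) → ρ ≤ edt Shat y := by
    intro y ρ h
    refine (le_infDist hFn).2 fun w hw => ?_
    have hw' : w ∈ closure Shatᶜ := by
      rw [frontier_eq_closure_inter_closure] at hw; exact hw.2
    have hcl : IsClosed {z | ρ ≤ dist y z} :=
      isClosed_le continuous_const (continuous_const.dist continuous_id)
    exact closure_minimal (fun z hz => h z hz) hcl hw'
  have hΓz : ∀ e ∈ Γ, ∀ z ∈ Shatᶜ, σ ≤ dist e z := by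
    intro e he z hz
    by_contra hcon
    push Not at hcon
    exact hz (hsub (mem_enlargement.2 ⟨e, he, by rw [dist_comm]; exact hcon.le⟩))
  have hlow : σ ≤ sigmaHat Shat := by
    obtain ⟨e, he⟩ := hΓn
    exact (hle_edt e σ (hΓz e he)).trans (hmaxle e (hsub (hΓS he)))
  have hedtF : ∀ y, edt Shat y ≤ infDist y (frontier S) + ε := fun y =>
    (infDist_le_infDist_add_hausdorffDist hfin).trans (by linarith)
  have hin : ∀ y ∈ S, edt Shat y ≤ σ - infDist y Γ + ε := by
    intro y hyS
    obtain ⟨e, he, ν, hν, hye, hb⟩ := hN y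
    have ht : infDist y Γ ≤ σ := by
      obtain ⟨x, hx, hxd⟩ := mem_enlargement.1 hyS
      exact (infDist_le_dist_of_mem hx).trans hxd
    obtain ⟨z, hz, hzd⟩ := exists_mem_frontier_enlargement hσ.le hσσ' he hν ht hb
    rw [← hye] at hzd
    have := infDist_le_dist_of_mem (x := y) hz
    linarith [hedtF y]
  have hout : ∀ y ∈ Shat, y ∉ S → edt Shat y ≤ 2 * ε + ε := by
    intro y hyS hyn
    have h1 : infDist y S < 2 * ε := by
      have := infDist_le_hausdorffDist_of_mem hyS hfin2
      rw [hausdorffDist_comm] at this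
      linarith
    obtain ⟨s, hs, hsd⟩ := (infDist_lt_iff hSn).1 h1
    obtain ⟨w, hw, hwf⟩ := exists_frontier_mem_segment hs hyn
    have h2 : dist y w ≤ dist y s := by
      rw [segment_symm] at hw; exact dist_le_of_mem_segment hw
    have := infDist_le_dist_of_mem (x := y) hwf
    linarith [hedtF y]
  have hup : sigmaHat Shat ≤ σ + ε := by
    rw [hsig]
    by_cases hyS : yh ∈ S
    · linarith [hin yh hyS, infDist_nonneg (x := yh) (s := Γ)]
    · linarith [hout yh hy hyS]
  have hexists : ∀ y, ∃ e ∈ Γ, infDist y Γ = dist y e := hΓc.exists_infDist_eq_dist hΓn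
  have hmem : ∀ y, y ∈ edtEstimator Shat ε ↔ ∀ z ∈ Shatᶜ, sigmaHat Shat - 2 * ε ≤ dist y z := by
    intro y
    constructor
    · rintro ⟨hy1, hy2⟩ z hz
      exact hy2.trans (hedt_le y hy1 z hz)
    · intro h
      refine ⟨?_, hle_edt y _ h⟩
      by_contra hcon
      have := h y hcon
      rw [dist_self] at this
      linarith
  have hcl : IsClosed (edtEstimator Shat ε) := by
    have : edtEstimator Shat ε = ⋂ z ∈ Shatᶜ, {y | sigmaHat Shat - 2 * ε ≤ dist y z} := by
      ext y; rw [hmem]; simp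
    rw [this]
    exact isClosed_biInter fun z _ =>
      isClosed_le continuous_const (continuous_id.dist continuous_const)
  refine ⟨hε, by linarith, hmem, fun e he z hz => ?_, fun z hz => ?_, fun y hyH => ?_, ?_,
    hc.of_isClosed_subset hcl fun y hy' => hy'.1⟩
  · linarith [hΓz e he z hz]
  · have := hedt_le yh hy z hz
    rw [← hsig] at this
    linarith
  · obtain ⟨e, he, hde⟩ := hexists y
    refine ⟨e, he, ?_⟩
    have h2 := hyH.2
    by_cases hyS : y ∈ S
    · linarith [hin y hyS]
    · linarith [hout y hyH.1 hyS]
  · obtain ⟨e, he, hde⟩ := hexists yh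
    refine ⟨e, he, ?_⟩
    by_cases hyS : yh ∈ S
    · linarith [hin yh hyS]
    · linarith [hout yh hy hyS]


/-! ### The hull of the estimator -/

/-- Stewart's theorem. -/
lemma dist_lineMap_sq (y e z : Plane) (c : ℝ) :
    dist (AffineMap.lineMap y e c) z ^ 2 =
      (1 - c) * dist y z ^ 2 + c * dist e z ^ 2 - c * (1 - c) * dist y e ^ 2 := by
  simp only [dist_eq_norm, norm_sq_coord, AffineMap.lineMap_apply, PiLp.sub_apply, vsub_eq_sub,
    vadd_eq_add, PiLp.add_apply, PiLp.smul_apply, smul_eq_mul]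
  ring

section Hull

variable {Γ H Z : Set Plane} {yh : Plane} {r ε : ℝ}

/-- By Stewart's theorem the squared distance from `z` at the fraction c of the way from `y` to `e`
is at least (1 − c)r² + c(r + δ)² − c(1 − c)|y − e|². As |y − e|² ≤ rδ, this is at least (r +
cδ/2)². So H contains discs that grow linearly along the segment from `y` to `e`. -/
lemma Core.hull (h : Core Γ H Z yh r ε) {e y q : Plane} {δ c : ℝ} (hδ : 0 < δ)
    (he : ∀ z ∈ Z, r + δ ≤ dist e z) (hy : y ∈ H) (hd : dist y e ^ 2 ≤ r * δ)
    (hc : c ∈ Icc (0 : ℝ) 1) (hq : dist q (AffineMap.lineMap y e c) ≤ c * δ / 2) : q ∈ H := by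
  rw [h.mem_iff]
  intro z hz
  have h1 := (h.mem_iff y).1 hy z hz
  have h2 := he z hz
  have hr : 0 < r := by nlinarith [h.r_big, h.ε_pos]
  have h3 : r + c * δ / 2 ≤ dist (AffineMap.lineMap y e c) z := by
    apply le_of_sq_le_sq _ dist_nonneg
    rw [dist_lineMap_sq]
    have e1 : r ^ 2 ≤ dist y z ^ 2 := by gcongr
    have e2 : (r + δ) ^ 2 ≤ dist e z ^ 2 := by gcongr
    have e3 : (1 - c) * r ^ 2 ≤ (1 - c) * dist y z ^ 2 :=
      mul_le_mul_of_nonneg_left e1 (by linarith [hc.2])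
    have e4 : c * (r + δ) ^ 2 ≤ c * dist e z ^ 2 := mul_le_mul_of_nonneg_left e2 hc.1
    have e5 : c * (1 - c) * dist y e ^ 2 ≤ c * (1 - c) * (r * δ) :=
      mul_le_mul_of_nonneg_left hd (mul_nonneg hc.1 (by linarith [hc.2]))
    have e6 : 0 ≤ c ^ 2 * (r * δ) := by positivity
    have e7 : 0 ≤ c * (1 - c) * δ ^ 2 :=
      mul_nonneg (mul_nonneg hc.1 (by linarith [hc.2])) (sq_nonneg _)
    nlinarith [mul_nonneg (sq_nonneg c) (sq_nonneg δ)]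
  have h4 := dist_triangle (AffineMap.lineMap y e c) q z
  rw [dist_comm _ q] at h4
  linarith

lemma Core.hull_curve (h : Core Γ H Z yh r ε) {e y q : Plane} {c : ℝ} (he : e ∈ Γ) (hy : y ∈ H)
    (hd : dist y e ≤ 5000 * ε) (hc : c ∈ Icc (0 : ℝ) 1)
    (hq : dist q (AffineMap.lineMap y e c) ≤ c * ε / 2) : q ∈ H := by
  refine h.hull h.ε_pos (h.curve e he) hy ?_ hc hq
  nlinarith [h.r_big, h.ε_pos, dist_nonneg (x := y) (y := e)]

lemma Core.hull_center (h : Core Γ H Z yh r ε) {y q : Plane} {c : ℝ} (hy : y ∈ H)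
    (hd : dist y yh ≤ 5000 * ε) (hc : c ∈ Icc (0 : ℝ) 1)
    (hq : dist q (AffineMap.lineMap y yh c) ≤ c * ε) : q ∈ H := by
  refine h.hull (δ := 2 * ε) (by linarith [h.ε_pos]) h.center hy ?_ hc (by linarith)
  nlinarith [h.r_big, h.ε_pos, dist_nonneg (x := y) (y := yh)]

lemma Core.mem_of_dist_curve_le (h : Core Γ H Z yh r ε) {e q : Plane} (he : e ∈ Γ)
    (hq : dist q e ≤ ε) : q ∈ H := by
  rw [h.mem_iff]
  intro z hz
  have := h.curve e he z hz
  have := dist_triangle e q z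
  rw [dist_comm e q] at this
  linarith

lemma Core.curve_subset (h : Core Γ H Z yh r ε) : Γ ⊆ H := fun e he =>
  h.mem_of_dist_curve_le he (by rw [dist_self]; exact h.ε_pos.le)

lemma Core.mem_of_dist_center_le (h : Core Γ H Z yh r ε) {q : Plane}
    (hq : dist q yh ≤ 2 * ε) : q ∈ H := by
  rw [h.mem_iff]
  intro z hz
  have := h.center z hz
  have := dist_triangle yh q z
  rw [dist_comm yh q] at this
  linarith

lemma Core.center_mem (h : Core Γ H Z yh r ε) : yh ∈ H :=
  h.mem_of_dist_center_le (by rw [dist_self]; linarith [h.ε_pos])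

lemma Core.segment_curve_subset (h : Core Γ H Z yh r ε) {e y : Plane} (he : e ∈ Γ) (hy : y ∈ H)
    (hd : dist y e ≤ 5000 * ε) : segment ℝ y e ⊆ H := by
  rw [segment_eq_image_lineMap]
  rintro _ ⟨c, hc, rfl⟩
  refine h.hull_curve he hy hd hc ?_
  rw [dist_self]
  have := h.ε_pos
  have := hc.1
  positivity

lemma Core.segment_center_subset (h : Core Γ H Z yh r ε) {y : Plane} (hy : y ∈ H)
    (hd : dist y yh ≤ 5000 * ε) : segment ℝ y yh ⊆ H := by
  rw [segment_eq_image_lineMap]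
  rintro _ ⟨c, hc, rfl⟩
  refine h.hull_center hy hd hc ?_
  rw [dist_self]
  have := h.ε_pos
  have := hc.1
  positivity

lemma Core.isClosed (h : Core Γ H Z yh r ε) : IsClosed H := h.isCompact.isClosed

lemma Core.frontier_subset (h : Core Γ H Z yh r ε) : frontier H ⊆ H := h.isClosed.frontier_subset

lemma notMem_frontier_of_ball_subset {A : Set Plane} {q p : Plane} {ρ : ℝ} (hA : ball p ρ ⊆ A)
    (hq : q ∈ frontier A) : ρ ≤ dist q p := by
  by_contra! hlt
  exact hq.2 (mem_interior.2 ⟨ball p ρ, hA, isOpen_ball, hlt⟩)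

lemma Core.le_dist_frontier (h : Core Γ H Z yh r ε) {q y : Plane} {c : ℝ} (hq : q ∈ frontier H)
    (hy : y ∈ H) (hd : dist y yh ≤ 5000 * ε) (hc : c ∈ Icc (0 : ℝ) 1) :
    c * ε ≤ dist q (AffineMap.lineMap y yh c) :=
  notMem_frontier_of_ball_subset (fun _ hx => h.hull_center hy hd hc (le_of_lt hx)) hq

lemma Core.le_dist_frontier_curve (h : Core Γ H Z yh r ε) {q y e : Plane} {c : ℝ}
    (hq : q ∈ frontier H) (he : e ∈ Γ) (hy : y ∈ H) (hd : dist y e ≤ 5000 * ε)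
    (hc : c ∈ Icc (0 : ℝ) 1) : c * ε / 2 ≤ dist q (AffineMap.lineMap y e c) :=
  notMem_frontier_of_ball_subset (fun _ hx => h.hull_curve he hy hd hc (le_of_lt hx)) hq

lemma Core.two_mul_le_dist_frontier (h : Core Γ H Z yh r ε) {q : Plane} (hq : q ∈ frontier H) :
    2 * ε ≤ dist q yh :=
  notMem_frontier_of_ball_subset (fun _ hx => h.mem_of_dist_center_le (le_of_lt hx)) hq

end Hull

/-! ### Charts -/

/-- Cartesian coordinates with origin `yh` and unit of length `ε`. -/
structure Chart (yh : Plane) (ε : ℝ) (X Y : Plane → ℝ) : Prop where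
  ε_pos : 0 < ε
  X_center : X yh = 0
  Y_center : Y yh = 0
  X_lineMap : ∀ p q c, X (AffineMap.lineMap p q c) = (1 - c) * X p + c * X q
  Y_lineMap : ∀ p q c, Y (AffineMap.lineMap p q c) = (1 - c) * Y p + c * Y q
  dist_sq : ∀ p q, dist p q ^ 2 = ε ^ 2 * ((X p - X q) ^ 2 + (Y p - Y q) ^ 2)
  surj : ∀ a b, ∃ p, X p = a ∧ Y p = b

namespace Chart

variable {yh : Plane} {ε : ℝ} {X Y : Plane → ℝ}

lemma negX (h : Chart yh ε X Y) : Chart yh ε (fun p => -X p) Y where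
  ε_pos := h.ε_pos
  X_center := by rw [h.X_center, neg_zero]
  Y_center := h.Y_center
  X_lineMap p q c := by rw [h.X_lineMap]; ring
  Y_lineMap := h.Y_lineMap
  dist_sq p q := by rw [h.dist_sq]; ring
  surj a b := by
    obtain ⟨p, hp, hp'⟩ := h.surj (-a) b
    exact ⟨p, by rw [hp, neg_neg], hp'⟩

lemma dist_le (h : Chart yh ε X Y) {p q : Plane} {ρ : ℝ} (hρ : 0 ≤ ρ)
    (hpq : (X p - X q) ^ 2 + (Y p - Y q) ^ 2 ≤ ρ ^ 2) : dist p q ≤ ρ * ε := by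
  apply le_of_sq_le_sq _ (mul_nonneg hρ h.ε_pos.le)
  rw [h.dist_sq, mul_pow, mul_comm]
  gcongr

lemma sq_le_of_dist_le (h : Chart yh ε X Y) {p q : Plane} {ρ : ℝ} (hpq : dist p q ≤ ρ * ε) :
    (X p - X q) ^ 2 + (Y p - Y q) ^ 2 ≤ ρ ^ 2 := by
  have h1 : dist p q ^ 2 ≤ (ρ * ε) ^ 2 := by gcongr
  rw [h.dist_sq, mul_pow, mul_comm] at h1
  exact le_of_mul_le_mul_right h1 (by have := h.ε_pos; positivity)

lemma le_sq_of_le_dist (h : Chart yh ε X Y) {p q : Plane} {ρ : ℝ} (hρ : 0 ≤ ρ)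
    (hpq : ρ * ε ≤ dist p q) : ρ ^ 2 ≤ (X p - X q) ^ 2 + (Y p - Y q) ^ 2 := by
  have h1 : (ρ * ε) ^ 2 ≤ dist p q ^ 2 :=
    pow_le_pow_left₀ (mul_nonneg hρ h.ε_pos.le) hpq 2
  rw [h.dist_sq, mul_pow, mul_comm] at h1
  exact le_of_mul_le_mul_left h1 (by have := h.ε_pos; positivity)

lemma le_dist (h : Chart yh ε X Y) {p q : Plane} {ρ : ℝ}
    (hpq : ρ ^ 2 ≤ (X p - X q) ^ 2 + (Y p - Y q) ^ 2) : ρ * ε ≤ dist p q := by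
  apply le_of_sq_le_sq _ dist_nonneg
  rw [h.dist_sq, mul_pow, mul_comm]
  gcongr

lemma abs_X_sub_le (h : Chart yh ε X Y) {p q : Plane} {ρ : ℝ} (hpq : dist p q ≤ ρ * ε) :
    |X p - X q| ≤ ρ := by
  have hρ : 0 ≤ ρ := nonneg_of_mul_nonneg_left (dist_nonneg.trans hpq) h.ε_pos
  apply abs_le_of_sq_le_sq _ hρ
  nlinarith [h.sq_le_of_dist_le hpq, sq_nonneg (Y p - Y q)]

lemma abs_Y_sub_le (h : Chart yh ε X Y) {p q : Plane} {ρ : ℝ} (hpq : dist p q ≤ ρ * ε) :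
    |Y p - Y q| ≤ ρ := by
  have hρ : 0 ≤ ρ := nonneg_of_mul_nonneg_left (dist_nonneg.trans hpq) h.ε_pos
  apply abs_le_of_sq_le_sq _ hρ
  nlinarith [h.sq_le_of_dist_le hpq, sq_nonneg (X p - X q)]

lemma dist_le_add (h : Chart yh ε X Y) (p q : Plane) :
    dist p q ≤ (|X p - X q| + |Y p - Y q|) * ε := by
  apply h.dist_le (by positivity)
  nlinarith [abs_nonneg (X p - X q), abs_nonneg (Y p - Y q), sq_abs (X p - X q),
    sq_abs (Y p - Y q)]

lemma continuous_X (h : Chart yh ε X Y) : Continuous X := by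
  have hε := h.ε_pos
  refine (LipschitzWith.of_dist_le_mul (K := ε⁻¹.toNNReal) fun p q => ?_).continuous
  rw [Real.coe_toNNReal _ (by positivity), Real.dist_eq]
  exact h.abs_X_sub_le (by field_simp; rfl)

lemma continuous_Y (h : Chart yh ε X Y) : Continuous Y := by
  have hε := h.ε_pos
  refine (LipschitzWith.of_dist_le_mul (K := ε⁻¹.toNNReal) fun p q => ?_).continuous
  rw [Real.coe_toNNReal _ (by positivity), Real.dist_eq]
  exact h.abs_Y_sub_le (by field_simp; rfl)

lemma mem_segment (h : Chart yh ε X Y) {p q w : Plane} {s : ℝ} (hs : s ∈ Icc (0 : ℝ) 1)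
    (hX : X w = (1 - s) * X p + s * X q) (hY : Y w = (1 - s) * Y p + s * Y q) :
    w ∈ segment ℝ p q := by
  rw [segment_eq_image_lineMap]
  refine ⟨s, hs, ?_⟩
  rw [← sub_eq_zero, ← norm_eq_zero, ← dist_eq_norm, ← sq_eq_zero_iff, h.dist_sq, h.X_lineMap,
    h.Y_lineMap, hX, hY]
  ring

lemma exists_of_mem_segment (h : Chart yh ε X Y) {p q w : Plane} (hw : w ∈ segment ℝ p q) :
    ∃ s ∈ Icc (0 : ℝ) 1, X w = (1 - s) * X p + s * X q ∧ Y w = (1 - s) * Y p + s * Y q := by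
  rw [segment_eq_image_lineMap] at hw
  obtain ⟨s, hs, rfl⟩ := hw
  exact ⟨s, hs, h.X_lineMap _ _ _, h.Y_lineMap _ _ _⟩

lemma ext (h : Chart yh ε X Y) {p q : Plane} (hX : X p = X q) (hY : Y p = Y q) : p = q := by
  have := h.dist_sq p q
  rw [hX, hY] at this
  simpa using this

lemma X_lineMap_center (h : Chart yh ε X Y) (q : Plane) (c : ℝ) :
    X (AffineMap.lineMap yh q c) = c * X q := by rw [h.X_lineMap, h.X_center]; ring

lemma Y_lineMap_center (h : Chart yh ε X Y) (q : Plane) (c : ℝ) :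
    Y (AffineMap.lineMap yh q c) = c * Y q := by rw [h.Y_lineMap, h.Y_center]; ring

end Chart

lemma exists_chart {yh τ : Plane} {ε : ℝ} (hε : 0 < ε) (hτ : ‖τ‖ = 1) :
    Chart yh ε (fun p => ε⁻¹ * inner ℝ τ (p - yh)) (fun p => ε⁻¹ * cross τ (p - yh)) where
  ε_pos := hε
  X_center := by simp
  Y_center := by simp [cross]
  X_lineMap p q c := by
    simp only [inner_coord, AffineMap.lineMap_apply, PiLp.sub_apply, vsub_eq_sub,
      vadd_eq_add, PiLp.add_apply, PiLp.smul_apply, smul_eq_mul]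
    ring
  Y_lineMap p q c := by
    simp only [cross, AffineMap.lineMap_apply, PiLp.sub_apply, vsub_eq_sub,
      vadd_eq_add, PiLp.add_apply, PiLp.smul_apply, smul_eq_mul]
    ring
  dist_sq p q := by
    have h : τ 0 ^ 2 + τ 1 ^ 2 = 1 := by rw [← norm_sq_coord, hτ]; norm_num
    simp only [dist_eq_norm, norm_sq_coord, inner_coord, cross, PiLp.sub_apply]
    field_simp
    linear_combination (-((p 0 - q 0) ^ 2 + (p 1 - q 1) ^ 2)) * h
  surj a b := by
    have h : τ 0 ^ 2 + τ 1 ^ 2 = 1 := by rw [← norm_sq_coord, hτ]; norm_num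
    refine ⟨yh + (ε * a) • τ + (ε * b) • rot τ, ?_, ?_⟩
    · simp only [inner_coord, PiLp.sub_apply, PiLp.add_apply, PiLp.smul_apply, smul_eq_mul,
        rot_zero_apply, rot_one_apply]
      field_simp
      linear_combination ε * a * h
    · simp only [cross, PiLp.sub_apply, PiLp.add_apply, PiLp.smul_apply, smul_eq_mul,
        rot_zero_apply, rot_one_apply]
      field_simp
      linear_combination ε * b * h


/-! ### The estimator near the maximum of the distance transform -/

/-- Local picture: in the chart the curve is nearly the horizontal line at height `t`. -/
structure Loc (Γ H Z : Set Plane) (yh : Plane) (r ε : ℝ) (X Y : Plane → ℝ) (t : ℝ) : Prop where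
  core : Core Γ H Z yh r ε
  chart : Chart yh ε X Y
  abs_t : |t| ≤ 101 / 100
  flat : ∀ e ∈ Γ, dist e yh ≤ 2500 * ε → |Y e - t| ≤ 1 / 100

/-- `q` is an end point of a short chord through `yh`. -/
def ChordEnd (H : Set Plane) (yh : Plane) (ε : ℝ) (q : Plane) : Prop :=
  q ∈ frontier H ∧ ∃ p ∈ frontier H, yh ∈ segment ℝ p q ∧ dist p q ≤ 8 * ε

/-- Cross product in a chart. -/
def cr (X Y : Plane → ℝ) (q y : Plane) : ℝ := X q * Y y - Y q * X y

/-- The distance from `y` to the short chords is at least `η`. -/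
def Clears (H : Set Plane) (yh : Plane) (ε η : ℝ) (y : Plane) : Prop :=
  ∀ b ∈ shortChords H yh ε ∩ H, η ≤ dist y b

/-- `y` lies to the right of the short chords, on the side on which the curve leaves. -/
def MainRight (Γ H : Set Plane) (yh : Plane) (ε : ℝ) (X Y : Plane → ℝ) (y : Plane) : Prop :=
  ∀ q, ChordEnd H yh ε q → 0 ≤ X q → ∀ e ∈ Γ, X e ∈ Icc (301 / 50) 2000 →
    dist e yh ≤ 2500 * ε → 0 ≤ cr X Y q e * cr X Y q y

namespace Loc

variable {Γ H Z : Set Plane} {yh : Plane} {r ε : ℝ} {X Y : Plane → ℝ} {t : ℝ}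

lemma negX (h : Loc Γ H Z yh r ε X Y t) : Loc Γ H Z yh r ε (fun p => -X p) Y t :=
  ⟨h.core, h.chart.negX, h.abs_t, h.flat⟩

lemma strip (h : Loc Γ H Z yh r ε X Y t) {y : Plane} (hy : y ∈ H) (hd : dist y yh ≤ 2400 * ε) :
    |Y y - t| ≤ 151 / 50 := by
  obtain ⟨e, he, hde⟩ := h.core.near y hy
  have h1 := h.flat e he (by
    have := dist_triangle e y yh
    rw [dist_comm e y] at this
    linarith [h.core.ε_pos])
  have h2 := h.chart.abs_Y_sub_le hde
  rw [abs_le] at *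
  constructor <;> linarith

lemma abs_Y_le (h : Loc Γ H Z yh r ε X Y t) {y : Plane} (hy : y ∈ H)
    (hd : dist y yh ≤ 2400 * ε) : |Y y| ≤ 403 / 100 := by
  have h1 := h.strip hy hd
  have h2 := h.abs_t
  rw [abs_le] at *
  constructor <;> linarith

lemma dist_center_le (h : Loc Γ H Z yh r ε X Y t) (y : Plane) :
    dist y yh ≤ (|X y| + |Y y|) * ε := by
  have := h.chart.dist_le_add y yh
  rwa [h.chart.X_center, h.chart.Y_center, sub_zero, sub_zero] at this

lemma abs_X_le (h : Loc Γ H Z yh r ε X Y t) {y : Plane} {ρ : ℝ} (hd : dist y yh ≤ ρ * ε) :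
    |X y| ≤ ρ := by
  have := h.chart.abs_X_sub_le hd
  rwa [h.chart.X_center, sub_zero] at this

/-- Points of the estimator in the steep sector lie on short chords. -/
lemma mem_shortChords_of_steep_of_ne (h : Loc Γ H Z yh r ε X Y t) {y : Plane} (hy : y ∈ H)
    (hd : dist y yh ≤ 2400 * ε) (hne : Y y ≠ 0) (hs : 4 * |X y| ≤ 3 * |Y y|) :
    ∃ p ∈ frontier H, ∃ q ∈ frontier H, yh ∈ segment ℝ p q ∧ dist p q ≤ 8 * ε ∧
      y ∈ segment ℝ p q := by
  have hb' : 0 < |Y y| := abs_pos.2 hne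
  have hloc : ∀ z : Plane, ∀ μ : ℝ, X z = μ * X y → Y z = μ * Y y → |μ| * |Y y| ≤ 10 →
      dist z yh ≤ 2400 * ε := by
    intro z μ h1 h2 h3
    refine (h.dist_center_le z).trans ?_
    rw [h1, h2, abs_mul, abs_mul]
    have : |μ| * |X y| ≤ 10 := by nlinarith [abs_nonneg μ]
    nlinarith [h.core.ε_pos]
  -- From `x` the ray in direction ±(X y, Y y) is followed up to height 10, which is outside the
  -- strip that contains H; a boundary point of H is met on the way.
  have key : ∀ κ : ℝ, |κ| = 1 → ∀ x ∈ H, dist x yh ≤ 2400 * ε → ∀ s, 0 ≤ s →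
      X x = s * (κ * X y) → Y x = s * (κ * Y y) →
      ∃ q ∈ frontier H, ∃ μ, s ≤ μ ∧ X q = μ * (κ * X y) ∧ Y q = μ * (κ * Y y) ∧
        dist q yh ≤ 2400 * ε := by
    intro κ hκ x hx hxd s hs0 hxX hxY
    have hz : ∃ z ∉ H, X z = 10 / |Y y| * (κ * X y) ∧ Y z = 10 / |Y y| * (κ * Y y) := by
      obtain ⟨z, h1, h2⟩ := h.chart.surj (10 / |Y y| * (κ * X y)) (10 / |Y y| * (κ * Y y))
      refine ⟨z, fun hzH => ?_, h1, h2⟩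
      have h3 := h.abs_Y_le hzH (hloc z (10 / |Y y| * κ) (by rw [h1]; ring) (by rw [h2]; ring)
        (by rw [abs_mul, hκ, abs_div, abs_abs]; field_simp; norm_num))
      rw [h2, abs_mul, abs_mul, hκ, abs_div, abs_abs, abs_of_pos (by norm_num : (0 : ℝ) < 10),
        one_mul, div_mul_cancel₀ _ hb'.ne'] at h3
      linarith
    obtain ⟨z, hzH, hzX, hzY⟩ := hz
    have hs' : s ≤ 10 / |Y y| := by
      have := h.abs_Y_le hx hxd
      rw [hxY, abs_mul, abs_mul, hκ, one_mul, abs_of_nonneg hs0] at this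
      rw [le_div_iff₀ hb']
      linarith
    obtain ⟨q, hq, hqf⟩ := exists_frontier_mem_segment hx hzH
    obtain ⟨c, hc, h1, h2⟩ := h.chart.exists_of_mem_segment hq
    have h3 : X q = ((1 - c) * s + c * (10 / |Y y|)) * (κ * X y) := by rw [h1, hxX, hzX]; ring
    have h4 : Y q = ((1 - c) * s + c * (10 / |Y y|)) * (κ * Y y) := by rw [h2, hxY, hzY]; ring
    refine ⟨q, hqf, _, ?_, h3, h4, hloc q (((1 - c) * s + c * (10 / |Y y|)) * κ)
      (by rw [h3]; ring) (by rw [h4]; ring) ?_⟩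
    · nlinarith [hc.1]
    · rw [abs_mul, hκ, mul_one]
      have h5 : 0 ≤ (1 - c) * s := mul_nonneg (by linarith [hc.2]) hs0
      rw [abs_of_nonneg (by have := hc.1; positivity)]
      have h6 : (1 - c) * s + c * (10 / |Y y|) ≤ 10 / |Y y| := by nlinarith [hc.2]
      calc _ ≤ 10 / |Y y| * |Y y| := by gcongr
        _ = 10 := div_mul_cancel₀ _ hb'.ne'
  obtain ⟨q, hqf, μ, hμ, hqX, hqY, hqd⟩ := key 1 (by simp) y hy hd 1 zero_le_one
    (by ring) (by ring)
  obtain ⟨p, hpf, ν, hν, hpX, hpY, hpd⟩ := key (-1) (by simp) yh h.core.center_mem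
    (by rw [dist_self]; linarith [h.core.ε_pos]) 0 le_rfl (by rw [h.chart.X_center]; ring)
    (by rw [h.chart.Y_center]; ring)
  have hsum : 0 < μ + ν := by linarith
  have hseg : ∀ z : Plane, ∀ s : ℝ, -ν ≤ s → s ≤ μ → X z = s * X y → Y z = s * Y y →
      z ∈ segment ℝ p q := by
    intro z s h1 h2 h3 h4
    refine h.chart.mem_segment (s := (s + ν) / (μ + ν)) ⟨by apply div_nonneg <;> linarith,
      (div_le_one hsum).2 (by linarith)⟩ ?_ ?_
    · rw [h3, hpX, hqX]; field_simp; ring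
    · rw [h4, hpY, hqY]; field_simp; ring
  refine ⟨p, hpf, q, hqf, hseg yh 0 (by linarith) (by linarith) (by rw [h.chart.X_center]; ring)
    (by rw [h.chart.Y_center]; ring), ?_, hseg y 1 (by linarith) hμ (by ring) (by ring)⟩
  apply h.chart.dist_le (by norm_num)
  have h1 := h.strip (h.core.frontier_subset hqf) hqd
  have h2 := h.strip (h.core.frontier_subset hpf) hpd
  -- The ends differ by at most 6.04 in height and by at most 3/4 of that sideways, so the chord has
  -- length at most 5/4 · 6.04 = 7.55 < 8.
  have h3 : |Y p - Y q| ≤ 151 / 25 := by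
    rw [abs_le] at *; constructor <;> linarith
  have h4 : (X p - X q) ^ 2 ≤ 9 / 16 * (Y p - Y q) ^ 2 := by
    have : 16 * X y ^ 2 ≤ 9 * Y y ^ 2 := by
      rw [← sq_abs (X y), ← sq_abs (Y y)]
      nlinarith [abs_nonneg (X y)]
    rw [hpX, hqX, hpY, hqY]
    nlinarith [mul_le_mul_of_nonneg_left this (sq_nonneg (μ + ν))]
  have h5 : (Y p - Y q) ^ 2 ≤ (151 / 25) ^ 2 := by
    rw [← sq_abs]; gcongr
  nlinarith

lemma mem_shortChords_of_steep (h : Loc Γ H Z yh r ε X Y t) {y : Plane} (hy : y ∈ H)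
    (hd : dist y yh ≤ 2400 * ε) (hs : 4 * |X y| ≤ 3 * |Y y|) : y ∈ shortChords H yh ε := by
  by_cases hne : Y y = 0
  · have hX : X y = 0 := by
      rw [hne, abs_zero] at hs
      exact abs_nonpos_iff.1 (by linarith)
    obtain rfl : y = yh := h.chart.ext (by rw [hX, h.chart.X_center]) (by rw [hne, h.chart.Y_center])
    -- The centre itself is on the vertical chord, found through the point at height 1.
    obtain ⟨z, hzX, hzY⟩ := h.chart.surj 0 1
    have hzd : dist z y ≤ 2 * ε := (h.dist_center_le z).trans (by
      rw [hzX, hzY]; simp; linarith [h.core.ε_pos])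
    obtain ⟨p, hp, q, hq, h1, h2, -⟩ := h.mem_shortChords_of_steep_of_ne
      (h.core.mem_of_dist_center_le hzd) (by linarith [h.core.ε_pos]) (by rw [hzY]; norm_num)
      (by rw [hzX, hzY]; norm_num)
    exact ⟨p, hp, q, hq, h1, h2, h1⟩
  · exact h.mem_shortChords_of_steep_of_ne hy hd hne hs

lemma center_mem_blade (h : Loc Γ H Z yh r ε X Y t) : yh ∈ shortChords H yh ε ∩ H :=
  ⟨h.mem_shortChords_of_steep h.core.center_mem (by rw [dist_self]; linarith [h.core.ε_pos])
    (by rw [h.chart.X_center, h.chart.Y_center]; simp), h.core.center_mem⟩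

/-! #### Chord ends -/

lemma chordEnd_dist_ge (h : Loc Γ H Z yh r ε X Y t) {q : Plane} (hq : ChordEnd H yh ε q) :
    4 ≤ X q ^ 2 + Y q ^ 2 := by
  have := h.chart.le_sq_of_le_dist (by norm_num) (h.core.two_mul_le_dist_frontier hq.1)
  rw [h.chart.X_center, h.chart.Y_center, sub_zero, sub_zero] at this
  linarith

/-- The part of the chord on the other side of the centre takes at least 2ε of the 8ε. -/
lemma chordEnd_dist (h : Loc Γ H Z yh r ε X Y t) {q : Plane} (hq : ChordEnd H yh ε q) :
    dist q yh ≤ 6 * ε := by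
  obtain ⟨-, p, hp, hs, hd⟩ := hq
  have h1 := (mem_segment_iff_wbtw.1 hs).dist_add_dist
  have h2 := h.core.two_mul_le_dist_frontier hp
  rw [dist_comm q]
  linarith

lemma chordEnd_dist_le (h : Loc Γ H Z yh r ε X Y t) {q : Plane} (hq : ChordEnd H yh ε q) :
    X q ^ 2 + Y q ^ 2 ≤ 36 := by
  have := h.chart.sq_le_of_dist_le (h.chordEnd_dist hq)
  rw [h.chart.X_center, h.chart.Y_center, sub_zero, sub_zero] at this
  linarith

lemma chordEnd_mem (h : Loc Γ H Z yh r ε X Y t) {q : Plane} (hq : ChordEnd H yh ε q) : q ∈ H :=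
  h.core.frontier_subset hq.1

lemma chordEnd_strip (h : Loc Γ H Z yh r ε X Y t) {q : Plane} (hq : ChordEnd H yh ε q) :
    |Y q - t| ≤ 151 / 50 :=
  h.strip (h.chordEnd_mem hq) ((h.chordEnd_dist hq).trans (by linarith [h.core.ε_pos]))

lemma chordEnd_opposite (h : Loc Γ H Z yh r ε X Y t) {q : Plane} (hq : ChordEnd H yh ε q) :
    ∃ p, ChordEnd H yh ε p ∧ ∃ c, 0 < c ∧ X p = -(c * X q) ∧ Y p = -(c * Y q) := by
  have hq' := hq
  obtain ⟨hqf, p, hp, hs, hd⟩ := hq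
  have hpE : ChordEnd H yh ε p := ⟨hp, q, hqf, by rwa [segment_symm], by rwa [dist_comm]⟩
  have h1 := h.chordEnd_dist_ge hq'
  have h2 := h.chordEnd_dist_ge hpE
  obtain ⟨s, hs, hX, hY⟩ := h.chart.exists_of_mem_segment hs
  rw [h.chart.X_center] at hX
  rw [h.chart.Y_center] at hY
  have hs1 : s ≠ 1 := by
    rintro rfl
    have e1 : X q = 0 := by linarith
    have e2 : Y q = 0 := by linarith
    rw [e1, e2] at h1
    linarith
  have hs0 : s ≠ 0 := by
    rintro rfl
    have e1 : X p = 0 := by linarith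
    have e2 : Y p = 0 := by linarith
    rw [e1, e2] at h2
    linarith
  have hs1' : 0 < 1 - s := sub_pos.2 (lt_of_le_of_ne hs.2 hs1)
  refine ⟨p, hpE, s / (1 - s), div_pos (lt_of_le_of_ne hs.1 hs0.symm) hs1', ?_, ?_⟩
  · field_simp; linarith
  · field_simp; linarith

lemma lineMap_chordEnd_mem (h : Loc Γ H Z yh r ε X Y t) {q : Plane} (hq : ChordEnd H yh ε q)
    {μ : ℝ} (hμ : μ ∈ Icc (0 : ℝ) 1) :
    AffineMap.lineMap yh q μ ∈ shortChords H yh ε ∩ H := by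
  have hm : AffineMap.lineMap yh q μ ∈ segment ℝ yh q := by
    rw [segment_eq_image_lineMap]; exact ⟨μ, hμ, rfl⟩
  have hH : AffineMap.lineMap yh q μ ∈ H := by
    rw [segment_symm] at hm
    exact h.core.segment_center_subset (h.chordEnd_mem hq)
      ((h.chordEnd_dist hq).trans (by linarith [h.core.ε_pos])) hm
  obtain ⟨hqf, p, hp, hs, hd⟩ := hq
  exact ⟨⟨p, hp, q, hqf, hs, hd,
    (convex_segment p q).segment_subset hs (right_mem_segment ℝ p q) hm⟩, hH⟩

lemma exists_chordEnd_of_mem (h : Loc Γ H Z yh r ε X Y t) {b : Plane}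
    (hb : b ∈ shortChords H yh ε) :
    ∃ q, ChordEnd H yh ε q ∧ ∃ μ ∈ Icc (0 : ℝ) 1, X b = μ * X q ∧ Y b = μ * Y q := by
  obtain ⟨p, hp, q, hq, hs, hd, hbs⟩ := hb
  obtain ⟨s, hs', hX, hY⟩ := h.chart.exists_of_mem_segment hs
  obtain ⟨a, ha, hbX, hbY⟩ := h.chart.exists_of_mem_segment hbs
  rw [h.chart.X_center] at hX
  rw [h.chart.Y_center] at hY
  have hqE : ChordEnd H yh ε q := ⟨hq, p, hp, hs, hd⟩
  have hpE : ChordEnd H yh ε p := ⟨hp, q, hq, by rwa [segment_symm], by rwa [dist_comm]⟩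
  rcases le_total s a with hsa | hsa
  · rcases eq_or_lt_of_le hs'.2 with rfl | hs1
    · refine ⟨q, hqE, 0, by simp, ?_, ?_⟩
      · rw [hbX, le_antisymm ha.2 hsa]; linarith
      · rw [hbY, le_antisymm ha.2 hsa]; linarith
    · have h1 : 0 < 1 - s := by linarith
      refine ⟨q, hqE, (a - s) / (1 - s), ⟨div_nonneg (by linarith) h1.le,
        (div_le_one h1).2 (by linarith [ha.2])⟩, ?_, ?_⟩
      · rw [hbX]; field_simp; linear_combination (a - 1) * hX
      · rw [hbY]; field_simp; linear_combination (a - 1) * hY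
  · rcases eq_or_lt_of_le hs'.1 with rfl | hs1
    · refine ⟨p, hpE, 0, by simp, ?_, ?_⟩
      · rw [hbX, le_antisymm hsa ha.1]; linarith
      · rw [hbY, le_antisymm hsa ha.1]; linarith
    · refine ⟨p, hpE, (s - a) / s, ⟨div_nonneg (by linarith) hs1.le,
        (div_le_one hs1).2 (by linarith [ha.1])⟩, ?_, ?_⟩
      · rw [hbX]; field_simp; linear_combination (-a) * hX
      · rw [hbY]; field_simp; linear_combination (-a) * hY

/-! #### Clearance -/

lemma clears_coord (h : Loc Γ H Z yh r ε X Y t) {η : ℝ} (hη : 0 ≤ η) {y q : Plane}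
    (hy : Clears H yh ε (η * ε) y) (hq : ChordEnd H yh ε q) {μ : ℝ} (hμ : μ ∈ Icc (0 : ℝ) 1) :
    η ^ 2 ≤ (X y - μ * X q) ^ 2 + (Y y - μ * Y q) ^ 2 := by
  have := h.chart.le_sq_of_le_dist hη (hy _ (h.lineMap_chordEnd_mem hq hμ))
  rwa [h.chart.X_lineMap_center, h.chart.Y_lineMap_center] at this

lemma slope_lt (h : Loc Γ H Z yh r ε X Y t) {η : ℝ} (hη : 0 < η) {y : Plane} (hy : y ∈ H)
    (hd : dist y yh ≤ 2400 * ε) (hc : Clears H yh ε (η * ε) y) : 3 * |Y y| < 4 * |X y| := by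
  by_contra! hle
  have := hc y ⟨h.mem_shortChords_of_steep hy hd hle, hy⟩
  rw [dist_self] at this
  nlinarith [h.core.ε_pos]

/-- At heights |Y| ≤ 2 the vertical axis lies in the ball B(ŷ, 2ε), hence on short chords; at larger
heights the slope bound already gives |X| > 3/2. So no point outside the cut set and near the centre
has X = 0. -/
lemma le_abs_X (h : Loc Γ H Z yh r ε X Y t) {η : ℝ} (hη : 0 < η) (hη1 : η ≤ 1) {y : Plane}
    (hy : y ∈ H) (hd : dist y yh ≤ 2400 * ε) (hc : Clears H yh ε (η * ε) y) : η ≤ |X y| := by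
  have h1 := h.slope_lt hη hy hd hc
  rcases le_or_gt |Y y| 2 with hY | hY
  · obtain ⟨w, hwX, hwY⟩ := h.chart.surj 0 (Y y)
    have hwd : dist w yh ≤ 2 * ε := (h.dist_center_le w).trans (by
      rw [hwX, hwY, abs_zero, zero_add]; nlinarith [h.core.ε_pos])
    have hwH := h.core.mem_of_dist_center_le hwd
    have hw := h.mem_shortChords_of_steep hwH (by linarith [h.core.ε_pos])
      (by rw [hwX]; simp)
    have := h.chart.le_sq_of_le_dist hη.le (hc w ⟨hw, hwH⟩)
    rw [hwX, hwY, sub_self, sub_zero, zero_pow two_ne_zero, add_zero] at this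
    rw [← abs_of_pos hη]
    exact sq_le_sq.1 this
  · linarith

end Loc


/-! ### Leaving a short chord along the curve -/

/-- In the direction of the chord end q, the curve point (a, b) lies beyond q. It suffices that
3.03|q₂| + 1/1000 ≤ q₁(7.5 − q₁), which is checked on four ranges of q₁, with |q₂| bounded by the
slope, by the strip, or by |q| ≤ 6. -/
lemma sq_add_sq_add_le_inner {q₁ q₂ a b : ℝ} (h₁ : 0 ≤ q₁)
    (hs : |q₂| ≤ 4 / 3 * q₁ + 1 / 10 ^ 6) (hq : q₁ ^ 2 + q₂ ^ 2 ≤ 36) (hq' : 4 ≤ q₁ ^ 2 + q₂ ^ 2)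
    (hy : |q₂| ≤ 403 / 100) (hd : |q₂ - b| ≤ 303 / 100) (ha : 15 / 2 ≤ a) :
    q₁ ^ 2 + q₂ ^ 2 + 1 / 1000 ≤ q₁ * a + q₂ * b := by
  have h0 := abs_nonneg q₂
  have e1 : q₂ * (q₂ - b) ≤ |q₂| * (303 / 100) := by
    calc q₂ * (q₂ - b) ≤ |q₂ * (q₂ - b)| := le_abs_self _
      _ = |q₂| * |q₂ - b| := abs_mul _ _
      _ ≤ _ := by gcongr
  have e2 : q₁ * (15 / 2) ≤ q₁ * a := by gcongr
  rw [← sq_abs q₂] at hq hq'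
  suffices h : |q₂| * (303 / 100) + 1 / 1000 ≤ q₁ * (15 / 2 - q₁) by nlinarith
  have h1 : 1 ≤ q₁ := by
    by_contra! hlt
    nlinarith
  rcases le_or_gt q₁ (34 / 10) with h2 | h2
  · nlinarith
  rcases le_or_gt q₁ 5 with h3 | h3
  · nlinarith [mul_nonneg (show (0 : ℝ) ≤ q₁ - 5 / 2 by linarith) (sub_nonneg.2 h3)]
  rcases le_or_gt q₁ (11 / 2) with h4 | h4
  · have h5 : |q₂| ≤ 332 / 100 := by
      by_contra! hlt
      nlinarith
    nlinarith [mul_nonneg (show (0 : ℝ) ≤ q₁ - 2 by linarith) (sub_nonneg.2 h4)]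
  · have h5 : |q₂| ≤ 24 / 10 := by
      by_contra! hlt
      nlinarith
    have h6 : q₁ ≤ 6 := by nlinarith
    nlinarith [mul_nonneg (show (0 : ℝ) ≤ q₁ - 3 / 2 by linarith) (sub_nonneg.2 h6)]

/-- Clearance from the segment from `0` to `(Q, 0)` along a segment from `(a, b)` to `(A, B)`. -/
lemma clearance_axis {a b A B Q η l μ : ℝ} (hη : 0 < η) (hη1 : η ≤ 1 / 10 ^ 6) (hQ : 2 ≤ Q)
    (hQ6 : Q ≤ 6) (hb : 0 ≤ b) (hB : 2 / 5 ≤ B)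
    (hcl : ∀ μ ∈ Icc (0 : ℝ) 1, η ^ 2 ≤ b ^ 2 + (a - μ * Q) ^ 2)
    (hBL : ∀ μ ∈ Icc (0 : ℝ) 1, (1 - μ) ^ 2 ≤ (μ * b) ^ 2 + (Q - μ * a) ^ 2)
    (hneg : a < 0 → η ≤ b) (hA : b < η → Q < a → a ≤ Q + 6 * η → a ≤ A)
    (hl : l ∈ Icc (0 : ℝ) 1) (hμ : μ ∈ Icc (0 : ℝ) 1) :
    η ^ 2 + l ^ 2 / 400 ≤ ((1 - l) * b + l * B) ^ 2 + ((1 - l) * a + l * A - μ * Q) ^ 2 := by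
  have hl0 := hl.1
  have hl1 : 0 ≤ 1 - l := by linarith [hl.2]
  -- At height at least η above the line of the chord, the height alone provides the clearance,
  -- since it moves towards B ≥ 2/5.
  rcases le_or_gt η b with hbη | hbη
  · have h1 : η + l / 20 ≤ (1 - l) * b + l * B := by nlinarith
    have h2 : (η + l / 20) ^ 2 ≤ ((1 - l) * b + l * B) ^ 2 := by gcongr
    nlinarith [sq_nonneg ((1 - l) * a + l * A - μ * Q), mul_nonneg hη.le hl0]
  have ha0 : 0 ≤ a := by
    by_contra! hlt
    linarith [hneg hlt]
  have haQ : Q < a := by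
    by_contra! hle
    have := hcl (a / Q) ⟨by positivity, (div_le_one (by linarith)).2 hle⟩
    rw [div_mul_cancel₀ _ (by linarith), sub_self] at this
    nlinarith
  -- The starting point is now almost on the axis and beyond the tip. By `hBL` the tip is not inside
  -- the hull of the starting point and the centre, so the two are within Q·b ≤ 6η along the axis.
  -- Then `hA` says that the motion leads away from the tip.
  have ha : a ≤ Q + 6 * η := by
    have hpos : 0 < a := by linarith
    have hle : Q / a ≤ 1 := (div_le_one hpos).2 haQ.le
    have h1 := hBL (Q / a) ⟨by positivity, hle⟩
    rw [div_mul_cancel₀ _ hpos.ne', sub_self] at h1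
    have h2 : 1 - Q / a ≤ Q / a * b := by
      apply le_of_sq_le_sq _ (by positivity)
      linarith
    have h3 : a - Q ≤ Q * b := by
      have : (1 - Q / a) * a ≤ Q / a * b * a := by gcongr
      field_simp at this
      linarith
    nlinarith
  have h1 := hA hbη haQ ha
  have h2 : a - Q ≤ (1 - l) * a + l * A - μ * Q := by nlinarith [hμ.2]
  have h3 : (a - Q) ^ 2 ≤ ((1 - l) * a + l * A - μ * Q) ^ 2 :=
    pow_le_pow_left₀ (by linarith) h2 2
  have h4 : b + l * (1 / 5) ≤ (1 - l) * b + l * B := by nlinarith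
  have h5 : (b + l * (1 / 5)) ^ 2 ≤ ((1 - l) * b + l * B) ^ 2 := by gcongr
  have h6 := hcl 1 ⟨zero_le_one, le_rfl⟩
  rw [one_mul] at h6
  nlinarith [mul_nonneg hb hl0]

lemma exists_polar {q₁ q₂ : ℝ} (hq : q₁ ^ 2 + q₂ ^ 2 ≤ 36) (hq' : 4 ≤ q₁ ^ 2 + q₂ ^ 2) :
    ∃ Q u v : ℝ, 2 ≤ Q ∧ Q ≤ 6 ∧ u ^ 2 + v ^ 2 = 1 ∧ q₁ = Q * u ∧ q₂ = Q * v := by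
  have hQ2 : 2 ≤ √(q₁ ^ 2 + q₂ ^ 2) := Real.le_sqrt_of_sq_le (by linarith)
  have hs := Real.sq_sqrt (show 0 ≤ q₁ ^ 2 + q₂ ^ 2 by positivity)
  have hpos : 0 < √(q₁ ^ 2 + q₂ ^ 2) := by linarith
  refine ⟨√(q₁ ^ 2 + q₂ ^ 2), q₁ / √(q₁ ^ 2 + q₂ ^ 2), q₂ / √(q₁ ^ 2 + q₂ ^ 2), hQ2,
    Real.sqrt_le_iff.2 ⟨by norm_num, by linarith⟩, ?_, by field_simp, by field_simp⟩
  rw [div_pow, div_pow, ← add_div, hs, div_self]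
  linarith

lemma exists_sign {a b c : ℝ} (hc : 0 < c) (h : c ^ 2 ≤ a ^ 2) (hab : 0 ≤ a * b) :
    ∃ s : ℝ, s ^ 2 = 1 ∧ c ≤ s * a ∧ 0 ≤ s * b := by
  have h' := sq_le_sq.1 h
  rw [abs_of_pos hc] at h'
  rcases le_total 0 a with h0 | h0
  · rw [abs_of_nonneg h0] at h'
    exact ⟨1, by norm_num, by linarith, by
      rw [one_mul]; exact nonneg_of_mul_nonneg_right hab (by linarith)⟩
  · rw [abs_of_nonpos h0] at h'
    refine ⟨-1, by norm_num, by linarith, ?_⟩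
    have : 0 ≤ (-a) * (-b) := by linarith
    have := nonneg_of_mul_nonneg_right this (by linarith)
    linarith

/-- Rotating the chord onto the axis and reflecting with the sign `s` reduces this to
`clearance_axis`. The bound 2/5 comes from a²/(9Q²) with a ≥ 15/2 and Q ≤ 6. -/
lemma clearance_chord {x y a b q₁ q₂ η l μ : ℝ} (hη : 0 < η) (hη1 : η ≤ 1 / 10 ^ 8)
    (hx : η ≤ x) (hxy : 3 * |y| < 4 * x) (ha : 15 / 2 ≤ a) (h₁ : 0 ≤ q₁)
    (hq : q₁ ^ 2 + q₂ ^ 2 ≤ 36) (hq' : 4 ≤ q₁ ^ 2 + q₂ ^ 2) (hy : |q₂| ≤ 403 / 100)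
    (hd : |q₂ - b| ≤ 303 / 100)
    (hcl : ∀ μ ∈ Icc (0 : ℝ) 1, η ^ 2 ≤ (x - μ * q₁) ^ 2 + (y - μ * q₂) ^ 2)
    (hBL : ∀ μ ∈ Icc (0 : ℝ) 1, (1 - μ) ^ 2 ≤ (q₁ - μ * x) ^ 2 + (q₂ - μ * y) ^ 2)
    (hclear : (a ^ 2 + b ^ 2) / 9 ≤ (q₁ * b - q₂ * a) ^ 2)
    (hmain : 0 ≤ (q₁ * b - q₂ * a) * (q₁ * y - q₂ * x))
    (hl : l ∈ Icc (0 : ℝ) 1) (hμ : μ ∈ Icc (0 : ℝ) 1) :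
    η ^ 2 + l ^ 2 / 400 ≤
      ((1 - l) * x + l * a - μ * q₁) ^ 2 + ((1 - l) * y + l * b - μ * q₂) ^ 2 := by
  obtain ⟨Q, u, v, hQ, hQ6, huv, rfl, rfl⟩ := exists_polar hq hq'
  have hQ0 : 0 < Q := by linarith
  have hu : 0 ≤ u := by nlinarith
  obtain ⟨s, hs, hsB, hsb⟩ := exists_sign (c := 2 / 5) (by norm_num)
    (show (2 / 5) ^ 2 ≤ (u * b - v * a) ^ 2 by nlinarith [sq_nonneg b])
    (show 0 ≤ (u * b - v * a) * (u * y - v * x) by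
      have e1 : (Q * u * b - Q * v * a) * (Q * u * y - Q * v * x) =
        Q ^ 2 * ((u * b - v * a) * (u * y - v * x)) := by ring
      rw [e1] at hmain
      exact nonneg_of_mul_nonneg_right hmain (by positivity))
  have id1 : ∀ x y μ : ℝ, (x - μ * (Q * u)) ^ 2 + (y - μ * (Q * v)) ^ 2 =
      (s * (u * y - v * x)) ^ 2 + (u * x + v * y - μ * Q) ^ 2 := fun x y μ => by
    linear_combination (-(u * y - v * x) ^ 2) * hs + (μ ^ 2 * Q ^ 2 - x ^ 2 - y ^ 2) * huv
  have id2 : ∀ μ : ℝ, (Q * u - μ * x) ^ 2 + (Q * v - μ * y) ^ 2 =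
      (μ * (s * (u * y - v * x))) ^ 2 + (Q - μ * (u * x + v * y)) ^ 2 := fun μ => by
    linear_combination (-μ ^ 2 * (u * y - v * x) ^ 2) * hs +
      (Q ^ 2 - μ ^ 2 * x ^ 2 - μ ^ 2 * y ^ 2) * huv
  have key := clearance_axis (a := u * x + v * y) (b := s * (u * y - v * x))
    (A := u * a + v * b) (B := s * (u * b - v * a)) (Q := Q) (η := η) (l := l) (μ := μ) hη
    (by linarith) hQ hQ6 hsb hsB (fun μ hμ => by rw [← id1]; exact hcl μ hμ)
    (fun μ hμ => by rw [← id2]; exact hBL μ hμ) ?_ ?_ hl hμ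
  · rw [id1]
    convert key using 2 <;> ring
  · intro hneg
    apply le_of_sq_le_sq _ hsb
    rw [mul_pow, hs, one_mul]
    refine (show η ^ 2 ≤ x ^ 2 by gcongr).trans ?_
    have hx0 : 0 ≤ u * x := mul_nonneg hu (hη.le.trans hx)
    have hw : 0 ≤ u * x * (-(v * y) - u * x) := mul_nonneg hx0 (by linarith)
    have hz : 0 ≤ u * x * (-(v * y)) := mul_nonneg hx0 (by linarith)
    have e : x ^ 2 = u ^ 2 * x ^ 2 + v ^ 2 * x ^ 2 := by linear_combination (-(x ^ 2)) * huv
    rw [e]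
    linarith [mul_nonneg (sq_nonneg u) (sq_nonneg y)]
  · intro h1 h2 h3
    have hd2 : (x - 1 * (Q * u)) ^ 2 + (y - 1 * (Q * v)) ^ 2 ≤ (7 * η) ^ 2 := by
      rw [id1]
      have e5 := pow_le_pow_left₀ hsb h1.le 2
      have e6 : (u * x + v * y - 1 * Q) ^ 2 ≤ (6 * η) ^ 2 :=
        pow_le_pow_left₀ (by linarith) (by linarith) 2
      linarith [sq_nonneg η]
    simp only [one_mul] at hd2
    have h4 : |x - Q * u| ≤ 7 * η :=
      abs_le_of_sq_le_sq (by linarith [sq_nonneg (y - Q * v)]) (by linarith)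
    have h5 : |y - Q * v| ≤ 7 * η :=
      abs_le_of_sq_le_sq (by linarith [sq_nonneg (x - Q * u)]) (by linarith)
    have h6 : |Q * v| ≤ 4 / 3 * (Q * u) + 1 / 10 ^ 6 := by
      have := abs_sub_abs_le_abs_sub (Q * v) y
      rw [abs_sub_comm] at this
      linarith [(abs_le.1 h4).2]
    have h7 := sq_add_sq_add_le_inner h₁ h6 hq hq' hy hd ha
    have h8 : Q * (u * x + v * y) ≤ Q * (u * a + v * b) := by
      have e2 : (Q * u) ^ 2 + (Q * v) ^ 2 = Q ^ 2 := by linear_combination Q ^ 2 * huv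
      have e3 : Q * (u * x + v * y) ≤ Q * (Q + 6 * η) := by gcongr
      have e4 : Q * η ≤ 6 * η := by gcongr
      linarith
    exact le_of_mul_le_mul_left h8 hQ0

namespace Loc

variable {Γ H Z : Set Plane} {yh : Plane} {r ε : ℝ} {X Y : Plane → ℝ} {t : ℝ}

lemma le_frontier (h : Loc Γ H Z yh r ε X Y t) {q y : Plane} (hq : q ∈ frontier H) (hy : y ∈ H)
    (hd : dist y yh ≤ 5000 * ε) {μ : ℝ} (hμ : μ ∈ Icc (0 : ℝ) 1) :
    (1 - μ) ^ 2 ≤ (X q - μ * X y) ^ 2 + (Y q - μ * Y y) ^ 2 := by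
  have := h.chart.le_sq_of_le_dist (by linarith [hμ.2]) (h.core.le_dist_frontier hq hy hd
    (c := 1 - μ) ⟨by linarith [hμ.2], by linarith [hμ.1]⟩)
  rw [h.chart.X_lineMap, h.chart.Y_lineMap, h.chart.X_center, h.chart.Y_center] at this
  simpa using this

/-- The points within distance ε/3 of the segment from the centre to `e` are interior to H: for μ ≤
2/3 by the hull about the centre, with radius (1 − μ)ε, and for μ ≥ 2/3 by the hull about `e`, with
radius με/2. -/
lemma le_frontier_curve (h : Loc Γ H Z yh r ε X Y t) {q e : Plane} (hq : q ∈ frontier H)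
    (he : e ∈ Γ) (hd : dist e yh ≤ 5000 * ε) {μ : ℝ} (hμ : μ ∈ Icc (0 : ℝ) 1) :
    1 / 9 ≤ (X q - μ * X e) ^ 2 + (Y q - μ * Y e) ^ 2 := by
  rcases le_total μ (2 / 3) with h1 | h1
  · have := h.le_frontier hq (h.core.curve_subset he) hd hμ
    nlinarith
  · have := h.chart.le_sq_of_le_dist (ρ := μ / 2) (by linarith)
      (p := q) (q := AffineMap.lineMap yh e μ) (by
        have := h.core.le_dist_frontier_curve hq he h.core.center_mem (by rwa [dist_comm]) hμ
        linarith)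
    rw [h.chart.X_lineMap_center, h.chart.Y_lineMap_center] at this
    nlinarith

lemma curve_Y (h : Loc Γ H Z yh r ε X Y t) {e : Plane} (he : e ∈ Γ)
    (hd : dist e yh ≤ 2500 * ε) : |Y e| ≤ 102 / 100 := by
  have h1 := h.flat e he hd
  have h2 := h.abs_t
  rw [abs_le] at *
  constructor <;> linarith

/-- The direction of the curve stays away from the directions of the short chords. -/
lemma cr_sq_ge (h : Loc Γ H Z yh r ε X Y t) {q e : Plane} (hq : ChordEnd H yh ε q)
    (hqX : 0 ≤ X q) (he : e ∈ Γ) (hd : dist e yh ≤ 2500 * ε) (hX : 15 / 2 ≤ X e) :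
    (X e ^ 2 + Y e ^ 2) / 9 ≤ cr X Y q e ^ 2 := by
  have h1 := h.chordEnd_dist_ge hq
  have h2 := h.chordEnd_dist_le hq
  have h3 := h.curve_Y he hd
  have h3' : Y e ^ 2 ≤ (102 / 100) ^ 2 := by rw [← sq_abs]; gcongr
  have id : cr X Y q e ^ 2 + (X q * X e + Y q * Y e) ^ 2 =
      (X q ^ 2 + Y q ^ 2) * (X e ^ 2 + Y e ^ 2) := by rw [cr]; ring
  have hE : 56 ≤ X e ^ 2 := by nlinarith
  -- If the angle is not obtuse, the foot of the perpendicular from `q` lies on the segment to `e`,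
  -- and |cr|/|e| is the distance to it. If it is obtuse, it is close to a right angle because X q ≥
  -- 0 and |Y e| is small.
  rcases le_or_gt 0 (X q * X e + Y q * Y e) with hi | hi
  · set I := X q * X e + Y q * Y e with hI
    have hN : 0 < X e ^ 2 + Y e ^ 2 := by positivity
    have hIle : I ≤ X e ^ 2 + Y e ^ 2 := by
      nlinarith [sq_nonneg (X q - X e), sq_nonneg (Y q - Y e), sq_nonneg (Y e)]
    have h4 := h.le_frontier_curve hq.1 he (by linarith [h.core.ε_pos])
      (μ := I / (X e ^ 2 + Y e ^ 2)) ⟨by positivity, (div_le_one hN).2 hIle⟩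
    have h5 : (X q - I / (X e ^ 2 + Y e ^ 2) * X e) ^ 2 +
        (Y q - I / (X e ^ 2 + Y e ^ 2) * Y e) ^ 2 = cr X Y q e ^ 2 / (X e ^ 2 + Y e ^ 2) := by
      rw [eq_div_iff hN.ne', ← sub_eq_iff_eq_add.2 id.symm]
      field_simp
      rw [hI]
      ring
    rw [h5, le_div_iff₀ hN] at h4
    linarith
  · have h4 : (X q * X e + Y q * Y e) ^ 2 ≤ (X q ^ 2 + Y q ^ 2) * (11 / 10) := by
      have h5 : 0 ≤ X q * X e := mul_nonneg hqX (by linarith)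
      have h6 : (X q * X e + Y q * Y e) ^ 2 ≤ (Y q * Y e) ^ 2 := by nlinarith
      have h7 : (Y q * Y e) ^ 2 ≤ Y q ^ 2 * (11 / 10) := by
        rw [mul_pow]; gcongr; linarith
      nlinarith [sq_nonneg (X q)]
    nlinarith [sq_nonneg (Y e)]

/-- Beyond the end of a short chord there are no points of the estimator. -/
lemma one_le_of_ray (h : Loc Γ H Z yh r ε X Y t) {q z : Plane} (hq : ChordEnd H yh ε q)
    (hz : z ∈ H) (hd : dist z yh ≤ 5000 * ε) {c : ℝ} (hc : 0 ≤ c) (hX : X q = c * X z)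
    (hY : Y q = c * Y z) : 1 ≤ c := by
  by_contra! hlt
  have := h.le_frontier hq.1 hz hd ⟨hc, hlt.le⟩
  rw [hX, hY, sub_self, sub_self] at this
  nlinarith

/-- On the line of `q`, a point with X ≥ 6.02 would lie behind `q`, since |q| ≤ 6. -/
lemma cr_ne_zero_of_far (h : Loc Γ H Z yh r ε X Y t) {q z : Plane} (hq : ChordEnd H yh ε q)
    (hqX : 0 ≤ X q) (hz : z ∈ H) (hd : dist z yh ≤ 5000 * ε) (hX : 301 / 50 ≤ X z) :
    cr X Y q z ≠ 0 := by
  intro h0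
  rw [cr, sub_eq_zero] at h0
  have hz0 : 0 < X z := by linarith
  have h1 := h.one_le_of_ray hq hz hd (c := X q / X z) (by positivity) (by field_simp)
    (by field_simp; linarith)
  rw [le_div_iff₀ hz0, one_mul] at h1
  nlinarith [h.chordEnd_dist_le hq, sq_nonneg (Y q)]

/-- The segment from `y` to `e` stays in H and to the right of X = 6.02, where it cannot cross the
line of the chord. -/
lemma cr_mul_pos_of_far (h : Loc Γ H Z yh r ε X Y t) {q y e : Plane} (hq : ChordEnd H yh ε q)
    (hqX : 0 ≤ X q) (hy : y ∈ H) (hyd : dist y yh ≤ 2400 * ε) (hyX : 301 / 50 ≤ X y) (he : e ∈ Γ)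
    (hd : dist e yh ≤ 2500 * ε) (hX : 301 / 50 ≤ X e) : 0 < cr X Y q e * cr X Y q y := by
  by_contra! hle
  have hε := h.core.ε_pos
  have hye : dist y e ≤ 5000 * ε := by
    have := dist_triangle_right y e yh
    linarith
  obtain ⟨s, hs, hs0⟩ : ∃ s ∈ Icc (0 : ℝ) 1, (1 - s) * cr X Y q y + s * cr X Y q e = 0 := by
    have hc : ContinuousOn (fun s : ℝ => (1 - s) * cr X Y q y + s * cr X Y q e) (Icc 0 1) := by
      fun_prop
    rcases le_total (cr X Y q e) 0 with h0 | h0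
    · rcases le_total (cr X Y q y) 0 with h1 | h1
      · rcases mul_eq_zero.1 (le_antisymm hle (mul_nonneg_of_nonpos_of_nonpos h0 h1)) with h2 | h2
        · exact ⟨1, by simp, by rw [h2]; simp⟩
        · exact ⟨0, by simp, by rw [h2]; simp⟩
      · obtain ⟨s, hs, hs'⟩ := intermediate_value_Icc' zero_le_one hc
          (show (0 : ℝ) ∈ Icc _ _ from ⟨by simpa using h0, by simpa using h1⟩)
        exact ⟨s, hs, hs'⟩
    · rcases le_total (cr X Y q y) 0 with h1 | h1
      · obtain ⟨s, hs, hs'⟩ := intermediate_value_Icc zero_le_one hc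
          (show (0 : ℝ) ∈ Icc _ _ from ⟨by simpa using h1, by simpa using h0⟩)
        exact ⟨s, hs, hs'⟩
      · rcases mul_eq_zero.1 (le_antisymm hle (mul_nonneg h0 h1)) with h2 | h2
        · exact ⟨1, by simp, by rw [h2]; simp⟩
        · exact ⟨0, by simp, by rw [h2]; simp⟩
  have hmem : AffineMap.lineMap y e s ∈ segment ℝ y e := by
    rw [segment_eq_image_lineMap]; exact ⟨s, hs, rfl⟩
  refine h.cr_ne_zero_of_far hq hqX (h.core.segment_curve_subset he hy hye hmem) ?_ ?_ ?_
  · have h1 : AffineMap.lineMap y e s ∈ closedBall yh (2500 * ε) :=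
      (convex_closedBall yh (2500 * ε)).segment_subset (by rw [mem_closedBall]; linarith)
        (by rwa [mem_closedBall]) hmem
    rw [mem_closedBall] at h1
    linarith
  · rw [h.chart.X_lineMap]
    nlinarith [hs.1, hs.2]
  · rw [cr, h.chart.X_lineMap, h.chart.Y_lineMap, ← hs0, cr, cr]
    ring

/-- A single point of the curve far to the right decides, because all such points lie strictly on
the same side of each chord. -/
lemma mainRight_of (h : Loc Γ H Z yh r ε X Y t) {y e : Plane} (he : e ∈ Γ)
    (hd : dist e yh ≤ 2400 * ε) (hX : 301 / 50 ≤ X e)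
    (hy : ∀ q, ChordEnd H yh ε q → 0 ≤ X q → 0 ≤ cr X Y q e * cr X Y q y) :
    MainRight Γ H yh ε X Y y := by
  intro q hq hqX e' he' hX' hd'
  have h1 := h.cr_mul_pos_of_far hq hqX (h.core.curve_subset he) hd hX he' hd' hX'.1
  have h2 := hy q hq hqX
  by_contra! h3
  nlinarith [mul_nonneg h1.le h2, mul_neg_of_neg_of_pos h3
    (by positivity [show cr X Y q e ≠ 0 by rintro h0; rw [h0] at h1; simp at h1] :
      0 < cr X Y q e ^ 2)]

/-- Along the segment from a point to the right of the short chords to a point of the curve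
further right, the distance to the short chords increases. -/
lemma clearance_segment (h : Loc Γ H Z yh r ε X Y t) {η : ℝ} (hη : 0 < η)
    (hη1 : η ≤ 1 / 10 ^ 8) {x e : Plane} (hx : x ∈ H) (hxd : dist x yh ≤ 2400 * ε) (hX : 0 < X x)
    (hc : Clears H yh ε (η * ε) x) (hm : MainRight Γ H yh ε X Y x) (he : e ∈ Γ)
    (heX : X e ∈ Icc (15 / 2) 2000) (hed : dist e yh ≤ 2500 * ε) {l : ℝ}
    (hl : l ∈ Icc (0 : ℝ) 1) {q : Plane} (hq : ChordEnd H yh ε q) {μ : ℝ}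
    (hμ : μ ∈ Icc (0 : ℝ) 1) :
    η ^ 2 + l ^ 2 / 400 ≤ ((1 - l) * X x + l * X e - μ * X q) ^ 2 +
      ((1 - l) * Y x + l * Y e - μ * Y q) ^ 2 := by
  have hε := h.core.ε_pos
  have h1 := h.le_abs_X hη (by linarith) hx hxd hc
  rw [abs_of_pos hX] at h1
  rcases le_or_gt 0 (X q) with hq0 | hq0
  · have h2 := h.slope_lt hη hx hxd hc
    rw [abs_of_pos hX] at h2
    refine clearance_chord hη hη1 h1 h2 heX.1 hq0 (h.chordEnd_dist_le hq) (h.chordEnd_dist_ge hq)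
      (h.abs_Y_le (h.chordEnd_mem hq) ((h.chordEnd_dist hq).trans (by linarith))) ?_
      (fun μ hμ => h.clears_coord hη.le hc hq hμ)
      (fun μ hμ => h.le_frontier hq.1 hx (by linarith) hμ) (h.cr_sq_ge hq hq0 he hed heX.1)
      (hm q hq hq0 e he ⟨by linarith [heX.1], heX.2⟩ hed) hl hμ
    have h3 := h.chordEnd_strip hq
    have h4 := h.flat e he hed
    rw [abs_le] at *
    constructor <;> linarith
  · have h2 : η + l * 7 ≤ (1 - l) * X x + l * X e - μ * X q := by
      have := hμ.1
      have := heX.1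
      have := hl.1
      have := hl.2
      nlinarith
    have h3 : (η + l * 7) ^ 2 ≤ ((1 - l) * X x + l * X e - μ * X q) ^ 2 :=
      pow_le_pow_left₀ (by have := hl.1; positivity) h2 2
    nlinarith [sq_nonneg ((1 - l) * Y x + l * Y e - μ * Y q), mul_nonneg hη.le hl.1]

end Loc


/-! ### The cut set and its complement -/

/-- Lying on a segment is equality in the triangle inequality, a closed condition, so the set is a
projection of a compact set of triples. -/
lemma isCompact_shortChords_inter {H : Set Plane} (hH : IsCompact H) (yh : Plane) (ε : ℝ) :
    IsCompact (shortChords H yh ε ∩ H) := by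
  have hfr : IsCompact (frontier H) := hH.of_isClosed_subset isClosed_frontier
    hH.isClosed.frontier_subset
  have hcl : IsClosed {w : Plane × Plane × Plane | dist w.1 yh + dist yh w.2.1 = dist w.1 w.2.1 ∧
      dist w.1 w.2.1 ≤ 8 * ε ∧ dist w.1 w.2.2 + dist w.2.2 w.2.1 = dist w.1 w.2.1} := by
    rw [ofPred_and, ofPred_and]
    exact (isClosed_eq (by fun_prop) (by fun_prop)).inter
      ((isClosed_le (by fun_prop) (by fun_prop)).inter
        (isClosed_eq (by fun_prop) (by fun_prop)))
  have hc := ((hfr.prod (hfr.prod hH)).inter_right hcl).image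
    (f := fun w => w.2.2) (by fun_prop)
  convert hc using 1
  ext x
  constructor
  · rintro ⟨⟨p, hp, q, hq, h1, h2, h3⟩, hx⟩
    exact ⟨(p, q, x), ⟨⟨hp, hq, hx⟩, dist_add_dist_eq_iff.2 (mem_segment_iff_wbtw.1 h1), h2,
      dist_add_dist_eq_iff.2 (mem_segment_iff_wbtw.1 h3)⟩, rfl⟩
  · rintro ⟨⟨p, q, x⟩, ⟨⟨hp, hq, hx⟩, h1, h2, h3⟩, rfl⟩
    exact ⟨⟨p, hp, q, hq, mem_segment_iff_wbtw.2 (dist_add_dist_eq_iff.1 h1), h2,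
      mem_segment_iff_wbtw.2 (dist_add_dist_eq_iff.1 h3)⟩, hx⟩

lemma isClosed_cutSet {H : Set Plane} (hH : IsCompact H) (yh : Plane) (ε : ℝ) {η : ℝ}
    (hη : 0 ≤ η) : IsClosed (cutSet H yh ε η) := by
  rw [cutSet, enlargement, ← (isCompact_shortChords_inter hH yh ε).cthickening_eq_biUnion_closedBall
    hη]
  exact isClosed_cthickening

/-- `S` is a union of connected components of `G`. -/
def Absorbs (G S : Set Plane) : Prop :=
  S ⊆ G ∧ ∀ P ⊆ G, IsPreconnected P → (P ∩ S).Nonempty → P ⊆ S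

lemma absorbs_self (G : Set Plane) : Absorbs G G := ⟨Subset.rfl, fun _ h _ _ => h⟩

lemma absorbs_connectedComponentIn (G : Set Plane) (p : Plane) :
    Absorbs G (connectedComponentIn G p) := by
  refine ⟨connectedComponentIn_subset G p, fun P hP hc hne => ?_⟩
  obtain ⟨z, hzP, hz⟩ := hne
  rw [connectedComponentIn_eq hz]
  exact hc.subset_connectedComponentIn hzP hP

lemma clears_of_mem_closure {H : Set Plane} {yh y : Plane} {ε η : ℝ}
    (hy : y ∈ closure (H \ cutSet H yh ε η)) : Clears H yh ε η y := by
  intro b hb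
  have hcl : IsClosed {y | η ≤ dist y b} := isClosed_le (by fun_prop) (by fun_prop)
  refine closure_minimal (fun z hz => ?_) hcl hy
  by_contra hlt
  exact hz.2 (mem_enlargement.2 ⟨b, hb, (not_le.1 hlt).le⟩)

lemma mem_of_mem_closure {H A : Set Plane} {y : Plane} (hH : IsClosed H)
    (hy : y ∈ closure (H \ A)) : y ∈ H := closure_minimal sdiff_subset hH hy

namespace Loc

variable {Γ H Z : Set Plane} {yh : Plane} {r ε : ℝ} {X Y : Plane → ℝ} {t η : ℝ}

lemma mem_sdiff {y : Plane} (hy : y ∈ H)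
    (hc : ∀ b ∈ shortChords H yh ε ∩ H, η * ε < dist y b) : y ∈ H \ cutSet H yh ε (η * ε) := by
  refine ⟨hy, fun hA => ?_⟩
  obtain ⟨b, hb, hd⟩ := mem_enlargement.1 hA
  linarith [hc b hb]

lemma mem_sdiff_of_coord (h : Loc Γ H Z yh r ε X Y t) {y : Plane} (hy : y ∈ H)
    (hc : ∀ q, ChordEnd H yh ε q → ∀ μ ∈ Icc (0 : ℝ) 1,
      η ^ 2 < (X y - μ * X q) ^ 2 + (Y y - μ * Y q) ^ 2) : y ∈ H \ cutSet H yh ε (η * ε) := by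
  refine mem_sdiff hy fun b hb => ?_
  obtain ⟨q, hq, μ, hμ, h1, h2⟩ := h.exists_chordEnd_of_mem hb.1
  have h3 := hc q hq μ hμ
  rw [← h1, ← h2] at h3
  by_contra! hle
  linarith [h.chart.sq_le_of_dist_le hle]

lemma cutSet_dist_le (h : Loc Γ H Z yh r ε X Y t) (hη1 : η ≤ 1 / 10 ^ 8) {a : Plane}
    (ha : a ∈ cutSet H yh ε (η * ε)) : dist a yh ≤ 61 / 10 * ε := by
  have hε := h.core.ε_pos
  obtain ⟨b, hb, hd⟩ := mem_enlargement.1 ha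
  obtain ⟨q, hq, μ, hμ, h1, h2⟩ := h.exists_chordEnd_of_mem hb.1
  have h3 : dist b yh ≤ 6 * ε := by
    apply h.chart.dist_le (by norm_num)
    rw [h1, h2, h.chart.X_center, h.chart.Y_center]
    have h4 := h.chordEnd_dist_le hq
    have h5 : μ ^ 2 ≤ 1 := pow_le_one₀ hμ.1 hμ.2
    nlinarith [sq_nonneg (X q), sq_nonneg (Y q)]
  have := dist_triangle a b yh
  nlinarith

lemma mem_sdiff_of_dist (h : Loc Γ H Z yh r ε X Y t) (hη1 : η ≤ 1 / 10 ^ 8) {y : Plane}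
    (hy : y ∈ H) (hd : 61 / 10 * ε < dist y yh) : y ∈ H \ cutSet H yh ε (η * ε) :=
  ⟨hy, fun ha => (h.cutSet_dist_le hη1 ha).not_gt hd⟩

lemma mem_sdiff_of_X (h : Loc Γ H Z yh r ε X Y t) (hη1 : η ≤ 1 / 10 ^ 8) {y : Plane}
    (hy : y ∈ H) (hX : 61 / 10 < |X y|) : y ∈ H \ cutSet H yh ε (η * ε) := by
  refine h.mem_sdiff_of_dist hη1 hy ?_
  by_contra! hle
  linarith [h.abs_X_le hle]

/-- Every point of the cut set is joined to the centre: straight to a nearby point of a short chord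
and then along that chord. -/
lemma exists_path_cutSet (h : Loc Γ H Z yh r ε X Y t) (hη : 0 ≤ η) {a b : Plane}
    (ha : a ∈ cutSet H yh ε (η * ε)) (hb : b ∈ cutSet H yh ε (η * ε)) :
    ∃ γ : Path a b, range γ ⊆ cutSet H yh ε (η * ε) := by
  have hηε : 0 ≤ η * ε := mul_nonneg hη h.core.ε_pos.le
  have key : ∀ a ∈ cutSet H yh ε (η * ε), JoinedIn (cutSet H yh ε (η * ε)) a yh := by
    intro a ha
    obtain ⟨b, hb, hd⟩ := mem_enlargement.1 ha
    have h1 : JoinedIn (cutSet H yh ε (η * ε)) a b := JoinedIn.of_segment_subset fun w hw =>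
      mem_enlargement.2 ⟨b, hb, (convex_closedBall b (η * ε)).segment_subset hd
        (mem_closedBall_self hηε) hw⟩
    refine h1.trans (JoinedIn.of_segment_subset fun w hw => ?_)
    obtain ⟨q, hq, μ, hμ, h2, h3⟩ := h.exists_chordEnd_of_mem hb.1
    obtain ⟨s, hs, h4, h5⟩ := h.chart.exists_of_mem_segment hw
    have e : w = AffineMap.lineMap yh q ((1 - s) * μ) := by
      refine h.chart.ext ?_ ?_
      · rw [h.chart.X_lineMap_center, h4, h2, h.chart.X_center]; ring
      · rw [h.chart.Y_lineMap_center, h5, h3, h.chart.Y_center]; ring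
    refine mem_enlargement.2 ⟨w, ?_, by rwa [dist_self]⟩
    rw [e]
    exact h.lineMap_chordEnd_mem hq ⟨mul_nonneg (by linarith [hs.2]) hμ.1,
      mul_le_one₀ (by linarith [hs.1]) hμ.1 hμ.2⟩
  obtain ⟨γ, hγ⟩ := (key a ha).trans (key b hb).symm
  exact ⟨γ, by rintro _ ⟨s, rfl⟩; exact hγ s⟩

/-! #### Segments to the curve -/

/-- Points to the right of the short chords, in the main part. -/
lemma clearance_lineMap (h : Loc Γ H Z yh r ε X Y t) (hη : 0 < η)
    (hη1 : η ≤ 1 / 10 ^ 8) {x e : Plane} (hx : x ∈ closure (H \ cutSet H yh ε (η * ε)))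
    (hxd : dist x yh ≤ 2400 * ε) (hX : 0 < X x) (hm : MainRight Γ H yh ε X Y x) (he : e ∈ Γ)
    (heX : X e ∈ Icc (15 / 2) 2000) (hed : dist e yh ≤ 2500 * ε) {l : ℝ}
    (hl : l ∈ Icc (0 : ℝ) 1) {b : Plane} (hb : b ∈ shortChords H yh ε ∩ H) :
    √(η ^ 2 + l ^ 2 / 400) * ε ≤ dist (AffineMap.lineMap x e l) b := by
  obtain ⟨q, hq, μ, hμ, h1, h2⟩ := h.exists_chordEnd_of_mem hb.1
  apply h.chart.le_dist
  rw [Real.sq_sqrt (by positivity), h.chart.X_lineMap, h.chart.Y_lineMap, h1, h2]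
  exact h.clearance_segment hη hη1 (mem_of_mem_closure h.core.isClosed hx) hxd hX
    (clears_of_mem_closure hx) hm he heX hed hl hq hμ

lemma lineMap_mem_sdiff (h : Loc Γ H Z yh r ε X Y t) (hη : 0 < η)
    (hη1 : η ≤ 1 / 10 ^ 8) {x e : Plane} (hx : x ∈ closure (H \ cutSet H yh ε (η * ε)))
    (hxd : dist x yh ≤ 2400 * ε) (hX : 0 < X x) (hm : MainRight Γ H yh ε X Y x) (he : e ∈ Γ)
    (heX : X e ∈ Icc (15 / 2) 2000) (hed : dist e yh ≤ 2500 * ε) {l : ℝ}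
    (hl : l ∈ Ioc (0 : ℝ) 1) : AffineMap.lineMap x e l ∈ H \ cutSet H yh ε (η * ε) := by
  have hε := h.core.ε_pos
  have hl' := Ioc_subset_Icc_self hl
  refine mem_sdiff ?_ fun b hb => ?_
  · refine h.core.segment_curve_subset he (mem_of_mem_closure h.core.isClosed hx) ?_ ?_
    · have := dist_triangle_right x e yh
      linarith
    · rw [segment_eq_image_lineMap]; exact ⟨l, hl', rfl⟩
  · refine lt_of_lt_of_le ?_ (h.clearance_lineMap hη hη1 hx hxd hX hm he heX hed hl' hb)
    refine mul_lt_mul_of_pos_right (Real.lt_sqrt_of_sq_lt ?_) hε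
    have := hl.1
    have : 0 < l ^ 2 := by positivity
    linarith

lemma segment_subset_closure (h : Loc Γ H Z yh r ε X Y t) (hη : 0 < η)
    (hη1 : η ≤ 1 / 10 ^ 8) {S : Set Plane} (hS : Absorbs (H \ cutSet H yh ε (η * ε)) S)
    {x e : Plane} (hx : x ∈ closure S)
    (hxd : dist x yh ≤ 2400 * ε) (hX : 0 < X x) (hm : MainRight Γ H yh ε X Y x) (he : e ∈ Γ)
    (heX : X e ∈ Icc (15 / 2) 2000) (hed : dist e yh ≤ 2500 * ε) (heS : e ∈ S) :
    (∀ l ∈ Ioc (0 : ℝ) 1, AffineMap.lineMap x e l ∈ S) ∧ segment ℝ x e ⊆ closure S := by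
  have key : (fun l : ℝ => AffineMap.lineMap x e l) '' Ioc (0 : ℝ) 1 ⊆ S := by
    refine hS.2 _ ?_ ?_ ?_
    · rintro _ ⟨l, hl, rfl⟩
      exact h.lineMap_mem_sdiff hη hη1 (closure_mono hS.1 hx) hxd hX hm he heX hed hl
    · refine isPreconnected_Ioc.image _ ?_
      exact AffineMap.lineMap_continuous.continuousOn
    · exact ⟨e, ⟨1, by simp, by simp⟩, heS⟩
  refine ⟨fun l hl => key ⟨l, hl, rfl⟩, ?_⟩
  rw [segment_eq_image_lineMap]
  rintro _ ⟨l, hl, rfl⟩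
  rcases eq_or_lt_of_le hl.1 with rfl | hl0
  · simpa using hx
  · exact subset_closure (key ⟨l, ⟨hl0, hl.2⟩, rfl⟩)

/-- Nearby points to the right of the short chords are joined by short paths. -/
lemma exists_pathDist_le (h : Loc Γ H Z yh r ε X Y t) (hη : 0 < η)
    (hη1 : η ≤ 1 / 10 ^ 8) {S : Set Plane} (hS : Absorbs (H \ cutSet H yh ε (η * ε)) S) {e : Plane}
    (he : e ∈ Γ) (heX : X e ∈ Icc (15 / 2) 2000) (hed : dist e yh ≤ 2500 * ε) (heS : e ∈ S)
    {δ : ℝ} (hδ : 0 < δ) :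
    ∃ ρ > 0, ∀ x ∈ closure S, ∀ x' ∈ closure S, dist x yh ≤ 2400 * ε → dist x' yh ≤ 2400 * ε →
      0 < X x → 0 < X x' → MainRight Γ H yh ε X Y x → MainRight Γ H yh ε X Y x' →
      dist x x' ≤ ρ → pathDist (closure S) x x' ≤ ENNReal.ofReal δ := by
  have hε := h.core.ε_pos
  obtain ⟨l, hl, hlδ⟩ : ∃ l ∈ Ioc (0 : ℝ) 1, l * (10000 * ε) ≤ δ / 2 := by
    refine ⟨min 1 (δ / 2 / (10000 * ε)), ⟨by positivity, min_le_left _ _⟩, ?_⟩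
    rw [← le_div_iff₀ (by positivity)]
    exact min_le_right _ _
  have hl' := Ioc_subset_Icc_self hl
  -- After the fraction l of the way to `e` the clearance exceeds η by m and the hull has radius
  -- lε/2. A crossing shorter than mε and lε/2 at that place stays in `S`, and l is so small that
  -- the whole detour is short.
  set m := √(η ^ 2 + l ^ 2 / 400) - η with hm
  have hm0 : 0 < m := sub_pos.2 (Real.lt_sqrt_of_sq_lt (by
    have := hl.1
    have : 0 < l ^ 2 := by positivity
    linarith))
  refine ⟨min (δ / 2) (min (l * ε / 2) (m * ε / 2)),
    by have := hl.1; positivity, ?_⟩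
  intro x hx x' hx' hxd hxd' hX hX' hmx hmx' hd
  have hd1 : dist x x' ≤ δ / 2 := hd.trans (min_le_left _ _)
  have hd2 : dist x x' ≤ l * ε / 2 := hd.trans ((min_le_right _ _).trans (min_le_left _ _))
  have hd3 : dist x x' ≤ m * ε / 2 := hd.trans ((min_le_right _ _).trans (min_le_right _ _))
  obtain ⟨h1, h2⟩ := h.segment_subset_closure hη hη1 hS hx hxd hX hmx he heX hed heS
  obtain ⟨h1', h2'⟩ := h.segment_subset_closure hη hη1 hS hx' hxd' hX' hmx' he heX hed heS
  have hxe : ∀ x : Plane, dist x yh ≤ 2400 * ε → dist x e ≤ 5000 * ε := fun x hx => by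
    have := dist_triangle_right x e yh
    linarith
  have hsub : ∀ x : Plane, dist x yh ≤ 2400 * ε → segment ℝ x e ⊆ closure S →
      pathDist (closure S) x (AffineMap.lineMap x e l) ≤ ENNReal.ofReal (l * (5000 * ε)) := by
    intro x hx hs
    refine (pathDist_le_of_segment fun w hw => hs ?_).trans (ENNReal.ofReal_le_ofReal ?_)
    · refine (convex_segment x e).segment_subset (left_mem_segment ℝ x e) ?_ hw
      rw [segment_eq_image_lineMap]; exact ⟨l, hl', rfl⟩
    · rw [dist_left_lineMap, Real.norm_eq_abs, abs_of_pos hl.1]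
      have := hxe x hx
      have := hl.1
      gcongr
  have hll : dist (AffineMap.lineMap x e l) (AffineMap.lineMap x' e l) ≤ dist x x' := by
    rw [dist_eq_norm, AffineMap.lineMap_apply_module, AffineMap.lineMap_apply_module,
      add_sub_add_right_eq_sub, ← smul_sub, norm_smul, dist_eq_norm x x', Real.norm_eq_abs,
      abs_of_nonneg (by linarith [hl.2])]
    nlinarith [norm_nonneg (x - x'), hl.1]
  have hmid : segment ℝ (AffineMap.lineMap x e l) (AffineMap.lineMap x' e l) ⊆ S := by
    refine hS.2 _ ?_ (convex_segment _ _).isPreconnected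
      ⟨_, left_mem_segment ℝ _ _, h1 l hl⟩
    intro w hw
    have hwd : dist w (AffineMap.lineMap x e l) ≤ dist x x' := by
      rw [dist_comm]
      exact (dist_le_of_mem_segment hw).trans hll
    refine mem_sdiff ?_ fun b hb => ?_
    · exact h.core.hull_curve he (mem_of_mem_closure h.core.isClosed (closure_mono hS.1 hx))
        (hxe x hxd) hl' (hwd.trans hd2)
    · have h3 := h.clearance_lineMap hη hη1 (closure_mono hS.1 hx) hxd hX hmx he heX hed hl' hb
      have h4 := dist_triangle (AffineMap.lineMap x e l) w b
      rw [dist_comm _ w] at h4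
      have h5 : √(η ^ 2 + l ^ 2 / 400) = m + η := by rw [hm]; ring
      rw [h5] at h3
      nlinarith
  calc pathDist (closure S) x x'
      ≤ pathDist (closure S) x (AffineMap.lineMap x e l) +
        (pathDist (closure S) (AffineMap.lineMap x e l) (AffineMap.lineMap x' e l) +
          pathDist (closure S) (AffineMap.lineMap x' e l) x') :=
        (pathDist_triangle _ _ _ _).trans (add_le_add le_rfl (pathDist_triangle _ _ _ _))
    _ ≤ ENNReal.ofReal (l * (5000 * ε)) + (ENNReal.ofReal (δ / 2) +
          ENNReal.ofReal (l * (5000 * ε))) := by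
        refine add_le_add (hsub x hxd h2) (add_le_add ?_ ?_)
        · exact (pathDist_le_of_segment (hmid.trans subset_closure)).trans
            (ENNReal.ofReal_le_ofReal (hll.trans hd1))
        · rw [pathDist_comm]
          exact hsub x' hxd' h2'
    _ = ENNReal.ofReal (l * (5000 * ε) + (δ / 2 + l * (5000 * ε))) := by
        have := hl.1
        rw [← ENNReal.ofReal_add (by positivity) (by positivity),
          ← ENNReal.ofReal_add (by positivity) (by positivity)]
    _ ≤ ENNReal.ofReal δ := ENNReal.ofReal_le_ofReal (by linarith)

/-- Clearance from the short chords on the line through the centre and a point of the curve. -/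
lemma clearance_line (h : Loc Γ H Z yh r ε X Y t) {e q : Plane} (he : e ∈ Γ) (heX : 15 / 2 ≤ X e)
    (hed : dist e yh ≤ 2500 * ε) (hq : ChordEnd H yh ε q) (l μ : ℝ) :
    l ^ 2 * (X e ^ 2 + Y e ^ 2) ≤ 324 * ((l * X e - μ * X q) ^ 2 + (l * Y e - μ * Y q) ^ 2) := by
  obtain ⟨p, hp, hpX, ν, hν1, hν2⟩ :
      ∃ p, ChordEnd H yh ε p ∧ 0 ≤ X p ∧ ∃ ν : ℝ, X q = ν * X p ∧ Y q = ν * Y p := by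
    rcases le_or_gt 0 (X q) with h0 | h0
    · exact ⟨q, hq, h0, 1, by ring, by ring⟩
    · obtain ⟨p, hp, c, hc, hpX, hpY⟩ := h.chordEnd_opposite hq
      refine ⟨p, hp, by nlinarith, -c⁻¹, ?_, ?_⟩
      · rw [hpX]; field_simp
      · rw [hpY]; field_simp
  rw [hν1, hν2]
  have h5 := h.cr_sq_ge hp hpX he hed heX
  have h6 := h.chordEnd_dist_le hp
  have e1 : l * cr X Y p e = X p * (l * Y e - μ * (ν * Y p)) -
    Y p * (l * X e - μ * (ν * X p)) := by rw [cr]; ring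
  have e2 : (X p * (l * Y e - μ * (ν * Y p)) - Y p * (l * X e - μ * (ν * X p))) ^ 2 ≤
    (X p ^ 2 + Y p ^ 2) *
      ((l * X e - μ * (ν * X p)) ^ 2 + (l * Y e - μ * (ν * Y p)) ^ 2) := by
    linarith [sq_nonneg (X p * (l * X e - μ * (ν * X p)) + Y p * (l * Y e - μ * (ν * Y p)))]
  rw [← e1, mul_pow] at e2
  have h8 : (X p ^ 2 + Y p ^ 2) *
      ((l * X e - μ * (ν * X p)) ^ 2 + (l * Y e - μ * (ν * Y p)) ^ 2) ≤
      36 * ((l * X e - μ * (ν * X p)) ^ 2 + (l * Y e - μ * (ν * Y p)) ^ 2) := by gcongr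
  have h9 : l ^ 2 * ((X e ^ 2 + Y e ^ 2) / 9) ≤ l ^ 2 * cr X Y p e ^ 2 := by gcongr
  linarith

/-- The segment from the centre to a point of the curve leaves the cut set near the centre. -/
lemma exists_exit (h : Loc Γ H Z yh r ε X Y t) (hη : 0 < η)
    (hη1 : η ≤ 1 / 10 ^ 8) {S : Set Plane} (hS : Absorbs (H \ cutSet H yh ε (η * ε)) S) {e : Plane}
    (he : e ∈ Γ) (heX : X e ∈ Icc (15 / 2) 2000) (hed : dist e yh ≤ 2400 * ε) (heS : e ∈ S) :
    ∃ a ∈ closure S ∩ frontier (cutSet H yh ε (η * ε)), dist a yh ≤ 1 / 100 * ε ∧ 0 < X a ∧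
      MainRight Γ H yh ε X Y a := by
  have hε := h.core.ε_pos
  have heX1 := heX.1
  set A := cutSet H yh ε (η * ε) with hA
  set f : ℝ → Plane := fun l => AffineMap.lineMap yh e l with hf
  have hfc : Continuous f := AffineMap.lineMap_continuous
  have hAcl : IsClosed A := isClosed_cutSet h.core.isCompact _ _ (by positivity)
  have hyA : yh ∈ A := mem_enlargement.2 ⟨yh, h.center_mem_blade, by rw [dist_self]; positivity⟩
  -- The exit point is the last point of the segment in the cut set.
  obtain ⟨l, ⟨hl, hlA⟩, hlmax⟩ := (isCompact_Icc.inter_right (hAcl.preimage hfc)).exists_isGreatest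
    ⟨(0 : ℝ), ⟨le_rfl, zero_le_one⟩, by simpa [hf] using hyA⟩
  have hl1 : l < 1 := by
    refine lt_of_le_of_ne hl.2 ?_
    rintro rfl
    have : f 1 = e := by simp [hf]
    rw [mem_preimage, this] at hlA
    exact (hS.1 heS).2 hlA
  have hfH : ∀ s ∈ Icc (0 : ℝ) 1, f s ∈ H := fun s hs =>
    h.core.segment_curve_subset he h.core.center_mem (by rw [dist_comm]; linarith) (by
      rw [segment_eq_image_lineMap]; exact ⟨s, hs, rfl⟩)
  have hout : f '' Ioc l 1 ⊆ S := by
    refine hS.2 _ ?_ (isPreconnected_Ioc.image _ hfc.continuousOn)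
      ⟨e, ⟨1, ⟨hl1, le_rfl⟩, by simp [hf]⟩, heS⟩
    rintro _ ⟨s, hs, rfl⟩
    have hs' : s ∈ Icc (0 : ℝ) 1 := ⟨hl.1.trans hs.1.le, hs.2⟩
    exact ⟨hfH s hs', fun hsA => (hlmax ⟨hs', hsA⟩).not_gt hs.1⟩
  have hlS : f l ∈ closure S := by
    have h1 : l ∈ closure (Ioc l 1) := by
      rw [closure_Ioc hl1.ne]; exact ⟨le_rfl, hl1.le⟩
    have h2 := image_closure_subset_closure_image (s := Ioc l 1) hfc ⟨l, h1, rfl⟩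
    exact closure_mono hout h2
  -- The direction of `e` is bounded away from all chord directions, so a point of the segment
  -- within η of a chord has l|e| ≤ 18η.
  have hsmall : l ^ 2 * (X e ^ 2 + Y e ^ 2) ≤ (1 / 100) ^ 2 := by
    obtain ⟨b, hb, hd⟩ := mem_enlargement.1 hlA
    obtain ⟨q, hq, μ, hμ, h1, h2⟩ := h.exists_chordEnd_of_mem hb.1
    have h3 := h.chart.sq_le_of_dist_le hd
    rw [h1, h2, h.chart.X_lineMap_center, h.chart.Y_lineMap_center] at h3
    have h4 := h.clearance_line he heX1 (by linarith) hq l μ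
    nlinarith
  have hfX : X (f l) = l * X e := h.chart.X_lineMap_center _ _
  have hfY : Y (f l) = l * Y e := h.chart.Y_lineMap_center _ _
  have hdist : dist (f l) yh ≤ 1 / 100 * ε := by
    apply h.chart.dist_le (by norm_num)
    rw [hfX, hfY, h.chart.X_center, h.chart.Y_center]
    linarith
  have hl0 : 0 < l := by
    refine lt_of_le_of_ne hl.1 ?_
    rintro rfl
    have h1 := clears_of_mem_closure (closure_mono hS.1 hlS) yh h.center_mem_blade
    have : f 0 = yh := by simp [hf]
    rw [this, dist_self] at h1
    linarith [mul_pos hη hε]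
  refine ⟨f l, ⟨hlS, subset_closure hlA, fun hint => ?_⟩, hdist, ?_, ?_⟩
  · have h1 := mem_closure_iff.1 hlS _ isOpen_interior hint
    obtain ⟨z, hz1, hz2⟩ := h1
    exact (hS.1 hz2).2 (interior_subset hz1)
  · rw [hfX]; nlinarith
  · refine h.mainRight_of he hed (by linarith) fun q hq hqX => ?_
    have : cr X Y q (f l) = l * cr X Y q e := by rw [cr, cr, hfX, hfY]; ring
    rw [this]
    nlinarith [mul_nonneg hl.1 (mul_self_nonneg (cr X Y q e))]

/-! #### Sectors -/

/-- A point on the ray of `q` is not behind `q`, so it lies on the chord itself and is cut away. -/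
lemma cr_ne_zero (h : Loc Γ H Z yh r ε X Y t) (hη : 0 < η) {q y : Plane}
    (hq : ChordEnd H yh ε q) (hqX : 0 ≤ X q) (hy : y ∈ H) (hd : dist y yh ≤ 2400 * ε)
    (hc : Clears H yh ε (η * ε) y) (hX : 0 < X y) : cr X Y q y ≠ 0 := by
  intro h0
  rw [cr, sub_eq_zero] at h0
  have e1 : X q = X q / X y * X y := by field_simp
  have e2 : Y q = X q / X y * Y y := by field_simp; linarith
  have h1 := h.one_le_of_ray hq hy (by linarith [h.core.ε_pos]) (by positivity) e1 e2
  set c := X q / X y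
  have h2 := h.clears_coord hη.le hc hq (μ := c⁻¹) ⟨by positivity, inv_le_one_of_one_le₀ h1⟩
  rw [e1, e2, inv_mul_cancel_left₀ (by positivity), inv_mul_cancel_left₀ (by positivity)] at h2
  nlinarith

/-- A sector cut off by a short chord is not connected with the rest. -/
lemma sector (h : Loc Γ H Z yh r ε X Y t) (hη : 0 < η) (hη1 : η ≤ 1 / 10 ^ 8) {e q : Plane}
    (he : e ∈ Γ) (heX : 301 / 50 ≤ X e) (hed : dist e yh ≤ 2400 * ε) (hq : ChordEnd H yh ε q)
    (hqX : 0 ≤ X q) {P : Set Plane} (hP : P ⊆ closure (H \ cutSet H yh ε (η * ε)))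
    (hPc : IsPreconnected P) {p p' : Plane} (hp : p ∈ P) (hp' : p' ∈ P)
    (hpd : dist p yh ≤ 100 * ε) (hpX : 0 < X p) (hpc : cr X Y q e * cr X Y q p < 0) :
    dist p' yh ≤ 100 * ε ∧ 0 < X p' ∧ cr X Y q e * cr X Y q p' < 0 := by
  have hε := h.core.ε_pos
  have hcX := h.chart.continuous_X
  have hcc : Continuous fun y => cr X Y q e * cr X Y q y := by
    have := h.chart.continuous_Y
    unfold cr
    fun_prop
  by_contra hcon
  have hF1 : IsClosed {y | dist y yh ≤ 100 * ε ∧ 0 ≤ X y ∧ cr X Y q e * cr X Y q y ≤ 0} := by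
    rw [ofPred_and, ofPred_and]
    exact (isClosed_le (by fun_prop) (by fun_prop)).inter
      ((isClosed_le continuous_const hcX).inter (isClosed_le hcc continuous_const))
  have hF2 : IsClosed {y | 100 * ε ≤ dist y yh ∨ X y ≤ 0 ∨ 0 ≤ cr X Y q e * cr X Y q y} := by
    rw [ofPred_or, ofPred_or]
    exact (isClosed_le (by fun_prop) (by fun_prop)).union
      ((isClosed_le hcX continuous_const).union (isClosed_le continuous_const hcc))
  -- Otherwise the set meets the boundary of the sector: the circle of radius 100 ε, where points
  -- lie on the side of the curve, or X = 0, or the line of the chord, which are both excluded by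
  -- the clearance.
  obtain ⟨y, hyP, ⟨h1, h2, h3⟩, hy2⟩ := isPreconnected_closed_iff.1 hPc _ _ hF1 hF2
    (fun y _ => by
      by_cases hy : 100 * ε ≤ dist y yh ∨ X y ≤ 0 ∨ 0 ≤ cr X Y q e * cr X Y q y
      · exact Or.inr hy
      · push Not at hy
        exact Or.inl ⟨hy.1.le, hy.2.1.le, hy.2.2.le⟩)
    ⟨p, hp, hpd, hpX.le, hpc.le⟩
    ⟨p', hp', by
      by_contra hn
      rw [mem_ofPred_eq] at hn
      push Not at hn
      exact hcon ⟨hn.1.le, hn.2.1, hn.2.2⟩⟩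
  have hyH := mem_of_mem_closure h.core.isClosed (hP hyP)
  have hyc := clears_of_mem_closure (hP hyP)
  have hyX := h.le_abs_X hη (by linarith) hyH (by linarith) hyc
  rw [abs_of_nonneg h2] at hyX
  rcases hy2 with hy2 | hy2 | hy2
  · have h4 := h.dist_center_le y
    have h5 := h.abs_Y_le hyH (by linarith)
    have h6 : 301 / 50 ≤ X y := by
      rw [abs_of_nonneg h2] at h4
      by_contra! hlt
      nlinarith
    have := h.cr_mul_pos_of_far hq hqX hyH (by linarith) h6 he (by linarith) heX
    linarith
  · linarith
  · rcases mul_eq_zero.1 (le_antisymm h3 hy2) with h0 | h0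
    · exact h.cr_ne_zero_of_far hq hqX (h.core.curve_subset he) (by linarith) heX h0
    · exact h.cr_ne_zero hη hq hqX hyH (by linarith) hyc (by linarith) h0

lemma mainRight_of_far (h : Loc Γ H Z yh r ε X Y t) {y : Plane} (hy : y ∈ H)
    (hd : dist y yh ≤ 2400 * ε) (hX : 301 / 50 ≤ X y) : MainRight Γ H yh ε X Y y :=
  fun _ hq hqX _ he heX hed => (h.cr_mul_pos_of_far hq hqX hy hd hX he hed heX.1).le

/-- By `sector` a connected set that enters a pocket stays in it, so one point outside all pockets
suffices. -/
lemma mainRight_of_isPreconnected (h : Loc Γ H Z yh r ε X Y t) (hη : 0 < η)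
    (hη1 : η ≤ 1 / 10 ^ 8) {e : Plane} (he : e ∈ Γ) (heX : X e ∈ Icc (301 / 50) 2000)
    (hed : dist e yh ≤ 2400 * ε) {P : Set Plane}
    (hP : P ⊆ closure (H \ cutSet H yh ε (η * ε))) (hPc : IsPreconnected P) {p p' : Plane}
    (hp : p ∈ P) (hp' : p' ∈ P) (hpm : X p ≤ 0 ∨ 100 * ε < dist p yh ∨ MainRight Γ H yh ε X Y p)
    (hd' : dist p' yh ≤ 2400 * ε) (hX' : 0 < X p') : MainRight Γ H yh ε X Y p' := by
  rcases le_or_gt (301 / 50) (X p') with h0 | h0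
  · exact h.mainRight_of_far (mem_of_mem_closure h.core.isClosed (hP hp')) hd' h0
  have hd'' : dist p' yh ≤ 100 * ε := by
    have h1 := h.dist_center_le p'
    have h2 := h.abs_Y_le (mem_of_mem_closure h.core.isClosed (hP hp')) hd'
    rw [abs_of_pos hX'] at h1
    nlinarith [h.core.ε_pos]
  refine h.mainRight_of he hed heX.1 fun q hq hqX => ?_
  by_contra! hlt
  obtain ⟨h1, h2, h3⟩ := h.sector hη hη1 he heX.1 hed hq hqX hP hPc hp' hp hd'' hX' hlt
  rcases hpm with h4 | h4 | h4
  · linarith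
  · linarith
  · linarith [h4 q hq hqX e he heX (by linarith [h.core.ε_pos])]

end Loc


namespace Loc

variable {Γ H Z : Set Plane} {yh : Plane} {r ε : ℝ} {X Y : Plane → ℝ} {t η : ℝ}

/-! #### Sectors cut off by the short chords -/

/-- On the side of the centre opposite to the curve there are points outside the cut set. -/
lemma exists_opposite (h : Loc Γ H Z yh r ε X Y t) (hη : 0 < η) (hη1 : η ≤ 1 / 10 ^ 8)
    {e : Plane} (he : e ∈ Γ) (heX : 15 / 2 ≤ X e) (hed : dist e yh ≤ 2500 * ε) :
    ∃ y ∈ H \ cutSet H yh ε (η * ε), X y < 0 ∧ dist y yh ≤ 2 * ε := by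
  have hpos : 0 < X e := by linarith
  have hY := h.curve_Y he hed
  have e1 : (X e)⁻¹ * X e = 1 := inv_mul_cancel₀ hpos.ne'
  have hX : X (AffineMap.lineMap yh e (-(X e)⁻¹)) = -1 := by
    rw [h.chart.X_lineMap_center, neg_mul, e1]
  have hY' : |Y (AffineMap.lineMap yh e (-(X e)⁻¹))| ≤ 1 := by
    rw [h.chart.Y_lineMap_center, neg_mul, abs_neg, abs_mul, abs_of_pos (inv_pos.2 hpos),
      inv_mul_le_iff₀ hpos]
    linarith
  have hd : dist (AffineMap.lineMap yh e (-(X e)⁻¹)) yh ≤ 2 * ε := by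
    refine (h.dist_center_le _).trans ?_
    rw [hX]
    norm_num
    nlinarith [h.core.ε_pos]
  refine ⟨_, h.mem_sdiff_of_coord (h.core.mem_of_dist_center_le hd) fun q hq μ _ => ?_,
    by rw [hX]; norm_num, hd⟩
  have h1 := h.clearance_line he heX hed hq (-(X e)⁻¹) μ
  rw [h.chart.X_lineMap_center, h.chart.Y_lineMap_center]
  have h2 : 1 ≤ (-(X e)⁻¹) ^ 2 * (X e ^ 2 + Y e ^ 2) := by
    have : (-(X e)⁻¹) ^ 2 * X e ^ 2 = 1 := by rw [← mul_pow, neg_mul, e1]; norm_num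
    rw [mul_add, this]
    linarith [mul_nonneg (sq_nonneg (-(X e)⁻¹)) (sq_nonneg (Y e))]
  have h3 : η ^ 2 ≤ (1 / 10 ^ 8) ^ 2 := by gcongr
  linarith

/-- Moving away from the centre does not bring a point closer to the cut set. -/
lemma lineMap_mem_of_one_le (h : Loc Γ H Z yh r ε X Y t) (hη : 0 < η) {x : Plane}
    (hx : x ∈ closure (H \ cutSet H yh ε (η * ε))) {μ : ℝ} (hμ : 1 ≤ μ)
    (hH : AffineMap.lineMap yh x μ ∈ H) :
    AffineMap.lineMap yh x μ ∈ closure (H \ cutSet H yh ε (η * ε)) := by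
  rcases eq_or_lt_of_le hμ with rfl | hμ
  · simpa using hx
  · refine subset_closure (h.mem_sdiff_of_coord hH fun q hq ν hν => ?_)
    have hμ0 : 0 < μ := by linarith
    have h1 := h.clears_coord hη.le (clears_of_mem_closure hx) hq (μ := ν / μ)
      ⟨div_nonneg hν.1 hμ0.le, (div_le_one hμ0).2 (by linarith [hν.2])⟩
    rw [h.chart.X_lineMap_center, h.chart.Y_lineMap_center]
    have e1 : (μ * X x - ν * X q) ^ 2 + (μ * Y x - ν * Y q) ^ 2 =
        μ ^ 2 * ((X x - ν / μ * X q) ^ 2 + (Y x - ν / μ * Y q) ^ 2) := by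
      field_simp
    rw [e1]
    have h2 : 1 < μ ^ 2 := one_lt_pow₀ hμ two_ne_zero
    have h3 : 0 < η ^ 2 := by positivity
    nlinarith

lemma pathDist_lineMap_le (h : Loc Γ H Z yh r ε X Y t) (hη : 0 < η) {x : Plane}
    (hx : x ∈ closure (H \ cutSet H yh ε (η * ε))) {μ : ℝ} (hμ : 1 ≤ μ)
    (hH : AffineMap.lineMap yh x μ ∈ H) (hd : dist (AffineMap.lineMap yh x μ) yh ≤ 100 * ε) :
    pathDist (closure (H \ cutSet H yh ε (η * ε))) x (AffineMap.lineMap yh x μ) ≤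
      ENNReal.ofReal (200 * ε) := by
  have hε := h.core.ε_pos
  have hμ0 : 0 < μ := by linarith
  have hseg : ∀ ν ∈ Icc 1 μ, AffineMap.lineMap yh x ν ∈ H := fun ν hν => by
    refine h.core.segment_center_subset hH (by linarith) ?_
    refine h.chart.mem_segment (s := 1 - ν / μ)
      ⟨by rw [sub_nonneg, div_le_one hμ0]; exact hν.2,
        by have := hν.1; linarith [div_nonneg (by linarith : 0 ≤ ν) hμ0.le]⟩ ?_ ?_
    · rw [h.chart.X_lineMap_center, h.chart.X_lineMap_center, h.chart.X_center]; field_simp; ring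
    · rw [h.chart.Y_lineMap_center, h.chart.Y_lineMap_center, h.chart.Y_center]; field_simp; ring
  have hxd : dist x yh ≤ 100 * ε := by
    rw [dist_lineMap_left, Real.norm_eq_abs, abs_of_pos hμ0, dist_comm] at hd
    nlinarith [dist_nonneg (x := x) (y := yh)]
  refine (pathDist_le_of_segment ?_).trans (ENNReal.ofReal_le_ofReal
    ((dist_triangle_right _ _ yh).trans (by linarith)))
  intro w hw
  obtain ⟨s, hs, h1, h2⟩ := h.chart.exists_of_mem_segment hw
  have hν : (1 - s) * 1 + s * μ ∈ Icc 1 μ := ⟨by nlinarith [hs.1], by nlinarith [hs.2]⟩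
  obtain rfl : w = AffineMap.lineMap yh x ((1 - s) * 1 + s * μ) := by
    refine h.chart.ext ?_ ?_
    · rw [h1, h.chart.X_lineMap_center, h.chart.X_lineMap_center]; ring
    · rw [h2, h.chart.Y_lineMap_center, h.chart.Y_lineMap_center]; ring
  exact h.lineMap_mem_of_one_le hη hx hν.1 (hseg _ hν)

/-- The outermost points of the estimator on rays through the centre depend on the slope in a
Lipschitz way. -/
lemma exists_outer (h : Loc Γ H Z yh r ε X Y t) :
    ∃ (R : ℝ → ℝ) (c : ℝ → Plane), (∀ k, X (c k) = R k ∧ Y (c k) = R k * k) ∧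
      (∀ k, R k ∈ Icc 0 10) ∧ (∀ k, |k| ≤ 4 / 3 → c k ∈ H) ∧
      (∀ k, |k| ≤ 4 / 3 → ∀ p ∈ H, X p ∈ Icc 0 10 → Y p = X p * k → X p ≤ R k) ∧
      ∀ k k', |k| ≤ 4 / 3 → |k'| ≤ 4 / 3 → R k - 100 * |k - k'| ≤ R k' := by
  have hε := h.core.ε_pos
  choose P hPX hPY using fun k => h.chart.surj 1 k
  have hex : ∀ k : ℝ, ∃ u, IsGreatest
      (Icc (0 : ℝ) 10 ∩ (fun u : ℝ => AffineMap.lineMap yh (P k) u) ⁻¹' H) u := fun k => by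
    refine (isCompact_Icc.inter_right (h.core.isClosed.preimage ?_)).exists_isGreatest
      ⟨0, ⟨le_rfl, by norm_num⟩, by simpa using h.core.center_mem⟩
    exact AffineMap.lineMap_continuous
  choose R hR using hex
  have hX : ∀ k u, X (AffineMap.lineMap yh (P k) u) = u := fun k u => by
    rw [h.chart.X_lineMap_center, hPX, mul_one]
  have hY : ∀ k u, Y (AffineMap.lineMap yh (P k) u) = u * k := fun k u => by
    rw [h.chart.Y_lineMap_center, hPY]
  refine ⟨R, fun k => AffineMap.lineMap yh (P k) (R k), fun k => ⟨hX _ _, hY _ _⟩,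
    fun k => (hR k).1.1, fun k _ => (hR k).1.2, fun k _ p hp hpX hpY => (hR k).2 ⟨hpX, ?_⟩, ?_⟩
  · have : AffineMap.lineMap yh (P k) (X p) = p := h.chart.ext (hX _ _) (by rw [hY, hpY])
    rwa [mem_preimage, this]
  · intro k k' hk hk'
    have hR0 := (hR k).1.1
    set y := AffineMap.lineMap yh (P k) (R k) with hy
    have hyH : y ∈ H := (hR k).1.2
    have hyd : dist y yh ≤ 5000 * ε := by
      refine (h.dist_center_le y).trans ?_
      rw [hX, hY, abs_mul, abs_of_nonneg hR0.1]
      have : R k * |k| ≤ 10 * (4 / 3) := by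
        have := hR0.2
        gcongr
      nlinarith [hR0.2]
    set d := |k - k'| with hd
    have hd0 : 0 ≤ d := abs_nonneg _
    have hpos : 0 < 1 + 10 * d := by positivity
    -- Shrinking by μ gives a hull of radius 1 − μ about the shrunk point, and μ makes this equal to
    -- 10μd, the bound for the offset caused by the change of slope.
    set μ := 1 / (1 + 10 * d) with hμ
    have hμ0 : 0 < μ := by positivity
    have hμ1 : μ ≤ 1 := by rw [hμ, div_le_one hpos]; linarith
    have hμd : 1 - μ = μ * (10 * d) := by rw [hμ]; field_simp; ring
    have hmem : AffineMap.lineMap yh (P k') (μ * R k) ∈ H := by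
      refine h.core.hull_center (c := 1 - μ) hyH hyd ⟨by linarith, by linarith⟩ ?_
      refine (h.chart.dist_le_add _ _).trans ?_
      refine mul_le_mul_of_nonneg_right ?_ hε.le
      rw [hX, hY, h.chart.X_lineMap, h.chart.Y_lineMap, hX, hY, h.chart.X_center,
        h.chart.Y_center]
      have e1 : μ * R k - ((1 - (1 - μ)) * R k + (1 - μ) * 0) = 0 := by ring
      have e2 : μ * R k * k' - ((1 - (1 - μ)) * (R k * k) + (1 - μ) * 0) =
        -(μ * R k * (k - k')) := by ring
      rw [e1, e2, abs_zero, abs_neg, abs_mul, abs_mul, abs_of_pos hμ0, abs_of_nonneg hR0.1,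
        zero_add, hμd, ← hd]
      have := hR0.2
      rw [mul_assoc]
      gcongr
    have h1 := (hR k').2 ⟨⟨mul_nonneg hμ0.le hR0.1, by nlinarith [hR0.1, hR0.2]⟩, hmem⟩
    have h2 : (1 - μ) * R k ≤ 100 * d := by
      rw [hμd]
      have h3 : R k ≤ 10 := hR0.2
      calc μ * (10 * d) * R k ≤ 1 * (10 * d) * 10 := by gcongr; exact hR0.1
        _ = 100 * d := by ring
    linarith

/-- Inside a sector cut off by a short chord, connected points are joined by short paths. -/
lemma pathDist_le_of_sector (h : Loc Γ H Z yh r ε X Y t) (hη : 0 < η) (hη1 : η ≤ 1 / 10 ^ 8)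
    {e q : Plane} (he : e ∈ Γ) (heX : 301 / 50 ≤ X e) (hed : dist e yh ≤ 2400 * ε)
    (hq : ChordEnd H yh ε q) (hqX : 0 ≤ X q) {x z : Plane}
    (hxd : dist x yh ≤ 100 * ε) (hxX : 0 < X x) (hxc : cr X Y q e * cr X Y q x < 0)
    (hfin : pathDist (closure (H \ cutSet H yh ε (η * ε))) x z ≠ ∞) :
    pathDist (closure (H \ cutSet H yh ε (η * ε))) x z ≤ ENNReal.ofReal (2000 * ε) := by
  have hε := h.core.ε_pos
  set K := closure (H \ cutSet H yh ε (η * ε)) with hK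
  obtain ⟨γ, hγ⟩ := exists_path_of_pathDist_ne_top hfin
  have hxγ : x ∈ range γ := ⟨0, γ.source⟩
  have hzγ : z ∈ range γ := ⟨1, γ.target⟩
  have hall : ∀ p ∈ range γ, p ∈ H ∧ dist p yh ≤ 100 * ε ∧ 0 < X p ∧ X p ≤ 10 ∧
      |Y p / X p| ≤ 4 / 3 := by
    intro p hp
    obtain ⟨h1, h2, h3⟩ := h.sector hη hη1 he heX hed hq hqX hγ (isPreconnected_range_path γ)
      hxγ hp hxd hxX hxc
    have hpH := mem_of_mem_closure h.core.isClosed (hγ hp)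
    have h4 := h.slope_lt hη hpH (by linarith) (clears_of_mem_closure (hγ hp))
    refine ⟨hpH, h1, h2, ?_, ?_⟩
    · by_contra! hlt
      linarith [h.cr_mul_pos_of_far hq hqX hpH (by linarith) (by linarith) he (by linarith) heX]
    · rw [abs_div, div_le_iff₀ (abs_pos.2 h2.ne')]
      linarith
  -- The short path goes radially outwards to the outer curve `c`, along `c` through slopes attained
  -- on γ, and radially back. Moving outwards never reaches the cut set, and γ guarantees that the
  -- slopes in between are available.
  obtain ⟨R, c, hc, hR, hcH, hRmax, hRlip⟩ := h.exists_outer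
  have hcd : ∀ k, |k| ≤ 4 / 3 → dist (c k) yh ≤ 100 * ε := fun k hk => by
    refine (h.dist_center_le _).trans ?_
    rw [(hc k).1, (hc k).2, abs_mul, abs_of_nonneg (hR k).1]
    have : R k * |k| ≤ 10 * (4 / 3) := by
      have := (hR k).2
      gcongr
    nlinarith [(hR k).2]
  have hray : ∀ p ∈ range γ, ∃ μ : ℝ, 1 ≤ μ ∧ c (Y p / X p) = AffineMap.lineMap yh p μ := by
    intro p hp
    obtain ⟨h1, -, h2, h3, h4⟩ := hall p hp
    have h5 := hRmax _ h4 p h1 ⟨h2.le, h3⟩ (by field_simp)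
    refine ⟨R (Y p / X p) / X p, (one_le_div h2).2 h5, h.chart.ext ?_ ?_⟩
    · rw [h.chart.X_lineMap_center, (hc _).1]; field_simp
    · rw [h.chart.Y_lineMap_center, (hc _).2]; field_simp
  have hrad : ∀ p ∈ range γ, pathDist K p (c (Y p / X p)) ≤ ENNReal.ofReal (200 * ε) := by
    intro p hp
    obtain ⟨μ, hμ, h1⟩ := hray p hp
    have h2 := hcH _ (hall p hp).2.2.2.2
    have h3 := hcd _ (hall p hp).2.2.2.2
    rw [h1] at h2 h3 ⊢
    exact h.pathDist_lineMap_le hη (hγ hp) hμ h2 h3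
  have hcK : ∀ p ∈ range γ, c (Y p / X p) ∈ K := by
    intro p hp
    obtain ⟨μ, hμ, h1⟩ := hray p hp
    have h2 := hcH _ (hall p hp).2.2.2.2
    rw [h1] at h2 ⊢
    exact h.lineMap_mem_of_one_le hη (hγ hp) hμ h2
  have himg : ((fun p => Y p / X p) '' range γ).OrdConnected := by
    refine ((isPreconnected_range_path γ).image _ ?_).ordConnected
    exact h.chart.continuous_Y.continuousOn.div h.chart.continuous_X.continuousOn
      fun p hp => (hall p hp).2.2.1.ne'
  have hlip : LipschitzOnWith (250 * ε).toNNReal c (Icc (-(4 / 3)) (4 / 3)) := by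
    refine LipschitzOnWith.of_dist_le_mul fun k hk k' hk' => ?_
    have hk := abs_le.2 hk
    have hk' := abs_le.2 hk'
    rw [Real.coe_toNNReal _ (by positivity), Real.dist_eq]
    have h1 : |R k - R k'| ≤ 100 * |k - k'| := by
      have h2 := hRlip k k' hk hk'
      have h3 := hRlip k' k hk' hk
      rw [abs_sub_comm] at h3
      rw [abs_le]
      constructor <;> linarith
    refine (h.chart.dist_le_add _ _).trans ?_
    rw [(hc k).1, (hc k').1, (hc k).2, (hc k').2]
    have h2 : |R k * k - R k' * k'| ≤ 100 * |k - k'| * (4 / 3) + 10 * |k - k'| := by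
      have e1 : R k * k - R k' * k' = (R k - R k') * k + R k' * (k - k') := by ring
      rw [e1]
      refine (abs_add_le _ _).trans ?_
      rw [abs_mul, abs_mul, abs_of_nonneg (hR k').1]
      have := (hR k').2
      gcongr
    nlinarith [abs_nonneg (k - k')]
  have harc : ∀ a ∈ range γ, ∀ b ∈ range γ, Y a / X a ≤ Y b / X b →
      pathDist K (c (Y a / X a)) (c (Y b / X b)) ≤ ENNReal.ofReal (1000 * ε) := by
    intro a ha b hb hab
    have ha' := abs_le.1 (hall a ha).2.2.2.2
    have hb' := abs_le.1 (hall b hb).2.2.2.2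
    refine (pathDist_le_of_lipschitzOn hab (hlip.mono (Icc_subset_Icc ha'.1 hb'.2)) ?_).trans ?_
    · intro k hk
      obtain ⟨p, hp, rfl⟩ := himg.out ⟨a, ha, rfl⟩ ⟨b, hb, rfl⟩ hk
      exact hcK p hp
    · rw [ENNReal.ofReal, ENNReal.ofReal, ← ENNReal.coe_mul, ENNReal.coe_le_coe,
        ← Real.toNNReal_mul (by positivity)]
      exact Real.toNNReal_le_toNNReal (by nlinarith)
  have hmid : pathDist K (c (Y x / X x)) (c (Y z / X z)) ≤ ENNReal.ofReal (1000 * ε) := by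
    rcases le_total (Y x / X x) (Y z / X z) with h1 | h1
    · exact harc x hxγ z hzγ h1
    · rw [pathDist_comm]; exact harc z hzγ x hxγ h1
  calc pathDist K x z ≤ pathDist K x (c (Y x / X x)) +
        (pathDist K (c (Y x / X x)) (c (Y z / X z)) + pathDist K (c (Y z / X z)) z) :=
        (pathDist_triangle _ _ _ _).trans (add_le_add le_rfl (pathDist_triangle _ _ _ _))
    _ ≤ ENNReal.ofReal (200 * ε) + (ENNReal.ofReal (1000 * ε) + ENNReal.ofReal (200 * ε)) := by
        refine add_le_add (hrad x hxγ) (add_le_add hmid ?_)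
        rw [pathDist_comm]
        exact hrad z hzγ
    _ = ENNReal.ofReal (200 * ε + (1000 * ε + 200 * ε)) := by
        rw [← ENNReal.ofReal_add (by positivity) (by positivity),
          ← ENNReal.ofReal_add (by positivity) (by positivity)]
    _ ≤ ENNReal.ofReal (2000 * ε) := ENNReal.ofReal_le_ofReal (by linarith)

end Loc


/-! ### Paths along the curve -/

lemma isClosed_enlargement {C : Set Plane} (hC : IsCompact C) {ρ : ℝ} (hρ : 0 ≤ ρ) :
    IsClosed (enlargement C ρ) := by
  rw [enlargement, ← hC.cthickening_eq_biUnion_closedBall hρ]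
  exact isClosed_cthickening

lemma isClosed_near {g : ℝ → Plane} {a b ρ : ℝ} (hg : ContinuousOn g (Icc a b)) (hρ : 0 ≤ ρ) :
    IsClosed {y | ∃ s ∈ Icc a b, dist y (g s) ≤ ρ} := by
  convert isClosed_enlargement (isCompact_Icc.image_of_continuousOn hg) hρ using 1
  ext y
  simp [mem_enlargement]

/-- On a nearly straight piece `g s` is within 2κ of a point of the chord from `g u` to `g v`, and
balls are convex. -/
lemma dist_le_of_between {g : ℝ → Plane} {τ y : Plane} {u v s ρ κ : ℝ} (hs : s ∈ Icc u v)
    (hflat : ∀ w ∈ Icc u v, ‖g w - g u - (w - u) • τ‖ ≤ κ) (hu : dist y (g u) ≤ ρ)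
    (hv : dist y (g v) ≤ ρ) : dist y (g s) ≤ ρ + 2 * κ := by
  have hκ : 0 ≤ κ := (norm_nonneg _).trans (hflat s hs)
  rcases eq_or_lt_of_le (hs.1.trans hs.2) with rfl | huv
  · rw [le_antisymm hs.2 hs.1]; linarith
  set l := (s - u) / (v - u) with hl
  have huv' : 0 < v - u := by linarith
  have hl0 : 0 ≤ l := div_nonneg (by linarith [hs.1]) huv'.le
  have hl1 : l ≤ 1 := (div_le_one huv').2 (by linarith [hs.2])
  have hm : AffineMap.lineMap (g u) (g v) l ∈ closedBall y ρ := by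
    refine (convex_closedBall y ρ).segment_subset
      (show g u ∈ closedBall y ρ by rwa [mem_closedBall, dist_comm])
      (show g v ∈ closedBall y ρ by rwa [mem_closedBall, dist_comm]) ?_
    rw [segment_eq_image_lineMap]; exact ⟨l, ⟨hl0, hl1⟩, rfl⟩
  have h1 : dist (AffineMap.lineMap (g u) (g v) l) (g s) ≤ 2 * κ := by
    rw [dist_eq_norm, norm_sub_rev, AffineMap.lineMap_apply_module]
    have hls : (s - u) • τ = (l * (v - u)) • τ := by rw [hl, div_mul_cancel₀ _ huv'.ne']
    have e : g s - ((1 - l) • g u + l • g v) =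
        (g s - g u - (s - u) • τ) - l • (g v - g u - (v - u) • τ) := by
      rw [hls, mul_smul]
      module
    rw [e]
    refine (norm_sub_le _ _).trans ?_
    rw [norm_smul, Real.norm_eq_abs, abs_of_nonneg hl0]
    have h2 := hflat s hs
    have h3 := hflat v ⟨huv.le, le_rfl⟩
    nlinarith [norm_nonneg (g v - g u - (v - u) • τ)]
  have := dist_triangle y (AffineMap.lineMap (g u) (g v) l) (g s)
  rw [mem_closedBall, dist_comm] at hm
  linarith

lemma Core.pathDist_curve_le {Γ H Z : Set Plane} {yh : Plane} {r ε : ℝ}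
    (h : Core Γ H Z yh r ε) {e y : Plane} (he : e ∈ Γ) (hy : y ∈ H) (hd : dist y e ≤ 5000 * ε) :
    pathDist H y e ≤ ENNReal.ofReal (dist y e) :=
  pathDist_le_of_segment (h.segment_curve_subset he hy hd)

/-- In the estimator, nearby points are joined by short paths. -/
lemma Core.exists_pathDist_le {Γ H Z : Set Plane} {yh : Plane} {r ε : ℝ}
    (h : Core Γ H Z yh r ε) {δ : ℝ} (hδ : 0 < δ) :
    ∃ ρ > 0, ∀ x ∈ H, ∀ x' ∈ H, dist x x' ≤ ρ → pathDist H x x' ≤ ENNReal.ofReal δ := by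
  have hε := h.ε_pos
  obtain ⟨l, hl, hlδ⟩ : ∃ l ∈ Ioc (0 : ℝ) 1, l * (10000 * ε) ≤ δ / 2 := by
    refine ⟨min 1 (δ / 2 / (10000 * ε)), ⟨by positivity, min_le_left _ _⟩, ?_⟩
    rw [← le_div_iff₀ (by positivity)]
    exact min_le_right _ _
  have hl' := Ioc_subset_Icc_self hl
  refine ⟨min (δ / 2) (min ε (l * ε / 2)), by have := hl.1; positivity, fun x hx x' hx' hd => ?_⟩
  have hd1 : dist x x' ≤ δ / 2 := hd.trans (min_le_left _ _)
  have hd2 : dist x x' ≤ l * ε / 2 := hd.trans ((min_le_right _ _).trans (min_le_right _ _))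
  have hd3 : dist x x' ≤ ε := hd.trans ((min_le_right _ _).trans (min_le_left _ _))
  obtain ⟨e, he, hde⟩ := h.near x hx
  have hxe : dist x e ≤ 5000 * ε := by linarith
  have hxe' : dist x' e ≤ 5000 * ε := by
    have := dist_triangle_left x' e x
    linarith
  have hll : dist (AffineMap.lineMap x e l) (AffineMap.lineMap x' e l) ≤ dist x x' := by
    rw [dist_eq_norm, AffineMap.lineMap_apply_module, AffineMap.lineMap_apply_module,
      add_sub_add_right_eq_sub, ← smul_sub, norm_smul, dist_eq_norm x x', Real.norm_eq_abs,
      abs_of_nonneg (by linarith [hl.2])]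
    nlinarith [norm_nonneg (x - x'), hl.1]
  have hsub : ∀ x ∈ H, dist x e ≤ 5000 * ε →
      pathDist H x (AffineMap.lineMap x e l) ≤ ENNReal.ofReal (l * (5000 * ε)) := by
    intro x hx hxe
    refine (pathDist_le_of_segment fun w hw => h.segment_curve_subset he hx hxe ?_).trans
      (ENNReal.ofReal_le_ofReal ?_)
    · refine (convex_segment x e).segment_subset (left_mem_segment ℝ x e) ?_ hw
      rw [segment_eq_image_lineMap]; exact ⟨l, hl', rfl⟩
    · rw [dist_left_lineMap, Real.norm_eq_abs, abs_of_pos hl.1]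
      have := hl.1
      gcongr
  calc pathDist H x x'
      ≤ pathDist H x (AffineMap.lineMap x e l) +
        (pathDist H (AffineMap.lineMap x e l) (AffineMap.lineMap x' e l) +
          pathDist H (AffineMap.lineMap x' e l) x') :=
        (pathDist_triangle _ _ _ _).trans (add_le_add le_rfl (pathDist_triangle _ _ _ _))
    _ ≤ ENNReal.ofReal (l * (5000 * ε)) + (ENNReal.ofReal (δ / 2) +
          ENNReal.ofReal (l * (5000 * ε))) := by
        refine add_le_add (hsub x hx hxe) (add_le_add ?_ ?_)
        · refine (pathDist_le_of_segment fun w hw => h.hull_curve he hx hxe hl' ?_).trans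
            (ENNReal.ofReal_le_ofReal (hll.trans hd1))
          rw [dist_comm]
          exact (dist_le_of_mem_segment hw).trans (hll.trans hd2)
        · rw [pathDist_comm]
          exact hsub x' hx' hxe'
    _ = ENNReal.ofReal (l * (5000 * ε) + (δ / 2 + l * (5000 * ε))) := by
        have := hl.1
        rw [← ENNReal.ofReal_add (by positivity) (by positivity),
          ← ENNReal.ofReal_add (by positivity) (by positivity)]
    _ ≤ ENNReal.ofReal δ := ENNReal.ofReal_le_ofReal (by linarith)

/-- `h₁` and `h₂` make the path distance continuous on M₁ × M₂ for the Euclidean metric; compactness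
gives the maximum. -/
lemma exists_max_pathDist {K M₁ M₂ : Set Plane} (hM₁ : IsCompact M₁) (hM₂ : IsCompact M₂)
    (hn₁ : M₁.Nonempty) (hn₂ : M₂.Nonempty)
    (hfin : ∀ x ∈ M₁, ∀ z ∈ M₂, pathDist K x z ≠ ∞)
    (h₁ : ∀ δ > 0, ∃ ρ > 0, ∀ x ∈ M₁, ∀ x' ∈ M₁, dist x x' ≤ ρ →
      pathDist K x x' ≤ ENNReal.ofReal δ)
    (h₂ : ∀ δ > 0, ∃ ρ > 0, ∀ x ∈ M₂, ∀ x' ∈ M₂, dist x x' ≤ ρ →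
      pathDist K x x' ≤ ENNReal.ofReal δ) :
    ∃ x ∈ M₁, ∃ z ∈ M₂, ∀ x' ∈ M₁, ∀ z' ∈ M₂, pathDist K x' z' ≤ pathDist K x z := by
  have hcont : ContinuousOn (fun w : Plane × Plane => (pathDist K w.1 w.2).toReal) (M₁ ×ˢ M₂) := by
    rw [Metric.continuousOn_iff]
    rintro ⟨x, z⟩ ⟨hx, hz⟩ δ hδ
    obtain ⟨ρ₁, hρ₁, h1⟩ := h₁ (δ / 4) (by positivity)
    obtain ⟨ρ₂, hρ₂, h2⟩ := h₂ (δ / 4) (by positivity)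
    refine ⟨min ρ₁ ρ₂, lt_min hρ₁ hρ₂, ?_⟩
    rintro ⟨x', z'⟩ ⟨hx', hz'⟩ hd
    simp only at hx hz hx' hz' ⊢
    rw [Prod.dist_eq, max_lt_iff] at hd
    have hdx := h1 x' hx' x hx (hd.1.le.trans (min_le_left _ _))
    have hdz := h2 z' hz' z hz (hd.2.le.trans (min_le_right _ _))
    have key : ∀ x z x' z', pathDist K x z ≠ ∞ → pathDist K x' x ≤ ENNReal.ofReal (δ / 4) →
        pathDist K z' z ≤ ENNReal.ofReal (δ / 4) →
        (pathDist K x' z').toReal ≤ (pathDist K x z).toReal + δ / 2 := by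
      intro x z x' z' hf hx hz
      have : pathDist K x' z' ≤ pathDist K x z + ENNReal.ofReal (δ / 2) := by
        calc pathDist K x' z' ≤ pathDist K x' x + (pathDist K x z + pathDist K z z') :=
              (pathDist_triangle _ _ _ _).trans (add_le_add le_rfl (pathDist_triangle _ _ _ _))
          _ ≤ ENNReal.ofReal (δ / 4) + (pathDist K x z + ENNReal.ofReal (δ / 4)) := by
              rw [pathDist_comm K z]; gcongr
          _ = pathDist K x z + (ENNReal.ofReal (δ / 4) + ENNReal.ofReal (δ / 4)) := by ring
          _ = _ := by
              rw [← ENNReal.ofReal_add (by positivity) (by positivity)]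
              congr 2; ring
      have h3 := ENNReal.toReal_mono (ENNReal.add_ne_top.2 ⟨hf, ENNReal.ofReal_ne_top⟩) this
      rwa [ENNReal.toReal_add hf ENNReal.ofReal_ne_top, ENNReal.toReal_ofReal (by positivity)]
        at h3
    have k1 := key x z x' z' (hfin x hx z hz) hdx hdz
    have k2 := key x' z' x z (hfin x' hx' z' hz') (by rwa [pathDist_comm]) (by rwa [pathDist_comm])
    rw [Real.dist_eq, abs_lt]
    constructor <;> linarith
  obtain ⟨⟨x, z⟩, ⟨hx, hz⟩, hmax⟩ := (hM₁.prod hM₂).exists_isMaxOn (hn₁.prod hn₂) hcont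
  refine ⟨x, hx, z, hz, fun x' hx' z' hz' => ?_⟩
  exact (ENNReal.toReal_le_toReal (hfin x' hx' z' hz') (hfin x hx z hz)).1
    (hmax (show (x', z') ∈ M₁ ×ˢ M₂ from ⟨hx', hz'⟩))

namespace OpenCurve

variable {Γ H Z : Set Plane} {yh : Plane} {r ε : ℝ} {g T : ℝ → Plane} {L σ : ℝ}

lemma mem (h : OpenCurve Γ g T L σ) {s : ℝ} (hs : s ∈ Icc 0 L) : g s ∈ Γ := by
  rw [h.image]; exact ⟨s, hs, rfl⟩

lemma exists_near (h : OpenCurve Γ g T L σ) (hc : Core Γ H Z yh r ε) {y : Plane} (hy : y ∈ H) :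
    ∃ s ∈ Icc 0 L, dist y (g s) ≤ 3 * ε := by
  obtain ⟨e, he, hd⟩ := hc.near y hy
  rw [h.image] at he
  obtain ⟨s, hs, rfl⟩ := he
  exact ⟨s, hs, hd⟩

lemma pathDist_le (h : OpenCurve Γ g T L σ) {K : Set Plane} {s t : ℝ} (hs : 0 ≤ s) (hst : s ≤ t)
    (ht : t ≤ L) (hK : MapsTo g (Icc s t) K) :
    pathDist K (g s) (g t) ≤ ENNReal.ofReal (t - s) := by
  have hl : LipschitzOnWith 1 g (Icc s t) := LipschitzOnWith.of_dist_le_mul fun u hu v hv => by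
    rw [dist_comm, dist_eq_norm, dist_comm, Real.dist_eq]
    simpa using h.strand.norm_sub_le (Icc_subset_Icc hs ht hu) (Icc_subset_Icc hs ht hv)
  simpa using pathDist_le_of_lipschitzOn hst hl hK

lemma between (h : OpenCurve Γ g T L σ) (hε : 0 < ε) (hbig : 10 ^ 10 * ε ≤ σ) {u v s ρ : ℝ}
    {y : Plane} (hu0 : 0 ≤ u) (hv0 : v ≤ L) (hs : s ∈ Icc u v) (hl : v - u ≤ 1000 * ε)
    (hu : dist y (g u) ≤ ρ) (hv : dist y (g v) ≤ ρ) : dist y (g s) ≤ ρ + 1 / 100 * ε := by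
  have hσ := h.σ_pos
  have := dist_le_of_between (τ := T u) (κ := 1 / 200 * ε) hs (fun w hw => ?_) hu hv
  · linarith
  · refine (h.flat ⟨hu0, by linarith [hs.1, hs.2]⟩ ⟨hu0.trans hw.1, hw.2.trans hv0⟩ ?_).trans ?_
    · rw [abs_of_nonneg (by linarith [hw.1])]; linarith [hw.2]
    · rw [div_le_iff₀ hσ]
      have h1 : (w - u) ^ 2 ≤ (1000 * ε) ^ 2 :=
        pow_le_pow_left₀ (by linarith [hw.1]) (by linarith [hw.2]) 2
      nlinarith

lemma arc_le_of_dist (h : OpenCurve Γ g T L σ) (hε : 0 < ε) (hbig : 10 ^ 10 * ε ≤ σ) {u v ρ : ℝ}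
    (hu : u ∈ Icc 0 L) (hv : v ∈ Icc 0 L) (hρ : ρ ≤ 10 ^ 10) (hd : dist (g u) (g v) ≤ ρ * ε) :
    |u - v| ≤ 2 * ρ * ε := by
  have hle : ρ * ε ≤ σ := by nlinarith
  rw [dist_eq_norm] at hd
  rcases le_total u v with huv | huv
  · rw [norm_sub_rev] at hd
    rw [abs_of_nonpos (by linarith)]
    linarith [h.arc_le hu.1 hv.2 huv (by linarith)]
  · rw [abs_of_nonneg (by linarith)]
    linarith [h.arc_le hv.1 hu.2 huv (by linarith)]

/-- A connected subset of the estimator covers the part of the curve between the positions of two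
of its points. -/
lemma cover (h : OpenCurve Γ g T L σ) (hc : Core Γ H Z yh r ε) (hbig : 10 ^ 10 * ε ≤ σ)
    {P : Set Plane} (hP : P ⊆ H) (hPc : IsPreconnected P) {x z : Plane} (hx : x ∈ P) (hz : z ∈ P)
    {a b s : ℝ} (ha : 0 ≤ a) (hb : b ≤ L) (hxa : dist x (g a) ≤ 3 * ε)
    (hzb : dist z (g b) ≤ 3 * ε) (hs : s ∈ Icc a b) : ∃ c ∈ P, dist c (g s) ≤ 31 / 10 * ε := by
  have hε := hc.ε_pos
  have hs0 : s ∈ Icc 0 L := ⟨ha.trans hs.1, hs.2.trans hb⟩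
  have hcl : ∀ a b, 0 ≤ a → b ≤ L → IsClosed {y | ∃ s ∈ Icc a b, dist y (g s) ≤ 3 * ε} :=
    fun a b ha hb => isClosed_near (h.strand.continuousOn.mono (Icc_subset_Icc ha hb))
      (by positivity)
  -- The points near the curve before `s` and those near the curve after `s` form two closed sets
  -- that cover `P`. A common point is near `g u` and `g v` with u ≤ s ≤ v, hence near `g s`.
  obtain ⟨c, hcP, ⟨u, hu, hcu⟩, v, hv, hcv⟩ := isPreconnected_closed_iff.1 hPc _ _
    (hcl 0 s le_rfl hs0.2) (hcl s L hs0.1 le_rfl)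
    (fun y hy => by
      obtain ⟨w, hw, hd⟩ := h.exists_near hc (hP hy)
      rcases le_total w s with hws | hws
      · exact Or.inl ⟨w, ⟨hw.1, hws⟩, hd⟩
      · exact Or.inr ⟨w, ⟨hws, hw.2⟩, hd⟩)
    ⟨x, hx, a, ⟨ha, hs.1⟩, hxa⟩ ⟨z, hz, b, ⟨hs.2, hb⟩, hzb⟩
  have huv : |u - v| ≤ 2 * 6 * ε := h.arc_le_of_dist hε hbig ⟨hu.1, hu.2.trans hs0.2⟩
    ⟨hs0.1.trans hv.1, hv.2⟩ (by norm_num) (by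
      have := dist_triangle_left (g u) (g v) c
      linarith)
  rw [abs_le] at huv
  have := h.between hε hbig hu.1 hv.2 ⟨hu.2, hv.1⟩ (by linarith) hcu hcv
  exact ⟨c, hcP, by linarith⟩

/-- If replacing `x₀` by the initial point of the curve does not increase the distance to `x₁`,
then `x₀` is close to the initial point. -/
lemma near_start (h : OpenCurve Γ g T L σ) (hc : Core Γ H Z yh r ε) (hbig : 10 ^ 10 * ε ≤ σ)
    {K : Set Plane} (hK : K ⊆ H) {x₀ x₁ : Plane} (hx₀ : x₀ ∈ K) {a b : ℝ} (ha : 0 ≤ a)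
    (hab : a ≤ b) (hb : b ≤ L) (hxa : dist x₀ (g a) ≤ 3 * ε) (hxb : dist x₁ (g b) ≤ 3 * ε)
    (hfin : pathDist K (g 0) x₁ ≠ ∞) (hle : pathDist K (g 0) x₁ ≤ pathDist K x₀ x₁)
    (hseg : ∀ w ∈ K, dist w (g a) ≤ 31 / 10 * ε → segment ℝ w (g a) ⊆ K) {s : ℝ}
    (hs : s ∈ Icc 0 a) : dist x₀ (g s) ≤ 13 * ε := by
  have hε := hc.ε_pos
  have haL : a ∈ Icc 0 L := ⟨ha, hab.trans hb⟩
  have h0L : (0 : ℝ) ∈ Icc 0 L := ⟨le_rfl, h.pos.le⟩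
  obtain ⟨w, ⟨hw, hwK⟩, hwle⟩ := exists_crossing_le (W := closedBall (g a) (31 / 10 * ε)) hfin hle
    (fun γ hγ => by
      obtain ⟨c, hc, hd⟩ := h.cover hc hbig (hγ.trans hK) (isPreconnected_range_path γ)
        ⟨0, γ.source⟩ ⟨1, γ.target⟩ le_rfl hb (by rw [dist_self]; positivity) hxb
        (s := a) ⟨ha, hab⟩
      exact ⟨c, hc, hd⟩)
    (δ := 1 / 10 * ε) (by positivity)
  rw [mem_closedBall] at hw
  -- Through the landmark `g a` the distance is at most 3ε + 3.1ε. Together with the slack ε/10, `g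
  -- 0` is within 6.2ε of `w`, hence within 9.3ε of `g a`, and within 12.3ε of `x₀`.
  have h1 : pathDist K x₀ w ≤ ENNReal.ofReal (61 / 10 * ε) := by
    refine (pathDist_triangle K x₀ (g a) w).trans ?_
    rw [pathDist_comm K (g a)]
    refine (add_le_add (pathDist_le_of_segment (hseg x₀ hx₀ (by linarith)))
      (pathDist_le_of_segment (hseg w hwK hw))).trans ?_
    rw [← ENNReal.ofReal_add dist_nonneg dist_nonneg]
    exact ENNReal.ofReal_le_ofReal (by linarith)
  have h2 : dist (g 0) w ≤ 62 / 10 * ε := by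
    have h3 := (edist_le_pathDist K (g 0) w).trans (hwle.trans (add_le_add h1 le_rfl))
    rw [← ENNReal.ofReal_add (by positivity) (by positivity), edist_dist,
      ENNReal.ofReal_le_ofReal_iff (by positivity)] at h3
    linarith
  have h4 := dist_triangle (g 0) w (g a)
  have h5 : |0 - a| ≤ 2 * 10 * ε := h.arc_le_of_dist hε hbig h0L haL (by norm_num) (by linarith)
  rw [zero_sub, abs_neg, abs_of_nonneg ha] at h5
  have h6 := dist_triangle_right x₀ (g 0) (g a)
  have := h.between (y := x₀) (ρ := 123 / 10 * ε) hε hbig le_rfl haL.2 hs (by linarith)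
    (by linarith) (by linarith)
  linarith

lemma near_end (h : OpenCurve Γ g T L σ) (hc : Core Γ H Z yh r ε) (hbig : 10 ^ 10 * ε ≤ σ)
    {K : Set Plane} (hK : K ⊆ H) {x₀ x₁ : Plane} (hx₀ : x₀ ∈ K) {a b : ℝ} (hb : 0 ≤ b)
    (hab : b ≤ a) (ha : a ≤ L) (hxa : dist x₀ (g a) ≤ 3 * ε) (hxb : dist x₁ (g b) ≤ 3 * ε)
    (hfin : pathDist K (g L) x₁ ≠ ∞) (hle : pathDist K (g L) x₁ ≤ pathDist K x₀ x₁)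
    (hseg : ∀ w ∈ K, dist w (g a) ≤ 31 / 10 * ε → segment ℝ w (g a) ⊆ K) {s : ℝ}
    (hs : s ∈ Icc a L) : dist x₀ (g s) ≤ 13 * ε := by
  have e : ∀ s, L + -1 * (L - s) = s := fun s => by ring
  have := h.reverse.near_start hc hbig hK hx₀ (x₁ := x₁) (a := L - a) (b := L - b)
    (by linarith) (by linarith) (by linarith) (by rwa [e]) (by rwa [e]) (by simpa using hfin)
    (by simpa using hle) (by simpa only [e] using hseg) (s := L - s)
    ⟨by linarith [hs.2], by linarith [hs.1]⟩
  rwa [e] at this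

lemma pathDist_ne_top (h : OpenCurve Γ g T L σ) (hc : Core Γ H Z yh r ε) {x z : Plane}
    (hx : x ∈ H) (hz : z ∈ H) : pathDist H x z ≠ ∞ := by
  have hε := hc.ε_pos
  have key : ∀ x ∈ H, pathDist H x (g 0) ≠ ∞ := by
    intro x hx
    obtain ⟨s, hs, hd⟩ := h.exists_near hc hx
    refine ne_top_of_le_ne_top ?_ (pathDist_triangle H x (g s) (g 0))
    refine ENNReal.add_ne_top.2 ⟨ne_top_of_le_ne_top ENNReal.ofReal_ne_top
      (hc.pathDist_curve_le (h.mem hs) hx (by linarith)), ?_⟩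
    rw [pathDist_comm]
    exact ne_top_of_le_ne_top ENNReal.ofReal_ne_top (h.pathDist_le le_rfl hs.1 hs.2
      fun w hw => hc.curve_subset (h.mem ⟨hw.1, hw.2.trans hs.2⟩))
  refine ne_top_of_le_ne_top (ENNReal.add_ne_top.2 ⟨key x hx, ?_⟩)
    (pathDist_triangle H x (g 0) z)
  rw [pathDist_comm]
  exact key z hz

lemma exists_openOutput (h : OpenCurve Γ g T L σ) (hc : Core Γ H Z yh r ε) :
    ∃ C, OpenOutput H C := by
  have hne : H.Nonempty := ⟨yh, hc.center_mem⟩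
  obtain ⟨x, hx, z, hz, hmax⟩ := exists_max_pathDist hc.isCompact hc.isCompact hne hne
    (fun x hx z hz => h.pathDist_ne_top hc hx hz) (fun δ hδ => hc.exists_pathDist_le hδ)
    (fun δ hδ => hc.exists_pathDist_le hδ)
  have hfin := h.pathDist_ne_top hc hx hz
  obtain ⟨γ, hγ⟩ := exists_path_of_pathDist_ne_top hfin
  exact ⟨range γ, x, z, γ, ⟨⟨⟨hx, mem_univ _⟩, ⟨hz, mem_univ _⟩, hfin,
    fun u hu v hv _ => hmax u hu.1 v hv.1⟩, hγ⟩, rfl⟩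

/-- A connected set that joins a maximising pair covers the whole curve. -/
lemma cover_of_isEndpointPair (h : OpenCurve Γ g T L σ) (hc : Core Γ H Z yh r ε)
    (hbig : 10 ^ 10 * ε ≤ σ) {x₀ x₁ : Plane} (hpair : IsEndpointPair H univ univ x₀ x₁)
    {P : Set Plane} (hP : P ⊆ H) (hPc : IsPreconnected P) (h₀ : x₀ ∈ P) (h₁ : x₁ ∈ P) {s : ℝ}
    (hs : s ∈ Icc 0 L) : ∃ c ∈ P, dist c (g s) ≤ 13 * ε := by
  have hε := hc.ε_pos
  obtain ⟨a, ha, hxa⟩ := h.exists_near hc (hP h₀)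
  obtain ⟨b, hb, hxb⟩ := h.exists_near hc (hP h₁)
  wlog hab : a ≤ b generalizing x₀ x₁ a b
  · exact this hpair.symm h₁ h₀ b hb hxb a ha hxa (le_of_not_ge hab)
  have hseg : ∀ a ∈ Icc 0 L, ∀ w ∈ H, dist w (g a) ≤ 31 / 10 * ε → segment ℝ w (g a) ⊆ H :=
    fun a ha w hw hd => hc.segment_curve_subset (h.mem ha) hw (by linarith)
  have h0 : g 0 ∈ H := hc.curve_subset (h.mem ⟨le_rfl, h.pos.le⟩)
  have hL : g L ∈ H := hc.curve_subset (h.mem ⟨h.pos.le, le_rfl⟩)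
  -- Outside [a, b] the optimality of the end points is used, between them connectedness.
  rcases le_total s a with hsa | hsa
  · exact ⟨x₀, h₀, h.near_start hc hbig Subset.rfl (hP h₀) ha.1 hab hb.2 hxa hxb
      (h.pathDist_ne_top hc h0 (hP h₁)) (hpair.maximal _ ⟨h0, mem_univ _⟩ _ hpair.right_mem
        (h.pathDist_ne_top hc h0 (hP h₁))) (hseg a ha) ⟨hs.1, hsa⟩⟩
  rcases le_total s b with hsb | hsb
  · obtain ⟨c, hcP, hd⟩ := h.cover hc hbig hP hPc h₀ h₁ ha.1 hb.2 hxa hxb ⟨hsa, hsb⟩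
    exact ⟨c, hcP, by linarith⟩
  · exact ⟨x₁, h₁, h.near_end hc hbig Subset.rfl (hP h₁) ha.1 hab hb.2 hxb hxa
      (h.pathDist_ne_top hc hL (hP h₀)) (hpair.symm.maximal _ ⟨hL, mem_univ _⟩ _ hpair.left_mem
        (h.pathDist_ne_top hc hL (hP h₀))) (hseg b hb) ⟨hsb, hs.2⟩⟩

end OpenCurve

/-- Two sets are within Hausdorff distance `ρ` of each other if one is within distance `ρ` of the
other and conversely. -/
lemma hausdorffDist_le_of_near {Γ H Z C : Set Plane} {yh : Plane} {r ε η ρ : ℝ}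
    (hc : Core Γ H Z yh r ε) (hη : η ≤ 1) (hρ : 4 * ε ≤ ρ)
    (hC : C ⊆ H ∪ cutSet H yh ε (η * ε)) (hΓ : ∀ e ∈ Γ, ∃ c ∈ C, dist c e ≤ ρ) :
    hausdorffDist C Γ ≤ ρ := by
  have hε := hc.ε_pos
  refine hausdorffDist_le_of_mem_dist (by linarith) (fun c hcC => ?_) fun e he => ?_
  · rcases hC hcC with hcH | hcA
    · obtain ⟨e, he, hd⟩ := hc.near c hcH
      exact ⟨e, he, by linarith⟩
    · obtain ⟨b, hb, hd⟩ := mem_enlargement.1 hcA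
      obtain ⟨e, he, hd'⟩ := hc.near b hb.2
      refine ⟨e, he, (dist_triangle c b e).trans ?_⟩
      nlinarith
  · obtain ⟨c, hcC, hd⟩ := hΓ e he
    exact ⟨c, hcC, by rwa [dist_comm]⟩


/-! ### The general-curve algorithm on an open curve -/

lemma chart_param_le {yh τ p q : Plane} {ε d : ℝ} (hε : 0 < ε) (hτ : ‖τ‖ = 1)
    (h : ‖q - p - d • τ‖ ≤ 1 / 100 * ε) :
    |ε⁻¹ * inner ℝ τ (q - yh) - ε⁻¹ * inner ℝ τ (p - yh) - d / ε| ≤ 1 / 100 ∧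
      |ε⁻¹ * cross τ (q - yh) - ε⁻¹ * cross τ (p - yh)| ≤ 1 / 100 := by
  have h1 : τ 0 ^ 2 + τ 1 ^ 2 = 1 := by rw [← norm_sq_coord, hτ]; norm_num
  have e1 : ε⁻¹ * inner ℝ τ (q - yh) - ε⁻¹ * inner ℝ τ (p - yh) - d / ε =
      ε⁻¹ * inner ℝ τ (q - p - d • τ) := by
    simp only [inner_coord, PiLp.sub_apply, PiLp.smul_apply, smul_eq_mul]
    field_simp
    linear_combination d * h1
  have e2 : ε⁻¹ * cross τ (q - yh) - ε⁻¹ * cross τ (p - yh) = ε⁻¹ * cross τ (q - p - d • τ) := by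
    simp only [cross, PiLp.sub_apply, PiLp.smul_apply, smul_eq_mul]
    ring
  rw [e1, e2, abs_mul, abs_mul, abs_of_pos (inv_pos.2 hε), inv_mul_le_iff₀ hε, inv_mul_le_iff₀ hε]
  have h2 := abs_real_inner_le_norm τ (q - p - d • τ)
  have h3 := abs_cross_le τ (q - p - d • τ)
  rw [hτ, one_mul] at h2 h3
  constructor <;> linarith

/-- The estimator of an open curve with a chart at the centre in which the curve, near its
parameter `s₀`, runs from left to right. -/
structure OpenLoc (Γ H Z : Set Plane) (yh : Plane) (r ε : ℝ) (g T : ℝ → Plane) (L σ s₀ : ℝ)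
    (X Y : Plane → ℝ) (t : ℝ) : Prop where
  loc : Loc Γ H Z yh r ε X Y t
  curve : OpenCurve Γ g T L σ
  big : 10 ^ 10 * ε ≤ σ
  mem : s₀ ∈ Icc 0 L
  near : dist (g s₀) yh ≤ ε
  par : ∀ s ∈ Icc 0 L, |s - s₀| ≤ 5100 * ε → |X (g s) - X (g s₀) - (s - s₀) / ε| ≤ 1 / 100

lemma OpenCurve.exists_openLoc {Γ H Z : Set Plane} {yh : Plane} {r ε : ℝ} {g T : ℝ → Plane}
    {L σ : ℝ} (h : OpenCurve Γ g T L σ) (hc : Core Γ H Z yh r ε) (hbig : 10 ^ 10 * ε ≤ σ) :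
    ∃ s₀ X Y t, OpenLoc Γ H Z yh r ε g T L σ s₀ X Y t := by
  have hε := hc.ε_pos
  obtain ⟨e, he, hd⟩ := hc.near_center
  have he' := he
  rw [h.image] at he'
  obtain ⟨s₀, hs₀, rfl⟩ := he'
  have hτ := h.strand.unit s₀ hs₀
  have hpar : ∀ s ∈ Icc 0 L, |s - s₀| ≤ 5100 * ε →
      ‖g s - g s₀ - (s - s₀) • T s₀‖ ≤ 1 / 100 * ε := by
    intro s hs hl
    refine (h.flat hs₀ hs (by linarith)).trans ?_
    rw [div_le_iff₀ h.σ_pos, ← sq_abs]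
    have : |s - s₀| ^ 2 ≤ (5100 * ε) ^ 2 := by gcongr
    nlinarith
  have hch := exists_chart (yh := yh) hε hτ
  refine ⟨s₀, _, _, ε⁻¹ * cross (T s₀) (g s₀ - yh), ⟨⟨hc, hch, ?_, ?_⟩, h, hbig, hs₀,
    by rwa [dist_comm], fun s hs hl => (chart_param_le hε hτ (hpar s hs hl)).1⟩⟩
  · have := hch.abs_Y_sub_le (p := g s₀) (q := yh) (ρ := 1) (by rw [dist_comm]; linarith)
    rw [hch.Y_center, sub_zero] at this
    linarith
  · intro e he hed
    rw [h.image] at he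
    obtain ⟨s, hs, rfl⟩ := he
    have := h.arc_le_of_dist hε hbig hs hs₀ (ρ := 2501) (by norm_num) (by
      have := dist_triangle (g s) yh (g s₀)
      linarith)
    exact (chart_param_le hε hτ (hpar s hs (by linarith))).2

/-- The points near the centre with nonnegative first coordinate, and the other points near the
part of the curve over `[a, b]`. -/
def OnSide (g : ℝ → Plane) (yh : Plane) (ε : ℝ) (X : Plane → ℝ) (a b : ℝ) (y : Plane) : Prop :=
  (dist y yh ≤ 100 * ε ∧ 0 ≤ X y) ∨ (100 * ε ≤ dist y yh ∧ ∃ s ∈ Icc a b, dist y (g s) ≤ 3 * ε)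

lemma isClosed_onSide {g : ℝ → Plane} {yh : Plane} {ε : ℝ} {X : Plane → ℝ} {a b : ℝ}
    (hε : 0 ≤ ε) (hX : Continuous X) (hg : ContinuousOn g (Icc a b)) :
    IsClosed {y | OnSide g yh ε X a b y} := by
  unfold OnSide
  rw [ofPred_or, ofPred_and, ofPred_and]
  exact ((isClosed_le (by fun_prop) (by fun_prop)).inter (isClosed_le continuous_const hX)).union
    ((isClosed_le (by fun_prop) (by fun_prop)).inter (isClosed_near hg (by positivity)))

lemma onSide_reverse {g : ℝ → Plane} {yh : Plane} {ε L : ℝ} {X : Plane → ℝ} {a b a' b' : ℝ}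
    (ha : a' = L - b) (hb : b' = L - a) (y : Plane) :
    OnSide (fun s => g (L + -1 * s)) yh ε X a' b' y ↔ OnSide g yh ε X a b y := by
  subst ha hb
  unfold OnSide
  refine or_congr Iff.rfl (and_congr Iff.rfl ⟨?_, ?_⟩)
  · rintro ⟨s, hs, hd⟩
    exact ⟨L + -1 * s, ⟨by linarith [hs.2], by linarith [hs.1]⟩, hd⟩
  · rintro ⟨s, hs, hd⟩
    refine ⟨L - s, ⟨by linarith [hs.2], by linarith [hs.1]⟩, ?_⟩
    have e : L + -1 * (L - s) = s := by ring
    show dist y (g (L + -1 * (L - s))) ≤ 3 * ε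
    rwa [e]

namespace OpenLoc

variable {Γ H Z : Set Plane} {yh : Plane} {r ε : ℝ} {g T : ℝ → Plane} {L σ s₀ : ℝ}
  {X Y : Plane → ℝ} {t η : ℝ}

lemma reverse (h : OpenLoc Γ H Z yh r ε g T L σ s₀ X Y t) :
    OpenLoc Γ H Z yh r ε (fun s => g (L + -1 * s)) (fun s => (-1 : ℝ) • T (L + -1 * s)) L σ
      (L - s₀) (fun p => -X p) Y t where
  loc := h.loc.negX
  curve := h.curve.reverse
  big := h.big
  mem := ⟨by linarith [h.mem.2], by linarith [h.mem.1]⟩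
  near := by
    have e : L + -1 * (L - s₀) = s₀ := by ring
    rw [e]; exact h.near
  par s hs hl := by
    have e : L + -1 * (L - s₀) = s₀ := by ring
    have := h.par (L + -1 * s) ⟨by linarith [hs.2], by linarith [hs.1]⟩ (by
      rw [← abs_neg]; convert hl using 2; ring)
    rw [e, ← abs_neg]
    convert this using 2
    ring

lemma eps_pos (h : OpenLoc Γ H Z yh r ε g T L σ s₀ X Y t) : 0 < ε := h.loc.core.ε_pos

lemma abs_X_start (h : OpenLoc Γ H Z yh r ε g T L σ s₀ X Y t) : |X (g s₀)| ≤ 1 :=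
  h.loc.abs_X_le (by linarith [h.near])

lemma par_of_dist (h : OpenLoc Γ H Z yh r ε g T L σ s₀ X Y t) {s : ℝ} (hs : s ∈ Icc 0 L)
    (hd : dist (g s) yh ≤ 2400 * ε) : |X (g s) - X (g s₀) - (s - s₀) / ε| ≤ 1 / 100 := by
  refine h.par s hs ?_
  have := h.curve.arc_le_of_dist h.eps_pos h.big hs h.mem (ρ := 2401) (by norm_num) (by
    have := dist_triangle_right (g s) (g s₀) yh
    linarith [h.near])
  linarith [h.eps_pos]

lemma isClosed_right (h : OpenLoc Γ H Z yh r ε g T L σ s₀ X Y t) :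
    IsClosed {y | OnSide g yh ε X s₀ L y} :=
  isClosed_onSide h.eps_pos.le h.loc.chart.continuous_X
    (h.curve.strand.continuousOn.mono (Icc_subset_Icc h.mem.1 le_rfl))

lemma isClosed_left (h : OpenLoc Γ H Z yh r ε g T L σ s₀ X Y t) :
    IsClosed {y | OnSide g yh ε (fun p => -X p) 0 s₀ y} :=
  isClosed_onSide h.eps_pos.le h.loc.chart.continuous_X.neg
    (h.curve.strand.continuousOn.mono (Icc_subset_Icc le_rfl h.mem.2))

lemma right_or_left (h : OpenLoc Γ H Z yh r ε g T L σ s₀ X Y t) {y : Plane} (hy : y ∈ H) :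
    OnSide g yh ε X s₀ L y ∨ OnSide g yh ε (fun p => -X p) 0 s₀ y := by
  rcases le_total (dist y yh) (100 * ε) with hd | hd
  · rcases le_total 0 (X y) with h0 | h0
    · exact Or.inl (Or.inl ⟨hd, h0⟩)
    · exact Or.inr (Or.inl ⟨hd, by linarith⟩)
  · obtain ⟨s, hs, hds⟩ := h.curve.exists_near h.loc.core hy
    rcases le_total s s₀ with h0 | h0
    · exact Or.inr (Or.inr ⟨hd, s, ⟨hs.1, h0⟩, hds⟩)
    · exact Or.inl (Or.inr ⟨hd, s, ⟨h0, hs.2⟩, hds⟩)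

/-- On the circle of radius 100 ε the two clauses of `OnSide` agree: the height is bounded by the
strip, so |X| is large there and its sign tells on which part of the curve the point is. -/
lemma X_neg_of_near (h : OpenLoc Γ H Z yh r ε g T L σ s₀ X Y t) {y : Plane} (hy : y ∈ H)
    (hd : dist y yh = 100 * ε) {s : ℝ} (hs : s ∈ Icc 0 s₀) (hys : dist y (g s) ≤ 3 * ε) :
    X y < 0 := by
  have hε := h.eps_pos
  have h1 := h.par_of_dist ⟨hs.1, hs.2.trans h.mem.2⟩ (by
    have := dist_triangle_left (g s) yh y
    linarith)
  have h2 := abs_le.1 (h.loc.chart.abs_X_sub_le hys)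
  have h3 : (s - s₀) / ε ≤ 0 := div_nonpos_of_nonpos_of_nonneg (by linarith [hs.2]) hε.le
  have h4 := abs_le.1 h.abs_X_start
  have h5 := h.loc.dist_center_le y
  have h6 := h.loc.abs_Y_le hy (by linarith)
  by_contra! hX
  rw [abs_of_nonneg hX] at h5
  rw [abs_le] at h1
  nlinarith

/-- Inside the disc a common point has X = 0 and is cut away. Outside it would be near `g u` and `g
v` with v ≤ s₀ ≤ u and u − v ≤ 12ε, hence close to the centre. -/
lemma not_right_and_left (h : OpenLoc Γ H Z yh r ε g T L σ s₀ X Y t) (hη : 0 < η)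
    (hη1 : η ≤ 1 / 10 ^ 8) {y : Plane} (hy : y ∈ closure (H \ cutSet H yh ε (η * ε)))
    (hR : OnSide g yh ε X s₀ L y) (hL : OnSide g yh ε (fun p => -X p) 0 s₀ y) : False := by
  have hε := h.eps_pos
  have hyH := mem_of_mem_closure h.loc.core.isClosed hy
  rcases hR with ⟨hd, h0⟩ | ⟨hd, u, hu, hyu⟩
  · rcases hL with ⟨-, h0'⟩ | ⟨hd', s, hs, hys⟩
    · have := h.loc.le_abs_X hη (by linarith) hyH (by linarith) (clears_of_mem_closure hy)
      rw [le_antisymm (by linarith) h0, abs_zero] at this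
      linarith
    · linarith [h.X_neg_of_near hyH (le_antisymm hd hd') hs hys]
  · rcases hL with ⟨hd', h0⟩ | ⟨hd', v, hv, hyv⟩
    · have e : L + -1 * (L - u) = u := by ring
      have := h.reverse.X_neg_of_near hyH (le_antisymm hd' hd) (s := L - u)
        ⟨by linarith [hu.2], by linarith [hu.1]⟩ (by rwa [e])
      linarith
    · have huv := h.curve.arc_le_of_dist hε h.big ⟨h.mem.1.trans hu.1, hu.2⟩
        ⟨hv.1, hv.2.trans h.mem.2⟩ (ρ := 6) (by norm_num) (by
          have := dist_triangle_left (g u) (g v) y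
          linarith)
      rw [abs_le] at huv
      have h1 := h.curve.strand.norm_sub_le h.mem ⟨h.mem.1.trans hu.1, hu.2⟩
      rw [abs_of_nonneg (by linarith [hu.1]), ← dist_eq_norm] at h1
      have h2 := dist_triangle4 y (g u) (g s₀) yh
      linarith [h.near, hv.2]

lemma right_of_isPreconnected (h : OpenLoc Γ H Z yh r ε g T L σ s₀ X Y t) (hη : 0 < η)
    (hη1 : η ≤ 1 / 10 ^ 8) {P : Set Plane} (hP : P ⊆ closure (H \ cutSet H yh ε (η * ε)))
    (hPc : IsPreconnected P) {p p' : Plane} (hp : p ∈ P) (hp' : p' ∈ P)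
    (hR : OnSide g yh ε X s₀ L p) : OnSide g yh ε X s₀ L p' := by
  by_contra hn
  have hL := (h.right_or_left (mem_of_mem_closure h.loc.core.isClosed (hP hp'))).resolve_left hn
  obtain ⟨y, hyP, h1, h2⟩ := isPreconnected_closed_iff.1 hPc _ _ h.isClosed_right h.isClosed_left
    (fun y hy => h.right_or_left (mem_of_mem_closure h.loc.core.isClosed (hP hy)))
    ⟨p, hp, hR⟩ ⟨p', hp', hL⟩
  exact h.not_right_and_left hη hη1 (hP hyP) h1 h2

/-- The distance from a point of the main part to a point of the curve somewhat further right. -/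
lemma dist_le_of_X (h : OpenLoc Γ H Z yh r ε g T L σ s₀ X Y t) (hη : 0 < η)
    {x e : Plane} (hx : x ∈ closure (H \ cutSet H yh ε (η * ε)))
    (hd : dist x yh ≤ 2400 * ε) (hX : 0 < X x) (hX1 : X x ≤ 61 / 10) (he : e ∈ Γ)
    (hed : dist e yh ≤ 2400 * ε) (heX : X e ∈ Icc (751 / 100) (753 / 100)) :
    dist x e ≤ 153 / 20 * ε := by
  have hxH := mem_of_mem_closure h.loc.core.isClosed hx
  have h1 := h.loc.slope_lt hη hxH hd (clears_of_mem_closure hx)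
  have h2 := abs_le.1 (h.loc.strip hxH hd)
  have h3 := abs_le.1 (h.loc.flat e he (by linarith [h.eps_pos]))
  have h4 := abs_le.1 (h.loc.curve_Y he (by linarith [h.eps_pos]))
  rw [abs_of_pos hX] at h1
  have h5 := abs_lt.1 (show |Y x| < 4 / 3 * X x by linarith)
  obtain ⟨he1, he2⟩ := heX
  apply h.loc.chart.dist_le (by norm_num)
  rcases le_or_gt (X x) (3 / 2) with hc | hc
  · have h6 : (X x - X e) ^ 2 ≤ (753 / 100 - X x) ^ 2 := by
      rw [← neg_sub, neg_sq]
      exact pow_le_pow_left₀ (by linarith) (by linarith) 2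
    have h7 : (Y x - Y e) ^ 2 ≤ (4 / 3 * X x + 102 / 100) ^ 2 :=
      sq_le_sq' (by linarith) (by linarith)
    nlinarith
  · have h6 : (X x - X e) ^ 2 ≤ (603 / 100) ^ 2 := sq_le_sq' (by linarith) (by linarith)
    have h7 : (Y x - Y e) ^ 2 ≤ (303 / 100) ^ 2 := sq_le_sq' (by linarith) (by linarith)
    nlinarith

lemma dist_le_of_X' (h : OpenLoc Γ H Z yh r ε g T L σ s₀ X Y t) (hη : 0 < η)
    {x e : Plane} (hx : x ∈ closure (H \ cutSet H yh ε (η * ε)))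
    (hd : dist x yh ≤ 2400 * ε) (hX : 0 < X x) (hX1 : X x ≤ 148 / 10) (he : e ∈ Γ)
    (hed : dist e yh ≤ 2400 * ε) (heX : X e ∈ Icc (751 / 100) (753 / 100)) :
    dist x e ≤ 8 * ε := by
  rcases le_or_gt (X x) (61 / 10) with hc | hc
  · linarith [h.dist_le_of_X hη hx hd hX hc he hed heX, h.eps_pos]
  · have h2 := abs_le.1 (h.loc.strip (mem_of_mem_closure h.loc.core.isClosed hx) hd)
    have h3 := abs_le.1 (h.loc.flat e he (by linarith [h.eps_pos]))
    obtain ⟨he1, he2⟩ := heX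
    apply h.loc.chart.dist_le (by norm_num)
    have h6 : (X x - X e) ^ 2 ≤ (729 / 100) ^ 2 := sq_le_sq' (by linarith) (by linarith)
    have h7 : (Y x - Y e) ^ 2 ≤ (303 / 100) ^ 2 := sq_le_sq' (by linarith) (by linarith)
    nlinarith

/-- A point of the curve at a given small arc length to the right. -/
lemma X_param (h : OpenLoc Γ H Z yh r ε g T L σ s₀ X Y t) {d : ℝ} (hd : d ∈ Icc 0 2000)
    (hL : s₀ + d * ε ≤ L) : g (s₀ + d * ε) ∈ Γ ∧ dist (g (s₀ + d * ε)) yh ≤ (d + 1) * ε ∧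
      |X (g (s₀ + d * ε)) - X (g s₀) - d| ≤ 1 / 100 := by
  have hε := h.eps_pos
  have h0 : 0 ≤ d * ε := mul_nonneg hd.1 hε.le
  have hm : s₀ + d * ε ∈ Icc 0 L := ⟨by linarith [h.mem.1], hL⟩
  refine ⟨h.curve.mem hm, ?_, ?_⟩
  · have h1 := h.curve.strand.norm_sub_le h.mem hm
    rw [add_sub_cancel_left, abs_of_nonneg h0, ← dist_eq_norm] at h1
    have := dist_triangle (g (s₀ + d * ε)) (g s₀) yh
    linarith [h.near]
  · have h1 := h.par _ hm (by rw [add_sub_cancel_left, abs_of_nonneg h0]; nlinarith [hd.2])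
    rwa [add_sub_cancel_left, mul_div_cancel_right₀ _ hε.ne'] at h1

lemma right_of_param (h : OpenLoc Γ H Z yh r ε g T L σ s₀ X Y t) (hη1 : η ≤ 1 / 10 ^ 8) {s : ℝ}
    (hs : s ≤ L) (hs' : s₀ + (15 / 2 - X (g s₀)) * ε ≤ s) :
    g s ∈ H \ cutSet H yh ε (η * ε) ∧ OnSide g yh ε X s₀ L (g s) := by
  have hε := h.eps_pos
  have h0 := abs_le.1 h.abs_X_start
  have hs0 : s₀ ≤ s := by nlinarith
  have hsm : s ∈ Icc 0 L := ⟨h.mem.1.trans hs0, hs⟩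
  have hH := h.loc.core.curve_subset (h.curve.mem hsm)
  rcases le_total (dist (g s) yh) (100 * ε) with hd | hd
  · have h1 := abs_le.1 (h.par_of_dist hsm (by linarith))
    have h2 : 15 / 2 - X (g s₀) ≤ (s - s₀) / ε := by rw [le_div_iff₀ hε]; linarith
    have h3 : 749 / 100 ≤ X (g s) := by linarith
    exact ⟨h.loc.mem_sdiff_of_X hη1 hH (by rw [abs_of_pos] <;> linarith),
      Or.inl ⟨hd, by linarith⟩⟩
  · exact ⟨h.loc.mem_sdiff_of_dist hη1 hH (by linarith),
      Or.inr ⟨hd, s, ⟨hs0, hs⟩, by rw [dist_self]; positivity⟩⟩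

set_option maxHeartbeats 1000000 in
/-- The output on the part of the estimator to the right of the cut set covers the right part of
the curve. -/
lemma cover_right (h : OpenLoc Γ H Z yh r ε g T L σ s₀ X Y t) (hη : 0 < η)
    (hη1 : η ≤ 1 / 10 ^ 8) {S : Set Plane} (hS : Absorbs (H \ cutSet H yh ε (η * ε)) S)
    (hSc : IsPreconnected S)
    (hSR : ∀ y, y ∈ S ↔ y ∈ H \ cutSet H yh ε (η * ε) ∧ OnSide g yh ε X s₀ L y) {x₀ x₁ : Plane}
    (hpair : IsEndpointPair (closure S) univ (frontier (cutSet H yh ε (η * ε))) x₀ x₁)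
    {P : Set Plane} (hP : P ⊆ closure S) (hPc : IsPreconnected P) (h₀ : x₀ ∈ P) (h₁ : x₁ ∈ P)
    {s : ℝ} (hs : s ∈ Icc s₀ L) : ∃ c ∈ P, dist c (g s) ≤ 16 * ε := by
  have hε := h.eps_pos
  have hc := h.loc.core
  have hs0 := abs_le.1 h.abs_X_start
  have hsL : s ∈ Icc 0 L := ⟨h.mem.1.trans hs.1, hs.2⟩
  have hSK : closure S ⊆ closure (H \ cutSet H yh ε (η * ε)) := closure_mono hS.1
  have hSH : closure S ⊆ H := fun y hy => mem_of_mem_closure hc.isClosed (hSK hy)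
  have hSside : ∀ y ∈ closure S, OnSide g yh ε X s₀ L y := fun y hy =>
    closure_minimal (fun z hz => ((hSR z).1 hz).2) h.isClosed_right hy
  have hXpos : ∀ y ∈ closure S, dist y yh < 100 * ε → 0 < X y := fun y hy hd => by
    have h1 := h.loc.le_abs_X hη (by linarith) (hSH hy) (by linarith)
      (clears_of_mem_closure (hSK hy))
    rcases hSside y hy with h2 | h2
    · rw [abs_of_nonneg h2.2] at h1; linarith
    · linarith [h2.1]
  have hA := (isClosed_cutSet hc.isCompact yh ε (by positivity : 0 ≤ η * ε)).frontier_subset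
    hpair.right_mem.2
  have hx₁d := h.loc.cutSet_dist_le hη1 hA
  have hx₁S := hpair.right_mem.1
  have hx₁X := hXpos x₁ hx₁S (by linarith)
  have hx₁X' := h.loc.abs_X_le hx₁d
  rw [abs_of_pos hx₁X] at hx₁X'
  have hx₁s₀ : dist x₁ (g s₀) ≤ 71 / 10 * ε := by
    have := dist_triangle_right x₁ (g s₀) yh
    linarith [h.near]
  -- If the right part of the curve is short, the single point `x₁` is close to all of it: 15.51² +
  -- 3.03² < 16².
  rcases le_or_gt L (s₀ + 145 / 10 * ε) with hshort | hlong
  · refine ⟨x₁, h₁, h.loc.chart.dist_le (by norm_num) ?_⟩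
    have hd : dist (g s) yh ≤ 2400 * ε := by
      have h1 := h.curve.strand.norm_sub_le h.mem hsL
      rw [abs_of_nonneg (by linarith [hs.1]), ← dist_eq_norm] at h1
      have := dist_triangle (g s) (g s₀) yh
      linarith [h.near, hs.2]
    have h1 := abs_le.1 (h.par_of_dist hsL hd)
    have h2 : (s - s₀) / ε ≤ 145 / 10 := by rw [div_le_iff₀ hε]; linarith [hs.2]
    have h2' : 0 ≤ (s - s₀) / ε := div_nonneg (by linarith [hs.1]) hε.le
    have h3 := abs_le.1 (h.loc.flat _ (h.curve.mem hsL) (by linarith))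
    have h4 := abs_le.1 (h.loc.strip (hSH hx₁S) (by linarith))
    have h6 : (X x₁ - X (g s)) ^ 2 ≤ (1551 / 100) ^ 2 := sq_le_sq' (by linarith) (by linarith)
    have h7 : (Y x₁ - Y (g s)) ^ 2 ≤ (303 / 100) ^ 2 := sq_le_sq' (by linarith) (by linarith)
    nlinarith
  -- The relay point `e` has X ≈ 7.52: far enough right for `clearance_segment`, yet within 7.65ε of
  -- `x₁` and within 8ε of every point of the main part with X ≤ 14.8.
  obtain ⟨heΓ, hed, heX⟩ := h.X_param (d := 752 / 100 - X (g s₀)) ⟨by linarith, by linarith⟩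
    (by nlinarith)
  set s₁ := s₀ + (752 / 100 - X (g s₀)) * ε with hs₁
  have hs₁L : s₁ ≤ L := by nlinarith
  have hs₁0 : s₀ ≤ s₁ := by nlinarith
  set e := g s₁ with he
  have hed : dist e yh ≤ 2400 * ε := by nlinarith
  have heX : X e ∈ Icc (751 / 100) (753 / 100) := by
    rw [abs_le] at heX; constructor <;> linarith
  have heX' : X e ∈ Icc (15 / 2) 2000 := ⟨by linarith [heX.1], by linarith [heX.2]⟩
  have hgS : ∀ w ∈ Icc s₁ L, g w ∈ S := fun w hw =>
    (hSR _).2 (h.right_of_param hη1 hw.2 (by nlinarith [hw.1]))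
  have heS : e ∈ S := hgS s₁ ⟨le_rfl, hs₁L⟩
  have hmain : ∀ x ∈ closure S, dist x yh ≤ 2400 * ε → 0 < X x →
      MainRight Γ H yh ε X Y x := fun x hx hd hX =>
    h.loc.mainRight_of_isPreconnected hη hη1 heΓ ⟨by linarith [heX.1], heX'.2⟩ hed hSK hSc.closure
      (subset_closure heS) hx (Or.inr (Or.inr (h.loc.mainRight_of_far (hc.curve_subset heΓ) hed
        (by linarith [heX.1])))) hd hX
  have hxe : ∀ x ∈ closure S, dist x yh ≤ 2400 * ε → 0 < X x →
      pathDist (closure S) x e ≤ ENNReal.ofReal (dist x e) := fun x hx hd hX =>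
    pathDist_le_of_segment (h.loc.segment_subset_closure hη hη1 hS hx hd hX (hmain x hx hd hX) heΓ
      heX' (by linarith) heS).2
  have hx₁e := h.dist_le_of_X hη (hSK hx₁S) (by linarith) hx₁X hx₁X' heΓ hed heX
  have hLS : g L ∈ closure S := subset_closure (hgS L ⟨hs₁L, le_rfl⟩)
  have hfin : pathDist (closure S) (g L) x₁ ≠ ∞ := by
    refine ne_top_of_le_ne_top (ENNReal.add_ne_top.2 ⟨?_, ?_⟩) (pathDist_triangle _ (g L) e x₁)
    · rw [pathDist_comm]
      exact ne_top_of_le_ne_top ENNReal.ofReal_ne_top (h.curve.pathDist_le (h.mem.1.trans hs₁0)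
        hs₁L le_rfl fun w hw => subset_closure (hgS w hw))
    · rw [pathDist_comm]
      exact ne_top_of_le_ne_top ENNReal.ofReal_ne_top (hxe x₁ hx₁S (by linarith) hx₁X)
  have hle := hpair.maximal (g L) ⟨hLS, mem_univ _⟩ x₁ hpair.right_mem hfin
  have hx₀S := hpair.left_mem.1
  -- If `x₀` is this close, the path through `e` bounds its distance from `x₁` by 15.65ε. By
  -- maximality the end `g L` is as close to `x₁`, and so is, up to ε/100, the whole piece of the
  -- curve.
  by_cases hloc : dist x₀ yh < 100 * ε ∧ X x₀ ≤ 148 / 10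
  · have hX₀ := hXpos x₀ hx₀S hloc.1
    have h1 := h.dist_le_of_X' hη (hSK hx₀S) (by linarith [hloc.1]) hX₀ hloc.2 heΓ hed heX
    have h2 : pathDist (closure S) x₀ x₁ ≤ ENNReal.ofReal (1565 / 100 * ε) := by
      refine (pathDist_triangle _ x₀ e x₁).trans ?_
      rw [pathDist_comm _ e]
      refine (add_le_add (hxe x₀ hx₀S (by linarith [hloc.1]) hX₀)
        (hxe x₁ hx₁S (by linarith) hx₁X)).trans ?_
      rw [← ENNReal.ofReal_add dist_nonneg dist_nonneg]
      exact ENNReal.ofReal_le_ofReal (by linarith)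
    have h3 := (edist_le_pathDist _ _ _).trans (hle.trans h2)
    rw [edist_dist, ENNReal.ofReal_le_ofReal_iff (by positivity), dist_comm] at h3
    have h4 := h.curve.arc_le_of_dist hε h.big h.mem ⟨h.curve.pos.le, le_rfl⟩ (ρ := 23)
      (by norm_num) (by
        have := dist_triangle_left (g s₀) (g L) x₁
        linarith)
    rw [abs_le] at h4
    have := h.curve.between (y := x₁) (ρ := 1565 / 100 * ε) hε h.big h.mem.1 le_rfl hs
      (by linarith) (by linarith) h3
    exact ⟨x₁, h₁, by linarith⟩
  -- Otherwise `x₀` is near a point `g a` so far out that segments to it from nearby points avoid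
  -- the cut set, as `near_end` requires.
  obtain ⟨a, ha, hxa, haS, hafar⟩ : ∃ a ∈ Icc s₀ L, dist x₀ (g a) ≤ 3 * ε ∧ s₁ ≤ a ∧
      (117 / 10 ≤ X (g a) ∨ 97 * ε ≤ dist (g a) yh) := by
    rcases lt_or_ge (dist x₀ yh) (100 * ε) with hd | hd
    · have hX : 148 / 10 < X x₀ := by
        by_contra! hle
        exact hloc ⟨hd, hle⟩
      obtain ⟨a, ha, hxa⟩ := h.curve.exists_near hc (hSH hx₀S)
      have h1 := abs_le.1 (h.loc.chart.abs_X_sub_le hxa)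
      have h2 := abs_le.1 (h.par_of_dist ha (by
        have := dist_triangle_left (g a) yh x₀
        linarith))
      have h3 : 752 / 100 - X (g s₀) ≤ (a - s₀) / ε := by linarith
      rw [le_div_iff₀ hε] at h3
      exact ⟨a, ⟨by nlinarith, ha.2⟩, hxa, by linarith, Or.inl (by linarith)⟩
    · rcases hSside x₀ hx₀S with h1 | h1
      · have h2 := h.loc.dist_center_le x₀
        have h3 := h.loc.abs_Y_le (hSH hx₀S) (by linarith [h1.1])
        rw [abs_of_nonneg h1.2] at h2
        obtain ⟨a, ha, hxa⟩ := h.curve.exists_near hc (hSH hx₀S)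
        have hX : 90 ≤ X x₀ := by
          by_contra! hlt
          nlinarith
        have h4 := abs_le.1 (h.loc.chart.abs_X_sub_le hxa)
        have h5 := abs_le.1 (h.par_of_dist ha (by
          have := dist_triangle_left (g a) yh x₀
          linarith [h1.1]))
        have h6 : 752 / 100 - X (g s₀) ≤ (a - s₀) / ε := by linarith
        rw [le_div_iff₀ hε] at h6
        exact ⟨a, ⟨by nlinarith, ha.2⟩, hxa, by linarith, Or.inl (by linarith)⟩
      · obtain ⟨-, a, ha, hxa⟩ := h1
        have h2 := dist_triangle x₀ (g a) yh
        have h3 := h.curve.strand.norm_sub_le h.mem ⟨h.mem.1.trans ha.1, ha.2⟩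
        rw [abs_of_nonneg (by linarith [ha.1]), ← dist_eq_norm] at h3
        have h4 := dist_triangle (g a) (g s₀) yh
        exact ⟨a, ha, hxa, by nlinarith [h.near], Or.inr (by linarith)⟩
  have ha0 : a ∈ Icc 0 L := ⟨h.mem.1.trans ha.1, ha.2⟩
  obtain ⟨b, hb, hxb⟩ := h.curve.exists_near hc (hSH hx₁S)
  have hbd : dist (g b) yh ≤ 91 / 10 * ε := by
    have := dist_triangle_left (g b) yh x₁
    linarith
  have hbs : |b - s₀| ≤ 2 * (101 / 10) * ε := h.curve.arc_le_of_dist hε h.big hb h.mem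
    (by norm_num) (by
      have := dist_triangle_right (g b) (g s₀) yh
      linarith [h.near])
  rw [abs_le] at hbs
  -- `x₁` is in the cut set, so its position `b` is close to `s₀`; the position `a` of `x₀` is
  -- beyond it.
  have hba : b ≤ a := by
    by_contra! hlt
    have h1 := h.curve.strand.norm_sub_le h.mem ha0
    rw [abs_of_nonneg (by linarith [ha.1]), ← dist_eq_norm] at h1
    have h2 := dist_triangle (g a) (g s₀) yh
    have h3 : dist (g a) yh ≤ 22 * ε := by linarith [h.near]
    have h4 := abs_le.1 (h.par_of_dist ha0 (by linarith))
    have h5 := abs_le.1 (h.par_of_dist hb (by linarith))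
    have h6 : (a - s₀) / ε ≤ (b - s₀) / ε := by gcongr
    have h7 := abs_le.1 (h.loc.abs_X_le hbd)
    rcases hafar with h8 | h8
    · linarith
    · linarith
  have hseg : ∀ w ∈ closure S, dist w (g a) ≤ 31 / 10 * ε →
      segment ℝ w (g a) ⊆ closure S := by
    intro w hw hd
    refine Subset.trans (hS.2 _ (fun y hy => ?_) (convex_segment w (g a)).isPreconnected
      ⟨g a, right_mem_segment ℝ w (g a), hgS a ⟨haS, ha.2⟩⟩) subset_closure
    have hyH := hc.segment_curve_subset (h.curve.mem ha0) (hSH hw) (by linarith) hy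
    have hyd : dist y (g a) ≤ 31 / 10 * ε := by
      rw [segment_symm] at hy
      have := dist_le_of_mem_segment hy
      rw [dist_comm (g a) y, dist_comm (g a) w] at this
      linarith
    rcases hafar with h8 | h8
    · have := abs_le.1 (h.loc.chart.abs_X_sub_le hyd)
      exact h.loc.mem_sdiff_of_X hη1 hyH (by rw [abs_of_pos] <;> linarith)
    · have := dist_triangle_left (g a) yh y
      exact h.loc.mem_sdiff_of_dist hη1 hyH (by linarith)
  rcases le_total a s with has | has
  · have := h.curve.near_end hc h.big hSH hx₀S hb.1 hba ha.2 hxa hxb hfin hle hseg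
      (s := s) ⟨has, hs.2⟩
    exact ⟨x₀, h₀, by linarith⟩
  rcases le_total b s with hbs' | hbs'
  · obtain ⟨c, hcP, hd⟩ := h.curve.cover hc h.big (hP.trans hSH) hPc h₁ h₀ hb.1 ha.2 hxb hxa
      ⟨hbs', has⟩
    exact ⟨c, hcP, by linarith⟩
  · have := h.curve.between (y := x₁) (ρ := 71 / 10 * ε) hε h.big h.mem.1 hb.2 ⟨hs.1, hbs'⟩
      (by linarith) hx₁s₀ (by linarith)
    exact ⟨x₁, h₁, by linarith⟩

end OpenLoc


/-! ### Components of the complement of the cut set -/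

lemma subset_of_mem_components {G U : Set Plane} (hU : U ∈ components G) : U ⊆ G := by
  obtain ⟨p, -, rfl⟩ := hU
  exact connectedComponentIn_subset G p

lemma isPreconnected_of_mem_components {G U : Set Plane} (hU : U ∈ components G) :
    IsPreconnected U := by
  obtain ⟨p, -, rfl⟩ := hU
  exact isPreconnected_connectedComponentIn

lemma absorbs_of_mem_components {G U : Set Plane} (hU : U ∈ components G) : Absorbs G U := by
  obtain ⟨p, -, rfl⟩ := hU
  exact absorbs_connectedComponentIn G p

lemma exists_mem_components {G : Set Plane} {y : Plane} (hy : y ∈ G) :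
    ∃ U ∈ components G, y ∈ U :=
  ⟨_, mem_image_of_mem _ hy, mem_connectedComponentIn hy⟩

lemma ClosedOutput.subset {H C : Set Plane} {yh : Plane} {ε η : ℝ} (hH : IsClosed H)
    (h : ClosedOutput H yh ε η C) : C ⊆ H ∪ cutSet H yh ε η := by
  obtain ⟨x₀, x₁, γ, γ', ⟨-, hγ⟩, hγ', rfl⟩ := h
  exact union_subset_union (hγ.trans fun y hy => mem_of_mem_closure hH hy) hγ'

lemma GeneralOutput.subset {H C : Set Plane} {yh : Plane} {ε η : ℝ} (hH : IsClosed H)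
    (h : GeneralOutput H yh ε η C) : C ⊆ H ∪ cutSet H yh ε η := by
  rcases h with ⟨-, h⟩ | ⟨U, V, -, hUV, x₀, x₁, y₀, y₁, γ, β, γ', ⟨-, hγ⟩, hβ, ⟨-, hγ'⟩, rfl⟩
  · exact h.subset hH
  · have hcl : ∀ W ∈ components (H \ cutSet H yh ε η), closure W ⊆ H := fun W hW =>
      closure_minimal ((subset_of_mem_components hW).trans sdiff_subset) hH
    have hU := hcl U (hUV ▸ mem_insert _ _)
    have hV := hcl V (hUV ▸ mem_insert_of_mem _ rfl)
    rintro y ((hy | hy) | hy)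
    · exact Or.inl (hU (hγ hy))
    · exact Or.inr (hβ hy)
    · exact Or.inl (hV (hγ' hy))

namespace OpenLoc

variable {Γ H Z : Set Plane} {yh : Plane} {r ε : ℝ} {g T : ℝ → Plane} {L σ s₀ : ℝ}
  {X Y : Plane → ℝ} {t η : ℝ}

/-- If the curve is long enough on the right, it supplies a point there, and the opposite direction
through the centre supplies a point on the left even when the curve ends near `s₀`. -/
lemma exists_right_and_left_aux (h : OpenLoc Γ H Z yh r ε g T L σ s₀ X Y t) (hη : 0 < η)
    (hη1 : η ≤ 1 / 10 ^ 8) (hs : s₀ + 20 * ε ≤ L) :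
    (∃ y ∈ H \ cutSet H yh ε (η * ε), OnSide g yh ε X s₀ L y) ∧
      ∃ y ∈ H \ cutSet H yh ε (η * ε), OnSide g yh ε (fun p => -X p) 0 s₀ y := by
  have hε := h.eps_pos
  have hs0 := abs_le.1 h.abs_X_start
  obtain ⟨heΓ, hed, heX⟩ := h.X_param (d := 20) ⟨by norm_num, by norm_num⟩ hs
  rw [abs_le] at heX
  refine ⟨⟨_, h.right_of_param hη1 hs (by nlinarith)⟩, ?_⟩
  obtain ⟨y, hy, hyX, hyd⟩ := h.loc.exists_opposite hη hη1 heΓ (by linarith) (by linarith)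
  exact ⟨y, hy, Or.inl ⟨by linarith, by linarith⟩⟩

/-- As L ≥ 2σ, at least one of the two sides of `s₀` is long; reversal exchanges them. -/
lemma exists_right_and_left (h : OpenLoc Γ H Z yh r ε g T L σ s₀ X Y t) (hη : 0 < η)
    (hη1 : η ≤ 1 / 10 ^ 8) :
    (∃ y ∈ H \ cutSet H yh ε (η * ε), OnSide g yh ε X s₀ L y) ∧
      ∃ y ∈ H \ cutSet H yh ε (η * ε), OnSide g yh ε (fun p => -X p) 0 s₀ y := by
  have hε := h.eps_pos
  rcases le_total (s₀ + 20 * ε) L with hs | hs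
  · exact h.exists_right_and_left_aux hη hη1 hs
  · have h1 := h.curve.ends
    have h2 := h.curve.strand.norm_sub_le (s := L) (t := 0) ⟨h.curve.pos.le, le_rfl⟩
      ⟨le_rfl, h.curve.pos.le⟩
    rw [zero_sub, abs_neg, abs_of_pos h.curve.pos] at h2
    obtain ⟨⟨y, hy, hyR⟩, z, hz, hzL⟩ := h.reverse.exists_right_and_left_aux hη hη1
      (by linarith [h.big])
    rw [onSide_reverse (a := 0) (b := s₀) rfl (by ring)] at hyR
    rw [onSide_reverse (a := s₀) (b := L) (by ring) rfl] at hzL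
    simp only [neg_neg] at hzL
    exact ⟨⟨z, hz, hzL⟩, y, hy, hyR⟩

lemma cover_left (h : OpenLoc Γ H Z yh r ε g T L σ s₀ X Y t) (hη : 0 < η)
    (hη1 : η ≤ 1 / 10 ^ 8) {S : Set Plane} (hS : Absorbs (H \ cutSet H yh ε (η * ε)) S)
    (hSc : IsPreconnected S)
    (hSR : ∀ y, y ∈ S ↔
      y ∈ H \ cutSet H yh ε (η * ε) ∧ OnSide g yh ε (fun p => -X p) 0 s₀ y)
    {x₀ x₁ : Plane}
    (hpair : IsEndpointPair (closure S) univ (frontier (cutSet H yh ε (η * ε))) x₀ x₁)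
    {P : Set Plane} (hP : P ⊆ closure S) (hPc : IsPreconnected P) (h₀ : x₀ ∈ P) (h₁ : x₁ ∈ P)
    {s : ℝ} (hs : s ∈ Icc 0 s₀) : ∃ c ∈ P, dist c (g s) ≤ 16 * ε := by
  have := h.reverse.cover_right hη hη1 hS hSc (fun y => by
    rw [hSR, onSide_reverse (a := 0) (b := s₀) rfl (by ring)]) hpair hP hPc h₀ h₁ (s := L - s)
    ⟨by linarith [hs.2], by linarith [hs.1]⟩
  have e : L + -1 * (L - s) = s := by ring
  simpa only [e] using this

/-- Two components of the complement of the cut set are its right and its left part. -/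
lemma components_eq (h : OpenLoc Γ H Z yh r ε g T L σ s₀ X Y t) (hη : 0 < η)
    (hη1 : η ≤ 1 / 10 ^ 8) {U V : Set Plane}
    (hUV : components (H \ cutSet H yh ε (η * ε)) = {U, V}) {p : Plane} (hp : p ∈ U)
    (hpR : OnSide g yh ε X s₀ L p) :
    (∀ y, y ∈ U ↔ y ∈ H \ cutSet H yh ε (η * ε) ∧ OnSide g yh ε X s₀ L y) ∧
    ∀ y, y ∈ V ↔ y ∈ H \ cutSet H yh ε (η * ε) ∧ OnSide g yh ε (fun p => -X p) 0 s₀ y := by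
  have hU : U ∈ components (H \ cutSet H yh ε (η * ε)) := hUV ▸ mem_insert _ _
  have hV : V ∈ components (H \ cutSet H yh ε (η * ε)) := hUV ▸ mem_insert_of_mem _ rfl
  have hUR : ∀ y ∈ U, OnSide g yh ε X s₀ L y := fun y hy =>
    h.right_of_isPreconnected hη hη1 ((subset_of_mem_components hU).trans subset_closure)
      (isPreconnected_of_mem_components hU) hp hy hpR
  have hcov : ∀ y ∈ H \ cutSet H yh ε (η * ε), y ∈ U ∨ y ∈ V := fun y hy => by
    obtain ⟨W, hW, hyW⟩ := exists_mem_components hy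
    rw [hUV] at hW
    rcases hW with rfl | rfl
    · exact Or.inl hyW
    · exact Or.inr hyW
  have hno : ∀ y ∈ H \ cutSet H yh ε (η * ε), OnSide g yh ε X s₀ L y →
      OnSide g yh ε (fun p => -X p) 0 s₀ y → False := fun y hy =>
    h.not_right_and_left hη hη1 (subset_closure hy)
  obtain ⟨-, z, hz, hzL⟩ := h.exists_right_and_left hη hη1
  have hzV : z ∈ V := (hcov z hz).resolve_left fun hzU => hno z hz (hUR z hzU) hzL
  have hVL : ∀ y ∈ V, OnSide g yh ε (fun p => -X p) 0 s₀ y := fun y hy => by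
    have hyG := subset_of_mem_components hV hy
    refine (h.right_or_left hyG.1).resolve_left fun hyR => ?_
    exact hno z hz (h.right_of_isPreconnected hη hη1
      ((subset_of_mem_components hV).trans subset_closure)
      (isPreconnected_of_mem_components hV) hy hzV hyR) hzL
  refine ⟨fun y => ⟨fun hy => ⟨subset_of_mem_components hU hy, hUR y hy⟩, fun hy => ?_⟩,
    fun y => ⟨fun hy => ⟨subset_of_mem_components hV hy, hVL y hy⟩, fun hy => ?_⟩⟩
  · exact (hcov y hy.1).resolve_right fun hyV => hno y hy.1 hy.2 (hVL y hyV)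
  · exact (hcov y hy.1).resolve_left fun hyU => hno y hy.1 (hUR y hyU) hy.2

/-- Every output of the general-curve algorithm covers an open curve. -/
lemma cover_of_generalOutput (h : OpenLoc Γ H Z yh r ε g T L σ s₀ X Y t) (hη : 0 < η)
    (hη1 : η ≤ 1 / 10 ^ 8) {C : Set Plane} (hC : GeneralOutput H yh ε (η * ε) C) {s : ℝ}
    (hs : s ∈ Icc 0 L) : ∃ c ∈ C, dist c (g s) ≤ 16 * ε := by
  obtain ⟨⟨p, hp, hpR⟩, z, hz, hzL⟩ := h.exists_right_and_left hη hη1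
  rcases hC with ⟨⟨U, hU⟩, -⟩ | ⟨U, V, -, hUV, x₀, x₁, y₀, y₁, γ, β, γ', ⟨hpair, hγ⟩, -,
    ⟨hpair', hγ'⟩, rfl⟩
  -- A single component is impossible, since right and left both occur and no connected set outside
  -- the cut set meets both.
  · exfalso
    have hU' : U ∈ components (H \ cutSet H yh ε (η * ε)) := hU ▸ mem_singleton U
    have hall : ∀ y ∈ H \ cutSet H yh ε (η * ε), y ∈ U := fun y hy => by
      obtain ⟨W, hW, hyW⟩ := exists_mem_components hy
      rw [hU] at hW
      rwa [← mem_singleton_iff.1 hW]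
    exact h.not_right_and_left hη hη1 (subset_closure hz) (h.right_of_isPreconnected hη hη1
      ((subset_of_mem_components hU').trans subset_closure)
      (isPreconnected_of_mem_components hU') (hall p hp) (hall z hz) hpR) hzL
  have hU : U ∈ components (H \ cutSet H yh ε (η * ε)) := hUV ▸ mem_insert _ _
  have hV : V ∈ components (H \ cutSet H yh ε (η * ε)) := hUV ▸ mem_insert_of_mem _ rfl
  have hγc := isPreconnected_range_path γ
  have hγc' := isPreconnected_range_path γ'
  have hx₀ : x₀ ∈ range γ := ⟨0, γ.source⟩
  have hx₁ : x₁ ∈ range γ := ⟨1, γ.target⟩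
  have hy₀ : y₀ ∈ range γ' := ⟨0, γ'.source⟩
  have hy₁ : y₁ ∈ range γ' := ⟨1, γ'.target⟩
  obtain ⟨W, hW, hpW⟩ := exists_mem_components hp
  rw [hUV] at hW
  rcases hW with rfl | rfl
  · obtain ⟨h1, h2⟩ := h.components_eq hη hη1 hUV hpW hpR
    rcases le_total s₀ s with hs' | hs'
    · obtain ⟨c, hc, hd⟩ := h.cover_right hη hη1 (absorbs_of_mem_components hU)
        (isPreconnected_of_mem_components hU) h1 hpair hγ hγc hx₀ hx₁ ⟨hs', hs.2⟩
      exact ⟨c, Or.inl (Or.inl hc), hd⟩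
    · obtain ⟨c, hc, hd⟩ := h.cover_left hη hη1 (absorbs_of_mem_components hV)
        (isPreconnected_of_mem_components hV) h2 hpair'.symm hγ' hγc' hy₁ hy₀ ⟨hs.1, hs'⟩
      exact ⟨c, Or.inr hc, hd⟩
  · rw [pair_comm] at hUV
    obtain ⟨h1, h2⟩ := h.components_eq hη hη1 hUV hpW hpR
    rcases le_total s₀ s with hs' | hs'
    · obtain ⟨c, hc, hd⟩ := h.cover_right hη hη1 (absorbs_of_mem_components hV)
        (isPreconnected_of_mem_components hV) h1 hpair'.symm hγ' hγc' hy₁ hy₀ ⟨hs', hs.2⟩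
      exact ⟨c, Or.inr hc, hd⟩
    · obtain ⟨c, hc, hd⟩ := h.cover_left hη hη1 (absorbs_of_mem_components hU)
        (isPreconnected_of_mem_components hU) h2 hpair hγ hγc hx₀ hx₁ ⟨hs.1, hs'⟩
      exact ⟨c, Or.inl (Or.inl hc), hd⟩

end OpenLoc


/-! ### Closed curves -/

namespace ClosedCurve

variable {Γ : Set Plane} {g T : ℝ → Plane} {L σ : ℝ}

lemma comp_affine (h : ClosedCurve Γ g T L σ) {p ω : ℝ} (hω : ω = 1 ∨ ω = -1) :
    ClosedCurve Γ (fun s => g (p + ω * s)) (fun s => ω • T (p + ω * s)) L σ where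
  pos := h.pos
  σ_pos := h.σ_pos
  image := by
    refine Subset.antisymm (fun e he => ?_) ?_
    · rcases hω with rfl | rfl
      · obtain ⟨s, hs, rfl⟩ := h.exists_eq he p
        refine ⟨s - p, ⟨by linarith [hs.1], by linarith [hs.2]⟩, ?_⟩
        show g (p + 1 * (s - p)) = g s
        congr 1; ring
      · obtain ⟨s, hs, rfl⟩ := h.exists_eq he (p - L)
        refine ⟨p - s, ⟨by linarith [hs.2], by linarith [hs.1]⟩, ?_⟩
        show g (p + -1 * (p - s)) = g s
        congr 1; ring
    · rintro - ⟨s, -, rfl⟩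
      exact h.mem _
  strand a b := by
    rcases hω with rfl | rfl
    · exact (h.strand (p + a) (p + b)).comp_affine (by norm_num)
        fun t ht => ⟨by linarith [ht.1], by linarith [ht.2]⟩
    · exact (h.strand (p - b) (p - a)).comp_affine (by norm_num)
        fun t ht => ⟨by linarith [ht.2], by linarith [ht.1]⟩
  periodic s := by
    rcases hω with rfl | rfl
    · rw [← h.periodic (p + 1 * s)]; congr 1; ring
    · rw [← h.periodic (p + -1 * (s + L))]; congr 1; ring
  inj u w hw := by
    apply h.ne
    · rcases hω with rfl | rfl
      · intro h0; linarith [hw.1]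
      · intro h0; linarith [hw.1]
    · rw [show p + ω * w - (p + ω * u) = ω * (w - u) by ring, abs_mul,
        show |ω| = 1 by rcases hω with rfl | rfl <;> simp, one_mul, abs_lt]
      constructor <;> linarith [hw.1, hw.2, h.pos]

lemma arc_le_of_dist (h : ClosedCurve Γ g T L σ) {ε u v ρ : ℝ} (hε : 0 < ε)
    (hbig : 10 ^ 10 * ε ≤ σ) (huv : u ≤ v) (hvL : v ≤ u + L) (hρ : ρ ≤ 10 ^ 10)
    (hd : dist (g u) (g v) ≤ ρ * ε) : v - u ≤ 2 * ρ * ε ∨ u + L - v ≤ 2 * ρ * ε := by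
  rw [dist_comm, dist_eq_norm] at hd
  rcases h.arc_le huv hvL (by nlinarith) with h1 | h1
  · left; linarith
  · right; linarith

lemma pathDist_le (h : ClosedCurve Γ g T L σ) {K : Set Plane} {s t : ℝ} (hst : s ≤ t)
    (hK : MapsTo g (Icc s t) K) : pathDist K (g s) (g t) ≤ ENNReal.ofReal (t - s) := by
  have hl : LipschitzOnWith 1 g (Icc s t) := LipschitzOnWith.of_dist_le_mul fun u hu v hv => by
    rw [dist_comm, dist_eq_norm, dist_comm, Real.dist_eq]
    simpa using h.norm_sub_le u v
  simpa using pathDist_le_of_lipschitzOn hst hl hK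

lemma between (h : ClosedCurve Γ g T L σ) {ε u v s ρ : ℝ} {y : Plane} (hε : 0 < ε)
    (hbig : 10 ^ 10 * ε ≤ σ) (hs : s ∈ Icc u v) (hl : v - u ≤ 1000 * ε)
    (hu : dist y (g u) ≤ ρ) (hv : dist y (g v) ≤ ρ) : dist y (g s) ≤ ρ + 1 / 100 * ε := by
  have hσ := h.σ_pos
  have := dist_le_of_between (τ := T u) (κ := 1 / 200 * ε) hs (fun w hw => ?_) hu hv
  · linarith
  · have h1 : |w - u| ≤ 1000 * ε := by
      rw [abs_of_nonneg (by linarith [hw.1])]; linarith [hw.2]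
    refine (h.flat (by linarith)).trans ?_
    rw [div_le_iff₀ hσ, ← sq_abs]
    have : |w - u| ^ 2 ≤ (1000 * ε) ^ 2 := by gcongr
    nlinarith

end ClosedCurve

/-- The estimator of a closed curve with a chart at the centre in which the curve, near its
parameter `0`, runs from left to right. -/
structure ClosedLoc (Γ H Z : Set Plane) (yh : Plane) (r ε : ℝ) (g T : ℝ → Plane) (L σ : ℝ)
    (X Y : Plane → ℝ) (t : ℝ) : Prop where
  loc : Loc Γ H Z yh r ε X Y t
  curve : ClosedCurve Γ g T L σ
  big : 10 ^ 10 * ε ≤ σ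
  near : dist (g 0) yh ≤ ε
  par : ∀ s, |s| ≤ 5100 * ε → |X (g s) - X (g 0) - s / ε| ≤ 1 / 100

lemma ClosedCurve.exists_closedLoc {Γ H Z : Set Plane} {yh : Plane} {r ε : ℝ} {g T : ℝ → Plane}
    {L σ : ℝ} (h : ClosedCurve Γ g T L σ) (hc : Core Γ H Z yh r ε) (hbig : 10 ^ 10 * ε ≤ σ) :
    ∃ g T X Y t, ClosedLoc Γ H Z yh r ε g T L σ X Y t := by
  have hε := hc.ε_pos
  obtain ⟨e, he, hd⟩ := hc.near_center
  obtain ⟨s₀, -, rfl⟩ := h.exists_eq he 0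
  -- The parameter is shifted so that the chosen point near the centre has parameter 0.
  replace h := h.comp_affine (p := s₀) (Or.inl rfl)
  have hg0 : g s₀ = (fun s => g (s₀ + 1 * s)) 0 := by simp
  rw [hg0] at hd
  generalize (fun s => g (s₀ + 1 * s)) = g at h hd
  generalize (fun s => (1 : ℝ) • T (s₀ + 1 * s)) = T at h
  have hτ := (h.strand 0 L).unit 0 ⟨le_rfl, h.pos.le⟩
  have hpar : ∀ s, |s| ≤ 5100 * ε → ‖g s - g 0 - s • T 0‖ ≤ 1 / 100 * ε := by
    intro s hl
    have := h.flat (u := 0) (v := s) (by rw [sub_zero]; linarith)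
    rw [sub_zero] at this
    refine this.trans ?_
    rw [div_le_iff₀ h.σ_pos, ← sq_abs]
    have : |s| ^ 2 ≤ (5100 * ε) ^ 2 := by gcongr
    nlinarith
  have hch := exists_chart (yh := yh) hε hτ
  refine ⟨g, T, _, _, ε⁻¹ * cross (T 0) (g 0 - yh), ⟨hc, hch, ?_, ?_⟩, h, hbig,
    by rwa [dist_comm], fun s hl => (chart_param_le hε hτ (hpar s hl)).1⟩
  · have := hch.abs_Y_sub_le (p := g 0) (q := yh) (ρ := 1) (by rw [dist_comm]; linarith)
    rw [hch.Y_center, sub_zero] at this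
    linarith
  · intro e he hed
    obtain ⟨s, hs, rfl⟩ := h.exists_eq he 0
    have h1 : dist (g 0) (g s) ≤ 2501 * ε := by
      have := dist_triangle_left (g 0) (g s) yh
      rw [dist_comm yh (g s)] at this
      linarith
    rcases h.arc_le_of_dist hε hbig hs.1 hs.2.le (by norm_num) h1 with h2 | h2
    · exact (chart_param_le hε hτ (hpar s (by rw [abs_of_nonneg hs.1]; linarith))).2
    · have e : g s = g (s - L) := by rw [← h.periodic (s - L)]; simp
      rw [e]
      refine (chart_param_le hε hτ (hpar (s - L) ?_)).2
      rw [abs_of_nonpos (by linarith [hs.2])]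
      linarith

/-- A connected set without points in the cut set that joins points to the right and to the left
of the centre takes intermediate values of the first coordinate. -/
lemma Loc.exists_X_eq {Γ H Z : Set Plane} {yh : Plane} {r ε : ℝ} {X Y : Plane → ℝ} {t η : ℝ}
    (h : Loc Γ H Z yh r ε X Y t) (hη : 0 < η) (hη1 : η ≤ 1) {P : Set Plane}
    (hP : P ⊆ closure (H \ cutSet H yh ε (η * ε))) (hPc : IsPreconnected P) {p p' : Plane}
    (hp : p ∈ P) (hp' : p' ∈ P) (hpd : dist p yh ≤ 1000 * ε) (hpX : 0 ≤ X p) (hpX' : X p' ≤ 0)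
    {ξ : ℝ} (hξ : X p ≤ ξ) (hξ' : ξ ≤ 300) : ∃ c ∈ P, dist c yh ≤ 1000 * ε ∧ X c = ξ := by
  have hε := h.core.ε_pos
  have hX := h.chart.continuous_X
  obtain ⟨c, hcP, ⟨hcd, hc0, hcξ⟩, hc⟩ := isPreconnected_closed_iff.1 hPc
    {y | dist y yh ≤ 1000 * ε ∧ 0 ≤ X y ∧ X y ≤ ξ} {y | X y ≤ 0 ∨ ξ ≤ X y ∨ 1000 * ε ≤ dist y yh}
    (by
      rw [ofPred_and, ofPred_and]
      exact (isClosed_le (by fun_prop) (by fun_prop)).inter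
        ((isClosed_le continuous_const hX).inter (isClosed_le hX continuous_const)))
    (by
      rw [ofPred_or, ofPred_or]
      exact (isClosed_le hX continuous_const).union
        ((isClosed_le continuous_const hX).union (isClosed_le (by fun_prop) (by fun_prop))))
    (fun y _ => by
      by_contra hn
      rw [mem_union, not_or, mem_ofPred_eq, mem_ofPred_eq, not_or, not_or] at hn
      obtain ⟨h1, h2, h3, h4⟩ := hn
      exact h1 ⟨(not_le.1 h4).le, (not_le.1 h2).le, (not_le.1 h3).le⟩)
    ⟨p, hp, hpd, hpX, hξ⟩ ⟨p', hp', Or.inl hpX'⟩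
  have hcH := mem_of_mem_closure h.core.isClosed (hP hcP)
  refine ⟨c, hcP, hcd, le_antisymm hcξ ?_⟩
  rcases hc with hc | hc | hc
  · have := h.le_abs_X hη hη1 hcH (by linarith) (clears_of_mem_closure (hP hcP))
    rw [le_antisymm hc hc0, abs_zero] at this
    linarith
  · exact hc
  · have h1 := h.dist_center_le c
    have h2 := h.abs_Y_le hcH (by linarith)
    rw [abs_of_nonneg hc0] at h1
    nlinarith

/-- Such a set comes close to the part of the curve to the right of its point on the right. -/
lemma Loc.exists_near_of_le_X {Γ H Z : Set Plane} {yh : Plane} {r ε : ℝ} {X Y : Plane → ℝ}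
    {t η : ℝ} (h : Loc Γ H Z yh r ε X Y t) (hη : 0 < η) (hη1 : η ≤ 1) {P : Set Plane}
    (hP : P ⊆ closure (H \ cutSet H yh ε (η * ε))) (hPc : IsPreconnected P) {p p' : Plane}
    (hp : p ∈ P) (hp' : p' ∈ P) (hpd : dist p yh ≤ 1000 * ε) (hpX : 0 ≤ X p) (hpX' : X p' ≤ 0)
    {e : Plane} (he : e ∈ Γ) (hed : dist e yh ≤ 300 * ε) (hX : X p ≤ X e) :
    ∃ c ∈ P, dist c e ≤ 31 / 10 * ε := by
  obtain ⟨c, hc, hcd, hcX⟩ := h.exists_X_eq hη hη1 hP hPc hp hp' hpd hpX hpX' hX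
    ((le_abs_self _).trans (h.abs_X_le hed))
  have hε := h.core.ε_pos
  refine ⟨c, hc, h.chart.dist_le (by norm_num) ?_⟩
  have h1 := abs_le.1 (h.strip (mem_of_mem_closure h.core.isClosed (hP hc)) (by linarith))
  have h2 := abs_le.1 (h.flat e he (by linarith))
  have h3 : (Y c - Y e) ^ 2 ≤ (31 / 10) ^ 2 := sq_le_sq' (by linarith) (by linarith)
  rw [hcX, sub_self]
  linarith

namespace ClosedLoc

variable {Γ H Z : Set Plane} {yh : Plane} {r ε : ℝ} {g T : ℝ → Plane} {L σ : ℝ}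
  {X Y : Plane → ℝ} {t η : ℝ}

lemma eps_pos (h : ClosedLoc Γ H Z yh r ε g T L σ X Y t) : 0 < ε := h.loc.core.ε_pos

lemma le_length (h : ClosedLoc Γ H Z yh r ε g T L σ X Y t) : 4 * 10 ^ 10 * ε ≤ L := by
  linarith [h.curve.four_mul_le, h.big]

lemma sub_length (h : ClosedLoc Γ H Z yh r ε g T L σ X Y t) (s : ℝ) : g (s - L) = g s := by
  rw [← h.curve.periodic (s - L), sub_add_cancel]

lemma reverse (h : ClosedLoc Γ H Z yh r ε g T L σ X Y t) :
    ClosedLoc Γ H Z yh r ε (fun s => g (L + -1 * s)) (fun s => (-1 : ℝ) • T (L + -1 * s)) L σ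
      (fun p => -X p) Y t := by
  have e : ∀ s, g (L + -1 * s) = g (-s) := fun s => by
    rw [← h.curve.periodic (-s)]; congr 1; ring
  refine ⟨h.loc.negX, h.curve.comp_affine (Or.inr rfl), h.big, ?_, fun s hs => ?_⟩
  · rw [e, neg_zero]; exact h.near
  · have := h.par (-s) (by rwa [abs_neg])
    rw [e, e, neg_zero, ← abs_neg]
    convert this using 2
    ring

lemma abs_X_start (h : ClosedLoc Γ H Z yh r ε g T L σ X Y t) : |X (g 0)| ≤ 1 :=
  h.loc.abs_X_le (by linarith [h.near])

lemma param_of_dist (h : ClosedLoc Γ H Z yh r ε g T L σ X Y t) {s ρ : ℝ} (hs : s ∈ Icc 0 L)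
    (hρ : ρ ≤ 10 ^ 9) (hd : dist (g s) yh ≤ ρ * ε) :
    s ≤ 2 * (ρ + 1) * ε ∨ L - s ≤ 2 * (ρ + 1) * ε := by
  have hε := h.eps_pos
  have h1 := h.curve.arc_le_of_dist hε h.big hs.1 (by linarith [hs.2]) (ρ := ρ + 1) (by linarith)
    (by
      have := dist_triangle_left (g 0) (g s) yh
      rw [dist_comm yh, dist_comm yh] at this
      linarith [h.near])
  rcases h1 with h1 | h1
  · left; linarith
  · right; linarith

lemma abs_param (h : ClosedLoc Γ H Z yh r ε g T L σ X Y t) {s : ℝ} (hs : |s| ≤ 2000 * ε) :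
    g s ∈ Γ ∧ dist (g s) yh ≤ |s| + ε ∧ |X (g s) - s / ε| ≤ 101 / 100 := by
  have hε := h.eps_pos
  refine ⟨h.curve.mem s, ?_, ?_⟩
  · have h1 := h.curve.norm_sub_le 0 s
    rw [sub_zero, ← dist_eq_norm] at h1
    linarith [dist_triangle (g s) (g 0) yh, h.near]
  · have h1 := abs_le.1 (h.par s (by linarith))
    have h2 := abs_le.1 h.abs_X_start
    rw [abs_le]
    constructor <;> linarith

lemma mem_sdiff_param (h : ClosedLoc Γ H Z yh r ε g T L σ X Y t) (hη1 : η ≤ 1 / 10 ^ 8) {s : ℝ}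
    (hs : s ∈ Icc (10 * ε) (L - 10 * ε)) : g s ∈ H \ cutSet H yh ε (η * ε) := by
  have hε := h.eps_pos
  have hH := h.loc.core.curve_subset (h.curve.mem s)
  rcases le_or_gt (dist (g s) yh) (61 / 10 * ε) with hd | hd
  · rcases h.param_of_dist ⟨by linarith [hs.1], by linarith [hs.2]⟩ (by norm_num) hd with h1 | h1
    · have h2 := abs_le.1 (h.abs_param (s := s) (by
        rw [abs_of_nonneg (by linarith [hs.1])]; linarith)).2.2
      have h3 : 10 ≤ s / ε := by rw [le_div_iff₀ hε]; exact hs.1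
      exact h.loc.mem_sdiff_of_X hη1 hH (by rw [abs_of_pos] <;> linarith)
    · have h2 := abs_le.1 (h.abs_param (s := s - L) (by
        rw [abs_of_nonpos (by linarith [hs.2])]; linarith)).2.2
      have h3 : (s - L) / ε ≤ -10 := by rw [div_le_iff₀ hε]; linarith [hs.2]
      rw [h.sub_length] at h2
      exact h.loc.mem_sdiff_of_X hη1 hH (by rw [abs_of_neg] <;> linarith)
  · exact h.loc.mem_sdiff_of_dist hη1 hH hd

lemma isClosed_onSide (h : ClosedLoc Γ H Z yh r ε g T L σ X Y t) (a b : ℝ) :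
    IsClosed {y | OnSide g yh ε X a b y} :=
  Filament.isClosed_onSide h.eps_pos.le h.loc.chart.continuous_X (h.curve.strand a b).continuousOn

lemma X_neg_of_near (h : ClosedLoc Γ H Z yh r ε g T L σ X Y t) {y : Plane} (hy : y ∈ H)
    (hd : dist y yh = 100 * ε) {s u : ℝ} (hs : 240 * ε ≤ s) (hu : u ∈ Icc s L)
    (hyu : dist y (g u) ≤ 3 * ε) : X y < 0 := by
  have hε := h.eps_pos
  have h1 : dist (g u) yh ≤ 103 * ε := by linarith [dist_triangle_left (g u) yh y]
  rcases h.param_of_dist ⟨by linarith [hu.1], hu.2⟩ (by norm_num) h1 with h2 | h2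
  · linarith [hu.1]
  · have h3 := abs_le.1 (h.abs_param (s := u - L) (by
      rw [abs_of_nonpos (by linarith [hu.2])]; linarith)).2.2
    have h4 : (u - L) / ε ≤ 0 := div_nonpos_of_nonpos_of_nonneg (by linarith [hu.2]) hε.le
    rw [h.sub_length] at h3
    have h5 := abs_le.1 (h.loc.chart.abs_X_sub_le hyu)
    have h6 := h.loc.dist_center_le y
    have h7 := h.loc.abs_Y_le hy (by linarith)
    by_contra! hX
    rw [abs_of_nonneg hX] at h6
    nlinarith

/-- A connected set without points in the cut set that joins points to the right and to the left
of the centre comes close to all points of the curve that are far from the centre. -/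
lemma exists_near_of_far (h : ClosedLoc Γ H Z yh r ε g T L σ X Y t) (hη : 0 < η) (hη1 : η ≤ 1)
    {P : Set Plane} (hP : P ⊆ closure (H \ cutSet H yh ε (η * ε))) (hPc : IsPreconnected P)
    {p p' : Plane} (hp : p ∈ P) (hp' : p' ∈ P) (hpd : dist p yh ≤ 100 * ε)
    (hpd' : dist p' yh ≤ 100 * ε) (hpX : 0 ≤ X p) (hpX' : X p' ≤ 0) {s : ℝ}
    (hs : s ∈ Icc (240 * ε) (L - 240 * ε)) : ∃ c ∈ P, dist c (g s) ≤ 31 / 10 * ε := by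
  have hε := h.eps_pos
  have hPH : P ⊆ H := fun y hy => mem_of_mem_closure h.loc.core.isClosed (hP hy)
  have hcl : IsClosed {y | OnSide g yh ε (fun p => -X p) s L y} :=
    Filament.isClosed_onSide hε.le h.loc.chart.continuous_X.neg (h.curve.strand s L).continuousOn
  -- The two closed sets meet only near `g s`. At the other place where the two parts of the curve
  -- adjoin, the parameter 0, they are separated inside the disc by the sign of X, and a common
  -- point outside the disc would be too close to the centre.
  obtain ⟨y, hyP, hR, hL⟩ := isPreconnected_closed_iff.1 hPc _ _ (h.isClosed_onSide 0 s) hcl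
    (fun y hy => by
      rcases le_total (dist y yh) (100 * ε) with hd | hd
      · rcases le_total 0 (X y) with h0 | h0
        · exact Or.inl (Or.inl ⟨hd, h0⟩)
        · exact Or.inr (Or.inl ⟨hd, by linarith⟩)
      · obtain ⟨e, he, hde⟩ := h.loc.core.near y (hPH hy)
        obtain ⟨u, hu, rfl⟩ := h.curve.exists_eq he 0
        rcases le_total u s with h0 | h0
        · exact Or.inl (Or.inr ⟨hd, u, ⟨hu.1, h0⟩, hde⟩)
        · exact Or.inr (Or.inr ⟨hd, u, ⟨h0, by linarith [hu.2]⟩, hde⟩))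
    ⟨p, hp, Or.inl ⟨hpd, hpX⟩⟩ ⟨p', hp', Or.inl ⟨hpd', by linarith⟩⟩
  have hyH := hPH hyP
  rcases hR with ⟨hd, h0⟩ | ⟨hd, u, hu, hyu⟩
  · rcases hL with ⟨-, h0'⟩ | ⟨hd', v, hv, hyv⟩
    · have := h.loc.le_abs_X hη (by linarith) hyH (by linarith) (clears_of_mem_closure (hP hyP))
      rw [le_antisymm (by linarith) h0, abs_zero] at this
      linarith
    · linarith [h.X_neg_of_near hyH (le_antisymm hd hd') hs.1 hv hyv]
  · rcases hL with ⟨hd', h0⟩ | ⟨hd', v, hv, hyv⟩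
    · have e : L + -1 * (L - u) = u := by ring
      have := h.reverse.X_neg_of_near hyH (le_antisymm hd' hd) (s := L - s) (u := L - u)
        (by linarith [hs.2]) ⟨by linarith [hu.2], by linarith [hu.1]⟩ (by rwa [e])
      linarith
    · rcases h.curve.arc_le_of_dist hε h.big (hu.2.trans hv.1) (by linarith [hu.1, hv.2])
        (ρ := 6) (by norm_num) (by linarith [dist_triangle_left (g u) (g v) y]) with h1 | h1
      · exact ⟨y, hyP, by
          linarith [h.curve.between hε h.big ⟨hu.2, hv.1⟩ (by linarith) hyu hyv]⟩
      · have h2 := (h.abs_param (s := u) (by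
          rw [abs_of_nonneg hu.1]; linarith [hv.2])).2.1
        rw [abs_of_nonneg hu.1] at h2
        linarith [dist_triangle y (g u) yh, hv.2]

/-- Such a set comes close to all points of the curve, with the possible exception of a part near
the centre. -/
lemma exists_near_or (h : ClosedLoc Γ H Z yh r ε g T L σ X Y t) (hη : 0 < η) (hη1 : η ≤ 1)
    {P : Set Plane} (hP : P ⊆ closure (H \ cutSet H yh ε (η * ε))) (hPc : IsPreconnected P)
    {p p' : Plane} (hp : p ∈ P) (hp' : p' ∈ P) (hpd : dist p yh ≤ 100 * ε)
    (hpd' : dist p' yh ≤ 100 * ε) (hpX : 0 ≤ X p) (hpX' : X p' ≤ 0) {e : Plane} (he : e ∈ Γ) :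
    (∃ c ∈ P, dist c e ≤ 31 / 10 * ε) ∨ (dist e yh ≤ 300 * ε ∧ X p' ≤ X e ∧ X e ≤ X p) := by
  have hε := h.eps_pos
  by_cases hed : dist e yh ≤ 300 * ε
  · rcases le_total (X p) (X e) with h1 | h1
    · exact Or.inl (h.loc.exists_near_of_le_X hη hη1 hP hPc hp hp' (by linarith) hpX hpX' he hed h1)
    rcases le_total (X e) (X p') with h2 | h2
    · exact Or.inl (h.loc.negX.exists_near_of_le_X hη hη1 hP hPc hp' hp (by linarith)
        (by linarith) (by linarith) he hed (by linarith))
    exact Or.inr ⟨hed, h2, h1⟩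
  · left
    obtain ⟨s, hs, rfl⟩ := h.curve.exists_eq he 0
    refine h.exists_near_of_far hη hη1 hP hPc hp hp' hpd hpd' hpX hpX' ⟨?_, ?_⟩
    · by_contra! hlt
      have := (h.abs_param (s := s) (by rw [abs_of_nonneg hs.1]; linarith)).2.1
      rw [abs_of_nonneg hs.1] at this
      linarith
    · by_contra! hlt
      have := (h.abs_param (s := s - L) (by
        rw [abs_of_nonpos (by linarith [hs.2])]; linarith)).2.1
      rw [abs_of_nonpos (by linarith [hs.2]), h.sub_length] at this
      linarith

/-- The points to the right and to the left of the cut set are far apart in its complement. -/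
lemma le_pathDist (h : ClosedLoc Γ H Z yh r ε g T L σ X Y t) (hη : 0 < η) (hη1 : η ≤ 1)
    {K : Set Plane} (hK : K ⊆ closure (H \ cutSet H yh ε (η * ε))) {p p' : Plane}
    (hpd : dist p yh ≤ 100 * ε) (hpd' : dist p' yh ≤ 100 * ε) (hpX : 0 ≤ X p) (hpX' : X p' ≤ 0) :
    ENNReal.ofReal (10 ^ 6 * ε) ≤ pathDist K p p' := by
  have hε := h.eps_pos
  have hL := h.le_length
  refine le_iInf₂ fun γ hγ => ?_
  -- The landmark at arc length 10⁷ε is far from the centre both ways round, because L ≥ 4·10¹⁰ε.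
  obtain ⟨s, hs⟩ : ∃ s, s = 10 ^ 7 * ε := ⟨_, rfl⟩
  obtain ⟨c, hc, hcd⟩ := h.exists_near_of_far hη hη1 (hγ.trans hK) (isPreconnected_range_path γ)
    ⟨0, γ.source⟩ ⟨1, γ.target⟩ hpd hpd' hpX hpX' (s := s) ⟨by linarith, by linarith⟩
  refine le_trans ?_ (pathDist_add_le_of_mem_range γ hγ hc)
  refine le_trans ?_ le_self_add
  refine le_trans ?_ (edist_le_pathDist _ _ _)
  rw [edist_dist]
  apply ENNReal.ofReal_le_ofReal
  by_contra! hlt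
  have h1 : dist (g s) yh ≤ 2 * 10 ^ 6 * ε := by
    have h2 := dist_triangle4 (g s) c p yh
    rw [dist_comm _ c, dist_comm c p] at h2
    linarith
  rcases h.param_of_dist ⟨by linarith, by linarith⟩ (by norm_num) h1 with h3 | h3
  · linarith
  · linarith

end ClosedLoc


/-! ### Pairs of end points on the two sides of the cut -/

namespace Loc

variable {Γ H Z : Set Plane} {yh : Plane} {r ε : ℝ} {X Y : Plane → ℝ} {t η : ℝ}

lemma isClosed_mainRight (h : Loc Γ H Z yh r ε X Y t) :
    IsClosed {y | MainRight Γ H yh ε X Y y} := by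
  have hX := h.chart.continuous_X
  have hY := h.chart.continuous_Y
  simp only [MainRight, cr, ofPred_forall]
  exact isClosed_iInter fun q => isClosed_iInter fun _ => isClosed_iInter fun _ =>
    isClosed_iInter fun e => isClosed_iInter fun _ => isClosed_iInter fun _ =>
    isClosed_iInter fun _ => isClosed_le continuous_const (by fun_prop)

lemma X_ne_zero (h : Loc Γ H Z yh r ε X Y t) (hη : 0 < η) (hη1 : η ≤ 1) {y : Plane}
    (hy : y ∈ closure (H \ cutSet H yh ε (η * ε))) (hd : dist y yh ≤ 2400 * ε) : X y ≠ 0 := by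
  intro h0
  have := h.le_abs_X hη hη1 (mem_of_mem_closure h.core.isClosed hy) hd (clears_of_mem_closure hy)
  rw [h0, abs_zero] at this
  linarith

lemma pathDist_le_of_mainRight (h : Loc Γ H Z yh r ε X Y t) (hη : 0 < η) (hη1 : η ≤ 1 / 10 ^ 8)
    {S : Set Plane} (hS : Absorbs (H \ cutSet H yh ε (η * ε)) S) {e : Plane} (he : e ∈ Γ)
    (heX : X e ∈ Icc (15 / 2) 2000) (hed : dist e yh ≤ 20 * ε) (heS : e ∈ S) {x z : Plane}
    (hx : x ∈ closure S) (hz : z ∈ closure S) (hxd : dist x yh ≤ 250 * ε)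
    (hzd : dist z yh ≤ 250 * ε) (hxX : 0 < X x) (hzX : 0 < X z)
    (hxm : MainRight Γ H yh ε X Y x) (hzm : MainRight Γ H yh ε X Y z) :
    pathDist (closure S) x z ≤ ENNReal.ofReal (2000 * ε) := by
  have hε := h.core.ε_pos
  have key : ∀ x ∈ closure S, dist x yh ≤ 250 * ε → 0 < X x → MainRight Γ H yh ε X Y x →
      pathDist (closure S) x e ≤ ENNReal.ofReal (300 * ε) := fun x hx hd hX hm => by
    refine (pathDist_le_of_segment (h.segment_subset_closure hη hη1 hS hx (by linarith) hX hm he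
      heX (by linarith) heS).2).trans (ENNReal.ofReal_le_ofReal ?_)
    linarith [dist_triangle_right x e yh]
  refine (pathDist_triangle _ x e z).trans ?_
  rw [pathDist_comm _ e z]
  refine (add_le_add (key x hx hxd hxX hxm) (key z hz hzd hzX hzm)).trans ?_
  rw [← ENNReal.ofReal_add (by positivity) (by positivity)]
  exact ENNReal.ofReal_le_ofReal (by linarith)

/-- Points on the same side of the cut set that can be joined have a small distance. -/
lemma pathDist_le_of_right (h : Loc Γ H Z yh r ε X Y t) (hη : 0 < η) (hη1 : η ≤ 1 / 10 ^ 8)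
    {e : Plane} (he : e ∈ Γ) (heX : X e ∈ Icc (15 / 2) 2000) (hed : dist e yh ≤ 20 * ε)
    {x z : Plane} (hx : x ∈ closure (H \ cutSet H yh ε (η * ε)))
    (hz : z ∈ closure (H \ cutSet H yh ε (η * ε))) (hxd : dist x yh ≤ 100 * ε)
    (hzd : dist z yh ≤ 100 * ε) (hxX : 0 < X x) (hzX : 0 < X z)
    (hfin : pathDist (closure (H \ cutSet H yh ε (η * ε))) x z ≠ ∞) :
    pathDist (closure (H \ cutSet H yh ε (η * ε))) x z ≤ ENNReal.ofReal (2000 * ε) := by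
  have hε := h.core.ε_pos
  -- In the main part both points are joined through the relay point `e`; otherwise both are in the
  -- same pocket.
  by_cases hm : MainRight Γ H yh ε X Y x
  · obtain ⟨γ, hγ⟩ := exists_path_of_pathDist_ne_top hfin
    have hm' := h.mainRight_of_isPreconnected hη hη1 he ⟨by linarith [heX.1], heX.2⟩ (by linarith)
      hγ (isPreconnected_range_path γ) ⟨0, γ.source⟩ ⟨1, γ.target⟩ (Or.inr (Or.inr hm))
      (by linarith) hzX
    exact h.pathDist_le_of_mainRight hη hη1 (absorbs_self _) he heX hed
      (h.mem_sdiff_of_X hη1 (h.core.curve_subset he) (by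
        rw [abs_of_pos] <;> linarith [heX.1])) hx hz
      (by linarith) (by linarith) hxX hzX hm hm'
  · obtain ⟨q, hq, hqX, hqc⟩ : ∃ q, ChordEnd H yh ε q ∧ 0 ≤ X q ∧ cr X Y q e * cr X Y q x < 0 := by
      by_contra! hn
      exact hm (h.mainRight_of he (by linarith) (by linarith [heX.1]) hn)
    exact h.pathDist_le_of_sector hη hη1 he (by linarith [heX.1]) (by linarith) hq hqX hxd hxX hqc
      hfin

end Loc

namespace ClosedLoc

variable {Γ H Z : Set Plane} {yh : Plane} {r ε : ℝ} {g T : ℝ → Plane} {L σ : ℝ}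
  {X Y : Plane → ℝ} {t η : ℝ}

lemma start_mem (h : ClosedLoc Γ H Z yh r ε g T L σ X Y t) :
    g (10 * ε) ∈ Γ ∧ X (g (10 * ε)) ∈ Icc (15 / 2) 2000 ∧ dist (g (10 * ε)) yh ≤ 20 * ε := by
  have hε := h.eps_pos
  obtain ⟨h1, h2, h3⟩ := h.abs_param (s := 10 * ε) (by
    rw [abs_of_nonneg (by positivity)]; linarith)
  rw [mul_div_cancel_right₀ _ hε.ne', abs_le] at h3
  rw [abs_of_nonneg (by positivity)] at h2
  exact ⟨h1, ⟨by linarith, by linarith⟩, by linarith⟩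

lemma mem_reverse {g : ℝ → Plane} {S : Set Plane} {ε L : ℝ}
    (hgS : ∀ s ∈ Icc (10 * ε) (L - 10 * ε), g s ∈ S) :
    ∀ s ∈ Icc (10 * ε) (L - 10 * ε), (fun s => g (L + -1 * s)) s ∈ S :=
  fun s hs => hgS _ ⟨by linarith [hs.2], by linarith [hs.1]⟩

lemma start_param (h : ClosedLoc Γ H Z yh r ε g T L σ X Y t) :
    10 * ε ∈ Icc (10 * ε) (L - 10 * ε) := ⟨le_rfl, by linarith [h.le_length, h.eps_pos]⟩

lemma pathDist_ne_top (h : ClosedLoc Γ H Z yh r ε g T L σ X Y t) (hη : 0 < η)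
    (hη1 : η ≤ 1 / 10 ^ 8) {S : Set Plane} (hS : Absorbs (H \ cutSet H yh ε (η * ε)) S)
    (hgS : ∀ s ∈ Icc (10 * ε) (L - 10 * ε), g s ∈ S) {x z : Plane} (hx : x ∈ closure S)
    (hz : z ∈ closure S) (hxd : dist x yh ≤ 250 * ε) (hzd : dist z yh ≤ 250 * ε)
    (hxX : 0 < X x) (hzX : X z < 0) (hxm : MainRight Γ H yh ε X Y x)
    (hzm : MainRight Γ H yh ε (fun p => -X p) Y z) : pathDist (closure S) x z ≠ ∞ := by
  have hε := h.eps_pos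
  have hL := h.le_length
  obtain ⟨h1, h2, h3⟩ := h.start_mem
  obtain ⟨h1', h2', h3'⟩ := h.reverse.start_mem
  have f1 := pathDist_le_of_segment (h.loc.segment_subset_closure hη hη1 hS hx (by linarith) hxX
    hxm h1 h2 (by linarith) (hgS _ h.start_param)).2
  have f3 := pathDist_le_of_segment (h.loc.negX.segment_subset_closure hη hη1 hS hz (by linarith)
    (by linarith) hzm h1' h2' (by linarith) (mem_reverse hgS _ h.start_param)).2
  have f2 := h.curve.pathDist_le (s := 10 * ε) (t := L + -1 * (10 * ε)) (by linarith)
    (fun s hs => subset_closure (hgS s ⟨hs.1, by linarith [hs.2]⟩))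
  have ht : ∀ {a : ℝ≥0∞} {b : ℝ}, a ≤ ENNReal.ofReal b → a ≠ ∞ := fun hab =>
    ne_top_of_le_ne_top ENNReal.ofReal_ne_top hab
  rw [pathDist_comm] at f3
  exact ne_top_of_le_ne_top (ENNReal.add_ne_top.2 ⟨ht f1, ne_top_of_le_ne_top
    (ENNReal.add_ne_top.2 ⟨ht f2, ht f3⟩) (pathDist_triangle _ _ _ _)⟩) (pathDist_triangle _ _ _ _)

/-- The right end point of a pair that can be joined around the curve. -/
lemma mainRight_of_pathDist_ne_top (h : ClosedLoc Γ H Z yh r ε g T L σ X Y t) (hη : 0 < η)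
    (hη1 : η ≤ 1 / 10 ^ 8) {x z : Plane} (hxd : dist x yh ≤ 100 * ε)
    (hxX : 0 < X x) (hzX : X z < 0)
    (hfin : pathDist (closure (H \ cutSet H yh ε (η * ε))) x z ≠ ∞) :
    MainRight Γ H yh ε X Y x := by
  have hε := h.eps_pos
  obtain ⟨h1, h2, h3⟩ := h.start_mem
  obtain ⟨γ, hγ⟩ := exists_path_of_pathDist_ne_top hfin
  exact h.loc.mainRight_of_isPreconnected hη hη1 h1 ⟨by linarith [h2.1], h2.2⟩ (by linarith)
    hγ (isPreconnected_range_path γ) ⟨1, γ.target⟩ ⟨0, γ.source⟩ (Or.inl hzX.le)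
    (by linarith) hxX

lemma frontier_cutSet_spec (h : ClosedLoc Γ H Z yh r ε g T L σ X Y t) (hη : 0 < η)
    (hη1 : η ≤ 1 / 10 ^ 8) {x : Plane} (hx : x ∈ closure (H \ cutSet H yh ε (η * ε)))
    (hxA : x ∈ frontier (cutSet H yh ε (η * ε))) :
    x ∈ cutSet H yh ε (η * ε) ∧ dist x yh ≤ 100 * ε ∧ (0 < X x ∨ X x < 0) := by
  have hε := h.eps_pos
  have hA := (isClosed_cutSet h.loc.core.isCompact yh ε
    (by positivity : 0 ≤ η * ε)).frontier_subset hxA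
  have hd := h.loc.cutSet_dist_le hη1 hA
  exact ⟨hA, by linarith, (lt_or_gt_of_ne (h.loc.X_ne_zero hη (by linarith) hx
    (by linarith))).symm⟩

/-- A path in the cut set comes close to the part of the curve between its end points. -/
lemma exists_near_of_cutSet (h : ClosedLoc Γ H Z yh r ε g T L σ X Y t)
    (hη1 : η ≤ 1 / 10 ^ 8) {P : Set Plane} (hP : P ⊆ cutSet H yh ε (η * ε))
    (hPc : IsPreconnected P) {p p' : Plane} (hp : p ∈ P) (hp' : p' ∈ P) {e : Plane} (he : e ∈ Γ)
    (hed : dist e yh ≤ 300 * ε) (h₁ : X p' ≤ X e) (h₂ : X e ≤ X p) :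
    ∃ c ∈ P, dist c e ≤ 4 * ε := by
  have hε := h.eps_pos
  obtain ⟨c, hc, hcX⟩ := (hPc.image X h.loc.chart.continuous_X.continuousOn).Icc_subset
    ⟨p', hp', rfl⟩ ⟨p, hp, rfl⟩ ⟨h₁, h₂⟩
  obtain ⟨b, hb, hcb⟩ := mem_enlargement.1 (hP hc)
  refine ⟨c, hc, h.loc.chart.dist_le (by norm_num) ?_⟩
  have hcb' : dist c b ≤ 1 / 10 * ε := hcb.trans (by gcongr; linarith)
  have hbA : b ∈ cutSet H yh ε (0 * ε) := mem_enlargement.2 ⟨b, hb, by simp⟩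
  have hbd := h.loc.cutSet_dist_le (by norm_num) hbA
  have h1 := abs_le.1 (h.loc.strip hb.2 (by linarith))
  have h2 := abs_le.1 (h.loc.flat e he (by linarith))
  have h4 := abs_le.1 (h.loc.chart.abs_Y_sub_le hcb')
  have h3 : (Y c - Y e) ^ 2 ≤ 4 ^ 2 := sq_le_sq' (by linarith) (by linarith)
  rw [hcX, sub_self]
  linarith

/-- Every output of the closed-curve algorithm covers the curve. -/
lemma cover_of_closedOutput (h : ClosedLoc Γ H Z yh r ε g T L σ X Y t) (hη : 0 < η)
    (hη1 : η ≤ 1 / 10 ^ 8) {C : Set Plane} (hC : ClosedOutput H yh ε (η * ε) C) {e : Plane}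
    (he : e ∈ Γ) : ∃ c ∈ C, dist c e ≤ 4 * ε := by
  have hε := h.eps_pos
  obtain ⟨x₀, x₁, γ, γ', ⟨hpair, hγ⟩, hγ', rfl⟩ := hC
  have hS := absorbs_self (H \ cutSet H yh ε (η * ε))
  have hgS : ∀ s ∈ Icc (10 * ε) (L - 10 * ε), g s ∈ H \ cutSet H yh ε (η * ε) :=
    fun s hs => h.mem_sdiff_param hη1 hs
  obtain ⟨h1, h2, h3⟩ := h.start_mem
  obtain ⟨h1', h2', h3'⟩ := h.reverse.start_mem
  obtain ⟨a, ha, had, haX, ham⟩ := h.loc.exists_exit hη hη1 hS h1 h2 (by linarith)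
    (hgS _ h.start_param)
  obtain ⟨b, hb, hbd, hbX, hbm⟩ := h.loc.negX.exists_exit hη hη1 hS h1' h2' (by linarith)
    (mem_reverse hgS _ h.start_param)
  -- The exit points `a` and `b` form an admissible pair on opposite sides, so the maximum is at
  -- least 10⁶ε, which rules out pairs on one side.
  have hle : ENNReal.ofReal (10 ^ 6 * ε) ≤
      pathDist (closure (H \ cutSet H yh ε (η * ε))) x₀ x₁ :=
    (h.le_pathDist hη (by linarith) Subset.rfl (by linarith) (by linarith) haX.le
      (by linarith)).trans (hpair.maximal a ha b hb (h.pathDist_ne_top hη hη1 hS hgS ha.1 hb.1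
        (by linarith) (by linarith) haX (by linarith) ham hbm))
  have hlt : ¬ pathDist (closure (H \ cutSet H yh ε (η * ε))) x₀ x₁ ≤ ENNReal.ofReal (2000 * ε) :=
    fun h0 => by
      have := (ENNReal.ofReal_le_ofReal_iff (by positivity)).1 (hle.trans h0)
      linarith
  obtain ⟨hA₀, hd₀, hX₀⟩ := h.frontier_cutSet_spec hη hη1 hpair.left_mem.1 hpair.left_mem.2
  obtain ⟨hA₁, hd₁, hX₁⟩ := h.frontier_cutSet_spec hη hη1 hpair.right_mem.1 hpair.right_mem.2
  have hx₀ : x₀ ∈ range γ := ⟨0, γ.source⟩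
  have hx₁ : x₁ ∈ range γ := ⟨1, γ.target⟩
  have hx₀' : x₀ ∈ range γ' := ⟨1, γ'.target⟩
  have hx₁' : x₁ ∈ range γ' := ⟨0, γ'.source⟩
  -- γ comes close to everything except perhaps the part of the curve with X between the end points;
  -- that part is approached by γ', which takes all these values of X.
  have main : ∀ p ∈ range γ, ∀ p' ∈ range γ, p ∈ range γ' → p' ∈ range γ' →
      dist p yh ≤ 100 * ε → dist p' yh ≤ 100 * ε → 0 < X p → X p' < 0 →
      ∃ c ∈ range γ ∪ range γ', dist c e ≤ 4 * ε := by
    intro p hp p' hp' hpγ hpγ' hpd hpd' hpX hpX'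
    rcases h.exists_near_or hη (by linarith) hγ (isPreconnected_range_path γ) hp hp' hpd hpd'
      hpX.le hpX'.le he with ⟨c, hc, hcd⟩ | ⟨hed, h4, h5⟩
    · exact ⟨c, Or.inl hc, by linarith⟩
    · obtain ⟨c, hc, hcd⟩ := h.exists_near_of_cutSet hη1 hγ' (isPreconnected_range_path γ') hpγ
        hpγ' he hed h4 h5
      exact ⟨c, Or.inr hc, hcd⟩
  rcases hX₀ with h4 | h4 <;> rcases hX₁ with h5 | h5
  · exact absurd (h.loc.pathDist_le_of_right hη hη1 h1 h2 h3 hpair.left_mem.1 hpair.right_mem.1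
      hd₀ hd₁ h4 h5 hpair.joined) hlt
  · exact main x₀ hx₀ x₁ hx₁ hx₀' hx₁' hd₀ hd₁ h4 h5
  · exact main x₁ hx₁ x₀ hx₀ hx₁' hx₀' hd₁ hd₀ h5 h4
  · exact absurd (h.loc.negX.pathDist_le_of_right hη hη1 h1' h2' h3' hpair.left_mem.1
      hpair.right_mem.1 hd₀ hd₁ (by linarith) (by linarith) hpair.joined) hlt

/-- The closed-curve algorithm has an output. -/
lemma exists_closedOutput (h : ClosedLoc Γ H Z yh r ε g T L σ X Y t) (hη : 0 < η)
    (hη1 : η ≤ 1 / 10 ^ 8) : ∃ C, ClosedOutput H yh ε (η * ε) C := by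
  have hε := h.eps_pos
  have hS := absorbs_self (H \ cutSet H yh ε (η * ε))
  have hgS : ∀ s ∈ Icc (10 * ε) (L - 10 * ε), g s ∈ H \ cutSet H yh ε (η * ε) :=
    fun s hs => h.mem_sdiff_param hη1 hs
  obtain ⟨h1, h2, h3⟩ := h.start_mem
  obtain ⟨h1', h2', h3'⟩ := h.reverse.start_mem
  have hs := hgS _ h.start_param
  have hs' := mem_reverse hgS _ h.start_param
  obtain ⟨a, ha, had, haX, ham⟩ := h.loc.exists_exit hη hη1 hS h1 h2 (by linarith) hs
  obtain ⟨b, hb, hbd, hbX, hbm⟩ := h.loc.negX.exists_exit hη hη1 hS h1' h2' (by linarith) hs'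
  have hKA : IsCompact (closure (H \ cutSet H yh ε (η * ε)) ∩
      frontier (cutSet H yh ε (η * ε))) :=
    (h.loc.core.isCompact.of_isClosed_subset isClosed_closure
      (closure_minimal sdiff_subset h.loc.core.isClosed)).inter_right isClosed_frontier
  -- The maximum is sought only among right and left points of the main parts, where the path
  -- distance is finite and continuous. Other joined pairs are either on one side, hence closer, or
  -- on opposite sides, where being joined forces `MainRight`.
  have hc₁ : IsClosed {y | 0 ≤ X y ∧ MainRight Γ H yh ε X Y y} := by
    rw [ofPred_and]
    exact (isClosed_le continuous_const h.loc.chart.continuous_X).inter h.loc.isClosed_mainRight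
  have hc₂ : IsClosed {y | 0 ≤ -X y ∧ MainRight Γ H yh ε (fun p => -X p) Y y} := by
    rw [ofPred_and]
    exact (isClosed_le continuous_const h.loc.chart.continuous_X.neg).inter
      h.loc.negX.isClosed_mainRight
  set K := closure (H \ cutSet H yh ε (η * ε)) with hK
  set F := frontier (cutSet H yh ε (η * ε)) with hF
  have hloc : ∀ x ∈ K ∩ F, x ∈ cutSet H yh ε (η * ε) ∧ dist x yh ≤ 100 * ε ∧
      (0 < X x ∨ X x < 0) := fun x hx => h.frontier_cutSet_spec hη hη1 hx.1 hx.2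
  have hpos : ∀ x ∈ K ∩ F, 0 ≤ X x → 0 < X x := fun x hx h0 =>
    (hloc x hx).2.2.resolve_right h0.not_gt
  have hneg : ∀ x ∈ K ∩ F, 0 ≤ -X x → X x < 0 := fun x hx h0 =>
    (hloc x hx).2.2.resolve_left (by linarith)
  have hd : ∀ x ∈ K ∩ F, dist x yh ≤ 2400 * ε := fun x hx => by linarith [(hloc x hx).2.1]
  have hfin : ∀ x ∈ K ∩ F ∩ {y | 0 ≤ X y ∧ MainRight Γ H yh ε X Y y},
      ∀ z ∈ K ∩ F ∩ {y | 0 ≤ -X y ∧ MainRight Γ H yh ε (fun p => -X p) Y y},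
      pathDist K x z ≠ ∞ := fun x hx z hz =>
    h.pathDist_ne_top hη hη1 hS hgS hx.1.1 hz.1.1 (by linarith [(hloc x hx.1).2.1])
      (by linarith [(hloc z hz.1).2.1]) (hpos x hx.1 hx.2.1) (hneg z hz.1 hz.2.1) hx.2.2 hz.2.2
  obtain ⟨x, hx, z, hz, hmax⟩ := exists_max_pathDist (hKA.inter_right hc₁) (hKA.inter_right hc₂)
    ⟨a, ha, haX.le, ham⟩ ⟨b, hb, hbX.le, hbm⟩ hfin
    (fun δ hδ => by
      obtain ⟨ρ, hρ, H1⟩ := h.loc.exists_pathDist_le hη hη1 hS h1 h2 (by linarith) hs hδ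
      exact ⟨ρ, hρ, fun x hx x' hx' hxx' => H1 x hx.1.1 x' hx'.1.1 (hd x hx.1) (hd x' hx'.1)
        (hpos x hx.1 hx.2.1) (hpos x' hx'.1 hx'.2.1) hx.2.2 hx'.2.2 hxx'⟩)
    (fun δ hδ => by
      obtain ⟨ρ, hρ, H1⟩ := h.loc.negX.exists_pathDist_le hη hη1 hS h1' h2' (by linarith) hs' hδ
      exact ⟨ρ, hρ, fun x hx x' hx' hxx' => H1 x hx.1.1 x' hx'.1.1 (hd x hx.1) (hd x' hx'.1)
        (by linarith [hneg x hx.1 hx.2.1]) (by linarith [hneg x' hx'.1 hx'.2.1])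
        hx.2.2 hx'.2.2 hxx'⟩)
  have hle : ENNReal.ofReal (2000 * ε) ≤ pathDist K x z :=
    (ENNReal.ofReal_le_ofReal (by linarith)).trans (h.le_pathDist hη (by linarith) Subset.rfl
      (hloc x hx.1).2.1 (hloc z hz.1).2.1 (hpos x hx.1 hx.2.1).le (hneg z hz.1 hz.2.1).le)
  have hRL : ∀ u ∈ K ∩ F, ∀ v ∈ K ∩ F, 0 < X u → X v < 0 → pathDist K u v ≠ ∞ →
      pathDist K u v ≤ pathDist K x z := fun u hu v hv hu0 hv0 huv =>
    hmax u ⟨hu, hu0.le, h.mainRight_of_pathDist_ne_top hη hη1 (hloc u hu).2.1 hu0 hv0 huv⟩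
      v ⟨hv, by linarith, h.reverse.mainRight_of_pathDist_ne_top hη hη1 (hloc v hv).2.1
        (by linarith) (z := u) (by linarith) (by rwa [pathDist_comm])⟩
  have hpair : IsEndpointPair K F F x z := ⟨hx.1, hz.1, hfin x hx z hz, fun u hu v hv huv => by
    rcases (hloc u hu).2.2 with h4 | h4 <;> rcases (hloc v hv).2.2 with h5 | h5
    · exact (h.loc.pathDist_le_of_right hη hη1 h1 h2 h3 hu.1 hv.1 (hloc u hu).2.1 (hloc v hv).2.1
        h4 h5 huv).trans hle
    · exact hRL u hu v hv h4 h5 huv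
    · rw [pathDist_comm] at huv ⊢
      exact hRL v hv u hu h5 h4 huv
    · exact (h.loc.negX.pathDist_le_of_right hη hη1 h1' h2' h3' hu.1 hv.1 (hloc u hu).2.1
        (hloc v hv).2.1 (by linarith) (by linarith) huv).trans hle⟩
  obtain ⟨γ, hγ⟩ := exists_path_of_pathDist_ne_top hpair.joined
  obtain ⟨γ', hγ'⟩ := h.loc.exists_path_cutSet hη.le (hloc z hz.1).1 (hloc x hx.1).1
  exact ⟨_, x, z, γ, γ', ⟨hpair, hγ⟩, hγ', rfl⟩

end ClosedLoc


/-! ### The general-curve algorithm on a closed curve -/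

namespace ClosedLoc

variable {Γ H Z : Set Plane} {yh : Plane} {r ε : ℝ} {g T : ℝ → Plane} {L σ : ℝ}
  {X Y : Plane → ℝ} {t η : ℝ}

lemma mainRight_of_mem_closure (h : ClosedLoc Γ H Z yh r ε g T L σ X Y t) (hη : 0 < η)
    (hη1 : η ≤ 1 / 10 ^ 8) {S : Set Plane} (hS : Absorbs (H \ cutSet H yh ε (η * ε)) S)
    (hSc : IsPreconnected S) (hgS : ∀ s ∈ Icc (10 * ε) (L - 10 * ε), g s ∈ S) {x : Plane}
    (hx : x ∈ closure S) (hd : dist x yh ≤ 2400 * ε) (hX : 0 < X x) :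
    MainRight Γ H yh ε X Y x := by
  have hε := h.eps_pos
  obtain ⟨h1, h2, h3⟩ := h.start_mem
  exact h.loc.mainRight_of_isPreconnected hη hη1 h1 ⟨by linarith [h2.1], h2.2⟩ (by linarith)
    (closure_mono hS.1) hSc.closure (subset_closure (hgS _ h.start_param)) hx
    (Or.inr (Or.inr (h.loc.mainRight_of_far (h.loc.core.curve_subset h1) (by linarith)
      (by linarith [h2.1])))) hd hX

/-- A point to the right of the cut set which is at least as far from some point on the left as
some point very close to the centre is itself close to the centre. -/
lemma X_le_of_pathDist_le (h : ClosedLoc Γ H Z yh r ε g T L σ X Y t) (hη : 0 < η)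
    (hη1 : η ≤ 1 / 10 ^ 8) {S : Set Plane} (hS : Absorbs (H \ cutSet H yh ε (η * ε)) S)
    (hSc : IsPreconnected S) (hgS : ∀ s ∈ Icc (10 * ε) (L - 10 * ε), g s ∈ S) {a x z : Plane}
    (hx : x ∈ closure S) (had : dist a yh ≤ 1 / 100 * ε)
    (hxd : dist x yh ≤ 250 * ε) (hzd : dist z yh ≤ 100 * ε) (haX : 0 < X a) (hxX : 0 < X x)
    (hzX : X z < 0) (hfin : pathDist (closure S) a z ≠ ∞)
    (hle : pathDist (closure S) a z ≤ pathDist (closure S) x z) : X x ≤ 3 / 20 := by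
  have hε := h.eps_pos
  have hL := h.le_length
  have hSK : closure S ⊆ closure (H \ cutSet H yh ε (η * ε)) := closure_mono hS.1
  have hSH : closure S ⊆ H := fun y hy => mem_of_mem_closure h.loc.core.isClosed (hSK hy)
  -- Lengths are compared up to the landmark `g (800 * ε)`, with `g (400 * ε)` as relay point. Over
  -- such distances the height differences, at most 3.04, lengthen the segments by only 1/25 and
  -- 1/50, so horizontal positions can be compared accurately.
  obtain ⟨w, ⟨hwW, hw⟩, hww⟩ := exists_crossing_le (W := {w | dist w (g (800 * ε)) ≤ 31 / 10 * ε})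
    hfin hle (fun γ hγ => by
      obtain ⟨c, hc, hcd⟩ := h.exists_near_of_far hη (by linarith) (hγ.trans hSK)
        (isPreconnected_range_path γ) ⟨0, γ.source⟩ ⟨1, γ.target⟩ (by linarith) hzd haX.le hzX.le
        (s := 800 * ε) ⟨by linarith, by linarith⟩
      exact ⟨c, hc, hcd⟩) (δ := 1 / 1000 * ε) (by positivity)
  replace hwW : dist w (g (800 * ε)) ≤ 31 / 10 * ε := hwW
  obtain ⟨-, hvd, hvX⟩ := h.abs_param (s := 800 * ε) (by
    rw [abs_of_nonneg (by positivity)]; linarith)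
  obtain ⟨heΓ, hed, heX⟩ := h.abs_param (s := 400 * ε) (by
    rw [abs_of_nonneg (by positivity)]; linarith)
  rw [mul_div_cancel_right₀ _ hε.ne', abs_le] at hvX heX
  rw [abs_of_nonneg (by positivity)] at hvd hed
  have hwX := abs_le.1 (h.loc.chart.abs_X_sub_le hwW)
  have hwd : dist w yh ≤ 900 * ε := by linarith [dist_triangle w (g (800 * ε)) yh]
  have heS : g (400 * ε) ∈ S := hgS _ ⟨by linarith, by linarith⟩
  generalize g (800 * ε) = v at *
  generalize g (400 * ε) = e at *
  have hseg : ∀ y ∈ closure S, dist y yh ≤ 2400 * ε → 0 < X y →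
      pathDist (closure S) y e ≤ ENNReal.ofReal (dist y e) := fun y hy hd hX =>
    pathDist_le_of_segment (h.loc.segment_subset_closure hη hη1 hS hy hd hX
      (h.mainRight_of_mem_closure hη hη1 hS hSc hgS hy hd hX) heΓ
      ⟨by linarith, by linarith⟩ (by linarith) heS).2
  have hYe := abs_le.1 (h.loc.flat e heΓ (by linarith))
  have hY : ∀ y ∈ closure S, dist y yh ≤ 2400 * ε → (Y y - Y e) ^ 2 ≤ (304 / 100) ^ 2 :=
    fun y hy hd => by
      have := abs_le.1 (h.loc.strip (hSH hy) hd)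
      exact sq_le_sq' (by linarith) (by linarith)
  have hx0 := (le_abs_self _).trans (h.loc.abs_X_le hxd)
  have d1 : dist x e ≤ (X e - X x + 1 / 25) * ε := by
    refine h.loc.chart.dist_le (by linarith) ?_
    have := hY x hx (by linarith)
    nlinarith
  have d2 : dist w e ≤ (X w - X e + 1 / 50) * ε := by
    refine h.loc.chart.dist_le (by linarith) ?_
    have := hY w hw (by linarith)
    nlinarith
  have d3 : (X w - X a) * ε ≤ dist a w :=
    h.loc.chart.le_dist (by nlinarith [sq_nonneg (Y a - Y w)])
  have ha0 := (le_abs_self _).trans (h.loc.abs_X_le had)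
  have d4 : dist a w ≤ dist x e + dist w e + 1 / 1000 * ε := by
    have h1 := (edist_le_pathDist _ a w).trans (hww.trans (add_le_add
      ((pathDist_triangle _ x e w).trans (add_le_add (hseg x hx (by linarith) hxX)
        ((pathDist_comm _ e w).trans_le (hseg w hw (by linarith) (by linarith))))) le_rfl))
    rw [← ENNReal.ofReal_add dist_nonneg dist_nonneg,
      ← ENNReal.ofReal_add (by positivity) (by positivity), edist_dist] at h1
    exact (ENNReal.ofReal_le_ofReal_iff (by positivity)).1 h1
  nlinarith

/-- A point that is far from the centre is not optimal. -/
lemma dist_le_of_pathDist_le (h : ClosedLoc Γ H Z yh r ε g T L σ X Y t) (hη : 0 < η)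
    (hη1 : η ≤ 1 / 10 ^ 8) {S : Set Plane} (hS : Absorbs (H \ cutSet H yh ε (η * ε)) S)
    (hgS : ∀ s ∈ Icc (10 * ε) (L - 10 * ε), g s ∈ S) {a x z : Plane}
    (hx : x ∈ closure S) (had : dist a yh ≤ 1 / 100 * ε) (hzd : dist z yh ≤ 100 * ε)
    (haX : 0 < X a) (hzX : X z < 0) (hfin : pathDist (closure S) a z ≠ ∞)
    (hle : pathDist (closure S) a z ≤ pathDist (closure S) x z) : dist x yh ≤ 250 * ε := by
  have hε := h.eps_pos
  have hSK : closure S ⊆ closure (H \ cutSet H yh ε (η * ε)) := closure_mono hS.1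
  have hSH : closure S ⊆ H := fun y hy => mem_of_mem_closure h.loc.core.isClosed (hSK hy)
  by_contra! hlt
  obtain ⟨e, he, hxe⟩ := h.loc.core.near x (hSH hx)
  obtain ⟨s, hs, rfl⟩ := h.curve.exists_eq he 0
  have hed : 247 * ε < dist (g s) yh := by linarith [dist_triangle x (g s) yh]
  have hs' : s ∈ Icc (240 * ε) (L - 240 * ε) := by
    constructor
    · by_contra! hlt
      have := (h.abs_param (s := s) (by rw [abs_of_nonneg hs.1]; linarith)).2.1
      rw [abs_of_nonneg hs.1] at this
      linarith
    · by_contra! hlt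
      have := (h.abs_param (s := s - L) (by
        rw [abs_of_nonpos (by linarith [hs.2])]; linarith)).2.1
      rw [abs_of_nonpos (by linarith [hs.2]), h.sub_length] at this
      linarith
  have hseg : ∀ w ∈ closure S, dist w (g s) ≤ 31 / 10 * ε →
      pathDist (closure S) w (g s) ≤ ENNReal.ofReal (31 / 10 * ε) := by
    intro w hw hd
    refine (pathDist_le_of_segment (Subset.trans (hS.2 _ (fun y hy => ?_)
      (convex_segment w (g s)).isPreconnected ⟨g s, right_mem_segment ℝ w (g s),
        hgS s ⟨by linarith [hs'.1], by linarith [hs'.2]⟩⟩) subset_closure)).trans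
      (ENNReal.ofReal_le_ofReal hd)
    have hyH := h.loc.core.segment_curve_subset he (hSH hw) (by linarith) hy
    rw [segment_symm] at hy
    have h1 := dist_le_of_mem_segment hy
    rw [dist_comm (g s) w] at h1
    exact h.loc.mem_sdiff_of_dist hη1 hyH (by linarith [dist_triangle (g s) y yh])
  -- The landmark is `g s` next to `x`. The comparison would put the exit point `a`, hence the
  -- centre, within about 10ε of `g s`.
  obtain ⟨w, ⟨hwW, hw⟩, hww⟩ := exists_crossing_le (W := {w | dist w (g s) ≤ 31 / 10 * ε})
    hfin hle (fun γ hγ => by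
      obtain ⟨c, hc, hcd⟩ := h.exists_near_of_far hη (by linarith) (hγ.trans hSK)
        (isPreconnected_range_path γ) ⟨0, γ.source⟩ ⟨1, γ.target⟩ (by linarith) hzd haX.le hzX.le
        hs'
      exact ⟨c, hc, hcd⟩) (δ := ε) hε
  replace hwW : dist w (g s) ≤ 31 / 10 * ε := hwW
  have h1 := (edist_le_pathDist _ a w).trans (hww.trans (add_le_add
    ((pathDist_triangle _ x (g s) w).trans (add_le_add (hseg x hx (by linarith))
      ((pathDist_comm _ (g s) w).trans_le (hseg w hw hwW)))) le_rfl))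
  rw [← ENNReal.ofReal_add (by positivity) (by positivity),
    ← ENNReal.ofReal_add (by positivity) (by positivity), edist_dist,
    ENNReal.ofReal_le_ofReal_iff (by positivity)] at h1
  have h2 := dist_triangle4 (g s) w a yh
  rw [dist_comm (g s) w, dist_comm w a] at h2
  linarith

/-- Comparison with the exit points gives |X| ≤ 3/20 for both end points, and the slope bound then
gives |Y| < 1/5 for `x₀`. Whatever the path does not approach lies between them and is close to
`x₀`, so no path through the cut set is needed here. -/
lemma cover_of_isEndpointPair_aux (h : ClosedLoc Γ H Z yh r ε g T L σ X Y t) (hη : 0 < η)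
    (hη1 : η ≤ 1 / 10 ^ 8) {S : Set Plane} (hS : Absorbs (H \ cutSet H yh ε (η * ε)) S)
    (hSc : IsPreconnected S) (hgS : ∀ s ∈ Icc (10 * ε) (L - 10 * ε), g s ∈ S) {x₀ x₁ : Plane}
    (hpair : IsEndpointPair (closure S) univ (frontier (cutSet H yh ε (η * ε))) x₀ x₁)
    {P : Set Plane} (hP : P ⊆ closure S) (hPc : IsPreconnected P) (h₀ : x₀ ∈ P) (h₁ : x₁ ∈ P)
    (hX₁ : X x₁ < 0) {e : Plane} (he : e ∈ Γ) : ∃ c ∈ P, dist c e ≤ 4 * ε := by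
  have hε := h.eps_pos
  have hSK : closure S ⊆ closure (H \ cutSet H yh ε (η * ε)) := closure_mono hS.1
  obtain ⟨k1, k2, k3⟩ := h.start_mem
  obtain ⟨k1', k2', k3'⟩ := h.reverse.start_mem
  have hs := hgS _ h.start_param
  have hgS' := mem_reverse hgS
  have hs' := hgS' _ h.start_param
  obtain ⟨a, ha, had, haX, ham⟩ := h.loc.exists_exit hη hη1 hS k1 k2 (by linarith) hs
  obtain ⟨b, hb, hbd, hbX, hbm⟩ := h.loc.negX.exists_exit hη hη1 hS k1' k2' (by linarith) hs'
  have hx₀ := hpair.left_mem.1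
  have hx₁ := hpair.right_mem.1
  have hd₁ := (h.frontier_cutSet_spec hη hη1 (hSK hx₁) hpair.right_mem.2).2.1
  have hm₁ := h.reverse.mainRight_of_mem_closure hη hη1 hS hSc hgS' hx₁ (by linarith)
    (by linarith)
  have hfin := h.pathDist_ne_top hη hη1 hS hgS ha.1 hx₁ (by linarith) (by linarith) haX hX₁ ham hm₁
  have hle := hpair.maximal a ⟨ha.1, mem_univ _⟩ x₁ hpair.right_mem hfin
  have hd₀ := h.dist_le_of_pathDist_le hη hη1 hS hgS hx₀ had hd₁ haX hX₁ hfin hle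
  -- On the left, `x₀` would be within path distance 2000 ε of `x₁`, less than the competitor `a`
  -- achieves.
  have hX₀ : 0 < X x₀ := by
    by_contra! hn
    have hlt := lt_of_le_of_ne hn (h.loc.X_ne_zero hη (by linarith) (hSK hx₀) (by linarith))
    have h1 := h.loc.negX.pathDist_le_of_mainRight hη hη1 hS k1' k2' k3' hs' hx₀ hx₁ hd₀
      (by linarith) (by linarith) (by linarith)
      (h.reverse.mainRight_of_mem_closure hη hη1 hS hSc hgS' hx₀ (by linarith) (by linarith)) hm₁
    have h2 := (h.le_pathDist hη (by linarith) hSK (by linarith) hd₁ haX.le hX₁.le).trans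
      (hle.trans h1)
    rw [ENNReal.ofReal_le_ofReal_iff (by positivity)] at h2
    linarith
  have hX₀' := h.X_le_of_pathDist_le hη hη1 hS hSc hgS hx₀ had hd₀ hd₁ haX hX₀ hX₁ hfin hle
  have hs₀ := h.loc.slope_lt hη (mem_of_mem_closure h.loc.core.isClosed (hSK hx₀)) (by linarith)
    (clears_of_mem_closure (hSK hx₀))
  rw [abs_of_pos hX₀] at hs₀
  have hd₀' : dist x₀ yh ≤ 100 * ε := by
    have := h.loc.dist_center_le x₀
    rw [abs_of_pos hX₀] at this
    nlinarith
  have hm₀ := h.mainRight_of_mem_closure hη hη1 hS hSc hgS hx₀ (by linarith) hX₀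
  have hfin' := h.pathDist_ne_top hη hη1 hS hgS hx₀ hb.1 hd₀ (by linarith) hX₀ (by linarith) hm₀ hbm
  have hle' := hpair.maximal x₀ hpair.left_mem b hb hfin'
  rw [pathDist_comm] at hfin'
  rw [pathDist_comm _ x₀ b, pathDist_comm _ x₀ x₁] at hle'
  have hX₁' := h.reverse.X_le_of_pathDist_le hη hη1 hS hSc hgS' hx₁ hbd (by linarith) hd₀' hbX
    (by linarith) (by linarith) hfin' hle'
  rcases h.exists_near_or hη (by linarith) (hP.trans hSK) hPc h₀ h₁ hd₀' hd₁ hX₀.le hX₁.le he with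
    ⟨c, hc, hcd⟩ | ⟨hed, h5, h6⟩
  · exact ⟨c, hc, by linarith⟩
  · refine ⟨x₀, h₀, h.loc.chart.dist_le (by norm_num) ?_⟩
    have h7 := abs_le.1 (h.loc.curve_Y he (by linarith))
    have h8 := abs_lt.1 (show |Y x₀| < 1 / 5 by linarith)
    have h9 : (X x₀ - X e) ^ 2 ≤ 1 ^ 2 := sq_le_sq' (by linarith) (by linarith)
    have h10 : (Y x₀ - Y e) ^ 2 ≤ 2 ^ 2 := sq_le_sq' (by linarith) (by linarith)
    linarith

/-- The open-curve algorithm on the main component of the complement of the cut set covers the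
curve. -/
lemma cover_of_isEndpointPair (h : ClosedLoc Γ H Z yh r ε g T L σ X Y t) (hη : 0 < η)
    (hη1 : η ≤ 1 / 10 ^ 8) {S : Set Plane} (hS : Absorbs (H \ cutSet H yh ε (η * ε)) S)
    (hSc : IsPreconnected S) (hgS : ∀ s ∈ Icc (10 * ε) (L - 10 * ε), g s ∈ S) {x₀ x₁ : Plane}
    (hpair : IsEndpointPair (closure S) univ (frontier (cutSet H yh ε (η * ε))) x₀ x₁)
    {P : Set Plane} (hP : P ⊆ closure S) (hPc : IsPreconnected P) (h₀ : x₀ ∈ P) (h₁ : x₁ ∈ P)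
    {e : Plane} (he : e ∈ Γ) : ∃ c ∈ P, dist c e ≤ 4 * ε := by
  rcases (h.frontier_cutSet_spec hη hη1 (closure_mono hS.1 hpair.right_mem.1)
    hpair.right_mem.2).2.2 with h1 | h1
  · exact h.reverse.cover_of_isEndpointPair_aux hη hη1 hS hSc (mem_reverse hgS) hpair hP hPc h₀ h₁
      (by linarith) he
  · exact h.cover_of_isEndpointPair_aux hη hη1 hS hSc hgS hpair hP hPc h₀ h₁ h1 he

/-- Every output of the general-curve algorithm covers a closed curve. -/
lemma cover_of_generalOutput (h : ClosedLoc Γ H Z yh r ε g T L σ X Y t) (hη : 0 < η)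
    (hη1 : η ≤ 1 / 10 ^ 8) {C : Set Plane} (hC : GeneralOutput H yh ε (η * ε) C) {e : Plane}
    (he : e ∈ Γ) : ∃ c ∈ C, dist c e ≤ 4 * ε := by
  rcases hC with ⟨-, hC⟩ | ⟨U, V, -, hUV, x₀, x₁, y₀, y₁, γ, β, γ', ⟨hpair, hγ⟩, -,
    ⟨hpair', hγ'⟩, rfl⟩
  · exact h.cover_of_closedOutput hη hη1 hC he
  -- The main component `W` contains the curve apart from the parameters within 10ε of 0. The path
  -- extracted from it already covers Γ, wherever the other component lies.
  obtain ⟨W, hW, hgW⟩ := exists_mem_components (h.mem_sdiff_param hη1 h.start_param)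
  have hWS := absorbs_of_mem_components hW
  have hgS : ∀ s ∈ Icc (10 * ε) (L - 10 * ε), g s ∈ W := fun s hs =>
    hWS.2 _ (image_subset_iff.2 fun u hu => h.mem_sdiff_param hη1 hu)
      (isPreconnected_Icc.image g (h.curve.strand _ _).continuousOn)
      ⟨_, mem_image_of_mem g h.start_param, hgW⟩ (mem_image_of_mem g hs)
  have hWc := isPreconnected_of_mem_components hW
  rw [hUV] at hW
  rcases hW with rfl | rfl
  · obtain ⟨c, hc, hd⟩ := h.cover_of_isEndpointPair hη hη1 hWS hWc hgS hpair hγ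
      (isPreconnected_range_path γ) ⟨0, γ.source⟩ ⟨1, γ.target⟩ he
    exact ⟨c, Or.inl (Or.inl hc), hd⟩
  · obtain ⟨c, hc, hd⟩ := h.cover_of_isEndpointPair hη hη1 hWS hWc hgS hpair'.symm hγ'
      (isPreconnected_range_path γ') ⟨1, γ'.target⟩ ⟨0, γ'.source⟩ he
    exact ⟨c, Or.inr hc, hd⟩

end ClosedLoc


/-! ### Assembly of the theorem -/

lemma OpenOutput.cover {Γ H Z C : Set Plane} {yh : Plane} {r ε : ℝ} {g T : ℝ → Plane} {L σ : ℝ}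
    (h : OpenCurve Γ g T L σ) (hc : Core Γ H Z yh r ε) (hbig : 10 ^ 10 * ε ≤ σ)
    (hC : OpenOutput H C) : C ⊆ H ∧ ∀ s ∈ Icc 0 L, ∃ c ∈ C, dist c (g s) ≤ 13 * ε := by
  obtain ⟨x₀, x₁, γ, ⟨hpair, hγ⟩, rfl⟩ := hC
  exact ⟨hγ, fun s hs => h.cover_of_isEndpointPair hc hbig hpair hγ (isPreconnected_range_path γ)
    ⟨0, γ.source⟩ ⟨1, γ.target⟩ hs⟩

end Filament

theorem mainTheorem6 :
    ∃ c : ℝ, 0 < c ∧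
      ∀ (f : ℝ → Filament.Plane) (σ ε η : ℝ) (Shat : Set Filament.Plane) (yhat : Filament.Plane),
        Filament.IsFilament f →
        0 < σ → ENNReal.ofReal σ < Filament.thickness (Filament.trace f) →
        (f 0 ≠ f 1 → 2 * σ < dist (f 0) (f 1)) →
        0 < ε → ε ≤ c * σ → 0 < η → η ≤ c * ε →
        IsCompact Shat → Filament.support f σ ⊆ Shat →
        Metric.hausdorffDist (Filament.support f σ) Shat ≤ ε →
        Metric.hausdorffDist (frontier (Filament.support f σ)) (frontier Shat) ≤ ε →
        yhat ∈ Shat → IsMaxOn (Filament.edt Shat) Shat yhat →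
        (f 0 = f 1 →
          (∃ C, Filament.ClosedOutput (Filament.edtEstimator Shat ε) yhat ε η C) ∧
          ∀ C, Filament.ClosedOutput (Filament.edtEstimator Shat ε) yhat ε η C ∨
              Filament.GeneralOutput (Filament.edtEstimator Shat ε) yhat ε η C →
            Metric.hausdorffDist C (Filament.trace f) ≤ 4 * ε) ∧
        (f 0 ≠ f 1 →
          (∃ C, Filament.OpenOutput (Filament.edtEstimator Shat ε) C) ∧
          ∀ C, Filament.OpenOutput (Filament.edtEstimator Shat ε) C ∨
              Filament.GeneralOutput (Filament.edtEstimator Shat ε) yhat ε η C →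
            Metric.hausdorffDist C (Filament.trace f) ≤ 16 * ε) := by
  refine ⟨1 / 10 ^ 10, by norm_num, ?_⟩
  intro f σ ε η Shat yhat hf hσ hth hopen hε hεσ hη hηε hcpt hsub hd hd' hy hmax
  -- In the charts lengths are measured in units of ε, so η is rescaled accordingly.
  obtain ⟨η, rfl⟩ : ∃ η', η = η' * ε := ⟨η / ε, (div_mul_cancel₀ _ hε.ne').symm⟩
  replace hη : 0 < η := pos_of_mul_pos_left hη hε.le
  have hη1 : η ≤ 1 / 10 ^ 8 := by
    have := le_of_mul_le_mul_right hηε hε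
    linarith
  have hbig : 10 ^ 10 * ε ≤ σ := by linarith
  constructor
  · intro hcl
    obtain ⟨g, T, L, σ', hσ', hc⟩ := hf.exists_closedCurve hσ hth hcl
    have core := Filament.core_edtEstimator hc.isCompact hc.nonempty hc.hasNormals hσ' hε hbig hcpt
      hsub hd hd' hy hmax
    obtain ⟨g, T, X, Y, t, h⟩ := hc.exists_closedLoc core (by linarith)
    refine ⟨h.exists_closedOutput hη hη1, fun C hC => ?_⟩
    refine Filament.hausdorffDist_le_of_near core (η := η) (by linarith) le_rfl ?_ fun e he => ?_
    · exact hC.elim (fun hC => hC.subset core.isClosed) fun hC => hC.subset core.isClosed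
    · exact hC.elim (fun hC => h.cover_of_closedOutput hη hη1 hC he)
        fun hC => h.cover_of_generalOutput hη hη1 hC he
  · intro hne
    obtain ⟨g, T, L, σ', hσ', hc⟩ := hf.exists_openCurve hσ hth (hopen hne)
    have core := Filament.core_edtEstimator hc.isCompact hc.nonempty hc.hasNormals hσ' hε hbig hcpt
      hsub hd hd' hy hmax
    obtain ⟨s₀, X, Y, t, h⟩ := hc.exists_openLoc core (by linarith)
    refine ⟨hc.exists_openOutput core, fun C hC => ?_⟩
    refine Filament.hausdorffDist_le_of_near core (η := η) (by linarith) (by linarith) ?_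
      fun e he => ?_
    · exact hC.elim (fun hC => (hC.cover hc core (by linarith)).1.trans Set.subset_union_left)
        fun hC => hC.subset core.isClosed
    · rw [hc.image] at he
      obtain ⟨s, hs, rfl⟩ := he
      rcases hC with hC | hC
      · obtain ⟨c, hcC, hcd⟩ := (hC.cover hc core (by linarith)).2 s hs
        exact ⟨c, hcC, by linarith⟩
      · exact h.cover_of_generalOutput hη hη1 hC hs
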